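/- Let $(M,g)$ be a compact smooth Riemannian manifold without boundary, with volume element $dv_g$ and Laplace–Beltrami operator $\Delta=\operatorname{div}\nabla$, let $n\ge 0$ and $k\ge 2$ be integers, and let $$u\in W^{k,2}(M,\mathbb S^n)=\{u\in W^{k,2}(M,\mathbb R^{n+1}) : |u(x)|=1 \text{ for a.e. } x\in M\}.$$ The extrinsic $k$-energy is $E_k(u)=\int_M|\Delta^s u|^2\,dv_g$ if $k=2s$, and $E_k(u)=\int_M|\nabla\Delta^s u|^2\,dv_g$ if $k=2s+1$. The map $u$ is called extrinsic weakly $k$-harmonic if $\frac{d}{dt}E_k(\Pi(u+t\phi))\big|_{t=0}=0$ for every $\phi\in C^\infty(M,\mathbb R^{n+1})$, where $\Pi(y)=y/|y|$. Put $$\lambda_k=\Delta^{k-1}\big(|\nabla u|^2\big)+\sum_{j=0}^{k-2}\Delta^j\big(\langle\Delta^{k-1-j}u,\Delta u\rangle\big)+2\sum_{j=0}^{k-2}\Delta^j\big(\nabla\Delta^{k-1-j}u\cdot\nabla u\big),\qquad \Delta^0 f=f.$$ Here every term is a distribution on $M$. With $u=(u^1,\dots,u^{n+1})$, the value of $\langle\Delta^{p}u,\Delta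 u\rangle$ at $\varphi\in C^\infty(M)$ is $\sum_a(\Delta^p u^a)(\varphi\,\Delta u^a)$, and the value of $\nabla\Delta^pu\cdot\nabla u$ is $-\sum_a(\Delta^p u^a)(\operatorname{div}(\varphi\nabla u^a))$. For $1\le p\le k-1$ the distribution $\Delta^pu^a$ acts on $W^{k-2,2}(M)$ by the duality pairing of $W^{-(k-2),2}(M)$ with $W^{k-2,2}(M)$. Say that a sequence of smooth functions converges boundedly if it is uniformly bounded and converges in $W^{k,2}(M)$. Let $\mathcal D_k$ be the space of linear functionals $\lambda$ on $C^\infty(M)$ such that $\lambda(v_i)\to0$ whenever $v_i\to0$ boundedly. For $\lambda\in\mathcal D_k$ and $f\in W^{k,2}(M)\cap L^\infty(M)$, the product $\lambda f$ is the distribution $(\lambda f)(\varphi)=\lim_i\lambda(v_i\varphi)$, for any smooth $v_i\to f$ boundedly. For $\lambda \in \mathcal D_k$, the equation $\Delta^ku+\lambda u=0$ in the sense of distributions means that $\int_M u^a\,\Delta^k\varphi\,dv_g+(\lambda u^a)(\varphi)=0$ for all $a=1,\dots,n+1$ and all $\varphi\in C^\infty(M)$. Then: 1. $\lambda_k\in\mathcal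 D_k$, so that the product $\lambda_k u$ is defined. 2. $u$ is extrinsic weakly $k$-harmonic if and only if $\Delta^k u+\lambda_k u=0$ in the sense of distributions. 3. If $\lambda\in\mathcal D_k$ and $\Delta^ku+\lambda u=0$ in the sense of distributions, then $\lambda=\lambda_k$. -/

import Mathlib

open MeasureTheory Filter Topology
open scoped Manifold ContDiff

namespace ExtrinsicHarmonic

noncomputable section

/-! ### Riemannian geometry in charts -/

section Geometry

variable {m : ℕ} {M : Type*} [TopologicalSpace M]
  [ChartedSpace (EuclideanSpace ℝ (Fin m)) M] [IsManifold (𝓡 m) ∞ M]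

/-- A smooth Riemannian metric on the `m`-dimensional smooth manifold `M`. -/
abbrev SmoothMetric (m : ℕ) (M : Type*) [TopologicalSpace M]
    [ChartedSpace (EuclideanSpace ℝ (Fin m)) M] [IsManifold (𝓡 m) ∞ M] :=
  Bundle.ContMDiffRiemannianMetric (𝓡 m) ∞ (EuclideanSpace ℝ (Fin m))
    (fun x : M => TangentSpace (𝓡 m) x)

/-- The standard basis vector `e_i` of `ℝᵐ`. -/
abbrev stdVec (i : Fin m) : EuclideanSpace ℝ (Fin m) := EuclideanSpace.single i 1

/-- The coordinate vector field `∂_i` of the chart `e`, at the point with coordinates `y`. -/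
def coordVec (e : OpenPartialHomeomorph M (EuclideanSpace ℝ (Fin m)))
    (y : EuclideanSpace ℝ (Fin m)) (i : Fin m) : TangentSpace (𝓡 m) (e.symm y) :=
  mfderiv (𝓡 m) (𝓡 m) e.symm y (stdVec i)

/-- The matrix `g_ij = g(∂_i, ∂_j)` of the metric in the chart `e`. -/
def gram (g : SmoothMetric m M) (e : OpenPartialHomeomorph M (EuclideanSpace ℝ (Fin m)))
    (y : EuclideanSpace ℝ (Fin m)) : Matrix (Fin m) (Fin m) ℝ :=
  Matrix.of fun i j => g.inner (e.symm y) (coordVec e y i) (coordVec e y j)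

/-- The Riemannian volume density `√(det g_ij)` in the chart `e`. -/
def density (g : SmoothMetric m M) (e : OpenPartialHomeomorph M (EuclideanSpace ℝ (Fin m)))
    (y : EuclideanSpace ℝ (Fin m)) : ℝ :=
  Real.sqrt (gram g e y).det

/-- The Riemannian volume of the chart domain of `e`, seen as a measure on `M`: the image under
`e⁻¹` of the measure `√(det g_ij) dy` on the chart target. -/
def chartVol [MeasurableSpace M] (g : SmoothMetric m M)
    (e : OpenPartialHomeomorph M (EuclideanSpace ℝ (Fin m))) : Measure M :=
  Measure.map e.symm
    ((volume.restrict e.target).withDensity fun y => ENNReal.ofReal (density g e y))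

/-- The Riemannian volume measure `dv_g`. The measures `chartVol g e` agree on the overlaps of
chart domains, so that their supremum is the measure which restricts to `chartVol g e` on the
domain of every chart `e` (`M` being covered by countably many charts). -/
def vol [MeasurableSpace M] (g : SmoothMetric m M) : Measure M :=
  ⨆ e ∈ atlas (EuclideanSpace ℝ (Fin m)) M, chartVol g e

/-- The Laplace–Beltrami operator on smooth functions,
`Δ f = (det g)^(-1/2) ∑_i ∂_i ((det g)^(1/2) ∑_j g^ij ∂_j f)`, computed at `x` in the preferred
chart at `x`. -/
def lap (g : SmoothMetric m M) (f : M → ℝ) (x : M) : ℝ :=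
  let e := chartAt (EuclideanSpace ℝ (Fin m)) x
  (density g e (e x))⁻¹ *
    ∑ i, fderiv ℝ (fun y => density g e y *
      ∑ j, (gram g e y)⁻¹ i j * fderiv ℝ (f ∘ e.symm) y (stdVec j)) (e x) (stdVec i)

/-- `f` is a smooth (`C^∞`) real function on `M`; on a compact manifold, a test function. -/
def IsSmooth (m : ℕ) {M : Type*} [TopologicalSpace M]
    [ChartedSpace (EuclideanSpace ℝ (Fin m)) M] (f : M → ℝ) : Prop :=
  ContMDiff (𝓡 m) 𝓘(ℝ, ℝ) ∞ f

end Geometry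

/-! ### Weak derivatives and Sobolev spaces -/

section Sobolev

variable {m : ℕ}

/-- The classical partial derivative `∂_{α 0} ⋯ ∂_{α (j-1)} F` of order `j`. -/
def partialD {j : ℕ} (α : Fin j → Fin m) (F : EuclideanSpace ℝ (Fin m) → ℝ)
    (y : EuclideanSpace ℝ (Fin m)) : ℝ :=
  iteratedFDeriv ℝ j F y fun i => stdVec (α i)

/-- `H` is the weak partial derivative `∂_α F` on the open set `U ⊆ ℝᵐ`. -/
def IsWeakDeriv (U : Set (EuclideanSpace ℝ (Fin m))) {j : ℕ} (α : Fin j → Fin m)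
    (F H : EuclideanSpace ℝ (Fin m) → ℝ) : Prop :=
  LocallyIntegrableOn F U ∧ LocallyIntegrableOn H U ∧
    ∀ φ : EuclideanSpace ℝ (Fin m) → ℝ, ContDiff ℝ ∞ φ → HasCompactSupport φ → tsupport φ ⊆ U →
      ∫ y, F y * partialD α φ y = (-1) ^ j * ∫ y, H y * φ y

variable {M : Type*} [TopologicalSpace M] [ChartedSpace (EuclideanSpace ℝ (Fin m)) M]

/-- `f ∈ W^{k,2}(M)` for a compact manifold `M`: in every chart, all the weak partial derivatives
of `f` of order at most `k` exist and are square integrable on compact sets. -/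
def MemSobolev (m k : ℕ) {M : Type*} [TopologicalSpace M]
    [ChartedSpace (EuclideanSpace ℝ (Fin m)) M] (f : M → ℝ) : Prop :=
  ∀ e ∈ atlas (EuclideanSpace ℝ (Fin m)) M, ∀ j ≤ k, ∀ α : Fin j → Fin m,
    ∃ H : EuclideanSpace ℝ (Fin m) → ℝ, IsWeakDeriv e.target α (f ∘ e.symm) H ∧
      ∀ K ⊆ e.target, IsCompact K → MemLp H 2 (volume.restrict K)

/-- The smooth functions `v i` converge to `f` in `W^{k,2}(M)`, for a compact manifold `M`. -/
def SobolevTendsto (m k : ℕ) {M : Type*} [TopologicalSpace M]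
    [ChartedSpace (EuclideanSpace ℝ (Fin m)) M] (v : ℕ → M → ℝ) (f : M → ℝ) : Prop :=
  ∀ e ∈ atlas (EuclideanSpace ℝ (Fin m)) M, ∀ j ≤ k, ∀ α : Fin j → Fin m,
    ∃ H : EuclideanSpace ℝ (Fin m) → ℝ, IsWeakDeriv e.target α (f ∘ e.symm) H ∧
      ∀ K ⊆ e.target, IsCompact K →
        Tendsto (fun i => eLpNorm (fun y => partialD α (v i ∘ e.symm) y - H y) 2
          (volume.restrict K)) atTop (𝓝 0)

/-- `v` is a sequence of smooth functions that is uniformly bounded and converges to `f` in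
`W^{k,2}(M)`. -/
def BoundedApprox (m k : ℕ) {M : Type*} [TopologicalSpace M]
    [ChartedSpace (EuclideanSpace ℝ (Fin m)) M] (v : ℕ → M → ℝ) (f : M → ℝ) : Prop :=
  (∀ i, IsSmooth m (v i)) ∧ (∃ C : ℝ, ∀ i x, |v i x| ≤ C) ∧ SobolevTendsto m k v f

end Sobolev

section Main

variable {m : ℕ} {M : Type*} [TopologicalSpace M]
  [ChartedSpace (EuclideanSpace ℝ (Fin m)) M] [IsManifold (𝓡 m) ∞ M]

/-- The vector field `X` is the weak gradient of `f`: in every chart, `g(X, ∂_i)` is the weak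
partial derivative `∂_i f`. -/
def IsWeakGrad (g : SmoothMetric m M) (f : M → ℝ) (X : (x : M) → TangentSpace (𝓡 m) x) : Prop :=
  ∀ e ∈ atlas (EuclideanSpace ℝ (Fin m)) M, ∀ i : Fin m,
    IsWeakDeriv e.target (fun _ : Fin 1 => i) (f ∘ e.symm)
      fun y => g.inner (e.symm y) (X (e.symm y)) (coordVec e y i)

open Classical in
/-- The weak gradient `∇f` (unique almost everywhere; zero if there is none). -/
def wgrad (g : SmoothMetric m M) (f : M → ℝ) : (x : M) → TangentSpace (𝓡 m) x :=
  if h : ∃ X, IsWeakGrad g f X then h.choose else fun _ => 0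

/-- The function `⟨∇f, ∇h⟩`. -/
def gradDot (g : SmoothMetric m M) (f h : M → ℝ) (x : M) : ℝ :=
  g.inner x (wgrad g f x) (wgrad g h x)

variable [MeasurableSpace M]

/-- `h ∈ L²(M)` represents the distribution `Δ^s f`. -/
def IsWeakLap (g : SmoothMetric m M) (s : ℕ) (f h : M → ℝ) : Prop :=
  MemLp h 2 (vol g) ∧
    ∀ φ : M → ℝ, IsSmooth m φ → ∫ x, h x * φ x ∂(vol g) = ∫ x, f x * (lap g)^[s] φ x ∂(vol g)

open Classical in
/-- The function `Δ^s f ∈ L²(M)` (unique almost everywhere), for `f ∈ W^{2s,2}(M)`. -/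
def wlap (g : SmoothMetric m M) (s : ℕ) (f : M → ℝ) : M → ℝ :=
  if h : ∃ h, IsWeakLap g s f h then h.choose else fun _ => 0

/-! ### Extrinsic `k`-harmonic maps into the sphere -/

/-- `u ∈ W^{k,2}(M, 𝕊ⁿ)`. -/
def MemSobolevSphere (g : SmoothMetric m M) (k : ℕ) {n : ℕ}
    (u : M → EuclideanSpace ℝ (Fin (n + 1))) : Prop :=
  (∀ a, MemLp (fun x => u x a) 2 (vol g) ∧ MemSobolev m k (fun x => u x a)) ∧
    ∀ᵐ x ∂(vol g), ‖u x‖ = 1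

/-- The extrinsic `k`-energy: `∫ |Δ^s u|²` if `k = 2s`, and `∫ |∇Δ^s u|²` if `k = 2s+1`. -/
def energy (g : SmoothMetric m M) (k : ℕ) {n : ℕ}
    (u : M → EuclideanSpace ℝ (Fin (n + 1))) : ℝ :=
  if Even k then
    ∫ x, ∑ a, (wlap g (k / 2) (fun z => u z a) x) ^ 2 ∂(vol g)
  else
    ∫ x, ∑ a, gradDot g (wlap g (k / 2) fun z => u z a) (wlap g (k / 2) fun z => u z a) x ∂(vol g)

/-- The variation `u_t = Π(u + tφ)`, with `Π(y) = y/|y|` the nearest point projection onto the unit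
sphere. -/
def variation {M : Type*} {n : ℕ} (u φ : M → EuclideanSpace ℝ (Fin (n + 1))) (t : ℝ) (x : M) :
    EuclideanSpace ℝ (Fin (n + 1)) :=
  ‖u x + t • φ x‖⁻¹ • (u x + t • φ x)

/-- `u` is an extrinsic weakly `k`-harmonic map: `d/dt E_k(Π(u + tφ)) = 0` at `t = 0` for every
smooth `φ : M → ℝⁿ⁺¹`. -/
def IsWeaklyHarmonic (g : SmoothMetric m M) (k : ℕ) {n : ℕ}
    (u : M → EuclideanSpace ℝ (Fin (n + 1))) : Prop :=
  ∀ φ : M → EuclideanSpace ℝ (Fin (n + 1)),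
    ContMDiff (𝓡 m) 𝓘(ℝ, EuclideanSpace ℝ (Fin (n + 1))) ∞ φ →
      HasDerivAt (fun t : ℝ => energy g k (variation u φ t)) 0 0

/-! ### Distributions

A distribution is represented by a functional on functions `M → ℝ`, of which only the values on
smooth functions matter. -/

/-- The distribution `φ ↦ ∫ f φ` of an integrable function `f`. -/
def ofFun (g : SmoothMetric m M) (f : M → ℝ) : (M → ℝ) → ℝ :=
  fun φ => ∫ x, f x * φ x ∂(vol g)

/-- The Laplacian of a distribution, `(ΔT)(φ) = T(Δφ)`. -/
def distLap (g : SmoothMetric m M) (T : (M → ℝ) → ℝ) : (M → ℝ) → ℝ :=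
  fun φ => T (lap g φ)

/-- The duality pairing of the distribution `Δ^p f` with a function `w` that need not be smooth,
for `f ∈ W^{k,2}(M)`, `w ∈ W^{l,2}(M)`, `2p ≤ k + l`: it is `∫ Δ^p f · w` if `2p ≤ k`, and otherwise
only `k` of the `2p` derivatives are left on `f`, the others are moved to `w`. For smooth `w` this
is `∫ f Δ^p w`. -/
def lapPair (g : SmoothMetric m M) (k p : ℕ) (f w : M → ℝ) : ℝ :=
  if 2 * p ≤ k then
    ∫ x, wlap g p f x * w x ∂(vol g)
  else if Even k then
    ∫ x, wlap g (k / 2) f x * wlap g (p - k / 2) w x ∂(vol g)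
  else
    -∫ x, gradDot g (wlap g (k / 2) f) (wlap g (p - k / 2 - 1) w) x ∂(vol g)

/-- The distribution `⟨Δ^p u, Δu⟩` for `u ∈ W^{k,2}`, `p ≤ k - 1`: its value on `φ` is the pairing
of `Δ^p u` with `φ Δu ∈ W^{k-2,2}`. -/
def lapDotLap (g : SmoothMetric m M) (k p : ℕ) {n : ℕ}
    (u : M → EuclideanSpace ℝ (Fin (n + 1))) : (M → ℝ) → ℝ :=
  fun φ => ∑ a, lapPair g k p (fun z => u z a) fun x => φ x * wlap g 1 (fun z => u z a) x

/-- The distribution `∇Δ^p u · ∇u` for `u ∈ W^{k,2}`, `p ≤ k - 1`: its value on `φ` is minus the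
pairing of `Δ^p u` with `div (φ ∇u) = φ Δu + ⟨∇φ, ∇u⟩ ∈ W^{k-2,2}`. -/
def gradLapDotGrad (g : SmoothMetric m M) (k p : ℕ) {n : ℕ}
    (u : M → EuclideanSpace ℝ (Fin (n + 1))) : (M → ℝ) → ℝ :=
  fun φ => -∑ a, lapPair g k p (fun z => u z a)
    fun x => φ x * wlap g 1 (fun z => u z a) x + gradDot g φ (fun z => u z a) x

/-- The distribution `λ_k = Δ^{k-1}(|∇u|²) + ∑_{j=0}^{k-2} Δ^j ⟨Δ^{k-1-j} u, Δu⟩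
+ 2 ∑_{j=0}^{k-2} Δ^j (∇Δ^{k-1-j} u · ∇u)`. -/
def multiplier (g : SmoothMetric m M) (k : ℕ) {n : ℕ}
    (u : M → EuclideanSpace ℝ (Fin (n + 1))) : (M → ℝ) → ℝ :=
  (distLap g)^[k - 1] (ofFun g fun x => ∑ a, gradDot g (fun z => u z a) (fun z => u z a) x)
    + ∑ j ∈ Finset.range (k - 1), (distLap g)^[j] (lapDotLap g k (k - 1 - j) u)
    + (2 : ℝ) • ∑ j ∈ Finset.range (k - 1), (distLap g)^[j] (gradLapDotGrad g k (k - 1 - j) u)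

/-- `T` is a distribution that is continuous for uniformly bounded convergence in `W^{k,2}(M)`.
These are the distributions that extend by continuity to `W^{k,2}(M) ∩ L^∞(M)`, so that they can be
multiplied by functions of that class. -/
def IsSobolevDistribution (m k : ℕ) {M : Type*} [TopologicalSpace M]
    [ChartedSpace (EuclideanSpace ℝ (Fin m)) M] (T : (M → ℝ) → ℝ) : Prop :=
  (∀ φ ψ : M → ℝ, IsSmooth m φ → IsSmooth m ψ → T (φ + ψ) = T φ + T ψ) ∧
  (∀ (c : ℝ) (φ : M → ℝ), IsSmooth m φ → T (c • φ) = c * T φ) ∧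
  ∀ v : ℕ → M → ℝ, BoundedApprox m k v 0 → Tendsto (fun i => T (v i)) atTop (𝓝 0)

/-- The distribution `S` is the product `T f` of the distribution `T` with a function
`f ∈ W^{k,2}(M) ∩ L^∞(M)`: smooth functions approximate `f` boundedly in `W^{k,2}(M)`, and
`T(v_i φ) → S(φ)` for every such approximation `v_i` and every smooth `φ`. -/
def IsProduct (m k : ℕ) {M : Type*} [TopologicalSpace M]
    [ChartedSpace (EuclideanSpace ℝ (Fin m)) M] (T : (M → ℝ) → ℝ) (f : M → ℝ)
    (S : (M → ℝ) → ℝ) : Prop :=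
  (∃ v, BoundedApprox m k v f) ∧
    ∀ v, BoundedApprox m k v f → ∀ φ : M → ℝ, IsSmooth m φ →
      Tendsto (fun i => T (v i * φ)) atTop (𝓝 (S φ))

/-- `Δ^k u + λ u = 0` in the sense of distributions: for every component `u^a` of `u`, the product
`λ u^a` is defined, and `(Δ^k u^a)(φ) + (λ u^a)(φ) = 0` for every smooth `φ`. -/
def SolvesEulerLagrange (g : SmoothMetric m M) (k : ℕ) {n : ℕ} (lam : (M → ℝ) → ℝ)
    (u : M → EuclideanSpace ℝ (Fin (n + 1))) : Prop :=
  ∀ a, ∃ S : (M → ℝ) → ℝ, IsProduct m k lam (fun x => u x a) S ∧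
    ∀ φ : M → ℝ, IsSmooth m φ → (distLap g)^[k] (ofFun g fun x => u x a) φ + S φ = 0

end Main

end

end ExtrinsicHarmonic

open ExtrinsicHarmonic

set_option linter.unusedSectionVars false

namespace ExtrinsicHarmonic

/-! ### Algebras of smooth functions with derivations -/

/-! Elements of W^{k,2} ∩ L^∞ are represented throughout by uniformly bounded sequences of smooth
functions that are Cauchy in W^{k,2}. Let q be the symmetric bilinear form of the energy, so that
E_k(u) = ∑_a q(u^a, u^a), and q(f, h) = (-1)^k ∫ h Δ^k f for smooth f, h. The form q uses only k
derivatives of each argument and is bounded on W^{k,2} (`exists_abs_q_le`).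

The algebraic core is `smoothMultiplier_eq`. For one smooth function f, the expression defining λ_k,
evaluated at φ, telescopes to ½ ∫ f² Δ^k φ - ∫ f φ Δ^k f. Sum this over the components of smooth
approximations v_i of u. As |u|² = 1, the first integrals tend to ½ ∫ Δ^k φ = 0, which leaves λ_k(φ)
= -(-1)^k lim ∑_a q(v_i^a, v_i^a φ) (`tendsto_sum_q_mul`). Formally λ_k = -⟨u, Δ^k u⟩, written so
that it makes sense in W^{k,2}.

The analytic core is that W^{k,2} ∩ L^∞ is an algebra (`exists_N_mul_le_mul`), and that a bounded
sequence which is null in W^{k,2} stays null after multiplication by a boundedly Cauchy one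
(`tendsto_N_mul_zero`). Both follow from Gagliardo–Nirenberg inequalities, proved by repeated
integration by parts (`powInt_D_le`, `exists_powInt_le`). Claim 1 results: if w → 0 boundedly, then
u w → 0 in W^{k,2}, so q(u, u w) → 0.

For claim 2, |u + tφ|² = 1 + s with s = 2t⟨u,φ⟩ + t²|φ|². For small t the power series of (1 +
s)^{-1/2} converges in the algebra, so Π(u + tφ) = u + t(φ - ⟨u,φ⟩u) + O(t²) in W^{k,2}
(`exists_approxVariation`). The energy therefore has the derivative 2 ∑_a q(u^a, φ^a - u^a⟨u,φ⟩) =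
2(-1)^k ∑_a (Δ^k u^a + λ_k u^a)(φ^a) at t = 0 (`tendsto_sum_q_tangentPart`,
`hasDerivAt_energy_variation`).

For claim 3, multiply the equation by u^a and sum: λ = λ|u|² = -⟨u, Δ^k u⟩ = λ_k. The products are
justified by joint limits in two indices (`tendsto_zero_of_double`).

The estimates are carried out in an abstract commutative algebra with finitely many derivations. On
M the derivations are ⟨∇F_α, ∇·⟩ with cut-off coordinate functions F_α: they are globally defined,
they span, and the resulting W^{k,2} convergence agrees with convergence in charts (`CauchyN.sConv`,
`cauchyN_of_sobolevTendsto`). Mollification in charts provides the approximations (`exists_approx`).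
-/

/-- An algebra of bounded measurable functions on a finite measure space, stable under composition
with smooth functions of one variable, together with finitely many derivations which satisfy an
integration by parts formula. -/
structure SobolevAlgebra {X : Type*} [MeasurableSpace X] (μ : Measure X) (𝒜 : Type*) [CommRing 𝒜]
    [Algebra ℝ 𝒜] (ι : Type*) where
  ev : 𝒜 →ₐ[ℝ] (X → ℝ)
  measurable_ev : ∀ f, Measurable (ev f)
  bounded : ∀ f, ∃ C, ∀ x, |ev f x| ≤ C
  D : ι → Derivation ℝ 𝒜 𝒜
  -- Minus the divergence of the vector field `D α`.
  dv : ι → 𝒜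
  ibp : ∀ α f, ∫ x, ev (D α f) x ∂μ = ∫ x, ev (f * dv α) x ∂μ
  -- Needed for the smooth regularization of `|D g|^(p-2) D g`, which serves as a test function in
  -- the Gagliardo–Nirenberg argument.
  exists_comp : ∀ (ψ : ℝ → ℝ), ContDiff ℝ ∞ ψ → ∀ f, ∃ h, (∀ x, ev h x = ψ (ev f x)) ∧
    ∀ α x, ev (D α h) x = deriv ψ (ev f x) * ev (D α f) x

namespace SobolevAlgebra

variable {X : Type*} [MeasurableSpace X] {μ : Measure X} [IsFiniteMeasure μ]
  {𝒜 : Type*} [CommRing 𝒜] [Algebra ℝ 𝒜] {ι : Type*} (S : SobolevAlgebra μ 𝒜 ι)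

lemma exists_pos_bound (f : 𝒜) : ∃ C, 0 < C ∧ ∀ x, |S.ev f x| ≤ C := by
  obtain ⟨C, hC⟩ := S.bounded f
  exact ⟨max C 1, by positivity, fun x => (hC x).trans (le_max_left _ _)⟩

lemma memLp (f : 𝒜) (p : ENNReal) : MemLp (S.ev f) p μ := by
  obtain ⟨C, hC⟩ := S.bounded f
  exact MemLp.of_bound (S.measurable_ev f).aestronglyMeasurable C (.of_forall hC)

lemma integrable (f : 𝒜) : Integrable (S.ev f) μ :=
  (S.memLp f 1).integrable le_rfl

lemma _root_.integrable_of_bounded' {f : X → ℝ} (hf : Measurable f) {C : ℝ} (hC : ∀ x, |f x| ≤ C) :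
    Integrable f μ :=
  (MemLp.of_bound hf.aestronglyMeasurable C (.of_forall hC)).integrable le_top

/-- The iterated derivation `D_I`, the first letter of `I` acting first. -/
def dw : List ι → 𝒜 →ₗ[ℝ] 𝒜
  | [] => LinearMap.id
  | α :: I => dw I ∘ₗ (S.D α).toLinearMap

@[simp] lemma dw_nil (v : 𝒜) : S.dw [] v = v := rfl

@[simp] lemma dw_cons (α : ι) (I : List ι) (v : 𝒜) : S.dw (α :: I) v = S.dw I (S.D α v) := rfl

lemma dw_append (I J : List ι) (v : 𝒜) : S.dw (I ++ J) v = S.dw J (S.dw I v) := by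
  induction I generalizing v with
  | nil => rfl
  | cons α I ih => simp [ih]

/-! ### Gagliardo–Nirenberg inequalities by integration by parts -/

/-- The integral `∫ |f|^p`. -/
noncomputable def powInt (p : ℝ) (f : 𝒜) : ℝ := ∫ x, |S.ev f x| ^ p ∂μ

lemma powInt_nonneg (p : ℝ) (f : 𝒜) : 0 ≤ S.powInt p f :=
  integral_nonneg fun _ => by positivity

lemma integrable_pow {p : ℝ} (hp : 0 ≤ p) (f : 𝒜) : Integrable (fun x => |S.ev f x| ^ p) μ := by
  obtain ⟨C, hC0, hC⟩ := S.exists_pos_bound f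
  refine integrable_of_bounded' (C := C ^ p) ((S.measurable_ev f).abs.pow_const p) fun x => ?_
  rw [abs_of_nonneg (by positivity)]
  exact Real.rpow_le_rpow (abs_nonneg _) (hC x) hp

/-- Hölder's inequality for three bounded functions. -/
lemma _root_.integral_mul_mul_rpow_le {a b c : X → ℝ} (ha : Integrable a μ) (hb : Integrable b μ)
    (hc : Integrable c μ) (ha0 : ∀ x, 0 ≤ a x) (hb0 : ∀ x, 0 ≤ b x) (hc0 : ∀ x, 0 ≤ c x)
    {r s t : ℝ} (hr : 0 ≤ r) (hs : 0 ≤ s) (ht : 0 ≤ t) (h : r + s + t = 1) :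
    ∫ x, a x ^ r * b x ^ s * c x ^ t ∂μ ≤
      (∫ x, a x ∂μ) ^ r * (∫ x, b x ∂μ) ^ s * (∫ x, c x ∂μ) ^ t := by
  have key := ENNReal.lintegral_prod_norm_pow_le (μ := μ) (Finset.univ : Finset (Fin 3))
    (f := ![fun x => ENNReal.ofReal (a x), fun x => ENNReal.ofReal (b x),
      fun x => ENNReal.ofReal (c x)]) (p := ![r, s, t])
    (by intro i _; fin_cases i
        · exact ha.aemeasurable.ennreal_ofReal
        · exact hb.aemeasurable.ennreal_ofReal
        · exact hc.aemeasurable.ennreal_ofReal)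
    (by simp [Fin.sum_univ_three, h]) (by intro i _; fin_cases i <;> simpa)
  simp only [Fin.prod_univ_three, Matrix.cons_val_zero, Matrix.cons_val_one, Matrix.cons_val] at key
  rw [← ofReal_integral_eq_lintegral_ofReal ha (.of_forall ha0),
    ← ofReal_integral_eq_lintegral_ofReal hb (.of_forall hb0),
    ← ofReal_integral_eq_lintegral_ofReal hc (.of_forall hc0),
    ENNReal.ofReal_rpow_of_nonneg (integral_nonneg ha0) hr,
    ENNReal.ofReal_rpow_of_nonneg (integral_nonneg hb0) hs,
    ENNReal.ofReal_rpow_of_nonneg (integral_nonneg hc0) ht] at key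
  have e1 : ∀ x, ENNReal.ofReal (a x) ^ r * ENNReal.ofReal (b x) ^ s * ENNReal.ofReal (c x) ^ t =
      ENNReal.ofReal (a x ^ r * b x ^ s * c x ^ t) := fun x => by
    rw [ENNReal.ofReal_rpow_of_nonneg (ha0 x) hr, ENNReal.ofReal_rpow_of_nonneg (hb0 x) hs,
      ENNReal.ofReal_rpow_of_nonneg (hc0 x) ht, ENNReal.ofReal_mul, ENNReal.ofReal_mul]
    · exact Real.rpow_nonneg (ha0 x) _
    · exact mul_nonneg (Real.rpow_nonneg (ha0 x) _) (Real.rpow_nonneg (hb0 x) _)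
  have hA := Real.rpow_nonneg (integral_nonneg (μ := μ) ha0) r
  have hB := Real.rpow_nonneg (integral_nonneg (μ := μ) hb0) s
  have hC := Real.rpow_nonneg (integral_nonneg (μ := μ) hc0) t
  simp only [e1] at key
  rw [← ENNReal.ofReal_mul hA, ← ENNReal.ofReal_mul (by positivity)] at key
  rw [integral_eq_lintegral_of_nonneg_ae]
  · exact ENNReal.toReal_le_of_le_ofReal (by positivity) key
  · exact .of_forall fun x => mul_nonneg
      (mul_nonneg (Real.rpow_nonneg (ha0 x) _) (Real.rpow_nonneg (hb0 x) _))
      (Real.rpow_nonneg (hc0 x) _)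
  · exact (((ha.aemeasurable.pow_const r).mul (hb.aemeasurable.pow_const s)).mul
      (hc.aemeasurable.pow_const t)).aestronglyMeasurable

lemma ibp_mul (α : ι) (f h : 𝒜) : ∫ x, S.ev (S.D α f * h) x ∂μ =
    ∫ x, S.ev (f * h * S.dv α - f * S.D α h) x ∂μ := by
  have h1 := S.ibp α (f * h)
  have h2 : S.D α f * h = S.D α (f * h) - f * S.D α h := by
    rw [Derivation.leibniz]; simp only [smul_eq_mul]; ring
  rw [h2]
  simp only [map_sub, Pi.sub_apply]
  rw [integral_sub (S.integrable _) (S.integrable _), integral_sub (S.integrable _)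
    (S.integrable _), h1]

lemma integrable_regularized (f g h : 𝒜) {r : ℝ} (hr : 0 ≤ r) {ε : ℝ} (hε : 0 ≤ ε) (a b : ℝ) :
    Integrable (fun x => |S.ev f x| * (S.ev g x ^ 2 + ε) ^ r *
      (a * |S.ev h x| + b * |S.ev g x|)) μ := by
  obtain ⟨F, hF0, hF⟩ := S.exists_pos_bound f
  obtain ⟨G, hG0, hG⟩ := S.exists_pos_bound g
  obtain ⟨H, hH0, hH⟩ := S.exists_pos_bound h
  have mf := S.measurable_ev f
  have mg := S.measurable_ev g
  have mh := S.measurable_ev h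
  refine integrable_of_bounded' (C := F * (G ^ 2 + ε) ^ r * (|a| * H + |b| * G))
    ((mf.abs.mul (((mg.pow_const 2).add_const ε).pow_const r)).mul
      ((mh.abs.const_mul a).add (mg.abs.const_mul b))) fun x => ?_
  have h3 : S.ev g x ^ 2 ≤ G ^ 2 := sq_le_sq' (abs_le.mp (hG x)).1 (abs_le.mp (hG x)).2
  rw [abs_mul, abs_mul, abs_abs, abs_of_nonneg (Real.rpow_nonneg (by positivity) _)]
  gcongr
  · exact hF x
  · refine (abs_add_le _ _).trans ?_
    rw [abs_mul, abs_mul, abs_abs, abs_abs]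
    gcongr
    · exact hH x
    · exact hG x

/-- Integration by parts for `∫ |D g|^p`, with a regularization of the power. -/
lemma powInt_D_le_regularized (α : ι) {c : ℝ} (hc : ∀ x, |S.ev (S.dv α) x| ≤ c) {p : ℝ}
    (hp : 2 ≤ p) (g : 𝒜) {ε : ℝ} (hε : 0 < ε) :
    S.powInt p (S.D α g) ≤ ∫ x, |S.ev g x| * (S.ev (S.D α g) x ^ 2 + ε) ^ ((p - 2) / 2) *
      ((p - 1) * |S.ev (S.D α (S.D α g)) x| + c * |S.ev (S.D α g) x|) ∂μ := by
  set r : ℝ := (p - 2) / 2 with hr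
  have hr0 : 0 ≤ r := by rw [hr]; linarith
  have hpos : ∀ s : ℝ, 0 < s ^ 2 + ε := fun s => by positivity
  -- A smooth substitute for `s |s|^(p-2)`. The shift by `ε` keeps the base positive, so the real
  -- power is differentiable also where `D g` vanishes.
  set ψ : ℝ → ℝ := fun s => s * (s ^ 2 + ε) ^ r with hψ
  have hψs : ContDiff ℝ ∞ ψ := by
    refine contDiff_id.mul (ContDiff.rpow_const_of_ne ?_ fun s => (hpos s).ne')
    fun_prop
  -- The derivative is `(s² + ε)^r + 2 r s² (s² + ε)^(r-1)`; replacing `s²` by `s² + ε` in the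
  -- second term gives the factor `2 r + 1 = p - 1`.
  have hderiv : ∀ s, |deriv ψ s| ≤ (p - 1) * (s ^ 2 + ε) ^ r := by
    intro s
    have h1 : HasDerivAt (fun s : ℝ => (s ^ 2 + ε) ^ r)
        ((2 * s) * r * (s ^ 2 + ε) ^ (r - 1)) s := by
      have := ((hasDerivAt_pow 2 s).add_const ε).rpow_const (p := r) (Or.inl (hpos s).ne')
      simpa using this
    have h2 : HasDerivAt ψ _ s := (hasDerivAt_id s).mul h1
    have h3 : deriv ψ s = (s ^ 2 + ε) ^ r + s * (2 * s * r * (s ^ 2 + ε) ^ (r - 1)) := by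
      rw [h2.deriv]; simp
    have h4 : (s ^ 2 + ε) ^ r = (s ^ 2 + ε) ^ (r - 1) * (s ^ 2 + ε) := by
      rw [Real.rpow_sub_one (hpos s).ne', div_mul_cancel₀ _ (hpos s).ne']
    have h5 : 0 < (s ^ 2 + ε) ^ (r - 1) := Real.rpow_pos_of_pos (hpos s) _
    have h6 : p - 1 = 2 * r + 1 := by rw [hr]; ring
    have h7 : s * (2 * s * r * (s ^ 2 + ε) ^ (r - 1)) = 2 * r * s ^ 2 * (s ^ 2 + ε) ^ (r - 1) := by
      ring
    rw [h3, h7, h4, h6, abs_of_nonneg (by positivity)]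
    have : 0 ≤ (s ^ 2 + ε) ^ (r - 1) * (r * ε) := by positivity
    nlinarith
  obtain ⟨h, hh1, hh2⟩ := S.exists_comp ψ hψs (S.D α g)
  obtain ⟨R, hR0, hR⟩ := S.exists_pos_bound (S.D α g)
  obtain ⟨G, hG0, hG⟩ := S.exists_pos_bound g
  obtain ⟨R2, hR20, hR2⟩ := S.exists_pos_bound (S.D α (S.D α g))
  have key := S.ibp_mul α g h
  have hc0 : ∀ x : X, 0 ≤ c := fun x => (abs_nonneg _).trans (hc x)
  -- Since `|s|^p ≤ s ψ(s)`, it suffices to integrate `D g · ψ(D g)` by parts: one derivative leaves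
  -- `g` and falls on `ψ(D g)`.
  calc S.powInt p (S.D α g) ≤ ∫ x, S.ev (S.D α g * h) x ∂μ := by
        refine integral_mono (S.integrable_pow (by linarith) _) (S.integrable _) fun x => ?_
        simp only [map_mul, Pi.mul_apply, hh1, hψ]
        set s := S.ev (S.D α g) x
        have : |s| ^ p = s ^ 2 * (s ^ 2) ^ r := by
          rcases eq_or_ne s 0 with h0 | h0
          · rw [h0]; simp; rw [Real.zero_rpow (by linarith)]
          · have hs : 0 < |s| := abs_pos.mpr h0
            rw [← sq_abs s, ← Real.rpow_natCast, ← Real.rpow_mul hs.le, ← Real.rpow_add hs]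
            congr 1; rw [hr]; push_cast; ring
        rw [this, ← mul_assoc, ← sq]
        gcongr
        linarith
    _ = ∫ x, S.ev (g * h * S.dv α - g * S.D α h) x ∂μ := key
    _ ≤ _ := by
        refine integral_mono (S.integrable _) (S.integrable_regularized _ _ _ hr0 hε.le _ _)
          fun x => ?_
        have hx := hderiv (S.ev (S.D α g) x)
        simp only [map_mul, map_sub, Pi.mul_apply, Pi.sub_apply, hh1, hh2, hψ]
        set s := S.ev (S.D α g) x
        have hP : 0 < (s ^ 2 + ε) ^ r := Real.rpow_pos_of_pos (hpos s) _
        set P := (s ^ 2 + ε) ^ r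
        calc _ ≤ |S.ev g x * (s * P) * S.ev (S.dv α) x|
              + |S.ev g x * (deriv ψ s * S.ev (S.D α (S.D α g)) x)| :=
              (le_abs_self _).trans (abs_sub _ _)
          _ = |S.ev g x| * P * (|S.ev (S.dv α) x| * |s|) +
              |S.ev g x| * (|deriv ψ s| * |S.ev (S.D α (S.D α g)) x|) := by
              simp only [abs_mul, abs_of_pos hP]; ring
          _ ≤ |S.ev g x| * P * (c * |s|) +
              |S.ev g x| * (((p - 1) * P) * |S.ev (S.D α (S.D α g)) x|) := by
              gcongr; exact hc x
          _ = _ := by ring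

/-- Integration by parts for `∫ |D g|^p`. -/
lemma powInt_D_le (α : ι) {c : ℝ} (hc : ∀ x, |S.ev (S.dv α) x| ≤ c) {p : ℝ}
    (hp : 2 ≤ p) (g : 𝒜) :
    S.powInt p (S.D α g) ≤ ∫ x, |S.ev g x| * |S.ev (S.D α g) x| ^ (p - 2) *
      ((p - 1) * |S.ev (S.D α (S.D α g)) x| + c * |S.ev (S.D α g) x|) ∂μ := by
  have hr : 0 ≤ (p - 2) / 2 := by linarith
  obtain ⟨R, hR0, hR⟩ := S.exists_pos_bound (S.D α g)
  obtain ⟨G, hG0, hG⟩ := S.exists_pos_bound g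
  obtain ⟨R2, hR20, hR2⟩ := S.exists_pos_bound (S.D α (S.D α g))
  have hlim : Tendsto (fun ε : ℝ => ∫ x, |S.ev g x| *
      (S.ev (S.D α g) x ^ 2 + ε) ^ ((p - 2) / 2) *
      ((p - 1) * |S.ev (S.D α (S.D α g)) x| + c * |S.ev (S.D α g) x|) ∂μ) (𝓝[>] 0)
      (𝓝 (∫ x, |S.ev g x| * |S.ev (S.D α g) x| ^ (p - 2) *
      ((p - 1) * |S.ev (S.D α (S.D α g)) x| + c * |S.ev (S.D α g) x|) ∂μ)) := by
    -- Let `ε` decrease to `0`; for `ε ≤ 1` the integrands share a constant bound. At `ε = 0` the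
    -- power is continuous because its exponent is nonnegative.
    refine tendsto_integral_filter_of_dominated_convergence
      (fun _ => G * (R ^ 2 + 1) ^ ((p - 2) / 2) * ((p - 1) * R2 + |c| * R)) ?_ ?_
      (integrable_const _) ?_
    · filter_upwards [self_mem_nhdsWithin] with ε hε
      exact (S.integrable_regularized _ _ _ hr (le_of_lt hε) _ _).aestronglyMeasurable
    · filter_upwards [self_mem_nhdsWithin, nhdsWithin_le_nhds (Iio_mem_nhds one_pos)] with ε hε h1
      refine .of_forall fun x => ?_
      have hε' : 0 < ε := hε
      have h3 : (S.ev (S.D α g) x) ^ 2 ≤ R ^ 2 := sq_le_sq' (abs_le.mp (hR x)).1 (abs_le.mp (hR x)).2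
      have hp1 : 0 ≤ p - 1 := by linarith
      have h1' : ε ≤ 1 := le_of_lt h1
      rw [Real.norm_eq_abs, abs_mul, abs_mul, abs_abs,
        abs_of_nonneg (Real.rpow_nonneg (by positivity) _)]
      gcongr
      · exact hG x
      · refine (abs_add_le _ _).trans ?_
        rw [abs_mul, abs_mul, abs_abs, abs_abs, abs_of_nonneg hp1]
        gcongr
        · exact hR2 x
        · exact hR x
    · refine .of_forall fun x => ?_
      have h0 : |S.ev (S.D α g) x| ^ (p - 2) = (S.ev (S.D α g) x ^ 2 + 0) ^ ((p - 2) / 2) := by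
        rw [add_zero, ← sq_abs, ← Real.rpow_natCast, ← Real.rpow_mul (abs_nonneg _)]
        congr 1; push_cast; ring
      rw [h0]
      refine Tendsto.mul_const _ (Tendsto.const_mul _ ?_)
      have hcont : Continuous fun ε : ℝ => (S.ev (S.D α g) x ^ 2 + ε) ^ ((p - 2) / 2) :=
        (continuous_const.add continuous_id).rpow_const fun _ => Or.inr hr
      exact (hcont.tendsto 0).mono_left nhdsWithin_le_nhds
  refine ge_of_tendsto hlim ?_
  filter_upwards [self_mem_nhdsWithin] with ε hε
  exact S.powInt_D_le_regularized α hc hp g hε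

end SobolevAlgebra
end ExtrinsicHarmonic

namespace ExtrinsicHarmonic
namespace SobolevAlgebra

variable {X : Type*} [MeasurableSpace X] {μ : Measure X} [IsFiniteMeasure μ]
  {𝒜 : Type*} [CommRing 𝒜] [Algebra ℝ 𝒜] {ι : Type*} (S : SobolevAlgebra μ 𝒜 ι)

/-- One step of the Gagliardo–Nirenberg inequality, from Hölder's inequality. -/
lemma powInt_D_le_holder (α : ι) {c : ℝ} (hc : ∀ x, |S.ev (S.dv α) x| ≤ c) (hc0 : 0 ≤ c) {p : ℝ}
    (hp : 2 ≤ p) (g : 𝒜) {a : X → ℝ} (ha : Integrable a μ) (ha0 : ∀ x, 0 ≤ a x) {A : ℝ}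
    (hA0 : 0 ≤ A) {θ p' : ℝ} (hθ : 0 ≤ θ) (hA : ∀ x, |S.ev g x| ≤ A * a x ^ θ) (hp' : 0 < p')
    (hsum : θ + 1 / p' = 2 / p) {Y : ℝ} (h2 : S.powInt p' (S.D α (S.D α g)) ≤ Y)
    (h1 : S.powInt p' (S.D α g) ≤ Y) :
    S.powInt p (S.D α g) ≤ (p - 1 + c) * (A * (∫ x, a x ∂μ) ^ θ * Y ^ (1 / p') *
      S.powInt p (S.D α g) ^ (1 - 2 / p)) := by
  have hp0 : 0 < p := by linarith
  have hq : 0 ≤ 1 - 2 / p := by rw [sub_nonneg, div_le_one hp0]; exact hp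
  have hp2 : p * (1 - 2 / p) = p - 2 := by field_simp
  set b : X → ℝ := fun x => |S.ev (S.D α g) x| ^ p
  have hb : Integrable b μ := S.integrable_pow hp0.le _
  have key : ∀ h : 𝒜, S.powInt p' h ≤ Y →
      Integrable (fun x => |S.ev g x| * |S.ev (S.D α g) x| ^ (p - 2) * |S.ev h x|) μ ∧
      ∫ x, |S.ev g x| * |S.ev (S.D α g) x| ^ (p - 2) * |S.ev h x| ∂μ ≤
      A * (∫ x, a x ∂μ) ^ θ * Y ^ (1 / p') * S.powInt p (S.D α g) ^ (1 - 2 / p) := by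
    intro h hY
    have hint : Integrable (fun x => |S.ev g x| * |S.ev (S.D α g) x| ^ (p - 2) * |S.ev h x|) μ := by
      obtain ⟨F, hF0, hF⟩ := S.exists_pos_bound g
      obtain ⟨G, hG0, hG⟩ := S.exists_pos_bound (S.D α g)
      obtain ⟨H, hH0, hH⟩ := S.exists_pos_bound h
      refine integrable_of_bounded' (C := F * G ^ (p - 2) * H)
        (((S.measurable_ev _).abs.mul ((S.measurable_ev _).abs.pow_const _)).mul
          (S.measurable_ev _).abs) fun x => ?_
      rw [abs_of_nonneg (by positivity)]
      have := Real.rpow_le_rpow (abs_nonneg _) (hG x) (by linarith : (0:ℝ) ≤ p - 2)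
      gcongr
      · exact hF x
      · exact hH x
    refine ⟨hint, ?_⟩
    have hH := integral_mul_mul_rpow_le ha (S.integrable_pow hp'.le h) hb ha0
      (fun _ => by positivity) (fun _ => by positivity) hθ (by positivity : 0 ≤ 1 / p') hq
      (by linarith)
    have hI : Integrable (fun x => A * (a x ^ θ * (|S.ev h x| ^ p') ^ (1 / p') *
        b x ^ (1 - 2 / p))) μ := by
      have hθ1 : θ ≤ 1 := by
        have : 2 / p ≤ 1 := by linarith
        have : 0 < 1 / p' := by positivity
        linarith
      obtain ⟨G, hG0, hG⟩ := S.exists_pos_bound (S.D α g)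
      obtain ⟨H, hH0, hH⟩ := S.exists_pos_bound h
      refine Integrable.const_mul (Integrable.mono' (g := fun x => (1 + a x) * (H * G ^ (p - 2)))
        (((integrable_const 1).add ha).mul_const _)
        (((ha.aemeasurable.pow_const θ).mul
          (((S.measurable_ev h).abs.pow_const _).pow_const _).aemeasurable).mul
          (hb.aemeasurable.pow_const _)).aestronglyMeasurable (.of_forall fun x => ?_)) A
      have e1 : (|S.ev h x| ^ p') ^ (1 / p') = |S.ev h x| := by
        rw [← Real.rpow_mul (abs_nonneg _), mul_one_div_cancel hp'.ne', Real.rpow_one]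
      have e2 : b x ^ (1 - 2 / p) = |S.ev (S.D α g) x| ^ (p - 2) := by
        rw [← Real.rpow_mul (abs_nonneg _), hp2]
      -- From `hsum` and `p ≥ 2` one has `θ ≤ 1`, so integrability of `a` suffices.
      have e3 : a x ^ θ ≤ 1 + a x := by
        have h1 : a x ^ θ ≤ (1 + a x) ^ θ := Real.rpow_le_rpow (ha0 x) (by linarith) hθ
        exact h1.trans (Real.rpow_le_self_of_one_le (by linarith [ha0 x]) hθ1)
      have e4 := Real.rpow_nonneg (ha0 x) θ
      simp only [Pi.mul_apply]
      rw [e1, e2, Real.norm_eq_abs, abs_of_nonneg (by positivity), mul_assoc]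
      have := Real.rpow_le_rpow (abs_nonneg _) (hG x) (by linarith : (0:ℝ) ≤ p - 2)
      have := ha0 x
      gcongr
      exact hH x
    have hAi := Real.rpow_nonneg (integral_nonneg (μ := μ) ha0) θ
    have hX := S.powInt_nonneg p (S.D α g)
    calc _ ≤ ∫ x, A * (a x ^ θ * (|S.ev h x| ^ p') ^ (1 / p') * b x ^ (1 - 2 / p)) ∂μ := by
          refine integral_mono hint hI fun x => ?_
          have e1 : (|S.ev h x| ^ p') ^ (1 / p') = |S.ev h x| := by
            rw [← Real.rpow_mul (abs_nonneg _), mul_one_div_cancel hp'.ne', Real.rpow_one]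
          have e2 : b x ^ (1 - 2 / p) = |S.ev (S.D α g) x| ^ (p - 2) := by
            rw [← Real.rpow_mul (abs_nonneg _), hp2]
          simp only
          rw [e1, e2]
          calc _ ≤ (A * a x ^ θ) * |S.ev (S.D α g) x| ^ (p - 2) * |S.ev h x| := by
                gcongr; exact hA x
            _ = _ := by ring
      _ = A * ∫ x, (a x ^ θ * (|S.ev h x| ^ p') ^ (1 / p') * b x ^ (1 - 2 / p)) ∂μ :=
          integral_const_mul _ _
      _ ≤ A * ((∫ x, a x ∂μ) ^ θ * (S.powInt p' h) ^ (1 / p') *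
            (S.powInt p (S.D α g)) ^ (1 - 2 / p)) := by gcongr; exact hH
      _ ≤ A * ((∫ x, a x ∂μ) ^ θ * Y ^ (1 / p') * (S.powInt p (S.D α g)) ^ (1 - 2 / p)) := by
          have := Real.rpow_le_rpow (S.powInt_nonneg p' h) hY (by positivity : 0 ≤ 1 / p')
          gcongr
      _ = _ := by ring
  obtain ⟨i1, b1⟩ := key _ h2
  obtain ⟨i2, b2⟩ := key _ h1
  have hp1 : 0 ≤ p - 1 := by linarith
  calc S.powInt p (S.D α g) ≤ _ := S.powInt_D_le α hc hp g
    _ = ∫ x, ((p - 1) * (|S.ev g x| * |S.ev (S.D α g) x| ^ (p - 2) *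
          |S.ev (S.D α (S.D α g)) x|) + c * (|S.ev g x| * |S.ev (S.D α g) x| ^ (p - 2) *
          |S.ev (S.D α g) x|)) ∂μ := by congr 1; ext x; ring
    _ = _ := by rw [integral_add (i1.const_mul _) (i2.const_mul _), integral_const_mul,
          integral_const_mul]
    _ ≤ _ := add_le_add (mul_le_mul_of_nonneg_left b1 hp1) (mul_le_mul_of_nonneg_left b2 hc0)
    _ = _ := by ring

variable [Finite ι]

/-- The words of length at most `n`. -/
noncomputable def _root_.ExtrinsicHarmonic.words (ι : Type*) [Finite ι] (n : ℕ) :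
    Finset (List ι) := (List.finite_length_le ι n).toFinset

@[simp] lemma _root_.ExtrinsicHarmonic.mem_words {n : ℕ} {I : List ι} :
    I ∈ words ι n ↔ I.length ≤ n := by simp [words]

/-- The sum of the integrals `∫ |D_I f|^(2k/i)` over the words of length at most `i`. -/
noncomputable def powSum (k i : ℕ) (f : 𝒜) : ℝ :=
  -- Shorter words are included because the divergence term in the integration by parts is of lower
  -- order.
  ∑ I ∈ words ι i, S.powInt (2 * k / i) (S.dw I f)

lemma powSum_nonneg (k i : ℕ) (f : 𝒜) : 0 ≤ S.powSum k i f :=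
  Finset.sum_nonneg fun _ _ => S.powInt_nonneg _ _

lemma powInt_le_powSum {k i : ℕ} {I : List ι} (hI : I.length ≤ i) (f : 𝒜) :
    S.powInt (2 * k / i) (S.dw I f) ≤ S.powSum k i f :=
  Finset.single_le_sum (f := fun I => S.powInt (2 * k / i) (S.dw I f))
    (fun _ _ => S.powInt_nonneg _ _) (by simpa using hI)

/-- Either `a Y` is at least half of `M`, or `M` is at most twice the other term and `M^(1-θ)` can
be divided out. This absorption, in place of Young's inequality, closes the estimates in which the
same sum occurs on both sides. -/
lemma _root_.le_const_mul_of_le_add_rpow {M Y a b θ : ℝ} (hM : 0 ≤ M) (hY : 0 ≤ Y) (ha : 0 ≤ a)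
    (hb : 0 ≤ b) (hθ : 0 < θ) (h : M ≤ a * Y + b * (M ^ (1 - θ) * Y ^ θ)) :
    M ≤ (2 * a + (2 * b) ^ (1 / θ)) * Y := by
  have hc : 0 ≤ (2 * b) ^ (1 / θ) := by positivity
  rcases le_total M (2 * a * Y) with h1 | h1
  · nlinarith [mul_nonneg hc hY]
  · rcases hM.eq_or_lt with h0 | h0
    · rw [← h0]; positivity
    have h2 : M ≤ 2 * b * (M ^ (1 - θ) * Y ^ θ) := by linarith
    have h3 : M = M ^ (1 - θ) * M ^ θ := by rw [← Real.rpow_add h0]; simp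
    have h4 : 0 < M ^ (1 - θ) := Real.rpow_pos_of_pos h0 _
    have h5 : M ^ θ ≤ 2 * b * Y ^ θ := by
      refine le_of_mul_le_mul_left ?_ h4
      calc M ^ (1 - θ) * M ^ θ = M := h3.symm
        _ ≤ _ := h2
        _ = _ := by ring
    have h6 : M ≤ (2 * b) ^ (1 / θ) * Y := by
      have := Real.rpow_le_rpow (by positivity) h5 (by positivity : 0 ≤ 1 / θ)
      rwa [Real.mul_rpow (by positivity) (by positivity), ← Real.rpow_mul hM,
        ← Real.rpow_mul hY, mul_one_div_cancel hθ.ne', Real.rpow_one, Real.rpow_one] at this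
    nlinarith [mul_nonneg ha hY]

lemma exists_bound_dv : ∃ c, 0 ≤ c ∧ ∀ α x, |S.ev (S.dv α) x| ≤ c := by
  have : Fintype ι := Fintype.ofFinite ι
  choose c hc0 hc using fun α => S.exists_pos_bound (S.dv α)
  exact ⟨∑ α, c α, Finset.sum_nonneg fun α _ => (hc0 α).le, fun α x => (hc α x).trans
    (Finset.single_le_sum (fun α _ => (hc0 α).le) (Finset.mem_univ α))⟩

/-- One interpolation step: if `α` is the last letter of `I = I' α`, then `D_I f` lies between
`D_{I'} f` and `D_{I' α α} f`. Information on `D_{I'} f` enters through `a` in `hprev`: a constant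
at the first order, a power of `|D_{I'} f|` afterwards. The previous order may be controlled by the
sum being estimated, because the absorption lemma removes it. -/
lemma exists_powSum_le_succ_of_prev {k : ℕ} {A : ℝ} (hA : 1 ≤ A) {i : ℕ} (hi : 1 ≤ i)
    (hik : i < k) {Cm : ℝ} (hCm : 0 ≤ Cm)
    (hprev : ∀ f : 𝒜, (∀ x, |S.ev f x| ≤ A) → ∀ I : List ι, I.length + 1 ≤ i → ∃ a : X → ℝ,
      Integrable a μ ∧ (∀ x, 0 ≤ a x) ∧
      (∀ x, |S.ev (S.dw I f) x| ≤ A * a x ^ (((i : ℝ) - 1) / (2 * k))) ∧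
      (∫ x, a x ∂μ) ^ (((i : ℝ) - 1) / (2 * k)) ≤
        (Cm * S.powSum k i f) ^ (((i : ℝ) - 1) / (2 * k))) :
    ∃ C, 0 ≤ C ∧ ∀ f : 𝒜, (∀ x, |S.ev f x| ≤ A) →
      S.powSum k i f ≤ C * S.powSum k (i + 1) f := by
  obtain ⟨c, hc0, hc⟩ := S.exists_bound_dv
  have hk0 : (0 : ℝ) < k := by exact_mod_cast (by omega : 0 < k)
  have hi0 : (0 : ℝ) < i := by exact_mod_cast hi
  have hi1 : (1 : ℝ) ≤ i := by exact_mod_cast hi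
  have hik' : (i : ℝ) + 1 ≤ k := by exact_mod_cast hik
  set p : ℝ := 2 * k / i with hp
  set p' : ℝ := 2 * k / ((i : ℝ) + 1) with hp'
  set θ : ℝ := ((i : ℝ) - 1) / (2 * k) with hθ
  have hp'0 : 0 < p' := by positivity
  have hpp' : p' ≤ p := by rw [hp, hp']; gcongr; linarith
  have hp2 : 2 ≤ p := by rw [hp, le_div_iff₀ hi0]; linarith
  have hθ0 : 0 ≤ θ := by rw [hθ]; apply div_nonneg <;> linarith
  -- The exponents are arithmetic in the order: `(i - 1) + (i + 1) = 2 i`.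
  have hsum : θ + 1 / p' = 2 / p := by rw [hθ, hp, hp']; field_simp; ring
  have hq : 0 ≤ 1 - 2 / p := by rw [sub_nonneg, div_le_one (by linarith)]; exact hp2
  have hcast : 2 * (k : ℝ) / ((i + 1 : ℕ) : ℝ) = p' := by rw [hp']; push_cast; rfl
  set B : ℝ := (p - 1 + c) * (A * Cm ^ θ)
  have hB : 0 ≤ B := mul_nonneg (by linarith) (by positivity)
  have hN : (0 : ℝ) ≤ ((words ι i).card : ℝ) := by positivity
  refine ⟨2 * ((words ι i).card * A ^ (p - p')) + (2 * ((words ι i).card * B)) ^ (1 / (1 / p')),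
    by positivity, fun f hf => ?_⟩
  set M := S.powSum k i f with hM
  set Y := S.powSum k (i + 1) f with hY
  have hM0 : 0 ≤ M := S.powSum_nonneg _ _ _
  have hY0 : 0 ≤ Y := S.powSum_nonneg _ _ _
  have hYle : ∀ I : List ι, I.length ≤ i + 1 → S.powInt p' (S.dw I f) ≤ Y := fun I hI => by
    rw [← hcast]; exact S.powInt_le_powSum hI f
  refine le_const_mul_of_le_add_rpow hM0 hY0 (by positivity) (by positivity)
    (by positivity : 0 < 1 / p') ?_
  have hword : ∀ I ∈ words ι i, S.powInt p (S.dw I f) ≤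
      A ^ (p - p') * Y + B * (M ^ (1 - 1 / p') * Y ^ (1 / p')) := by
    intro I hI
    rw [mem_words] at hI
    rcases List.eq_nil_or_concat I with rfl | ⟨I', α, rfl⟩
    -- The empty word has no derivative to integrate by parts; here `|f| ≤ A` lowers the exponent
    -- from `p` to `p'`.
    · have h1 : S.powInt p f ≤ A ^ (p - p') * S.powInt p' f := by
        rw [powInt, powInt, ← integral_const_mul]
        refine integral_mono (S.integrable_pow (by linarith) f)
          ((S.integrable_pow hp'0.le f).const_mul _) fun x => ?_
        have h2 : |S.ev f x| ^ p = |S.ev f x| ^ (p - p') * |S.ev f x| ^ p' := by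
          rw [← Real.rpow_add_of_nonneg (abs_nonneg _) (by linarith) hp'0.le]; congr 1; ring
        simp only [h2]
        have := Real.rpow_le_rpow (abs_nonneg _) (hf x) (by linarith : 0 ≤ p - p')
        gcongr
      have h3 := hYle [] (by simp)
      have : 0 ≤ B * (M ^ (1 - 1 / p') * Y ^ (1 / p')) := by positivity
      have : A ^ (p - p') * S.powInt p' f ≤ A ^ (p - p') * Y := by gcongr; exact h3
      simp only [dw_nil]
      linarith
    · rw [List.concat_eq_append] at hI ⊢
      have hI' : I'.length + 1 ≤ i := by simpa using hI
      obtain ⟨a, ha, ha0, hgA, haM⟩ := hprev f hf I' hI'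
      have e1 : S.dw (I' ++ [α]) f = S.D α (S.dw I' f) := by simp [dw_append]
      have e2 : S.dw (I' ++ [α, α]) f = S.D α (S.D α (S.dw I' f)) := by simp [dw_append]
      have h1 := hYle (I' ++ [α]) (by simp; omega)
      have h2 := hYle (I' ++ [α, α]) (by simp; omega)
      have h3 := S.powInt_le_powSum (k := k) hI f
      rw [e1] at h1 h3 ⊢
      rw [e2] at h2
      have key := S.powInt_D_le_holder α (hc α) hc0 hp2 (S.dw I' f) ha ha0 (by linarith) hθ0 hgA
        hp'0 hsum h2 h1
      have hX := S.powInt_nonneg p (S.D α (S.dw I' f))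
      have h4 := Real.rpow_le_rpow hX h3 hq
      -- `M^θ` comes from the order below and `M^(1-2/p)` from the Hölder factor of `D_I f` itself.
      have h5 : M ^ (1 - 1 / p') = M ^ θ * M ^ (1 - 2 / p) := by
        rw [← Real.rpow_add_of_nonneg hM0 hθ0 hq]; congr 1; linarith
      have hi' := Real.rpow_nonneg (integral_nonneg (μ := μ) ha0) θ
      rw [Real.mul_rpow hCm hM0] at haM
      calc _ ≤ _ := key
        _ ≤ (p - 1 + c) * (A * (Cm ^ θ * M ^ θ) * Y ^ (1 / p') * M ^ (1 - 2 / p)) := by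
          have : 0 ≤ p - 1 + c := by linarith
          gcongr
        _ = B * (M ^ (1 - 1 / p') * Y ^ (1 / p')) := by rw [h5]; ring
        _ ≤ _ := le_add_of_nonneg_left (by positivity)
  calc M ≤ ∑ I ∈ words ι i, (A ^ (p - p') * Y + B * (M ^ (1 - 1 / p') * Y ^ (1 / p'))) :=
        Finset.sum_le_sum hword
    _ = _ := by rw [Finset.sum_const, nsmul_eq_mul]; ring

/-- The Gagliardo–Nirenberg inequality for consecutive orders. -/
lemma exists_powSum_le_succ {k : ℕ} {A : ℝ} (hA : 1 ≤ A) (i : ℕ) (hi : 1 ≤ i) (hik : i < k) :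
    ∃ C, 0 ≤ C ∧ ∀ f : 𝒜, (∀ x, |S.ev f x| ≤ A) → S.powSum k i f ≤ C * S.powSum k (i + 1) f := by
  induction i, hi using Nat.le_induction with
  | base =>
    refine S.exists_powSum_le_succ_of_prev hA le_rfl hik zero_le_one fun f hf I hI => ?_
    -- For `i = 1` the exponent `(i-1)/(2k)` is zero and the word is empty, so only the uniform
    -- bound `A` is used.
    refine ⟨fun _ => 1, integrable_const _, fun _ => zero_le_one, fun x => ?_, ?_⟩
    · have : I = [] := List.length_eq_zero_iff.mp (by omega)
      simpa [this] using hf x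
    · simp
  | succ i hi ih =>
    obtain ⟨Cm, hCm, hM⟩ := ih (by omega)
    have hi0 : (0 : ℝ) < i := by exact_mod_cast hi
    have hk0 : (0 : ℝ) < k := by exact_mod_cast (by omega : 0 < k)
    refine S.exists_powSum_le_succ_of_prev hA (by omega) hik hCm fun f hf I hI => ?_
    -- The exponent with `i + 1` in place of `i` is `i/(2k)`, which turns this power back into `|D_I
    -- f|`.
    refine ⟨fun x => |S.ev (S.dw I f) x| ^ (2 * (k : ℝ) / i), S.integrable_pow (by positivity) _,
      fun x => by positivity, fun x => ?_, ?_⟩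
    · rw [← Real.rpow_mul (abs_nonneg _)]
      have : 2 * (k : ℝ) / i * ((((i + 1 : ℕ) : ℝ) - 1) / (2 * k)) = 1 := by
        push_cast; field_simp; ring
      rw [this, Real.rpow_one]
      exact le_mul_of_one_le_left (abs_nonneg _) hA
    · refine Real.rpow_le_rpow (S.powInt_nonneg _ _)
        ((S.powInt_le_powSum (by omega) f).trans (hM f hf)) ?_
      push_cast
      apply div_nonneg <;> linarith

/-- The Gagliardo–Nirenberg inequality. -/
lemma exists_powInt_le {k : ℕ} {A : ℝ} (hA : 1 ≤ A) (i : ℕ) (hi : 1 ≤ i) (hik : i ≤ k) :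
    ∃ C, 0 ≤ C ∧ ∀ f : 𝒜, (∀ x, |S.ev f x| ≤ A) → S.powSum k i f ≤ C * S.powSum k k f := by
  induction hik using Nat.decreasingInduction with
  | of_succ i hik ih =>
    obtain ⟨C, hC, h⟩ := ih (by omega)
    obtain ⟨C', hC', h'⟩ := S.exists_powSum_le_succ hA i hi hik
    exact ⟨C' * C, by positivity, fun f hf => (h' f hf).trans (by
      rw [mul_assoc]; exact mul_le_mul_of_nonneg_left (h f hf) hC')⟩
  | self => exact ⟨1, zero_le_one, fun f _ => by simp⟩

end SobolevAlgebra
end ExtrinsicHarmonic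

/-! ### W^{k,2} norms and Moser's product estimate -/

namespace ExtrinsicHarmonic
namespace SobolevAlgebra

variable {X : Type*} [MeasurableSpace X] {μ : Measure X} [IsFiniteMeasure μ]
  {𝒜 : Type*} [CommRing 𝒜] [Algebra ℝ 𝒜] {ι : Type*} (S : SobolevAlgebra μ 𝒜 ι)

/-- The class in `L²` of an element of the algebra. -/
noncomputable def lp : 𝒜 →ₗ[ℝ] Lp ℝ 2 μ where
  toFun f := (S.memLp f 2).toLp _
  map_add' f g := by
    rw [← MemLp.toLp_add]
    congr 1
    exact map_add S.ev f g
  map_smul' c f := by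
    rw [RingHom.id_apply, ← MemLp.toLp_const_smul]
    congr 1
    exact map_smul S.ev c f

lemma coeFn_lp (f : 𝒜) : S.lp f =ᵐ[μ] S.ev f := (S.memLp f 2).coeFn_toLp

lemma norm_lp_sq (f : 𝒜) : ‖S.lp f‖ ^ 2 = ∫ x, S.ev f x ^ 2 ∂μ := by
  rw [← real_inner_self_eq_norm_sq, L2.inner_def]
  refine integral_congr_ae ?_
  filter_upwards [S.coeFn_lp f] with x hx
  simp [hx, sq]

lemma inner_lp (f g : 𝒜) : inner ℝ (S.lp f) (S.lp g) = ∫ x, S.ev (f * g) x ∂μ := by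
  rw [L2.inner_def]
  refine integral_congr_ae ?_
  filter_upwards [S.coeFn_lp f, S.coeFn_lp g] with x hx hy
  simp [hx, hy, mul_comm]

lemma abs_integral_mul_le (f g : 𝒜) : |∫ x, S.ev (f * g) x ∂μ| ≤ ‖S.lp f‖ * ‖S.lp g‖ := by
  rw [← inner_lp]; exact abs_real_inner_le_norm _ _

lemma norm_lp_le_of_abs_le {f g : 𝒜} {A : ℝ}
    (h : ∀ x, |S.ev f x| ≤ A * |S.ev g x|) : ‖S.lp f‖ ≤ A * ‖S.lp g‖ := by
  refine Lp.norm_le_mul_norm_of_ae_le_mul ?_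
  filter_upwards [S.coeFn_lp f, S.coeFn_lp g] with x hx hy
  simpa [hx, hy] using h x

lemma norm_lp_mul_le {f g : 𝒜} {A : ℝ} (h : ∀ x, |S.ev f x| ≤ A) :
    ‖S.lp (f * g)‖ ≤ A * ‖S.lp g‖ := by
  refine S.norm_lp_le_of_abs_le fun x => ?_
  simp only [map_mul, Pi.mul_apply, abs_mul]
  exact mul_le_mul_of_nonneg_right (h x) (abs_nonneg _)

/-- Leibniz' rule for iterated derivations. -/
lemma exists_leibniz (K : List ι) : ∃ P : List (List ι × List ι),
    (∀ q ∈ P, q.1.length + q.2.length = K.length) ∧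
    ∀ f h : 𝒜, S.dw K (f * h) = (P.map fun q => S.dw q.1 f * S.dw q.2 h).sum := by
  induction K with
  | nil => exact ⟨[([], [])], by simp, by simp⟩
  | cons α K ih =>
    obtain ⟨P, hP, h⟩ := ih
    refine ⟨P.map (fun q => (q.1, α :: q.2)) ++ P.map (fun q => (α :: q.1, q.2)), ?_, ?_⟩
    · intro q hq
      simp only [List.mem_append, List.mem_map] at hq
      rcases hq with ⟨q', hq', rfl⟩ | ⟨q', hq', rfl⟩ <;>
        · have := hP q' hq'
          simp; omega
    · intro f g
      rw [dw_cons, Derivation.leibniz, smul_eq_mul, smul_eq_mul, map_add, h, mul_comm g, h]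
      simp [Function.comp_def]

variable [Finite ι]

/-- The `W^{k,2}` norm. -/
noncomputable def N (k : ℕ) (f : 𝒜) : ℝ := ∑ I ∈ words ι k, ‖S.lp (S.dw I f)‖

lemma N_nonneg (k : ℕ) (f : 𝒜) : 0 ≤ S.N k f := Finset.sum_nonneg fun _ _ => norm_nonneg _

lemma N_add_le (k : ℕ) (f g : 𝒜) : S.N k (f + g) ≤ S.N k f + S.N k g := by
  rw [N, N, N, ← Finset.sum_add_distrib]
  refine Finset.sum_le_sum fun I _ => ?_
  rw [map_add, map_add]
  exact norm_add_le _ _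

lemma N_smul (k : ℕ) (c : ℝ) (f : 𝒜) : S.N k (c • f) = |c| * S.N k f := by
  rw [N, N, Finset.mul_sum]
  refine Finset.sum_congr rfl fun I _ => ?_
  rw [map_smul, map_smul, norm_smul, Real.norm_eq_abs]

lemma N_neg (k : ℕ) (f : 𝒜) : S.N k (-f) = S.N k f := by
  rw [← neg_one_smul ℝ f, N_smul]; simp

lemma N_zero (k : ℕ) : S.N k (0 : 𝒜) = 0 := by simp [N]

lemma N_sub_le (k : ℕ) (f g : 𝒜) : S.N k (f - g) ≤ S.N k f + S.N k g := by
  rw [sub_eq_add_neg, ← S.N_neg k g]; exact S.N_add_le k _ _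

lemma N_sub_comm (k : ℕ) (f g : 𝒜) : S.N k (f - g) = S.N k (g - f) := by
  rw [← N_neg, neg_sub]

lemma norm_lp_dw_le {k : ℕ} {I : List ι} (hI : I.length ≤ k) (f : 𝒜) :
    ‖S.lp (S.dw I f)‖ ≤ S.N k f :=
  Finset.single_le_sum (f := fun I => ‖S.lp (S.dw I f)‖) (fun _ _ => norm_nonneg _)
    (by simpa using hI)

lemma norm_lp_le (k : ℕ) (f : 𝒜) : ‖S.lp f‖ ≤ S.N k f := S.norm_lp_dw_le (I := []) (by simp) f

lemma N_mono {j k : ℕ} (h : j ≤ k) (f : 𝒜) : S.N j f ≤ S.N k f :=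
  Finset.sum_le_sum_of_subset_of_nonneg (fun I hI => by simp at hI ⊢; omega)
    fun _ _ _ => norm_nonneg _

lemma exists_N_D_le (k : ℕ) : ∃ C, 0 ≤ C ∧ ∀ (α : ι) (f : 𝒜), S.N k (S.D α f) ≤ C * S.N (k + 1) f := by
  refine ⟨(words ι k).card, by positivity, fun α f => ?_⟩
  rw [N, ← nsmul_eq_mul]
  refine Finset.sum_le_card_nsmul _ _ _ fun I hI => ?_
  exact S.norm_lp_dw_le (I := α :: I) (by simpa using hI) f

lemma exists_N_le_of_forall {κ : Type*} (k : ℕ) (F : κ → 𝒜) (b : κ → ℝ)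
    (h : ∀ I : List ι, I.length ≤ k → ∃ C, 0 ≤ C ∧ ∀ i, ‖S.lp (S.dw I (F i))‖ ≤ C * b i) :
    ∃ C, 0 ≤ C ∧ ∀ i, S.N k (F i) ≤ C * b i := by
  choose! C hC0 hC using h
  refine ⟨∑ I ∈ words ι k, C I, Finset.sum_nonneg fun I hI => hC0 I (by simpa using hI),
    fun i => ?_⟩
  rw [N, Finset.sum_mul]
  exact Finset.sum_le_sum fun I hI => hC I (by simpa using hI) i

lemma norm_lp_list_sum_le {κ : Type*} (P : List κ) (F : κ → 𝒜) (b : ℝ)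
    (h : ∀ q ∈ P, ‖S.lp (F q)‖ ≤ b) : ‖S.lp (P.map F).sum‖ ≤ P.length * b := by
  induction P with
  | nil => simp
  | cons q P ih =>
    rw [List.map_cons, List.sum_cons, map_add]
    have h1 := h q (by simp)
    have h2 := ih fun q hq => h q (by simp [hq])
    calc _ ≤ _ := norm_add_le _ _
      _ ≤ b + P.length * b := add_le_add h1 h2
      _ = _ := by push_cast [List.length_cons]; ring

/-- Multiplication by a fixed element is bounded. -/
lemma exists_N_mul_le (k : ℕ) (a : 𝒜) : ∃ C, 0 ≤ C ∧ ∀ f, S.N k (a * f) ≤ C * S.N k f := by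
  refine S.exists_N_le_of_forall k _ _ fun K hK => ?_
  obtain ⟨P, hP, h⟩ := S.exists_leibniz K
  choose R hR0 hR using fun I => S.exists_pos_bound (S.dw I a)
  refine ⟨P.length * (P.map fun q => R q.1).sum, ?_, fun f => ?_⟩
  · refine mul_nonneg (by positivity) (List.sum_nonneg ?_)
    simp only [List.mem_map]; rintro _ ⟨q, _, rfl⟩; exact (hR0 _).le
  rw [h, mul_assoc]
  refine S.norm_lp_list_sum_le P _ _ fun q hq => ?_
  have h1 : R q.1 ≤ (P.map fun q => R q.1).sum := by
    refine List.single_le_sum ?_ _ (List.mem_map_of_mem hq)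
    simp only [List.mem_map]; rintro _ ⟨q, _, rfl⟩; exact (hR0 _).le
  have h2 := S.norm_lp_dw_le (k := k) (I := q.2) (by have := hP q hq; omega) f
  calc _ ≤ R q.1 * ‖S.lp (S.dw q.2 f)‖ := S.norm_lp_mul_le (hR _)
    _ ≤ _ := mul_le_mul h1 h2 (norm_nonneg _) ((hR0 _).le.trans h1)

/-- At top order the exponent `2k/i` equals `2`, so the Gagliardo–Nirenberg right-hand side is a sum
of squared L² norms. -/
lemma powSum_le_N_sq {k : ℕ} (hk : 1 ≤ k) (f : 𝒜) : S.powSum k k f ≤ S.N k f ^ 2 := by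
  have hk0 : (0 : ℝ) < k := by exact_mod_cast hk
  have : S.powSum k k f = ∑ I ∈ words ι k, ‖S.lp (S.dw I f)‖ ^ 2 := by
    refine Finset.sum_congr rfl fun I _ => ?_
    rw [norm_lp_sq, powInt]
    congr 1; ext x
    rw [mul_div_assoc, div_self hk0.ne', mul_one, ← sq_abs]
    exact_mod_cast Real.rpow_natCast _ 2
  rw [this, N]
  exact Finset.sum_sq_le_sq_sum_of_nonneg fun _ _ => norm_nonneg _

/-- Moser's product estimate, for the terms where both factors are differentiated. -/
lemma exists_norm_lp_dw_mul_dw_le {k : ℕ} {A : ℝ} (hA : 1 ≤ A) : ∃ C, 0 ≤ C ∧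
    ∀ (I J : List ι), I ≠ [] → J ≠ [] → I.length + J.length ≤ k → ∀ f h : 𝒜,
    (∀ x, |S.ev f x| ≤ A) → (∀ x, |S.ev h x| ≤ A) →
    ‖S.lp (S.dw I f * S.dw J h)‖ ≤ C * (S.N k f ^ ((I.length : ℝ) / k) *
      S.N k h ^ (((k : ℝ) - I.length) / k)) := by
  have key : ∀ i : ℕ, ∃ C, 0 ≤ C ∧ (1 ≤ i → i ≤ k → ∀ f : 𝒜, (∀ x, |S.ev f x| ≤ A) →
      S.powSum k i f ≤ C * S.powSum k k f) := by
    intro i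
    by_cases hi : 1 ≤ i ∧ i ≤ k
    · obtain ⟨C, hC, h⟩ := S.exists_powInt_le (k := k) hA i hi.1 hi.2
      exact ⟨C, hC, fun _ _ => h⟩
    · exact ⟨0, le_rfl, fun h1 h2 => absurd ⟨h1, h2⟩ hi⟩
  choose C0 hC0 hC using key
  set C : ℝ := 1 + ∑ i ∈ Finset.range (k + 1), C0 i with hCdef
  have hC1 : 1 ≤ C := le_add_of_nonneg_right (Finset.sum_nonneg fun i _ => hC0 i)
  have hGN : ∀ i : ℕ, 1 ≤ i → i ≤ k → ∀ f : 𝒜, (∀ x, |S.ev f x| ≤ A) →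
      S.powSum k i f ≤ C * S.N k f ^ 2 := by
    intro i h1 h2 f hf
    have h3 : C0 i ≤ C := by
      have := Finset.single_le_sum (f := C0) (s := Finset.range (k + 1)) (fun i _ => hC0 i)
        (Finset.mem_range.mpr (by omega : i < k + 1))
      linarith
    calc _ ≤ _ := hC i h1 h2 f hf
      _ ≤ C * S.N k f ^ 2 := mul_le_mul h3 (S.powSum_le_N_sq (h1.trans h2) f)
          (S.powSum_nonneg _ _ _) (by linarith)
  refine ⟨C, by linarith, fun I J hI hJ hIJ f h hf hh => ?_⟩
  have hI1 : 1 ≤ I.length := List.length_pos_iff.mpr hI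
  have hJ1 : 1 ≤ J.length := List.length_pos_iff.mpr hJ
  set i := I.length with hi
  have hi0 : (0 : ℝ) < i := by exact_mod_cast hI1
  have hik : i < k := by omega
  have hik' : (i : ℝ) < k := by exact_mod_cast hik
  have hk0 : (0 : ℝ) < k := by linarith
  have hcast : ((k - i : ℕ) : ℝ) = (k : ℝ) - i := by rw [Nat.cast_sub hik.le]
  have hki : (0 : ℝ) < (k : ℝ) - i := by linarith
  set r : ℝ := i / k with hr
  set s : ℝ := ((k : ℝ) - i) / k with hs
  have hr0 : 0 ≤ r := by positivity
  have hs0 : 0 ≤ s := by positivity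
  have hrs : r + s + 0 = 1 := by rw [hr, hs]; field_simp; ring
  have g1 := (S.powInt_le_powSum (k := k) (i := i) le_rfl f).trans (hGN i hI1 hik.le f hf)
  -- The word `J` has length at most `k - i`, so it may be measured with the exponent `2k/(k-i)`,
  -- conjugate to the exponent used for `I`.
  have g2 := (S.powInt_le_powSum (k := k) (i := k - i) (by omega : J.length ≤ k - i) h).trans
    (hGN (k - i) (by omega) (by omega) h hh)
  rw [hcast] at g2
  -- Two-factor Hölder; the third function is `1` with exponent `0`.
  have hold := integral_mul_mul_rpow_le (c := fun _ => (1 : ℝ))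
    (S.integrable_pow (p := 2 * k / i) (by positivity) (S.dw I f))
    (S.integrable_pow (p := 2 * k / ((k : ℝ) - i)) (by positivity) (S.dw J h))
    (integrable_const 1) (fun _ => by positivity) (fun _ => by positivity) (fun _ => zero_le_one)
    hr0 hs0 le_rfl hrs
  have e : ∀ x, (|S.ev (S.dw I f) x| ^ (2 * (k : ℝ) / i)) ^ r *
      (|S.ev (S.dw J h) x| ^ (2 * (k : ℝ) / ((k : ℝ) - i))) ^ s * (1 : ℝ) ^ (0 : ℝ) =
      S.ev (S.dw I f * S.dw J h) x ^ 2 := by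
    intro x
    rw [← Real.rpow_mul (abs_nonneg _), ← Real.rpow_mul (abs_nonneg _)]
    have e1 : 2 * (k : ℝ) / i * r = 2 := by rw [hr]; field_simp
    have e2 : 2 * (k : ℝ) / ((k : ℝ) - i) * s = 2 := by rw [hs]; field_simp
    rw [e1, e2]
    simp [mul_pow]
  simp only [e] at hold
  simp only [Real.rpow_zero, mul_one] at hold
  rw [← norm_lp_sq] at hold
  have hNf := S.N_nonneg k f
  have hNh := S.N_nonneg k h
  refine le_of_sq_le_sq ?_ (by positivity)
  calc _ ≤ _ := hold
    _ ≤ (C * S.N k f ^ 2) ^ r * (C * S.N k h ^ 2) ^ s :=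
        mul_le_mul (Real.rpow_le_rpow (S.powInt_nonneg _ _) g1 hr0)
          (Real.rpow_le_rpow (S.powInt_nonneg _ _) g2 hs0)
          (Real.rpow_nonneg (S.powInt_nonneg _ _) _) (by positivity)
    _ = C ^ (r + s) * (S.N k f ^ r * S.N k h ^ s) ^ 2 := by
        rw [Real.mul_rpow (by linarith) (by positivity), Real.mul_rpow (by linarith) (by positivity),
          Real.rpow_add (by linarith), mul_pow]
        have e1 : (S.N k f ^ 2) ^ r = (S.N k f ^ r) ^ 2 := by
          rw [← Real.rpow_natCast, ← Real.rpow_natCast, ← Real.rpow_mul hNf, ← Real.rpow_mul hNf,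
            mul_comm]
        have e2 : (S.N k h ^ 2) ^ s = (S.N k h ^ s) ^ 2 := by
          rw [← Real.rpow_natCast, ← Real.rpow_natCast, ← Real.rpow_mul hNh, ← Real.rpow_mul hNh,
            mul_comm]
        rw [e1, e2]; ring
    _ ≤ (C * (S.N k f ^ r * S.N k h ^ s)) ^ 2 := by
        rw [mul_pow C]
        refine mul_le_mul_of_nonneg_right ?_ (by positivity)
        have : r + s = 1 := by linarith
        rw [this, Real.rpow_one]
        nlinarith

end SobolevAlgebra
end ExtrinsicHarmonic

/-! ### The algebra W^{k,2} ∩ L^∞ and boundedly Cauchy sequences -/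

namespace ExtrinsicHarmonic
namespace SobolevAlgebra

variable {X : Type*} [MeasurableSpace X] {μ : Measure X} [IsFiniteMeasure μ]
  {𝒜 : Type*} [CommRing 𝒜] [Algebra ℝ 𝒜] {ι : Type*} (S : SobolevAlgebra μ 𝒜 ι) [Finite ι]

/-- The bounded functions in `W^{k,2}` form an algebra. -/
lemma exists_N_mul_le_mul (k : ℕ) : ∃ C, 0 ≤ C ∧ ∀ (f h : 𝒜) (a b : ℝ), 0 < a → 0 < b →
    (∀ x, |S.ev f x| ≤ a) → (∀ x, |S.ev h x| ≤ b) → S.N k f ≤ a → S.N k h ≤ b →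
    S.N k (f * h) ≤ C * (a * b) := by
  obtain ⟨C1, hC1, hM⟩ := S.exists_norm_lp_dw_mul_dw_le (k := k) le_rfl
  -- The constant of Moser's estimate depends on the uniform bound, so the estimate is proved for
  -- pairs of size one and extended by bilinearity.
  obtain ⟨C, hC, h⟩ := S.exists_N_le_of_forall k
    (κ := {q : 𝒜 × 𝒜 // (∀ x, |S.ev q.1 x| ≤ 1) ∧ (∀ x, |S.ev q.2 x| ≤ 1) ∧
      S.N k q.1 ≤ 1 ∧ S.N k q.2 ≤ 1}) (fun q => q.1.1 * q.1.2) (fun _ => 1) (by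
    intro K hK
    obtain ⟨P, hP, h⟩ := S.exists_leibniz K
    refine ⟨P.length * (1 + C1), by positivity, fun q => ?_⟩
    obtain ⟨⟨f, g⟩, hf, hg, hNf, hNg⟩ := q
    rw [mul_one, h]
    refine S.norm_lp_list_sum_le P _ _ fun q hq => ?_
    have hq' := hP q hq
    rcases eq_or_ne q.1 [] with h1 | h1
    · rw [h1, dw_nil]
      have := S.norm_lp_mul_le (g := S.dw q.2 g) hf
      have := S.norm_lp_dw_le (k := k) (I := q.2) (by omega) g
      simp only at *
      linarith
    rcases eq_or_ne q.2 [] with h2 | h2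
    · rw [h2, dw_nil, mul_comm]
      have := S.norm_lp_mul_le (g := S.dw q.1 f) hg
      have := S.norm_lp_dw_le (k := k) (I := q.1) (by omega) f
      simp only at *
      linarith
    · have h3 := hM q.1 q.2 h1 h2 (by omega) f g hf hg
      have hlen : (q.1.length : ℝ) ≤ k := by exact_mod_cast (by omega : q.1.length ≤ k)
      have h4 := Real.rpow_le_one (S.N_nonneg k f) hNf
        (by positivity : 0 ≤ (q.1.length : ℝ) / k)
      have h5 := Real.rpow_le_one (S.N_nonneg k g) hNg
        (div_nonneg (by linarith) (by positivity) : 0 ≤ ((k : ℝ) - q.1.length) / k)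
      have h6 := mul_le_one₀ h4 (Real.rpow_nonneg (S.N_nonneg k g) _) h5
      nlinarith)
  refine ⟨C, hC, fun f g a b ha hb hf hg hNf hNg => ?_⟩
  have hn : ∀ (c : ℝ) (f : 𝒜), 0 < c → (∀ x, |S.ev f x| ≤ c) → S.N k f ≤ c →
      (∀ x, |S.ev (c⁻¹ • f) x| ≤ 1) ∧ S.N k (c⁻¹ • f) ≤ 1 := by
    intro c f hc h1 h2
    constructor
    · intro x
      rw [map_smul, Pi.smul_apply, smul_eq_mul, abs_mul, abs_inv, abs_of_pos hc,
        inv_mul_le_iff₀ hc, mul_one]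
      exact h1 x
    · rw [N_smul, abs_inv, abs_of_pos hc, inv_mul_le_iff₀ hc, mul_one]
      exact h2
  obtain ⟨f1, f2⟩ := hn a f ha hf hNf
  obtain ⟨g1, g2⟩ := hn b g hb hg hNg
  have key := h ⟨(a⁻¹ • f, b⁻¹ • g), f1, g1, f2, g2⟩
  have e : f * g = (a * b) • ((a⁻¹ • f) * (b⁻¹ • g)) := by
    rw [smul_mul_smul_comm, smul_smul, mul_mul_mul_comm, mul_inv_cancel₀ ha.ne',
      mul_inv_cancel₀ hb.ne', one_mul, one_smul]
  rw [e, N_smul, abs_of_pos (by positivity)]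
  simp only at key
  nlinarith [mul_pos ha hb]

lemma tendsto_N_zero_iff {κ : Type*} {l : Filter κ} {k : ℕ} {f : κ → 𝒜} :
    Tendsto (fun i => S.N k (f i)) l (𝓝 0) ↔
      ∀ I : List ι, I.length ≤ k → Tendsto (fun i => S.lp (S.dw I (f i))) l (𝓝 0) := by
  constructor
  · intro h I hI
    rw [tendsto_zero_iff_norm_tendsto_zero]
    exact squeeze_zero (fun _ => norm_nonneg _) (fun i => S.norm_lp_dw_le hI (f i)) h
  · intro h
    have : Tendsto (fun i => ∑ I ∈ words ι k, ‖S.lp (S.dw I (f i))‖) l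
        (𝓝 (∑ I ∈ words ι k, 0)) := by
      refine tendsto_finsetSum _ fun I hI => ?_
      exact tendsto_zero_iff_norm_tendsto_zero.mp (h I (by simpa using hI))
    simpa [N] using this

lemma _root_.tendsto_list_map_sum_zero {κ β : Type*} {l : Filter β} (P : List κ) (F : κ → β → ℝ)
    (h : ∀ q ∈ P, Tendsto (F q) l (𝓝 0)) :
    Tendsto (fun i => (P.map fun q => F q i).sum) l (𝓝 0) := by
  induction P with
  | nil => simpa using tendsto_const_nhds
  | cons q P ih =>
    simp only [List.map_cons, List.sum_cons]
    simpa using (h q (by simp)).add (ih fun q hq => h q (by simp [hq]))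

lemma norm_lp_list_sum_le_sum {κ : Type*} (P : List κ) (F : κ → 𝒜) :
    ‖S.lp (P.map F).sum‖ ≤ (P.map fun q => ‖S.lp (F q)‖).sum := by
  induction P with
  | nil => simp
  | cons q P ih =>
    rw [List.map_cons, List.sum_cons, map_add, List.map_cons, List.sum_cons]
    exact (norm_add_le _ _).trans (by gcongr)

/-- The Leibniz term in which all derivatives fall on `h` lies outside Moser's estimate, and `D_J h`
need not be uniformly bounded. Replace `h` by a fixed `h0` close to it in W^{k,2}: the error is
controlled by `|f| ≤ A`, and `D_J h0` is bounded while `f` is null in L². -/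
lemma tendsto_lp_mul_dw_zero {κ : Type*} {l : Filter κ} {k : ℕ} {f h : κ → 𝒜} {A : ℝ}
    (hA : 0 < A) (hf : ∀ i x, |S.ev (f i) x| ≤ A)
    (hf0 : Tendsto (fun i => S.N k (f i)) l (𝓝 0))
    (hhC : ∀ ε > 0, ∃ h0 : 𝒜, ∀ᶠ i in l, S.N k (h i - h0) < ε) {J : List ι} (hJ : J.length ≤ k) :
    Tendsto (fun i => ‖S.lp (f i * S.dw J (h i))‖) l (𝓝 0) := by
  rw [Metric.tendsto_nhds]
  intro ε hε
  obtain ⟨h0, hh0⟩ := hhC (ε / (2 * A)) (by positivity)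
  obtain ⟨R, hR0, hR⟩ := S.exists_pos_bound (S.dw J h0)
  have := (hf0.eventually_lt_const (by positivity : 0 < ε / (2 * R)))
  filter_upwards [hh0, this] with i h3 h4
  rw [Real.dist_eq, sub_zero, abs_norm]
  have e : f i * S.dw J (h i) = f i * S.dw J (h i - h0) + S.dw J h0 * f i := by
    rw [map_sub]; ring
  have e1 : ‖S.lp (f i * S.dw J (h i - h0))‖ ≤ A * S.N k (h i - h0) :=
    (S.norm_lp_mul_le (hf i)).trans (mul_le_mul_of_nonneg_left (S.norm_lp_dw_le hJ _) hA.le)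
  have e2 : ‖S.lp (S.dw J h0 * f i)‖ ≤ R * S.N k (f i) :=
    (S.norm_lp_mul_le hR).trans (mul_le_mul_of_nonneg_left (S.norm_lp_le k _) hR0.le)
  have e3 : A * S.N k (h i - h0) < A * (ε / (2 * A)) := mul_lt_mul_of_pos_left h3 hA
  have e4 : R * S.N k (f i) < R * (ε / (2 * R)) := mul_lt_mul_of_pos_left h4 hR0
  have e5 : A * (ε / (2 * A)) = ε / 2 := by field_simp
  have e6 : R * (ε / (2 * R)) = ε / 2 := by field_simp
  rw [e, map_add]
  have := norm_add_le (S.lp (f i * S.dw J (h i - h0))) (S.lp (S.dw J h0 * f i))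
  linarith

/-- Moser's estimate contains the norm of `f` to the power `|I|/k`, which is positive because `I` is
nonempty. -/
lemma tendsto_lp_dw_mul_dw_zero {κ : Type*} {l : Filter κ} {k : ℕ} {f h : κ → 𝒜} {A : ℝ}
    (hA : 1 ≤ A) (hf : ∀ i x, |S.ev (f i) x| ≤ A) (hh : ∀ i x, |S.ev (h i) x| ≤ A)
    (hf0 : Tendsto (fun i => S.N k (f i)) l (𝓝 0)) {B : ℝ}
    (hB : ∀ᶠ i in l, S.N k (h i) ≤ B) {I J : List ι} (hI : I ≠ []) (hJ : J ≠ [])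
    (hIJ : I.length + J.length ≤ k) :
    Tendsto (fun i => ‖S.lp (S.dw I (f i) * S.dw J (h i))‖) l (𝓝 0) := by
  obtain ⟨C, hC0, hC⟩ := S.exists_norm_lp_dw_mul_dw_le (k := k) hA
  have hI0 : 0 < I.length := List.length_pos_iff.mpr hI
  have hlen : (I.length : ℝ) ≤ k := by exact_mod_cast (by omega : I.length ≤ k)
  have hk0' : (0 : ℝ) < k := by exact_mod_cast (by omega : 0 < k)
  have hr : 0 < (I.length : ℝ) / k := by positivity
  have hs : 0 ≤ ((k : ℝ) - I.length) / k := div_nonneg (by linarith) (by positivity)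
  have hlim : Tendsto (fun i => C * (S.N k (f i) ^ ((I.length : ℝ) / k) *
      B ^ (((k : ℝ) - I.length) / k))) l (𝓝 0) := by
    have h3 := (hf0.rpow_const (p := (I.length : ℝ) / k) (Or.inr hr.le)).mul_const
      (B ^ (((k : ℝ) - I.length) / k)) |>.const_mul C
    rwa [Real.zero_rpow hr.ne', zero_mul, mul_zero] at h3
  refine squeeze_zero' (.of_forall fun _ => norm_nonneg _) ?_ hlim
  filter_upwards [hB] with i hi
  refine (hC I J hI hJ hIJ (f i) (h i) (hf i) (hh i)).trans ?_
  exact mul_le_mul_of_nonneg_left (mul_le_mul_of_nonneg_left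
    (Real.rpow_le_rpow (S.N_nonneg k (h i)) hi hs) (Real.rpow_nonneg (S.N_nonneg k (f i)) _)) hC0

lemma tendsto_lp_dw_mul_zero {κ : Type*} {l : Filter κ} {f h : κ → 𝒜} {K : List ι}
    {P : List (List ι × List ι)}
    (hL : ∀ f h : 𝒜, S.dw K (f * h) = (P.map fun q => S.dw q.1 f * S.dw q.2 h).sum)
    (hterm : ∀ q ∈ P, Tendsto (fun i => ‖S.lp (S.dw q.1 (f i) * S.dw q.2 (h i))‖) l (𝓝 0)) :
    Tendsto (fun i => S.lp (S.dw K (f i * h i))) l (𝓝 0) := by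
  have hsum := tendsto_list_map_sum_zero P
    (fun q i => ‖S.lp (S.dw q.1 (f i) * S.dw q.2 (h i))‖) hterm
  refine squeeze_zero_norm (fun i => ?_) hsum
  rw [hL]
  exact S.norm_lp_list_sum_le_sum P (fun q => S.dw q.1 (f i) * S.dw q.2 (h i))

/-- Products with a factor which tends to zero boundedly tend to zero. -/
lemma tendsto_N_mul_zero {κ : Type*} {l : Filter κ} {k : ℕ} {f h : κ → 𝒜} {A : ℝ} (hA : 1 ≤ A)
    (hf : ∀ i x, |S.ev (f i) x| ≤ A) (hh : ∀ i x, |S.ev (h i) x| ≤ A)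
    (hf0 : Tendsto (fun i => S.N k (f i)) l (𝓝 0))
    (hhC : ∀ ε > 0, ∃ h0 : 𝒜, ∀ᶠ i in l, S.N k (h i - h0) < ε) :
    Tendsto (fun i => S.N k (f i * h i)) l (𝓝 0) := by
  obtain ⟨B, hB⟩ : ∃ B, ∀ᶠ i in l, S.N k (h i) ≤ B := by
    obtain ⟨h0, h1⟩ := hhC 1 one_pos
    refine ⟨1 + S.N k h0, ?_⟩
    filter_upwards [h1] with i hi
    have := S.N_add_le k (h i - h0) h0
    rw [sub_add_cancel] at this
    linarith
  rw [tendsto_N_zero_iff]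
  intro K hK
  obtain ⟨P, hP, hL⟩ := S.exists_leibniz K
  have hterm : ∀ q ∈ P, Tendsto (fun i => ‖S.lp (S.dw q.1 (f i) * S.dw q.2 (h i))‖) l (𝓝 0) := by
    rintro ⟨I, J⟩ hq
    have hq' : I.length + J.length = K.length := hP _ hq
    change Tendsto (fun i => ‖S.lp (S.dw I (f i) * S.dw J (h i))‖) l (𝓝 0)
    -- The Leibniz terms are separated by which factors are differentiated: only `f` (where `h` is
    -- bounded), only `h`, or both.
    rcases eq_or_ne J [] with rfl | h2
    · refine squeeze_zero (fun _ => norm_nonneg _) (g := fun i => A * S.N k (f i)) (fun i => ?_)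
        (by simpa using hf0.const_mul A)
      have hIk : I.length ≤ k := by simp at hq'; omega
      rw [mul_comm]
      exact (S.norm_lp_mul_le (hh i)).trans (mul_le_mul_of_nonneg_left
        (S.norm_lp_dw_le hIk _) (by linarith))
    rcases eq_or_ne I [] with rfl | h1
    · have hJk : J.length ≤ k := by simp at hq'; omega
      exact S.tendsto_lp_mul_dw_zero (by linarith) hf hf0 hhC hJk
    · exact S.tendsto_lp_dw_mul_dw_zero hA hf hh hf0 hB h1 h2 (by omega)
  exact S.tendsto_lp_dw_mul_zero hL hterm

/-- The sequence `v` is Cauchy in `W^{k,2}`. -/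
def CauchyN (k : ℕ) (v : ℕ → 𝒜) : Prop :=
  Tendsto (fun p : ℕ × ℕ => S.N k (v p.1 - v p.2)) atTop (𝓝 0)

/-- The sequence `v` is uniformly bounded, and Cauchy in `W^{k,2}`. -/
def BddCauchy (k : ℕ) (v : ℕ → 𝒜) : Prop :=
  (∃ A, ∀ i x, |S.ev (v i) x| ≤ A) ∧ S.CauchyN k v

variable {S} {k : ℕ} {v w : ℕ → 𝒜}

lemma CauchyN.of_le {F : ℕ → 𝒜} {j : ℕ} {C : ℝ} (hv : S.CauchyN k v)
    (h : ∀ i l, S.N j (F i - F l) ≤ C * S.N k (v i - v l)) : S.CauchyN j F :=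
  squeeze_zero (fun _ => S.N_nonneg _ _) (fun p => h p.1 p.2)
    (by simpa using Tendsto.const_mul C hv)

lemma CauchyN.mono {j : ℕ} (hv : S.CauchyN k v) (h : j ≤ k) : S.CauchyN j v :=
  hv.of_le (C := 1) fun i l => by rw [one_mul]; exact S.N_mono h _

lemma CauchyN.add (hv : S.CauchyN k v) (hw : S.CauchyN k w) :
    S.CauchyN k (fun i => v i + w i) := by
  refine squeeze_zero (fun _ => S.N_nonneg _ _) (fun p => ?_) (by simpa using Tendsto.add hv hw)
  rw [add_sub_add_comm]; exact S.N_add_le _ _ _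

lemma CauchyN.linearMap {j : ℕ} (hv : S.CauchyN k v) (T : 𝒜 →ₗ[ℝ] 𝒜) {C : ℝ}
    (h : ∀ f, S.N j (T f) ≤ C * S.N k f) : S.CauchyN j (fun i => T (v i)) :=
  hv.of_le (C := C) fun i l => by rw [← map_sub]; exact h _

lemma CauchyN.smul (c : ℝ) (hv : S.CauchyN k v) : S.CauchyN k (fun i => c • v i) :=
  hv.of_le (C := |c|) fun i l => by rw [← smul_sub, N_smul]

lemma CauchyN.mul_left (a : 𝒜) (hv : S.CauchyN k v) : S.CauchyN k (fun i => a * v i) := by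
  obtain ⟨C, _, hC⟩ := S.exists_N_mul_le k a
  exact hv.linearMap (LinearMap.mulLeft ℝ a) hC

lemma CauchyN.const (a : 𝒜) : S.CauchyN k (fun _ => a) := by
  simp [CauchyN, N_zero]

lemma CauchyN.sub (hv : S.CauchyN k v) (hw : S.CauchyN k w) :
    S.CauchyN k (fun i => v i - w i) := by
  simpa [sub_eq_add_neg] using hv.add (hw.smul (-1))

lemma CauchyN.sum {κ : Type*} {s : Finset κ} {f : κ → ℕ → 𝒜} (h : ∀ a ∈ s, S.CauchyN k (f a)) :
    S.CauchyN k (fun i => ∑ a ∈ s, f a i) := by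
  classical
  induction s using Finset.induction with
  | empty => simpa using CauchyN.const 0
  | insert a s ha ih =>
    simp only [Finset.sum_insert ha]
    exact (h a (by simp)).add (ih fun b hb => h b (by simp [hb]))

lemma CauchyN.eventually (hv : S.CauchyN k v) {ε : ℝ} (hε : 0 < ε) :
    ∃ n, ∀ i ≥ n, ∀ j ≥ n, S.N k (v i - v j) < ε := by
  obtain ⟨⟨a, b⟩, h⟩ := eventually_atTop.mp (Tendsto.eventually_lt_const hε hv)
  exact ⟨max a b, fun i hi j hj => h (i, j) ⟨le_of_max_le_left hi, le_of_max_le_right hj⟩⟩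

lemma cauchyN_iff : S.CauchyN k v ↔
    ∀ ε > 0, ∃ n, ∀ i ≥ n, ∀ j ≥ n, S.N k (v i - v j) < ε := by
  refine ⟨fun h ε hε => h.eventually hε, fun h => ?_⟩
  rw [CauchyN, Metric.tendsto_nhds]
  intro ε hε
  obtain ⟨n, hn⟩ := h ε hε
  filter_upwards [eventually_ge_atTop (n, n)] with p hp
  rw [Real.dist_eq, sub_zero, abs_of_nonneg (S.N_nonneg _ _)]
  exact hn _ hp.1 _ hp.2

lemma CauchyN.bounded (hv : S.CauchyN k v) : ∃ B, 0 ≤ B ∧ ∀ i, S.N k (v i) ≤ B := by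
  obtain ⟨n, hn⟩ := hv.eventually one_pos
  refine ⟨1 + S.N k (v n) + ∑ i ∈ Finset.range n, S.N k (v i), ?_, fun i => ?_⟩
  · have := S.N_nonneg k (v n)
    have := Finset.sum_nonneg (s := Finset.range n) fun i _ => S.N_nonneg k (v i)
    linarith
  · rcases lt_or_ge i n with h | h
    · have := Finset.single_le_sum (f := fun i => S.N k (v i)) (fun i _ => S.N_nonneg k (v i))
        (Finset.mem_range.mpr h)
      have := S.N_nonneg k (v n)
      linarith
    · have h1 := hn i h n le_rfl
      have h2 := S.N_add_le k (v i - v n) (v n)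
      rw [sub_add_cancel] at h2
      have := Finset.sum_nonneg (s := Finset.range n) fun i _ => S.N_nonneg k (v i)
      linarith

lemma BddCauchy.const (a : 𝒜) : S.BddCauchy k (fun _ => a) :=
  ⟨by obtain ⟨C, hC⟩ := S.bounded a; exact ⟨C, fun _ => hC⟩, CauchyN.const a⟩

lemma BddCauchy.add (hv : S.BddCauchy k v) (hw : S.BddCauchy k w) :
    S.BddCauchy k (fun i => v i + w i) := by
  obtain ⟨⟨A, hA⟩, hv⟩ := hv
  obtain ⟨⟨B, hB⟩, hw⟩ := hw
  refine ⟨⟨A + B, fun i x => ?_⟩, hv.add hw⟩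
  rw [map_add]
  exact (abs_add_le _ _).trans (add_le_add (hA i x) (hB i x))

lemma BddCauchy.smul (c : ℝ) (hv : S.BddCauchy k v) : S.BddCauchy k (fun i => c • v i) := by
  obtain ⟨⟨A, hA⟩, hv⟩ := hv
  refine ⟨⟨|c| * A, fun i x => ?_⟩, hv.smul c⟩
  rw [map_smul, Pi.smul_apply, smul_eq_mul, abs_mul]
  exact mul_le_mul_of_nonneg_left (hA i x) (abs_nonneg _)

lemma BddCauchy.sub (hv : S.BddCauchy k v) (hw : S.BddCauchy k w) :
    S.BddCauchy k (fun i => v i - w i) := by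
  simpa [sub_eq_add_neg] using hv.add (hw.smul (-1))

lemma BddCauchy.sum {κ : Type*} {s : Finset κ} {f : κ → ℕ → 𝒜}
    (h : ∀ a ∈ s, S.BddCauchy k (f a)) : S.BddCauchy k (fun i => ∑ a ∈ s, f a i) := by
  classical
  induction s using Finset.induction with
  | empty => simpa using BddCauchy.const 0
  | insert a s ha ih =>
    simp only [Finset.sum_insert ha]
    exact (h a (by simp)).add (ih fun b hb => h b (by simp [hb]))

/-- If `f` tends to zero boundedly along a filter and `v` is boundedly Cauchy, then the products
tend to zero. -/
lemma BddCauchy.tendsto_mul_zero {κ : Type*} {l : Filter κ} {f : κ → 𝒜} {A : ℝ}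
    (hf : ∀ i x, |S.ev (f i) x| ≤ A) (hf0 : Tendsto (fun i => S.N k (f i)) l (𝓝 0))
    (hv : S.BddCauchy k v) {n : κ → ℕ} (hn : Tendsto n l atTop) :
    Tendsto (fun i => S.N k (f i * v (n i))) l (𝓝 0) := by
  obtain ⟨⟨B, hB⟩, hv⟩ := hv
  refine S.tendsto_N_mul_zero (A := max 1 (max A B)) (le_max_left _ _)
    (fun i x => (hf i x).trans ((le_max_left _ _).trans (le_max_right _ _)))
    (fun i x => (hB _ x).trans ((le_max_right _ _).trans (le_max_right _ _))) hf0 fun ε hε => ?_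
  obtain ⟨m, hm⟩ := hv.eventually hε
  refine ⟨v m, ?_⟩
  filter_upwards [hn.eventually_ge_atTop m] with i hi
  exact hm _ hi _ le_rfl

/-- A difference of products is `(v_p - v_q) w_p + (w_p - w_q) v_q`. In each term a uniformly
bounded null family, indexed by pairs, multiplies a boundedly Cauchy sequence. -/
lemma BddCauchy.mul (hv : S.BddCauchy k v) (hw : S.BddCauchy k w) :
    S.BddCauchy k (fun i => v i * w i) := by
  obtain ⟨A, hA⟩ := hv.1
  obtain ⟨B, hB⟩ := hw.1
  refine ⟨⟨A * B, fun i x => ?_⟩, ?_⟩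
  · rw [map_mul, Pi.mul_apply, abs_mul]
    exact mul_le_mul (hA i x) (hB i x) (abs_nonneg _) ((abs_nonneg _).trans (hA i x))
  have hfst : Tendsto (Prod.fst : ℕ × ℕ → ℕ) atTop atTop := by
    rw [← prod_atTop_atTop_eq]; exact tendsto_fst
  have hsnd : Tendsto (Prod.snd : ℕ × ℕ → ℕ) atTop atTop := by
    rw [← prod_atTop_atTop_eq]; exact tendsto_snd
  have h1 := hw.tendsto_mul_zero (f := fun p : ℕ × ℕ => v p.1 - v p.2) (A := A + A)
    (fun p x => by rw [map_sub]; exact (abs_sub _ _).trans (add_le_add (hA _ x) (hA _ x)))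
    hv.2 hfst
  have h2 := hv.tendsto_mul_zero (f := fun p : ℕ × ℕ => w p.1 - w p.2) (A := B + B)
    (fun p x => by rw [map_sub]; exact (abs_sub _ _).trans (add_le_add (hB _ x) (hB _ x)))
    hw.2 hsnd
  refine squeeze_zero (fun _ => S.N_nonneg _ _) (fun p => ?_) (by simpa using h1.add h2)
  have e : v p.1 * w p.1 - v p.2 * w p.2 =
      (v p.1 - v p.2) * w p.1 + (w p.1 - w p.2) * v p.2 := by ring
  rw [e]
  exact S.N_add_le _ _ _

lemma BddCauchy.pow (hv : S.BddCauchy k v) (n : ℕ) : S.BddCauchy k (fun i => v i ^ n) := by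
  induction n with
  | zero => simpa using BddCauchy.const 1
  | succ n ih => simpa [pow_succ] using ih.mul hv

lemma CauchyN.cauchySeq_lp (hv : S.CauchyN k v) : CauchySeq (fun i => S.lp (v i)) := by
  rw [Metric.cauchySeq_iff]
  intro ε hε
  obtain ⟨n, hn⟩ := hv.eventually hε
  refine ⟨n, fun i hi j hj => ?_⟩
  rw [dist_eq_norm, ← map_sub]
  exact (S.norm_lp_le k _).trans_lt (hn i hi j hj)

lemma CauchyN.dw (hv : S.CauchyN k v) (I : List ι) {j : ℕ} (h : j + I.length ≤ k) :
    S.CauchyN j (fun i => S.dw I (v i)) := by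
  induction I generalizing k v with
  | nil => exact hv.mono (by simpa using h)
  | cons α I ih =>
    obtain ⟨C, _, hC⟩ := S.exists_N_D_le (j + I.length)
    have hv' := hv.mono (j := j + I.length + 1) (by simp at h; omega)
    simp only [dw_cons]
    exact ih (hv'.linearMap (S.D α).toLinearMap (hC α)) le_rfl

end SobolevAlgebra
end ExtrinsicHarmonic

/-! ### The Laplacian, the energy form and the multiplier identity -/

namespace ExtrinsicHarmonic

/-- A `SobolevAlgebra` with a Laplacian and its carré du champ, expressed by the derivations. -/
structure LaplaceAlgebra {X : Type*} [MeasurableSpace X] (μ : Measure X) (𝒜 : Type*) [CommRing 𝒜]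
    [Algebra ℝ 𝒜] (ι : Type*) [Fintype ι] extends SobolevAlgebra μ 𝒜 ι where
  L : 𝒜 →ₗ[ℝ] 𝒜
  Γ : 𝒜 →ₗ[ℝ] 𝒜 →ₗ[ℝ] 𝒜
  G : ι → ι → 𝒜
  L_mul : ∀ f h, L (f * h) = f * L h + h * L f + (2 : ℝ) • Γ f h
  Γ_comm : ∀ f h, Γ f h = Γ h f
  green : ∀ f h, ∫ x, ev (Γ f h) x ∂μ = -∫ x, ev (f * L h) x ∂μ
  Γ_eq : ∀ f h, Γ f h = ∑ α, ∑ β, G α β * D α f * D β h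
  ext_integral : ∀ f, (∀ h, ∫ x, ev (h * f) x ∂μ = 0) → f = 0

namespace LaplaceAlgebra

variable {X : Type*} [MeasurableSpace X] {μ : Measure X} [IsFiniteMeasure μ]
  {𝒜 : Type*} [CommRing 𝒜] [Algebra ℝ 𝒜] {ι : Type*} [Fintype ι] (S : LaplaceAlgebra μ 𝒜 ι)

lemma integral_add (f h : 𝒜) :
    ∫ x, S.ev (f + h) x ∂μ = ∫ x, S.ev f x ∂μ + ∫ x, S.ev h x ∂μ := by
  rw [map_add]; exact MeasureTheory.integral_add (S.integrable f) (S.integrable h)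

lemma integral_sub (f h : 𝒜) :
    ∫ x, S.ev (f - h) x ∂μ = ∫ x, S.ev f x ∂μ - ∫ x, S.ev h x ∂μ := by
  rw [map_sub]; exact MeasureTheory.integral_sub (S.integrable f) (S.integrable h)

lemma integral_neg (f : 𝒜) : ∫ x, S.ev (-f) x ∂μ = -∫ x, S.ev f x ∂μ := by
  rw [map_neg]; exact MeasureTheory.integral_neg _

lemma integral_smul (c : ℝ) (f : 𝒜) : ∫ x, S.ev (c • f) x ∂μ = c * ∫ x, S.ev f x ∂μ := by
  rw [map_smul]; exact MeasureTheory.integral_const_mul _ _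

lemma integral_sum {κ : Type*} (s : Finset κ) (f : κ → 𝒜) :
    ∫ x, S.ev (∑ i ∈ s, f i) x ∂μ = ∑ i ∈ s, ∫ x, S.ev (f i) x ∂μ := by
  rw [map_sum]
  simp only [Finset.sum_apply]
  exact integral_finsetSum _ fun i _ => S.integrable _

lemma L_comm (f h : 𝒜) : ∫ x, S.ev (f * S.L h) x ∂μ = ∫ x, S.ev (h * S.L f) x ∂μ := by
  have h1 := S.green f h
  have h2 := S.green h f
  rw [S.Γ_comm] at h2
  linarith

lemma L_pow_comm (s : ℕ) (f h : 𝒜) :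
    ∫ x, S.ev (f * (S.L ^ s) h) x ∂μ = ∫ x, S.ev (h * (S.L ^ s) f) x ∂μ := by
  induction s generalizing f h with
  | zero => simp [mul_comm]
  | succ s ih =>
    have e1 : (S.L ^ (s + 1)) h = (S.L ^ s) (S.L h) := by rw [pow_succ]; rfl
    have e2 : (S.L ^ (s + 1)) f = S.L ((S.L ^ s) f) := by rw [pow_succ']; rfl
    rw [e1, e2, ih, mul_comm, L_comm]

/-- The Laplacian in terms of the derivations. -/
lemma L_eq (f : 𝒜) : S.L f = ∑ α, ∑ β, (S.D α (S.G α β * S.D β f) -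
    S.dv α * S.G α β * S.D β f) := by
  rw [← sub_eq_zero]
  -- Both sides agree after integration against `h`: Green's formula handles `L`, integration by
  -- parts for each derivation handles the sum. The formula exhibits `L` as a second-order operator
  -- in the derivations, hence its boundedness in `bdd_L`.
  refine S.ext_integral _ fun h => ?_
  have h1 := S.green h f
  rw [S.Γ_eq] at h1
  rw [mul_sub, integral_sub, ← neg_eq_iff_eq_neg.mpr h1, Finset.mul_sum, integral_sum, integral_sum,
    ← Finset.sum_neg_distrib, ← Finset.sum_sub_distrib]
  refine Finset.sum_eq_zero fun α _ => ?_
  rw [Finset.mul_sum, integral_sum, integral_sum, ← Finset.sum_neg_distrib,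
    ← Finset.sum_sub_distrib]
  refine Finset.sum_eq_zero fun β _ => ?_
  have h2 := S.ibp_mul α h (S.G α β * S.D β f)
  have e1 : S.G α β * S.D α h * S.D β f = S.D α h * (S.G α β * S.D β f) := by ring
  rw [e1, h2, ← integral_neg, ← integral_sub]
  have e2 : -(h * (S.G α β * S.D β f) * S.dv α - h * S.D α (S.G α β * S.D β f)) -
    h * (S.D α (S.G α β * S.D β f) - S.dv α * S.G α β * S.D β f) = 0 := by ring
  rw [e2]; simp

/-- The operator `T` is bounded from `W^{k,2}` to `W^{j,2}`. -/
def Bdd (j k : ℕ) (T : 𝒜 → 𝒜) : Prop := ∃ C, 0 ≤ C ∧ ∀ f, S.N j (T f) ≤ C * S.N k f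

variable {S}

lemma Bdd.comp {i j k : ℕ} {T U : 𝒜 → 𝒜} (hT : S.Bdd i j T) (hU : S.Bdd j k U) :
    S.Bdd i k (fun f => T (U f)) := by
  obtain ⟨C, hC, h⟩ := hT
  obtain ⟨C', hC', h'⟩ := hU
  exact ⟨C * C', by positivity, fun f => (h _).trans (by
    rw [mul_assoc]; exact mul_le_mul_of_nonneg_left (h' f) hC)⟩

lemma Bdd.add {j k : ℕ} {T U : 𝒜 → 𝒜} (hT : S.Bdd j k T) (hU : S.Bdd j k U) :
    S.Bdd j k (fun f => T f + U f) := by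
  obtain ⟨C, hC, h⟩ := hT
  obtain ⟨C', hC', h'⟩ := hU
  exact ⟨C + C', by positivity, fun f => (S.N_add_le _ _ _).trans (by
    rw [add_mul]; exact add_le_add (h f) (h' f))⟩

lemma Bdd.neg {j k : ℕ} {T : 𝒜 → 𝒜} (hT : S.Bdd j k T) : S.Bdd j k (fun f => -T f) := by
  obtain ⟨C, hC, h⟩ := hT
  exact ⟨C, hC, fun f => by rw [S.N_neg]; exact h f⟩

lemma Bdd.sub {j k : ℕ} {T U : 𝒜 → 𝒜} (hT : S.Bdd j k T) (hU : S.Bdd j k U) :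
    S.Bdd j k (fun f => T f - U f) := by
  simpa only [sub_eq_add_neg] using hT.add hU.neg

lemma Bdd.sum {κ : Type*} {j k : ℕ} {s : Finset κ} {T : κ → 𝒜 → 𝒜}
    (hT : ∀ i ∈ s, S.Bdd j k (T i)) : S.Bdd j k (fun f => ∑ i ∈ s, T i f) := by
  classical
  induction s using Finset.induction with
  | empty => exact ⟨0, le_rfl, fun f => by simp [S.N_zero]⟩
  | insert a s ha ih =>
    simp only [Finset.sum_insert ha]
    exact (hT a (by simp)).add (ih fun b hb => hT b (by simp [hb]))

lemma Bdd.mono {i j k l : ℕ} {T : 𝒜 → 𝒜} (hT : S.Bdd j k T) (hi : i ≤ j) (hl : k ≤ l) :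
    S.Bdd i l T := by
  obtain ⟨C, hC, h⟩ := hT
  exact ⟨C, hC, fun f => ((S.N_mono hi _).trans (h f)).trans
    (mul_le_mul_of_nonneg_left (S.N_mono hl f) hC)⟩

lemma bdd_id (k : ℕ) : S.Bdd k k (fun f => f) := ⟨1, zero_le_one, fun f => by simp⟩

lemma bdd_mul (k : ℕ) (a : 𝒜) : S.Bdd k k (fun f => a * f) := S.exists_N_mul_le k a

lemma bdd_D (k : ℕ) (α : ι) : S.Bdd k (k + 1) (fun f => S.D α f) := by
  obtain ⟨C, hC, h⟩ := S.exists_N_D_le k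
  exact ⟨C, hC, h α⟩

lemma bdd_L (k : ℕ) : S.Bdd k (k + 2) (fun f => S.L f) := by
  simp only [L_eq]
  refine Bdd.sum fun α _ => Bdd.sum fun β _ => Bdd.sub ?_ ?_
  · exact (bdd_D k α).comp ((bdd_mul (k + 1) (S.G α β)).comp (bdd_D (k + 1) β))
  · exact ((bdd_mul k (S.dv α * S.G α β)).comp (bdd_D k β)).mono le_rfl (by omega)

lemma bdd_L_pow (k p : ℕ) : S.Bdd k (k + 2 * p) (fun f => (S.L ^ p) f) := by
  induction p with
  | zero => simpa using bdd_id k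
  | succ p ih =>
    have := ih.comp (bdd_L (S := S) (k + 2 * p))
    simpa [pow_succ, mul_add, add_assoc] using this

lemma bdd_Γ (k : ℕ) (a : 𝒜) : S.Bdd k (k + 1) (fun f => S.Γ a f) := by
  simp only [S.Γ_eq]
  exact Bdd.sum fun α _ => Bdd.sum fun β _ => (bdd_mul k (S.G α β * S.D α a)).comp (bdd_D k β)

lemma Bdd.cauchyN {j k : ℕ} {T : 𝒜 →ₗ[ℝ] 𝒜} (hT : S.Bdd j k T) {v : ℕ → 𝒜}
    (hv : S.CauchyN k v) : S.CauchyN j (fun i => T (v i)) := by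
  obtain ⟨C, _, h⟩ := hT
  exact hv.linearMap T h

variable (S)

lemma exists_abs_integral_Γ_le : ∃ C, 0 ≤ C ∧ ∀ f h, |∫ x, S.ev (S.Γ f h) x ∂μ| ≤
    C * (S.N 1 f * S.N 1 h) := by
  obtain ⟨C, hC, hD⟩ := S.exists_N_D_le 0
  choose R hR0 hR using fun q : ι × ι => S.exists_pos_bound (S.G q.1 q.2)
  refine ⟨∑ α, ∑ β, R (α, β) * (C * C), Finset.sum_nonneg fun α _ => Finset.sum_nonneg fun β _ => by
    have := hR0 (α, β); positivity, fun f h => ?_⟩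
  rw [S.Γ_eq, integral_sum, Finset.sum_mul]
  refine (Finset.abs_sum_le_sum_abs _ _).trans (Finset.sum_le_sum fun α _ => ?_)
  rw [integral_sum, Finset.sum_mul]
  refine (Finset.abs_sum_le_sum_abs _ _).trans (Finset.sum_le_sum fun β _ => ?_)
  have h1 := (S.norm_lp_le 0 _).trans (hD α f)
  have h2 := (S.norm_lp_le 0 _).trans (hD β h)
  have h3 := S.N_nonneg 1 f
  have h4 := S.N_nonneg 1 h
  have h5 := hR0 (α, β)
  calc _ ≤ ‖S.lp (S.G α β * S.D α f)‖ * ‖S.lp (S.D β h)‖ := S.abs_integral_mul_le _ _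
    _ ≤ (R (α, β) * (C * S.N 1 f)) * (C * S.N 1 h) := by
        refine mul_le_mul ?_ h2 (norm_nonneg _) (by positivity)
        exact (S.norm_lp_mul_le (hR (α, β))).trans (mul_le_mul_of_nonneg_left h1 h5.le)
    _ = _ := by ring

/-- The bilinear form of the `k`-energy. -/
noncomputable def q (k : ℕ) (f h : 𝒜) : ℝ :=
  if Even k then ∫ x, S.ev ((S.L ^ (k / 2)) f * (S.L ^ (k / 2)) h) x ∂μ
  else ∫ x, S.ev (S.Γ ((S.L ^ (k / 2)) f) ((S.L ^ (k / 2)) h)) x ∂μ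

/-- For even `k` self-adjointness of `L` moves everything to one side; for odd `k` one use of
Green's formula contributes the sign. Symmetry and bilinearity of `q`, and its identification with
`Δ^k`, are read off from this form. -/
lemma q_eq (k : ℕ) (f h : 𝒜) : S.q k f h = (-1) ^ k * ∫ x, S.ev (h * (S.L ^ k) f) x ∂μ := by
  rw [q]
  split_ifs with hk
  · obtain ⟨s, rfl⟩ := hk
    have e : (s + s) / 2 = s := by omega
    have e2 : (S.L ^ (s + s)) f = (S.L ^ s) ((S.L ^ s) f) := by rw [pow_add]; rfl
    rw [e, L_pow_comm, e2, Even.neg_one_pow ⟨s, rfl⟩, one_mul]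
  · rw [Nat.not_even_iff_odd] at hk
    rw [hk.neg_one_pow]
    obtain ⟨s, rfl⟩ := hk
    have e : (2 * s + 1) / 2 = s := by omega
    rw [e, S.Γ_comm, S.green, mul_comm, L_pow_comm]
    have e2 : (S.L ^ (2 * s + 1)) f = (S.L ^ s) (S.L ((S.L ^ s) f)) := by
      rw [two_mul, add_assoc, pow_add, pow_succ']; rfl
    rw [e2]; ring

lemma q_comm (k : ℕ) (f h : 𝒜) : S.q k f h = S.q k h f := by
  rw [q_eq, q_eq, L_pow_comm]

lemma q_add_left (k : ℕ) (f f' h : 𝒜) : S.q k (f + f') h = S.q k f h + S.q k f' h := by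
  rw [q_comm, q_eq, add_mul, integral_add, mul_add, ← q_eq, ← q_eq, q_comm, S.q_comm k h f']

lemma q_smul_left (k : ℕ) (c : ℝ) (f h : 𝒜) : S.q k (c • f) h = c * S.q k f h := by
  rw [q_comm, q_eq, smul_mul_assoc, integral_smul, mul_left_comm, ← q_eq, q_comm]

lemma q_add_right (k : ℕ) (f h h' : 𝒜) : S.q k f (h + h') = S.q k f h + S.q k f h' := by
  rw [q_comm, q_add_left, S.q_comm k h, S.q_comm k h']

lemma q_smul_right (k : ℕ) (c : ℝ) (f h : 𝒜) : S.q k f (c • h) = c * S.q k f h := by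
  rw [q_comm, q_smul_left, q_comm]

lemma q_sub_right (k : ℕ) (f h h' : 𝒜) : S.q k f (h - h') = S.q k f h - S.q k f h' := by
  rw [sub_eq_add_neg, ← neg_one_smul ℝ, q_add_right, q_smul_right]; ring

lemma q_sub_left (k : ℕ) (f h h' : 𝒜) : S.q k (h - h') f = S.q k h f - S.q k h' f := by
  rw [q_comm, q_sub_right, q_comm, S.q_comm k f h']

/-- The definition of `q` shares the derivatives equally, `k` on each argument, while `q_eq` puts
`2k` on one. This balanced form is what survives passage to W^{k,2} limits. -/
lemma exists_abs_q_le (k : ℕ) : ∃ C, 0 ≤ C ∧ ∀ f h, |S.q k f h| ≤ C * (S.N k f * S.N k h) := by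
  by_cases hk : Even k
  · obtain ⟨C, hC, h⟩ := bdd_L_pow (S := S) 0 (k / 2)
    have e : 0 + 2 * (k / 2) = k := by obtain ⟨s, rfl⟩ := hk; omega
    rw [e] at h
    refine ⟨C * C, by positivity, fun f g => ?_⟩
    rw [q, if_pos hk]
    have h1 := (S.norm_lp_le 0 _).trans (h f)
    have h2 := (S.norm_lp_le 0 _).trans (h g)
    calc _ ≤ _ := S.abs_integral_mul_le _ _
      _ ≤ (C * S.N k f) * (C * S.N k g) := mul_le_mul h1 h2 (norm_nonneg _)
          (mul_nonneg hC (S.N_nonneg _ _))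
      _ = _ := by ring
  · obtain ⟨C, hC, h⟩ := bdd_L_pow (S := S) 1 (k / 2)
    have e : 1 + 2 * (k / 2) = k := by
      obtain ⟨s, rfl⟩ := Nat.not_even_iff_odd.mp hk; omega
    rw [e] at h
    obtain ⟨C', hC', h'⟩ := S.exists_abs_integral_Γ_le
    refine ⟨C' * (C * C), by positivity, fun f g => ?_⟩
    rw [q, if_neg hk]
    have h1 := h f
    have h2 := h g
    calc _ ≤ _ := h' _ _
      _ ≤ C' * ((C * S.N k f) * (C * S.N k g)) := by
          refine mul_le_mul_of_nonneg_left ?_ hC'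
          exact mul_le_mul h1 h2 (S.N_nonneg _ _) (mul_nonneg hC (S.N_nonneg _ _))
      _ = _ := by ring

/-- The value at `φ` of the multiplier of a single smooth function. -/
noncomputable def smoothMultiplier (k : ℕ) (f φ : 𝒜) : ℝ :=
  ∫ x, S.ev (S.Γ f f * (S.L ^ (k - 1)) φ) x ∂μ +
    ∑ j ∈ Finset.range (k - 1),
      ∫ x, S.ev ((S.L ^ (k - 1 - j)) f * ((S.L ^ j) φ * S.L f)) x ∂μ +
    2 * ∑ j ∈ Finset.range (k - 1),
      -∫ x, S.ev ((S.L ^ (k - 1 - j)) f * ((S.L ^ j) φ * S.L f + S.Γ ((S.L ^ j) φ) f)) x ∂μ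

/-- Set `a j = ∫ L^(k-j) f · f · L^j φ`. Moving one `L` from the first factor onto `f · L^j φ` and
applying the product rule shows that the `j`-th summands together equal `a (j+1) - a j`. The sum
collapses to `a (k-1) - a 0`; here `a 0` is the last integral, and `a (k-1)` joins the `Γ f f` term
through `L(f²) = 2 f L f + 2 Γ f f`. For a sphere-valued map the integrals of `f f L^k φ` sum to `∫
L^k φ = 0`. -/
lemma smoothMultiplier_eq {k : ℕ} (hk : 1 ≤ k) (f φ : 𝒜) :
    S.smoothMultiplier k f φ =
      (1 / 2) * ∫ x, S.ev (f * f * (S.L ^ k) φ) x ∂μ - ∫ x, S.ev (f * φ * (S.L ^ k) f) x ∂μ := by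
  set a : ℕ → ℝ := fun j => ∫ x, S.ev ((S.L ^ (k - j)) f * (f * (S.L ^ j) φ)) x ∂μ with ha
  have hterm : ∀ j ∈ Finset.range (k - 1),
      ∫ x, S.ev ((S.L ^ (k - 1 - j)) f * ((S.L ^ j) φ * S.L f)) x ∂μ +
      2 * -∫ x, S.ev ((S.L ^ (k - 1 - j)) f * ((S.L ^ j) φ * S.L f + S.Γ ((S.L ^ j) φ) f)) x ∂μ =
      a (j + 1) - a j := by
    intro j hj
    rw [Finset.mem_range] at hj
    obtain ⟨p, hp⟩ : ∃ p, k = p + 1 + j := ⟨k - 1 - j, by omega⟩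
    have e1 : k - 1 - j = p := by omega
    have e2 : k - (j + 1) = p := by omega
    have e3 : k - j = p + 1 := by omega
    simp only [ha, e1, e2, e3]
    have e4 : (S.L ^ (p + 1)) f = S.L ((S.L ^ p) f) := by rw [pow_succ']; rfl
    have e5 : (S.L ^ (j + 1)) φ = S.L ((S.L ^ j) φ) := by rw [pow_succ']; rfl
    rw [e4, e5, mul_comm (S.L ((S.L ^ p) f)), S.L_comm (f * (S.L ^ j) φ), S.L_mul f,
      ← integral_sub, mul_neg, ← integral_smul, ← integral_neg, ← integral_add]
    refine congrArg (fun y : 𝒜 => ∫ x, S.ev y x ∂μ) ?_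
    rw [S.Γ_comm ((S.L ^ j) φ) f]
    simp only [Algebra.smul_def, map_ofNat]
    ring
  have hsum : ∑ j ∈ Finset.range (k - 1),
      ∫ x, S.ev ((S.L ^ (k - 1 - j)) f * ((S.L ^ j) φ * S.L f)) x ∂μ +
      2 * ∑ j ∈ Finset.range (k - 1),
      -∫ x, S.ev ((S.L ^ (k - 1 - j)) f * ((S.L ^ j) φ * S.L f + S.Γ ((S.L ^ j) φ) f)) x ∂μ =
      a (k - 1) - a 0 := by
    rw [Finset.mul_sum, ← Finset.sum_add_distrib, Finset.sum_congr rfl hterm,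
      Finset.sum_range_sub]
  rw [smoothMultiplier, add_assoc, hsum]
  have e0 : a 0 = ∫ x, S.ev (f * φ * (S.L ^ k) f) x ∂μ := by
    simp only [ha, Nat.sub_zero, pow_zero, Module.End.one_apply, mul_comm]
  have e1 : a (k - 1) = ∫ x, S.ev (f * S.L f * (S.L ^ (k - 1)) φ) x ∂μ := by
    have : k - (k - 1) = 1 := by omega
    simp only [ha, this, pow_one]
    refine congrArg (fun y : 𝒜 => ∫ x, S.ev y x ∂μ) ?_
    ring
  have e2 : (S.L ^ k) φ = S.L ((S.L ^ (k - 1)) φ) := by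
    obtain ⟨p, rfl⟩ : ∃ p, k = p + 1 := ⟨k - 1, by omega⟩
    rw [pow_succ']; rfl
  rw [e0, e1, e2, S.L_comm (f * f), S.L_mul, ← integral_smul, ← add_sub_assoc, ← integral_add]
  refine congrArg (fun y : 𝒜 => ∫ x, S.ev y x ∂μ - _) ?_
  simp only [Algebra.smul_def, map_ofNat]
  have e3 : (algebraMap ℝ 𝒜) (1 / 2) * (algebraMap ℝ 𝒜) 2 = 1 := by
    rw [← map_mul]; norm_num
  rw [map_ofNat] at e3
  linear_combination (-(S.Γ f f) - f * S.L f) * (S.L ^ (k - 1)) φ * e3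

end LaplaceAlgebra
end ExtrinsicHarmonic

/-! ### Power series in the algebra and the variation of a sphere-valued map -/

namespace ExtrinsicHarmonic

/-- The coefficients of the power series of `(1 + s)^(-1/2)`. -/
lemma exists_coeff_inv_sqrt : ∃ c : ℕ → ℝ, c 0 = 1 ∧ c 1 = -(1 / 2) ∧
    (∃ B, 0 ≤ B ∧ ∀ m, |c m| ≤ B * 2 ^ m) ∧
    ∀ s : ℝ, |s| ≤ 1 / 8 → HasSum (fun m => c m * s ^ m) ((1 + s) ^ (-(1 / 2) : ℝ)) := by
  have h := Real.one_add_rpow_hasFPowerSeriesOnBall_zero (a := -(1 / 2))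
  have hc : ∀ m, (binomialSeries ℝ (-(1 / 2) : ℝ)).coeff m = Ring.choose (-(1 / 2) : ℝ) m := by
    intro m
    rw [FormalMultilinearSeries.coeff, binomialSeries_apply]
    simp [List.prod_ofFn]
  refine ⟨fun m => Ring.choose (-(1 / 2) : ℝ) m, by simp, by simp, ?_, fun s hs => ?_⟩
  -- The radius of convergence is at least `1`; boundedness of the terms at radius `1/2` gives the
  -- growth rate `2 ^ m`.
  · have hr : ((1 / 2 : NNReal) : ENNReal) < (binomialSeries ℝ (-(1 / 2) : ℝ)).radius := by
      refine lt_of_lt_of_le ?_ h.r_le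
      norm_num
    obtain ⟨B, hB, hb⟩ := (binomialSeries ℝ (-(1 / 2) : ℝ)).norm_le_div_pow_of_pos_of_lt_radius
      (by norm_num : (0 : NNReal) < 1 / 2) hr
    refine ⟨B, hB.le, fun m => ?_⟩
    have := hb m
    rw [FormalMultilinearSeries.norm_apply_eq_norm_coef, hc] at this
    simpa using this
  · have := h.hasSum (y := s) (by
      rw [Metric.mem_eball, edist_zero_right, Real.enorm_eq_ofReal_abs]
      rw [← ENNReal.ofReal_one, ENNReal.ofReal_lt_ofReal_iff one_pos]
      linarith)
    simp only [zero_add, FormalMultilinearSeries.apply_eq_pow_smul_coeff, hc, smul_eq_mul] at this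
    simpa [mul_comm] using this

namespace SobolevAlgebra

variable {X : Type*} [MeasurableSpace X] {μ : Measure X} [IsFiniteMeasure μ]
  {𝒜 : Type*} [CommRing 𝒜] [Algebra ℝ 𝒜] {ι : Type*} (S : SobolevAlgebra μ 𝒜 ι) [Finite ι]

/-- `f` has size at most `a` in `W^{k,2} ∩ L^∞`. -/
def Small (k : ℕ) (a : ℝ) (f : 𝒜) : Prop := (∀ x, |S.ev f x| ≤ a) ∧ S.N k f ≤ a

variable {S} {k : ℕ}

lemma Small.mono {a b : ℝ} {f : 𝒜} (h : S.Small k a f) (hab : a ≤ b) : S.Small k b f :=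
  ⟨fun x => (h.1 x).trans hab, h.2.trans hab⟩

lemma Small.add {a b : ℝ} {f g : 𝒜} (hf : S.Small k a f) (hg : S.Small k b g) :
    S.Small k (a + b) (f + g) :=
  ⟨fun x => by rw [map_add]; exact (abs_add_le _ _).trans (add_le_add (hf.1 x) (hg.1 x)),
    (S.N_add_le _ _ _).trans (add_le_add hf.2 hg.2)⟩

lemma Small.smul {a : ℝ} {f : 𝒜} (c : ℝ) (hf : S.Small k a f) : S.Small k (|c| * a) (c • f) :=
  ⟨fun x => by
    rw [map_smul, Pi.smul_apply, smul_eq_mul, abs_mul]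
    exact mul_le_mul_of_nonneg_left (hf.1 x) (abs_nonneg _),
  by rw [N_smul]; exact mul_le_mul_of_nonneg_left hf.2 (abs_nonneg _)⟩

lemma small_zero : S.Small k 0 (0 : 𝒜) := ⟨fun x => by simp, by simp [N_zero]⟩

lemma Small.sum {κ : Type*} {s : Finset κ} {a : κ → ℝ} {f : κ → 𝒜}
    (h : ∀ i ∈ s, S.Small k (a i) (f i)) : S.Small k (∑ i ∈ s, a i) (∑ i ∈ s, f i) := by
  classical
  induction s using Finset.induction with
  | empty => simpa using small_zero
  | insert b s hb ih =>
    rw [Finset.sum_insert hb, Finset.sum_insert hb]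
    exact (h b (by simp)).add (ih fun i hi => h i (by simp [hi]))

variable (S k)

lemma exists_small_mul : ∃ C, 1 ≤ C ∧ ∀ (f h : 𝒜) (a b : ℝ), 0 < a → 0 < b → S.Small k a f →
    S.Small k b h → S.Small k (C * a * b) (f * h) := by
  obtain ⟨C, hC, h⟩ := S.exists_N_mul_le_mul k
  refine ⟨max C 1, le_max_right _ _, fun f g a b ha hb hf hg => ⟨fun x => ?_, ?_⟩⟩
  · rw [map_mul, Pi.mul_apply, abs_mul]
    calc _ ≤ a * b := mul_le_mul (hf.1 x) (hg.1 x) (abs_nonneg _) ha.le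
      _ ≤ max C 1 * (a * b) := le_mul_of_one_le_left (by positivity) (le_max_right _ _)
      _ = _ := by ring
  · calc _ ≤ C * (a * b) := h f g a b ha hb hf.1 hg.1 hf.2 hg.2
      _ ≤ max C 1 * (a * b) := by gcongr; exact le_max_left _ _
      _ = _ := by ring

/-- Powers of small elements. -/
lemma exists_small_pow : ∃ C, 1 ≤ C ∧ ∀ (f : 𝒜) (a : ℝ), 0 < a → S.Small k a f →
    ∀ m, S.Small k ((C * a) ^ (m + 1)) (f ^ (m + 1)) := by
  obtain ⟨C, hC, h⟩ := S.exists_small_mul k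
  refine ⟨C, hC, fun f a ha hf m => ?_⟩
  induction m with
  | zero => simpa using hf.mono (by nlinarith)
  | succ m ih =>
    rw [pow_succ' f, pow_succ' (C * a)]
    exact h f _ a _ ha (by positivity) hf ih

variable {S k}

lemma BddCauchy.exists_small {v : ℕ → 𝒜} (hv : S.BddCauchy k v) :
    ∃ A, 0 < A ∧ ∀ i, S.Small k A (v i) := by
  obtain ⟨⟨A, hA⟩, hv⟩ := hv
  obtain ⟨B, hB0, hB⟩ := hv.bounded
  exact ⟨max (max A B) 1, by positivity, fun i => ⟨fun x => (hA i x).trans (by simp),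
    (hB i).trans (by simp)⟩⟩

/-- The partial sums of a power series `∑ c_m s^m`, with `i + 2` terms. -/
noncomputable def partialSeries (c : ℕ → ℝ) (i : ℕ) (s : 𝒜) : 𝒜 :=
  -- With two extra terms, index `0` already contains the affine part, and every tail starts at
  -- order two.
  ∑ m ∈ Finset.range (i + 2), c m • s ^ m

/-- The omitted terms have size at most `B (2ρ)^m` with `2ρ ≤ 1/2`, so the geometric tail is at most
twice its first term. As that term has order at least two in `ρ`, it also yields the `t²` remainder
of the variation. -/
lemma small_partialSeries_sub {c : ℕ → ℝ} {B : ℝ} (hB : 0 ≤ B) (hc : ∀ m, |c m| ≤ B * 2 ^ m)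
    {s : 𝒜} {ρ : ℝ} (hρ0 : 0 ≤ ρ) (hρ : ρ ≤ 1 / 4) (hs : ∀ m, S.Small k (ρ ^ (m + 1)) (s ^ (m + 1)))
    {i j : ℕ} (hij : i ≤ j) :
    S.Small k (2 * B * (2 * ρ) ^ (i + 2)) (partialSeries c j s - partialSeries c i s) := by
  have e : partialSeries c j s - partialSeries c i s =
      ∑ m ∈ Finset.Ico (i + 2) (j + 2), c m • s ^ m := by
    rw [partialSeries, partialSeries, Finset.sum_Ico_eq_sub _ (by omega)]
  rw [e]
  have h1 : S.Small k (∑ m ∈ Finset.Ico (i + 2) (j + 2), B * (2 * ρ) ^ m)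
      (∑ m ∈ Finset.Ico (i + 2) (j + 2), c m • s ^ m) := by
    refine Small.sum fun m hm => ?_
    rw [Finset.mem_Ico] at hm
    obtain ⟨m, rfl⟩ : ∃ m', m = m' + 1 := ⟨m - 1, by omega⟩
    refine ((hs m).smul (c (m + 1))).mono ?_
    rw [mul_pow, ← mul_assoc]
    exact mul_le_mul_of_nonneg_right (hc _) (by positivity)
  refine h1.mono ?_
  rw [← Finset.mul_sum, mul_comm 2 B, mul_assoc]
  refine mul_le_mul_of_nonneg_left ?_ hB
  set x := 2 * ρ
  have hx0 : 0 ≤ x := by positivity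
  have hx : x ≤ 1 / 2 := by simp only [x]; linarith
  have key : ∀ n l : ℕ, ∑ m ∈ Finset.Ico n (n + l), x ^ m ≤ 2 * x ^ n - 2 * x ^ (n + l) := by
    intro n l
    induction l with
    | zero => simp
    | succ l ih =>
      rw [← add_assoc, Finset.sum_Ico_succ_top (by omega), pow_succ]
      have : 0 ≤ x ^ (n + l) := by positivity
      nlinarith
  obtain ⟨l, rfl⟩ := Nat.exists_eq_add_of_le hij
  have := key (i + 2) l
  have h3 : i + 2 + l = i + l + 2 := by ring
  rw [h3] at this
  have : 0 ≤ x ^ (i + l + 2) := by positivity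
  linarith

/-- The diagonal sequence of partial sums is boundedly Cauchy. -/
lemma bddCauchy_partialSeries {c : ℕ → ℝ} {B : ℝ} (hB : 0 ≤ B) (hc : ∀ m, |c m| ≤ B * 2 ^ m)
    {s : ℕ → 𝒜} (hsC : S.BddCauchy k s) {ρ : ℝ} (hρ0 : 0 ≤ ρ) (hρ : ρ ≤ 1 / 4)
    (hs : ∀ i m, S.Small k (ρ ^ (m + 1)) (s i ^ (m + 1))) :
    S.BddCauchy k (fun i => partialSeries c i (s i)) := by
  have hT : ∀ n, S.BddCauchy k (fun i => partialSeries c n (s i)) := fun n =>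
    BddCauchy.sum fun m _ => (hsC.pow m).smul _
  -- Truncation at a fixed `n` gives a boundedly Cauchy sequence, and the truncation error is small
  -- uniformly in `i`; an `ε/3` argument then treats the diagonal.
  have htail : ∀ n, ∀ i ≥ n, S.Small k (2 * B * (2 * ρ) ^ (n + 2))
      (partialSeries c i (s i) - partialSeries c n (s i)) := fun n i hi =>
    small_partialSeries_sub hB hc hρ0 hρ (hs i) hi
  constructor
  · obtain ⟨A, hA⟩ := (hT 0).1
    refine ⟨2 * B * (2 * ρ) ^ (0 + 2) + A, fun i x => ?_⟩
    have h1 := (htail 0 i (Nat.zero_le _)).1 x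
    have h2 := hA i x
    have e : partialSeries c i (s i) =
      (partialSeries c i (s i) - partialSeries c 0 (s i)) + partialSeries c 0 (s i) := by ring
    change |S.ev (partialSeries c i (s i)) x| ≤ _
    rw [e, map_add]
    exact (abs_add_le _ _).trans (add_le_add h1 h2)
  · rw [cauchyN_iff]
    intro ε hε
    have hlim : Tendsto (fun n : ℕ => 2 * B * (2 * ρ) ^ (n + 2)) atTop (𝓝 0) := by
      have := (tendsto_pow_atTop_nhds_zero_of_lt_one (by positivity : 0 ≤ 2 * ρ)
        (by linarith)).comp (tendsto_add_atTop_nat 2)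
      simpa [Function.comp_def] using this.const_mul (2 * B)
    obtain ⟨n, hn⟩ := (hlim.eventually_lt_const (by positivity : 0 < ε / 3)).exists
    obtain ⟨m, hm⟩ := (hT n).2.eventually (by positivity : 0 < ε / 3)
    refine ⟨max n m, fun i hi j hj => ?_⟩
    have h1 := (htail n i (le_of_max_le_left hi)).2
    have h2 := (htail n j (le_of_max_le_left hj)).2
    have h3 := hm i (le_of_max_le_right hi) j (le_of_max_le_right hj)
    have e : partialSeries c i (s i) - partialSeries c j (s j) =
        (partialSeries c i (s i) - partialSeries c n (s i)) +
        (partialSeries c n (s i) - partialSeries c n (s j)) -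
        (partialSeries c j (s j) - partialSeries c n (s j)) := by ring
    have h4 := S.N_sub_le k ((partialSeries c i (s i) - partialSeries c n (s i)) +
        (partialSeries c n (s i) - partialSeries c n (s j)))
        (partialSeries c j (s j) - partialSeries c n (s j))
    have h5 := S.N_add_le k (partialSeries c i (s i) - partialSeries c n (s i))
        (partialSeries c n (s i) - partialSeries c n (s j))
    rw [e]
    linarith

/-- Argument and truncation vary together. Dominated convergence for series applies because `2^m
(1/8)^m = (1/4)^m` is summable. -/
lemma _root_.tendsto_partial_sums_inv_sqrt {c : ℕ → ℝ} {B : ℝ} (hc : ∀ m, |c m| ≤ B * 2 ^ m)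
    (hsum : ∀ s : ℝ, |s| ≤ 1 / 8 → HasSum (fun m => c m * s ^ m) ((1 + s) ^ (-(1 / 2) : ℝ)))
    {z : ℕ → ℝ} {z0 : ℝ} (hz : ∀ j, |z j| ≤ 1 / 8) (hlim : Tendsto z atTop (𝓝 z0)) {n : ℕ → ℕ}
    (hn : Tendsto n atTop atTop) :
    Tendsto (fun j => ∑ m ∈ Finset.range (n j + 2), c m * z j ^ m) atTop
      (𝓝 ((1 + z0) ^ (-(1 / 2) : ℝ))) := by
  have hz0 : |z0| ≤ 1 / 8 := le_of_tendsto hlim.abs (.of_forall hz)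
  rw [← (hsum z0 hz0).tsum_eq]
  have key := tendsto_tsum_of_dominated_convergence (𝓕 := atTop)
    (f := fun j m => if m < n j + 2 then c m * z j ^ m else 0) (g := fun m => c m * z0 ^ m)
    (bound := fun m => B * (1 / 4) ^ m)
    ((summable_geometric_of_lt_one (by norm_num) (by norm_num)).mul_left B) ?_ ?_
  · refine key.congr fun j => ?_
    rw [tsum_eq_sum (s := Finset.range (n j + 2)) fun m hm => by
      rw [Finset.mem_range] at hm; rw [if_neg hm]]
    exact Finset.sum_congr rfl fun m hm => by rw [Finset.mem_range] at hm; rw [if_pos hm]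
  · intro m
    refine Tendsto.congr' ?_ ((hlim.pow m).const_mul (c m))
    filter_upwards [hn.eventually_ge_atTop m] with j hj
    rw [if_pos (by omega)]
  · refine .of_forall fun j m => ?_
    have hB : 0 ≤ B * 2 ^ m := (abs_nonneg _).trans (hc m)
    have h4 : B * (1 / 4) ^ m = B * 2 ^ m * (1 / 8) ^ m := by
      rw [mul_assoc, ← mul_pow]; norm_num
    split_ifs
    · rw [Real.norm_eq_abs, abs_mul, abs_pow, h4]
      have := pow_le_pow_left₀ (abs_nonneg _) (hz j) m
      exact mul_le_mul (hc m) this (by positivity) hB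
    · rw [norm_zero, h4]
      positivity

section Variation

variable {κ : Type*} [Fintype κ] (v : κ → ℕ → 𝒜) (φ : κ → 𝒜)

/-- The scalar product of `v i` and `φ`. -/
def dot (i : ℕ) : 𝒜 := ∑ b, v b i * φ b

/-- `2t⟨v,φ⟩ + t²|φ|²`. -/
def sqDefect (t : ℝ) (i : ℕ) : 𝒜 := (2 * t) • dot v φ i + t ^ 2 • ∑ b, φ b * φ b

/-- Smooth approximations of the variation `Π(u + tφ)`. -/
noncomputable def approxVariation (c : ℕ → ℝ) (t : ℝ) (a : κ) (i : ℕ) : 𝒜 :=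
  -- The first factor approximates `|u + tφ|⁻¹`: as `|u| = 1`, the limit of the defect is `|u + tφ|²
  -- - 1`. The `v a i` themselves need not have modulus one, so they are not normalized directly.
  partialSeries c i (sqDefect v φ t i) * (v a i + t • φ a)

/-- The derivative `φ - ⟨v,φ⟩v` of the variation. -/
def tangentPart (a : κ) (i : ℕ) : 𝒜 := φ a - v a i * dot v φ i

variable {v φ}

lemma bddCauchy_dot (hv : ∀ a, S.BddCauchy k (v a)) : S.BddCauchy k (dot v φ) :=
  BddCauchy.sum fun b _ => (hv b).mul (BddCauchy.const _)

lemma bddCauchy_tangentPart (hv : ∀ a, S.BddCauchy k (v a)) (a : κ) :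
    S.BddCauchy k (tangentPart v φ a) :=
  (BddCauchy.const _).sub ((hv a).mul (bddCauchy_dot hv))

/-- The approximations of the variation are boundedly Cauchy, and differentiable in `t` at `0`
uniformly in the index. -/
lemma exists_approxVariation {c : ℕ → ℝ} (hc0 : c 0 = 1) (hc1 : c 1 = -(1 / 2)) {B : ℝ}
    (hB : 0 ≤ B) (hc : ∀ m, |c m| ≤ B * 2 ^ m) (hv : ∀ a, S.BddCauchy k (v a)) :
    ∃ δ > 0, ∃ C, 0 ≤ C ∧ ∀ t : ℝ, |t| < δ →
      (∀ i x, |S.ev (sqDefect v φ t i) x| ≤ 1 / 8) ∧ ∀ a,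
      S.BddCauchy k (approxVariation v φ c t a) ∧
      ∀ i, S.Small k (C * t ^ 2) (approxVariation v φ c t a i - v a i - t • tangentPart v φ a i) := by
  obtain ⟨P, hP1, hP⟩ := S.exists_small_pow k
  obtain ⟨Q, hQ1, hQ⟩ := S.exists_small_mul k
  obtain ⟨D, hD0, hD⟩ := (bddCauchy_dot (φ := φ) hv).exists_small
  obtain ⟨E, hE0, hE⟩ := (BddCauchy.const (S := S) (k := k) (∑ b, φ b * φ b)).exists_small
  choose V hV0 hV using fun a => (hv a).exists_small
  choose F hF0 hF using fun a => (BddCauchy.const (S := S) (k := k) (φ a)).exists_small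
  set V' : ℝ := 1 + ∑ a, V a
  have hV'0 : 0 < V' := add_pos_of_pos_of_nonneg one_pos (Finset.sum_nonneg fun a _ => (hV0 a).le)
  have hV' : ∀ a i, S.Small k V' (v a i) := fun a i => (hV a i).mono (by
    have := Finset.single_le_sum (f := V) (fun a _ => (hV0 a).le) (Finset.mem_univ a)
    linarith)
  set F' : ℝ := 1 + ∑ a, F a
  have hF'0 : 0 < F' := add_pos_of_pos_of_nonneg one_pos (Finset.sum_nonneg fun a _ => (hF0 a).le)
  have hF' : ∀ a, S.Small k F' (φ a) := fun a => (hF a 0).mono (by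
    have := Finset.single_le_sum (f := F) (fun a _ => (hF0 a).le) (Finset.mem_univ a)
    linarith)
  set K : ℝ := 2 * D + E
  have hK0 : 0 < K := by positivity
  -- For `|t| ≤ 1` the quadratic part is absorbed by `t² ≤ |t|`, so the defect is of first order in
  -- `t`, uniformly in the index.
  have hsK : ∀ t : ℝ, |t| ≤ 1 → ∀ i, S.Small k (K * |t|) (sqDefect v φ t i) := by
    intro t ht i
    refine (((hD i).smul (2 * t)).add ((hE 0).smul (t ^ 2))).mono ?_
    rw [abs_mul, abs_two, abs_of_nonneg (sq_nonneg t), ← sq_abs]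
    have h2 : |t| ^ 2 ≤ |t| := by nlinarith [abs_nonneg t]
    simp only [K]
    nlinarith [mul_le_mul_of_nonneg_left h2 hE0.le]
  have hPK : 0 < P * K := by positivity
  -- This `δ` forces `P K |t| ≤ 1/8`, which keeps the geometric ratio `2ρ` below `1/2` and the
  -- defect within the range of the series. The last constant collects the three remainder terms
  -- estimated below.
  refine ⟨min 1 (1 / (8 * (P * K))), by positivity,
    Q * (2 * B * (2 * (P * K)) ^ 2 + 1) * (V' + F') + (E * V' * Q + K * F' * Q),
    by positivity, fun t ht => ?_⟩
  have ht1 : |t| ≤ 1 := (ht.trans_le (min_le_left _ _)).le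
  have ht2 : P * K * |t| ≤ 1 / 8 := by
    have := (ht.trans_le (min_le_right _ _)).le
    rw [le_div_iff₀ (by positivity)] at this
    linarith
  set ρ : ℝ := P * K * |t| with hρ
  have hρ0 : 0 ≤ ρ := by positivity
  have hKρ : K * |t| ≤ 1 / 8 := by
    have : K * |t| ≤ P * (K * |t|) := le_mul_of_one_le_left (by positivity) hP1
    linarith
  have hpow : ∀ i m, S.Small k (ρ ^ (m + 1)) (sqDefect v φ t i ^ (m + 1)) := by
    intro i m
    -- `t = 0` is separate because the power estimate needs a positive size; the defect then
    -- vanishes.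
    rcases (abs_nonneg t).eq_or_lt with h0 | h0
    · have ht0 : t = 0 := abs_eq_zero.mp h0.symm
      have : sqDefect v φ t i = 0 := by simp [sqDefect, ht0]
      rw [this, zero_pow (by omega)]
      exact small_zero.mono (by positivity)
    · have := hP (sqDefect v φ t i) (K * |t|) (by positivity) (hsK t ht1 i) m
      rwa [← mul_assoc] at this
  refine ⟨fun i x => ((hsK t ht1 i).1 x).trans hKρ, fun a => ⟨?_, fun i => ?_⟩⟩
  · have hsC : S.BddCauchy k (sqDefect v φ t) :=
      ((bddCauchy_dot hv).smul _).add (BddCauchy.const _)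
    exact (bddCauchy_partialSeries hB hc hsC hρ0 (by linarith) hpow).mul
      ((hv a).add (BddCauchy.const _))
  · rcases (abs_nonneg t).eq_or_lt with h0 | h0
    · have ht0 : t = 0 := abs_eq_zero.mp h0.symm
      have e : approxVariation v φ c t a i - v a i - t • tangentPart v φ a i = 0 := by
        rw [approxVariation, partialSeries, Finset.sum_range_succ']
        have : sqDefect v φ 0 i = 0 := by simp [sqDefect]
        simp [this, ht0, hc0]
      rw [e]
      exact small_zero.mono (by rw [ht0]; simp)
    have hdiff := small_partialSeries_sub hB hc hρ0 (by linarith) (hpow i) (Nat.zero_le i)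
    have e0 : partialSeries c 0 (sqDefect v φ t i) = 1 - (1 / 2 : ℝ) • sqDefect v φ t i := by
      rw [partialSeries, Finset.sum_range_succ, Finset.sum_range_one, hc0, hc1]
      simp [sub_eq_add_neg]
    rw [e0] at hdiff
    have hvt : S.Small k (V' + F') (v a i + t • φ a) :=
      (hV' a i).add (((hF' a).smul t).mono (by nlinarith))
    -- The summand `t ^ 2` makes the size positive even if `B = 0`.
    have h1 := hQ _ _ (2 * B * (2 * ρ) ^ (0 + 2) + t ^ 2) (V' + F')
      (by have : 0 < t ^ 2 := by rw [← sq_abs]; positivity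
          positivity) (by positivity) (hdiff.mono (by nlinarith [sq_nonneg t])) hvt
    have h2 := (hQ _ _ E V' hE0 hV'0 (hE 0) (hV' a i)).smul (-(t ^ 2 / 2))
    have h3 := (hQ _ _ (K * |t|) F' (by positivity) hF'0 (hsK t ht1 i) (hF' a)).smul (-(t / 2))
    -- The affine part `1 - s/2` of the series produces the linear term `t (φ - ⟨v,φ⟩ v)`. What is
    -- left is the series tail times `v + tφ`, the term `-(t²/2)|φ|² v`, and `-(t/2) s φ` with `s =
    -- O(t)`.
    have e : approxVariation v φ c t a i - v a i - t • tangentPart v φ a i =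
        (partialSeries c i (sqDefect v φ t i) - (1 - (1 / 2 : ℝ) • sqDefect v φ t i)) *
          (v a i + t • φ a) + ((-(t ^ 2 / 2)) • ((∑ b, φ b * φ b) * v a i) +
          (-(t / 2)) • (sqDefect v φ t i * φ a)) := by
      rw [approxVariation, tangentPart]
      have hs : (1 / 2 : ℝ) • sqDefect v φ t i =
          t • dot v φ i + (t ^ 2 / 2) • ∑ b, φ b * φ b := by
        rw [sqDefect, smul_add, smul_smul, smul_smul]; congr 2 <;> ring
      have hs2 : (-(t / 2)) • (sqDefect v φ t i * φ a) =
          -(t • (((1 / 2 : ℝ) • sqDefect v φ t i) * φ a)) := by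
        rw [smul_mul_assoc, smul_smul, ← neg_smul]; congr 1; ring
      rw [hs2, hs]
      simp only [Algebra.smul_def, map_neg]
      ring
    rw [e]
    refine (h1.add (h2.add h3)).mono ?_
    rw [abs_neg, abs_neg, abs_of_nonneg (by positivity : 0 ≤ t ^ 2 / 2), abs_div, abs_two, hρ]
    have e2 : (2 * (P * K * |t|)) ^ (0 + 2) = (2 * (P * K)) ^ 2 * t ^ 2 := by
      rw [← sq_abs t]; ring
    have e3 : |t| * |t| = t ^ 2 := by rw [← sq_abs]; ring
    rw [e2]
    have e4 : |t| / 2 * (Q * (K * |t|) * F') = (1 / 2) * (K * F' * Q) * t ^ 2 := by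
      rw [← e3]; ring
    rw [e4]
    have p1 : 0 ≤ E * V' * Q * t ^ 2 := by positivity
    have p2 : 0 ≤ K * F' * Q * t ^ 2 := by positivity
    nlinarith

end Variation

end SobolevAlgebra
end ExtrinsicHarmonic

/-! ### The metric and gradients in charts -/

namespace ExtrinsicHarmonic

section Geometry

variable {m : ℕ} {M : Type*} [TopologicalSpace M]
  [ChartedSpace (EuclideanSpace ℝ (Fin m)) M] [IsManifold (𝓡 m) ∞ M]
  {e e' : OpenPartialHomeomorph M (EuclideanSpace ℝ (Fin m))}
  (g : SmoothMetric m M)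

lemma chart_mdifferentiable (he : e ∈ atlas (EuclideanSpace ℝ (Fin m)) M) : e.MDifferentiable (𝓡 m) (𝓡 m) := by
  have : IsManifold (𝓡 m) 1 M := IsManifold.of_le (n := ∞) (by norm_num)
  exact mdifferentiable_of_mem_atlas he

lemma contMDiffOn_chart_symm (he : e ∈ atlas (EuclideanSpace ℝ (Fin m)) M) :
    ContMDiffOn (𝓡 m) (𝓡 m) ∞ e.symm e.target :=
  contMDiffOn_symm_of_mem_maximalAtlas (IsManifold.subset_maximalAtlas he)

lemma contMDiffOn_chart (he : e ∈ atlas (EuclideanSpace ℝ (Fin m)) M) :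
    ContMDiffOn (𝓡 m) (𝓡 m) ∞ e e.source :=
  contMDiffOn_of_mem_maximalAtlas (IsManifold.subset_maximalAtlas he)

lemma contDiffOn_comp_symm (he : e ∈ atlas (EuclideanSpace ℝ (Fin m)) M)
    {f : M → ℝ} (hf : ContMDiff (𝓡 m) 𝓘(ℝ, ℝ) ∞ f) :
    ContDiffOn ℝ ∞ (f ∘ e.symm) e.target :=
  contMDiffOn_iff_contDiffOn.mp (hf.comp_contMDiffOn (contMDiffOn_chart_symm he))

lemma contMDiffOn_coordVec (he : e ∈ atlas (EuclideanSpace ℝ (Fin m)) M) (i : Fin m) :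
    ContMDiffOn (𝓡 m) (𝓡 m).tangent ∞
      (fun y => (⟨e.symm y, coordVec e y i⟩ : TangentBundle (𝓡 m) M)) e.target := by
  have h1 := (contMDiffOn_chart_symm he).contMDiffOn_tangentMapWithin (m := ∞) (by simp)
    e.open_target.uniqueMDiffOn
  have h2 : ContMDiff (𝓡 m) (𝓡 m).tangent ∞
      (fun y : EuclideanSpace ℝ (Fin m) =>
        (⟨y, stdVec i⟩ : TangentBundle (𝓡 m) (EuclideanSpace ℝ (Fin m)))) := by
    exact contMDiff_vectorSpace_iff_contDiff.mpr contDiff_const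
  refine (h1.comp h2.contMDiffOn fun y hy => hy).congr fun y hy => ?_
  simp only [Function.comp, tangentMapWithin, coordVec]
  rw [mfderivWithin_of_isOpen e.open_target hy]

lemma contDiffOn_gram (he : e ∈ atlas (EuclideanSpace ℝ (Fin m)) M) (i j : Fin m) : ContDiffOn ℝ ∞ (fun y => gram g e y i j) e.target := by
  rw [← contMDiffOn_iff_contDiffOn]
  have h := ContMDiffOn.clm_bundle_apply₂ (F₁ := EuclideanSpace ℝ (Fin m))
    (F₂ := EuclideanSpace ℝ (Fin m)) (F₃ := ℝ) (E₃ := Bundle.Trivial M ℝ)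
    (b := e.symm) (ψ := fun y => g.inner (e.symm y))
    (g.contMDiff.comp_contMDiffOn (contMDiffOn_chart_symm he)) (contMDiffOn_coordVec he i)
    (contMDiffOn_coordVec he j)
  intro y hy
  have := h y hy
  rw [Bundle.contMDiffWithinAt_totalSpace] at this
  exact this.2

lemma coordVec_injective (he : e ∈ atlas (EuclideanSpace ℝ (Fin m)) M)
    {y : EuclideanSpace ℝ (Fin m)} (hy : y ∈ e.target) :
    Function.Bijective (mfderiv (𝓡 m) (𝓡 m) e.symm y) :=
  (chart_mdifferentiable he).symm.mfderiv_bijective hy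

/-- The vector with components `a` in the chart `e`. -/
noncomputable def vecOf (e : OpenPartialHomeomorph M (EuclideanSpace ℝ (Fin m)))
    (y : EuclideanSpace ℝ (Fin m)) (a : Fin m → ℝ) : TangentSpace (𝓡 m) (e.symm y) :=
  ∑ i, a i • coordVec e y i

lemma exists_vecOf_eq (he : e ∈ atlas (EuclideanSpace ℝ (Fin m)) M)
    {y : EuclideanSpace ℝ (Fin m)} (hy : y ∈ e.target) (X : TangentSpace (𝓡 m) (e.symm y)) :
    ∃ a, X = vecOf e y a := by
  obtain ⟨w', rfl⟩ := (coordVec_injective he hy).2 X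
  obtain ⟨w, rfl⟩ : ∃ w : EuclideanSpace ℝ (Fin m), w = w' := ⟨w', rfl⟩
  have hw : w = ∑ i, w i • stdVec i := by
    ext j
    simp [stdVec, Pi.single_apply]
  refine ⟨fun i => w i, ?_⟩
  conv_lhs => rw [hw]
  simp only [vecOf, coordVec]
  exact (map_sum (mfderiv (𝓡 m) (𝓡 m) e.symm y) _ _).trans
    (Finset.sum_congr rfl fun i _ => map_smul (mfderiv (𝓡 m) (𝓡 m) e.symm y) _ _)

lemma vecOf_ne_zero (he : e ∈ atlas (EuclideanSpace ℝ (Fin m)) M)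
    {y : EuclideanSpace ℝ (Fin m)} (hy : y ∈ e.target) {a : Fin m → ℝ} (ha : a ≠ 0) :
    vecOf e y a ≠ 0 := by
  intro h
  apply ha
  have h1 : mfderiv (𝓡 m) (𝓡 m) e.symm y (∑ i, a i • stdVec i : EuclideanSpace ℝ (Fin m)) = 0 := by
    refine Eq.trans ?_ h
    simp only [vecOf, coordVec]
    exact (map_sum (mfderiv (𝓡 m) (𝓡 m) e.symm y) _ _).trans
      (Finset.sum_congr rfl fun i _ => map_smul (mfderiv (𝓡 m) (𝓡 m) e.symm y) _ _)
  have h2 := (coordVec_injective he hy).1 (h1.trans (map_zero _).symm)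
  ext i
  have h3 : (∑ j, a j • stdVec j : EuclideanSpace ℝ (Fin m)) i = (0 : EuclideanSpace ℝ (Fin m)) i :=
    congrArg (fun w : EuclideanSpace ℝ (Fin m) => w i) h2
  simpa [stdVec, Pi.single_apply] using h3

lemma inner_vecOf_coordVec (y : EuclideanSpace ℝ (Fin m)) (a : Fin m → ℝ) (j : Fin m) :
    g.inner (e.symm y) (vecOf e y a) (coordVec e y j) = (gram g e y).mulVec a j := by
  simp only [vecOf, map_sum, map_smul, Matrix.mulVec, dotProduct, gram, Matrix.of_apply,
    sum_apply, smul_apply, smul_eq_mul]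
  refine Finset.sum_congr rfl fun i _ => ?_
  rw [g.symm, mul_comm]

lemma inner_vecOf_vecOf (y : EuclideanSpace ℝ (Fin m)) (a b : Fin m → ℝ) :
    g.inner (e.symm y) (vecOf e y a) (vecOf e y b) =
      dotProduct ((gram g e y).mulVec a) b := by
  conv_lhs => rw [vecOf.eq_def e y b]
  simp only [map_sum, map_smul, smul_eq_mul, dotProduct, inner_vecOf_coordVec]
  exact Finset.sum_congr rfl fun i _ => mul_comm _ _

lemma gram_posDef (he : e ∈ atlas (EuclideanSpace ℝ (Fin m)) M)
    {y : EuclideanSpace ℝ (Fin m)} (hy : y ∈ e.target) : (gram g e y).PosDef := by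
  refine Matrix.PosDef.of_dotProduct_mulVec_pos ?_ fun a ha => ?_
  · ext i j
    simp [gram, g.symm _ (coordVec e y j)]
  · have := g.pos (e.symm y) (vecOf e y a) (vecOf_ne_zero he hy ha)
    rw [inner_vecOf_vecOf] at this
    rw [star_trivial, dotProduct_comm]
    exact this

lemma gram_det_pos (he : e ∈ atlas (EuclideanSpace ℝ (Fin m)) M)
    {y : EuclideanSpace ℝ (Fin m)} (hy : y ∈ e.target) : 0 < (gram g e y).det :=
  (gram_posDef g he hy).det_pos

lemma density_pos (he : e ∈ atlas (EuclideanSpace ℝ (Fin m)) M)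
    {y : EuclideanSpace ℝ (Fin m)} (hy : y ∈ e.target) : 0 < density g e y :=
  Real.sqrt_pos.mpr (gram_det_pos g he hy)

lemma contDiffOn_det (he : e ∈ atlas (EuclideanSpace ℝ (Fin m)) M) :
    ContDiffOn ℝ ∞ (fun y => (gram g e y).det) e.target := by
  simp only [Matrix.det_apply']
  exact ContDiffOn.sum fun σ _ => contDiffOn_const.mul
    (contDiffOn_prod fun i _ => contDiffOn_gram g he _ _)

lemma contDiffOn_density (he : e ∈ atlas (EuclideanSpace ℝ (Fin m)) M) :
    ContDiffOn ℝ ∞ (density g e) e.target :=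
  (contDiffOn_det g he).sqrt fun _ hy => (gram_det_pos g he hy).ne'

/-- Cramer's rule: the entries are polynomials in the `g_ij` divided by the positive determinant. -/
lemma contDiffOn_gram_inv (he : e ∈ atlas (EuclideanSpace ℝ (Fin m)) M) (i j : Fin m) :
    ContDiffOn ℝ ∞ (fun y => (gram g e y)⁻¹ i j) e.target := by
  have h : ∀ y ∈ e.target, (gram g e y)⁻¹ i j =
      ((gram g e y).det)⁻¹ * ((gram g e y).updateRow j (Pi.single i 1)).det := by
    intro y hy
    rw [Matrix.inv_def, Matrix.smul_apply, Ring.inverse_eq_inv', Matrix.adjugate_apply, smul_eq_mul]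
  refine ContDiffOn.congr (((contDiffOn_det g he).inv fun y hy =>
    (gram_det_pos g he hy).ne').mul ?_) h
  simp only [Matrix.det_apply']
  refine ContDiffOn.sum fun σ _ => contDiffOn_const.mul (contDiffOn_prod fun l _ => ?_)
  rcases eq_or_ne (σ l) j with h | h
  · simp only [h, Matrix.updateRow_self]
    exact contDiffOn_const
  · simp only [Matrix.updateRow_ne h]
    exact contDiffOn_gram g he _ _

lemma isUnit_det_gram (he : e ∈ atlas (EuclideanSpace ℝ (Fin m)) M)
    {y : EuclideanSpace ℝ (Fin m)} (hy : y ∈ e.target) : IsUnit (gram g e y).det :=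
  (gram_det_pos g he hy).ne'.isUnit

lemma gram_symm (y : EuclideanSpace ℝ (Fin m)) : (gram g e y).transpose = gram g e y := by
  ext i j
  simp [gram, g.symm _ (coordVec e y j)]

/-- The metric in terms of covariant components. -/
lemma inner_eq_sum_gram_inv (he : e ∈ atlas (EuclideanSpace ℝ (Fin m)) M)
    {y : EuclideanSpace ℝ (Fin m)} (hy : y ∈ e.target) (X Y : TangentSpace (𝓡 m) (e.symm y)) :
    g.inner (e.symm y) X Y = ∑ i, ∑ j, (gram g e y)⁻¹ i j *
      g.inner (e.symm y) X (coordVec e y i) * g.inner (e.symm y) Y (coordVec e y j) := by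
  obtain ⟨a, rfl⟩ := exists_vecOf_eq he hy X
  obtain ⟨b, rfl⟩ := exists_vecOf_eq he hy Y
  simp only [inner_vecOf_vecOf, inner_vecOf_coordVec]
  have hb : b = (gram g e y)⁻¹.mulVec ((gram g e y).mulVec b) := by
    rw [Matrix.mulVec_mulVec, Matrix.nonsing_inv_mul _ (isUnit_det_gram g he hy), Matrix.one_mulVec]
  conv_lhs => rw [hb]
  simp only [dotProduct]
  refine Finset.sum_congr rfl fun i _ => ?_
  rw [show ∀ c : Fin m → ℝ, (gram g e y)⁻¹.mulVec c i = ∑ j, (gram g e y)⁻¹ i j * c j from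
    fun _ => rfl, Finset.mul_sum]
  exact Finset.sum_congr rfl fun j _ => by ring

lemma ext_coordVec (he : e ∈ atlas (EuclideanSpace ℝ (Fin m)) M)
    {y : EuclideanSpace ℝ (Fin m)} (hy : y ∈ e.target) {X Y : TangentSpace (𝓡 m) (e.symm y)}
    (h : ∀ i, g.inner (e.symm y) X (coordVec e y i) = g.inner (e.symm y) Y (coordVec e y i)) :
    X = Y := by
  by_contra hne
  have h1 := g.pos (e.symm y) (X - Y) (sub_ne_zero.mpr hne)
  rw [inner_eq_sum_gram_inv g he hy] at h1
  simp [map_sub, h] at h1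

/-- Positivity makes `X ↦ g(X, ·)` injective into the dual, hence surjective by equality of finite
dimensions. -/
lemma exists_grad (x : M) (ℓ : TangentSpace (𝓡 m) x →L[ℝ] ℝ) :
    ∃ X : TangentSpace (𝓡 m) x, ∀ v, g.inner x X v = ℓ v := by
  have : FiniteDimensional ℝ (TangentSpace (𝓡 m) x) :=
    inferInstanceAs (FiniteDimensional ℝ (EuclideanSpace ℝ (Fin m)))
  let T : TangentSpace (𝓡 m) x →ₗ[ℝ] (TangentSpace (𝓡 m) x →ₗ[ℝ] ℝ) :=
    { toFun := fun X => (g.inner x X : TangentSpace (𝓡 m) x →ₗ[ℝ] ℝ)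
      map_add' := fun X Y => by ext; simp
      map_smul' := fun c X => by ext; simp }
  have hT : Function.Injective T := by
    rw [injective_iff_map_eq_zero]
    intro X hX
    by_contra hne
    have h1 := g.pos x X hne
    have h2 : g.inner x X X = 0 := LinearMap.congr_fun hX X
    linarith
  have hs : Function.Surjective T :=
    (LinearMap.injective_iff_surjective_of_finrank_eq_finrank
      (Subspace.dual_finrank_eq (K := ℝ) (V := TangentSpace (𝓡 m) x)).symm).mp hT
  obtain ⟨X, hX⟩ := hs (ℓ : TangentSpace (𝓡 m) x →ₗ[ℝ] ℝ)
  exact ⟨X, fun v => LinearMap.congr_fun hX v⟩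

/-- The gradient of a function. -/
noncomputable def grad (f : M → ℝ) (x : M) : TangentSpace (𝓡 m) x :=
  (exists_grad g x (mfderiv (𝓡 m) 𝓘(ℝ, ℝ) f x)).choose

lemma inner_grad (f : M → ℝ) (x : M) (v : TangentSpace (𝓡 m) x) :
    g.inner x (grad g f x) v = mfderiv (𝓡 m) 𝓘(ℝ, ℝ) f x v :=
  (exists_grad g x (mfderiv (𝓡 m) 𝓘(ℝ, ℝ) f x)).choose_spec v

/-- The partial derivative `∂_i F`. -/
noncomputable abbrev pd (i : Fin m) (F : EuclideanSpace ℝ (Fin m) → ℝ)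
    (y : EuclideanSpace ℝ (Fin m)) : ℝ := fderiv ℝ F y (stdVec i)

lemma inner_grad_coordVec (he : e ∈ atlas (EuclideanSpace ℝ (Fin m)) M)
    {y : EuclideanSpace ℝ (Fin m)} (hy : y ∈ e.target) {f : M → ℝ}
    (hf : MDifferentiableAt (𝓡 m) 𝓘(ℝ, ℝ) f (e.symm y)) (i : Fin m) :
    g.inner (e.symm y) (grad g f (e.symm y)) (coordVec e y i) = pd i (f ∘ e.symm) y := by
  have h2 := mfderiv_comp y hf ((chart_mdifferentiable he).mdifferentiableAt_symm hy)
  rw [mfderiv_eq_fderiv] at h2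
  rw [inner_grad, coordVec, pd, h2]
  rfl

/-- The pairing `⟨∇f, ∇h⟩` of differentiable functions. -/
noncomputable def gam (f h : M → ℝ) (x : M) : ℝ := g.inner x (grad g f x) (grad g h x)

lemma gam_chart (he : e ∈ atlas (EuclideanSpace ℝ (Fin m)) M)
    {y : EuclideanSpace ℝ (Fin m)} (hy : y ∈ e.target) {f h : M → ℝ}
    (hf : MDifferentiableAt (𝓡 m) 𝓘(ℝ, ℝ) f (e.symm y))
    (hh : MDifferentiableAt (𝓡 m) 𝓘(ℝ, ℝ) h (e.symm y)) :
    gam g f h (e.symm y) = ∑ i, ∑ j, (gram g e y)⁻¹ i j * pd i (f ∘ e.symm) y *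
      pd j (h ∘ e.symm) y := by
  rw [gam, inner_eq_sum_gram_inv g he hy]
  simp only [inner_grad_coordVec g he hy hf, inner_grad_coordVec g he hy hh]

lemma gam_comm (f h : M → ℝ) (x : M) : gam g f h x = gam g h f x := g.symm _ _ _

end Geometry

end ExtrinsicHarmonic

/-! ### The Riemannian volume measure -/

namespace ExtrinsicHarmonic

section Volume

variable {m : ℕ} {M : Type*} [TopologicalSpace M]
  [ChartedSpace (EuclideanSpace ℝ (Fin m)) M] [IsManifold (𝓡 m) ∞ M]
  {e e' : OpenPartialHomeomorph M (EuclideanSpace ℝ (Fin m))}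
  (g : SmoothMetric m M)

/-- All tangent spaces share the model vector space. This allows a base point `e'⁻¹(e'(x))` to be
exchanged for `x` while the vectors are kept. -/
lemma inner_congr_point {x x' : M} (h : x = x') (v w : EuclideanSpace ℝ (Fin m)) :
    g.inner x (v : TangentSpace (𝓡 m) x) (w : TangentSpace (𝓡 m) x) =
      g.inner x' (v : TangentSpace (𝓡 m) x') (w : TangentSpace (𝓡 m) x') := by
  subst h
  rfl

lemma differentiableAt_transition (he : e ∈ atlas (EuclideanSpace ℝ (Fin m)) M)
    (he' : e' ∈ atlas (EuclideanSpace ℝ (Fin m)) M) {y : EuclideanSpace ℝ (Fin m)}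
    (hy : y ∈ e.target) (hy' : e.symm y ∈ e'.source) :
    DifferentiableAt ℝ (e' ∘ e.symm) y :=
  (((chart_mdifferentiable he').mdifferentiableAt hy').comp y
    ((chart_mdifferentiable he).mdifferentiableAt_symm hy)).differentiableAt

lemma coordVec_transition (he : e ∈ atlas (EuclideanSpace ℝ (Fin m)) M)
    (he' : e' ∈ atlas (EuclideanSpace ℝ (Fin m)) M) {y : EuclideanSpace ℝ (Fin m)}
    (hy : y ∈ e.target) (hy' : e.symm y ∈ e'.source) (i : Fin m) :
    (coordVec e y i : EuclideanSpace ℝ (Fin m)) =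
      vecOf e' (e' (e.symm y)) fun j => fderiv ℝ (e' ∘ e.symm) y (stdVec i) j := by
  have h1 : e.symm =ᶠ[𝓝 y] e'.symm ∘ (e' ∘ e.symm) := by
    filter_upwards [(e.isOpen_inter_preimage_symm e'.open_source).mem_nhds ⟨hy, hy'⟩] with z hz
    exact (e'.left_inv hz.2).symm
  have h2 : mfderiv (𝓡 m) (𝓡 m) e.symm y = mfderiv (𝓡 m) (𝓡 m) (e'.symm ∘ (e' ∘ e.symm)) y :=
    h1.mfderiv_eq
  have h3 := mfderiv_comp (I := 𝓡 m) (I' := 𝓡 m) (I'' := 𝓡 m) y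
    ((chart_mdifferentiable he').mdifferentiableAt_symm (e'.map_source hy'))
    (differentiableAt_transition he he' hy hy').mdifferentiableAt
  rw [coordVec, h2, h3]
  rw [mfderiv_eq_fderiv]
  set w : EuclideanSpace ℝ (Fin m) := fderiv ℝ (e' ∘ e.symm) y (stdVec i) with hw
  have hw' : w = ∑ j, w j • stdVec j := by
    ext j
    simp [stdVec, Pi.single_apply]
  change (mfderiv (𝓡 m) (𝓡 m) e'.symm (e' (e.symm y))) w = _
  conv_lhs => rw [hw']
  simp only [vecOf, coordVec]
  exact (map_sum (mfderiv (𝓡 m) (𝓡 m) e'.symm _) _ _).trans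
    (Finset.sum_congr rfl fun i _ => map_smul (mfderiv (𝓡 m) (𝓡 m) e'.symm _) _ _)

/-- The Gram matrices are related by `G_e = Jᵀ G_{e'} J` with `J` the Jacobian of the transition
map; take determinants and square roots. -/
lemma density_transition (he : e ∈ atlas (EuclideanSpace ℝ (Fin m)) M)
    (he' : e' ∈ atlas (EuclideanSpace ℝ (Fin m)) M) {y : EuclideanSpace ℝ (Fin m)}
    (hy : y ∈ e.target) (hy' : e.symm y ∈ e'.source) :
    density g e y = |(fderiv ℝ (e' ∘ e.symm) y).det| * density g e' (e' (e.symm y)) := by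
  set J : Matrix (Fin m) (Fin m) ℝ :=
    Matrix.of fun j i => fderiv ℝ (e' ∘ e.symm) y (stdVec i) j with hJ
  have h1 : gram g e y = J.transpose * (gram g e' (e' (e.symm y)) * J) := by
    ext i k
    have h2 : gram g e y i k = dotProduct ((gram g e' (e' (e.symm y))).mulVec fun j => J j i)
        (fun j => J j k) := by
      rw [← inner_vecOf_vecOf, gram, Matrix.of_apply]
      have h3 := inner_congr_point g (e'.left_inv hy').symm (coordVec e y i) (coordVec e y k)
      refine h3.trans ?_
      rw [coordVec_transition he he' hy hy' i, coordVec_transition he he' hy hy' k]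
      rfl
    rw [h2, dotProduct_comm, Matrix.dotProduct_mulVec, ← dotProduct_comm]
    rw [← Matrix.mulVec_transpose, gram_symm]
    rfl
  have h4 : J.det = (fderiv ℝ (e' ∘ e.symm) y).det := by
    have h5 := LinearMap.det_toMatrix (EuclideanSpace.basisFun (Fin m) ℝ).toBasis
      (fderiv ℝ (e' ∘ e.symm) y : EuclideanSpace ℝ (Fin m) →ₗ[ℝ] EuclideanSpace ℝ (Fin m))
    rw [ContinuousLinearMap.det, ← h5]
    congr 1
  rw [density, h1, Matrix.det_mul, Matrix.det_mul, Matrix.det_transpose, h4, density,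
    mul_comm (gram g e' _).det, ← mul_assoc, Real.sqrt_mul (mul_self_nonneg _),
    Real.sqrt_mul_self_eq_abs]

variable [MeasurableSpace M] [BorelSpace M]

/-- The measure `√(det g_ij) dy` on the chart target. -/
noncomputable def coordMeasure (e : OpenPartialHomeomorph M (EuclideanSpace ℝ (Fin m))) :
    Measure (EuclideanSpace ℝ (Fin m)) :=
  (volume.restrict e.target).withDensity fun y => ENNReal.ofReal (density g e y)

lemma aemeasurable_density (he : e ∈ atlas (EuclideanSpace ℝ (Fin m)) M) :
    AEMeasurable (density g e) (volume.restrict e.target) :=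
  (contDiffOn_density g he).continuousOn.aemeasurable e.open_target.measurableSet

lemma coordMeasure_ac : coordMeasure g e ≪ volume.restrict e.target :=
  withDensity_absolutelyContinuous _ _

lemma ac_coordMeasure (he : e ∈ atlas (EuclideanSpace ℝ (Fin m)) M) :
    volume.restrict e.target ≪ coordMeasure g e := by
  refine withDensity_absolutelyContinuous' (aemeasurable_density g he).ennreal_ofReal ?_
  filter_upwards [ae_restrict_mem e.open_target.measurableSet] with y hy
  simpa using density_pos g he hy

lemma aemeasurable_chart_symm (e : OpenPartialHomeomorph M (EuclideanSpace ℝ (Fin m))) :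
    AEMeasurable e.symm (volume.restrict e.target) :=
  e.continuousOn_symm.aemeasurable e.open_target.measurableSet

lemma measurableSet_inter_preimage_chart_symm
    (e : OpenPartialHomeomorph M (EuclideanSpace ℝ (Fin m))) {A : Set M} (hA : MeasurableSet A) :
    MeasurableSet (e.target ∩ e.symm ⁻¹' A) := by
  have h1 := (continuousOn_iff_continuous_domRestrict.1 e.continuousOn_symm).measurable hA
  have h2 := e.open_target.measurableSet.subtype_image h1
  convert h2 using 1
  ext y
  simp
  tauto

lemma chartVol_eq : chartVol g e = Measure.map e.symm (coordMeasure g e) := rfl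

lemma chartVol_apply {A : Set M} (hA : MeasurableSet A) :
    chartVol g e A = ∫⁻ y in e.target ∩ e.symm ⁻¹' A, ENNReal.ofReal (density g e y) := by
  have hm := measurableSet_inter_preimage_chart_symm e hA
  rw [chartVol_eq, Measure.map_apply_of_aemeasurable
    ((aemeasurable_chart_symm e).mono_ac (coordMeasure_ac g)) hA]
  have h1 : coordMeasure g e (e.symm ⁻¹' A) = coordMeasure g e (e.target ∩ e.symm ⁻¹' A) := by
    apply measure_congr
    have h2 : ∀ᵐ y ∂(coordMeasure g e), y ∈ e.target :=
      (coordMeasure_ac g).ae_le (ae_restrict_mem e.open_target.measurableSet)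
    filter_upwards [h2] with y hy
    exact propext ⟨fun h => ⟨hy, h⟩, fun h => h.2⟩
  rw [h1, coordMeasure, withDensity_apply _ hm, Measure.restrict_restrict hm,
    Set.inter_right_comm, Set.inter_self]

lemma chartVol_inter_source {A : Set M} (hA : MeasurableSet A) :
    chartVol g e (A ∩ e.source) = chartVol g e A := by
  rw [chartVol_apply g hA, chartVol_apply g (hA.inter e.open_source.measurableSet)]
  congr 2
  ext y
  simp only [Set.mem_inter_iff, Set.mem_preimage]
  exact ⟨fun h => ⟨h.1, h.2.1⟩, fun h => ⟨h.1, h.2, e.map_target h.1⟩⟩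

/-- Change of variables along the transition map: its Jacobian is exactly the factor in
`density_transition`. -/
lemma chartVol_eq_of_subset (he : e ∈ atlas (EuclideanSpace ℝ (Fin m)) M)
    (he' : e' ∈ atlas (EuclideanSpace ℝ (Fin m)) M) {A : Set M} (hA : MeasurableSet A)
    (h : A ⊆ e.source) (h' : A ⊆ e'.source) : chartVol g e A = chartVol g e' A := by
  rw [chartVol_apply g hA, chartVol_apply g hA]
  set s := e.target ∩ e.symm ⁻¹' A
  have hs : MeasurableSet s := measurableSet_inter_preimage_chart_symm e hA
  have himg : (e' ∘ e.symm) '' s = e'.target ∩ e'.symm ⁻¹' A := by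
    ext z
    constructor
    · rintro ⟨y, hy, rfl⟩
      refine ⟨e'.map_source (h' hy.2), ?_⟩
      simp only [Function.comp, Set.mem_preimage]
      rw [e'.left_inv (h' hy.2)]
      exact hy.2
    · rintro ⟨hz, hzA⟩
      refine ⟨e (e'.symm z), ⟨e.map_source (h hzA), ?_⟩, ?_⟩
      · simp only [Set.mem_preimage]
        rw [e.left_inv (h hzA)]
        exact hzA
      · simp only [Function.comp]
        rw [e.left_inv (h hzA), e'.right_inv hz]
  have hinj : Set.InjOn (e' ∘ e.symm) s := by
    intro y hy z hz hyz
    have := e'.injOn (h' hy.2) (h' hz.2) hyz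
    exact e.symm.injOn hy.1 hz.1 this
  rw [← himg, lintegral_image_eq_lintegral_abs_det_fderiv_mul volume hs
    (fun y hy => (differentiableAt_transition he he' hy.1 (h' hy.2)).hasFDerivAt.hasFDerivWithinAt)
    hinj]
  refine setLIntegral_congr_fun hs fun y hy => ?_
  rw [density_transition g he he' hy.1 (h' hy.2), ENNReal.ofReal_mul (abs_nonneg _)]
  rfl

lemma chartVol_le_vol (he : e ∈ atlas (EuclideanSpace ℝ (Fin m)) M) : chartVol g e ≤ vol g :=
  le_iSup₂ (f := fun e (_ : e ∈ atlas (EuclideanSpace ℝ (Fin m)) M) => chartVol g e) e he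

/-- Every chart volume is at most `chartVol g e` plus the part of `vol g` outside the domain of `e`,
because chart volumes agree on overlaps. The supremum `vol g` inherits this bound, so on the domain
of `e` it does not exceed `chartVol g e`. -/
lemma vol_restrict_source (he : e ∈ atlas (EuclideanSpace ℝ (Fin m)) M) :
    (vol g).restrict e.source = chartVol g e := by
  have hs := e.open_source.measurableSet
  have hle : vol g ≤ chartVol g e + (vol g).restrict e.sourceᶜ := by
    refine iSup₂_le fun e' he' => Measure.le_iff.mpr fun A hA => ?_
    rw [Measure.add_apply, Measure.restrict_apply hA, ← measure_inter_add_sdiff A hs]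
    refine add_le_add ?_ (chartVol_le_vol g he' _)
    rw [← chartVol_inter_source g (hA.inter hs), chartVol_eq_of_subset g he' he
      ((hA.inter hs).inter e'.open_source.measurableSet) (fun x hx => hx.2) (fun x hx => hx.1.2)]
    exact measure_mono fun x hx => hx.1.1
  refine le_antisymm (Measure.le_iff.mpr fun A hA => ?_) (Measure.le_iff.mpr fun A hA => ?_)
  · rw [Measure.restrict_apply hA, ← chartVol_inter_source g hA]
    refine (hle _).trans ?_
    rw [Measure.add_apply, Measure.restrict_apply (hA.inter hs), Set.inter_assoc,
      Set.inter_compl_self, Set.inter_empty, measure_empty, add_zero]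
  · rw [Measure.restrict_apply hA, ← chartVol_inter_source g hA]
    exact chartVol_le_vol g he _

lemma map_chart_symm (he : e ∈ atlas (EuclideanSpace ℝ (Fin m)) M) :
    Measure.map e.symm (coordMeasure g e) = (vol g).restrict e.source :=
  (vol_restrict_source g he).symm

lemma aemeasurable_chart_symm_coordMeasure :
    AEMeasurable e.symm (coordMeasure g e) :=
  (aemeasurable_chart_symm e).mono_ac (coordMeasure_ac g)

lemma aemeasurable_chart : AEMeasurable e ((vol g).restrict e.source) :=
  e.continuousOn.aemeasurable e.open_source.measurableSet

lemma map_chart (he : e ∈ atlas (EuclideanSpace ℝ (Fin m)) M) :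
    Measure.map e ((vol g).restrict e.source) = coordMeasure g e := by
  have h : AEMeasurable e (Measure.map e.symm (coordMeasure g e)) := by
    rw [map_chart_symm g he]
    exact aemeasurable_chart g
  rw [← map_chart_symm g he, AEMeasurable.map_map_of_aemeasurable h
    (aemeasurable_chart_symm_coordMeasure g)]
  conv_rhs => rw [← Measure.map_id (μ := coordMeasure g e)]
  refine Measure.map_congr ?_
  filter_upwards [(coordMeasure_ac g).ae_le (ae_restrict_mem e.open_target.measurableSet)] with y hy
  exact e.right_inv hy

/-- Almost everywhere on a chart domain, read in the chart. -/
lemma ae_restrict_source_iff (he : e ∈ atlas (EuclideanSpace ℝ (Fin m)) M) {p : M → Prop} :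
    (∀ᵐ x ∂(vol g).restrict e.source, p x) ↔ ∀ᵐ y ∂volume.restrict e.target, p (e.symm y) := by
  constructor
  · intro h
    rw [← map_chart_symm g he] at h
    exact (ac_coordMeasure g he).ae_le
      (ae_of_ae_map (aemeasurable_chart_symm_coordMeasure g) h)
  · intro h
    have h1 := (coordMeasure_ac g).ae_le h
    rw [← map_chart g he] at h1
    have h2 := ae_of_ae_map (aemeasurable_chart g) h1
    filter_upwards [h2, ae_restrict_mem e.open_source.measurableSet] with x hx hxs
    rwa [e.left_inv hxs] at hx

lemma integral_source (he : e ∈ atlas (EuclideanSpace ℝ (Fin m)) M) {f : M → ℝ}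
    (hf : AEStronglyMeasurable f ((vol g).restrict e.source)) :
    ∫ x in e.source, f x ∂(vol g) = ∫ y in e.target, density g e y * f (e.symm y) := by
  rw [← map_chart_symm g he] at hf ⊢
  rw [integral_map (aemeasurable_chart_symm_coordMeasure g) hf, coordMeasure,
    integral_withDensity_eq_integral_toReal_smul₀ (aemeasurable_density g he).ennreal_ofReal
      (ae_of_all _ fun _ => ENNReal.ofReal_lt_top)]
  refine setIntegral_congr_fun e.open_target.measurableSet fun y hy => ?_
  simp only [smul_eq_mul, ENNReal.toReal_ofReal (density_pos g he hy).le]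

lemma exists_density_bounds (he : e ∈ atlas (EuclideanSpace ℝ (Fin m)) M)
    {K : Set (EuclideanSpace ℝ (Fin m))} (hK : IsCompact K) (hKt : K ⊆ e.target) :
    ∃ C : ℝ, 0 < C ∧ ∀ y ∈ K, density g e y ≤ C ∧ C⁻¹ ≤ density g e y := by
  have hc : ContinuousOn (density g e) K := (contDiffOn_density g he).continuousOn.mono hKt
  have hc' : ContinuousOn (fun y => (density g e y)⁻¹) K :=
    hc.inv₀ fun y hy => (density_pos g he (hKt hy)).ne'
  obtain ⟨C₁, h₁⟩ := hK.bddAbove_image hc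
  obtain ⟨C₂, h₂⟩ := hK.bddAbove_image hc'
  refine ⟨max 1 (max C₁ C₂), by positivity, fun y hy => ⟨?_, ?_⟩⟩
  · exact (h₁ (Set.mem_image_of_mem _ hy)).trans ((le_max_left _ _).trans (le_max_right _ _))
  · have h3 : (density g e y)⁻¹ ≤ max 1 (max C₁ C₂) :=
      (h₂ (Set.mem_image_of_mem _ hy)).trans ((le_max_right _ _).trans (le_max_right _ _))
    exact inv_le_of_inv_le₀ (density_pos g he (hKt hy)) h3

lemma coordMeasure_restrict_le (he : e ∈ atlas (EuclideanSpace ℝ (Fin m)) M)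
    {K : Set (EuclideanSpace ℝ (Fin m))} (hK : IsCompact K) (hKt : K ⊆ e.target) :
    ∃ C : ℝ, 0 < C ∧ (coordMeasure g e).restrict K ≤ ENNReal.ofReal C • volume.restrict K ∧
      volume.restrict K ≤ ENNReal.ofReal C • (coordMeasure g e).restrict K := by
  obtain ⟨C, hC, h⟩ := exists_density_bounds g he hK hKt
  have hd : ∀ A, MeasurableSet A → (coordMeasure g e).restrict K A =
      ∫⁻ y in A ∩ K, ENNReal.ofReal (density g e y) := by
    intro A hA
    rw [Measure.restrict_apply hA, coordMeasure, withDensity_apply _ (hA.inter hK.measurableSet),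
      Measure.restrict_restrict (hA.inter hK.measurableSet),
      Set.inter_eq_left.mpr fun x hx => hKt hx.2]
  refine ⟨C, hC, Measure.le_iff.mpr fun A hA => ?_, Measure.le_iff.mpr fun A hA => ?_⟩
  · rw [hd A hA, Measure.smul_apply, Measure.restrict_apply hA, smul_eq_mul,
      ← setLIntegral_const]
    exact setLIntegral_mono' (hA.inter hK.measurableSet) fun y hy =>
      ENNReal.ofReal_le_ofReal (h y hy.2).1
  · rw [Measure.smul_apply, hd A hA, smul_eq_mul, Measure.restrict_apply hA]
    have h1 : ENNReal.ofReal C⁻¹ * volume (A ∩ K) ≤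
        ∫⁻ y in A ∩ K, ENNReal.ofReal (density g e y) := by
      rw [← setLIntegral_const]
      exact setLIntegral_mono' (hA.inter hK.measurableSet) fun y hy =>
        ENNReal.ofReal_le_ofReal (h y hy.2).2
    calc volume (A ∩ K) = ENNReal.ofReal C * (ENNReal.ofReal C⁻¹ * volume (A ∩ K)) := by
          rw [← mul_assoc, ← ENNReal.ofReal_mul hC.le, mul_inv_cancel₀ hC.ne', ENNReal.ofReal_one,
            one_mul]
      _ ≤ _ := by gcongr

lemma vol_restrict_image (he : e ∈ atlas (EuclideanSpace ℝ (Fin m)) M)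
    {K : Set (EuclideanSpace ℝ (Fin m))} (hK : IsCompact K) (hKt : K ⊆ e.target) [T2Space M] :
    (vol g).restrict (e.symm '' K) = Measure.map e.symm ((coordMeasure g e).restrict K) := by
  have hsub : e.symm '' K ⊆ e.source := by
    rintro _ ⟨y, hy, rfl⟩
    exact e.map_target (hKt hy)
  have hA : MeasurableSet (e.symm '' K) :=
    (hK.image_of_continuousOn (e.continuousOn_symm.mono hKt)).measurableSet
  ext B hB
  rw [Measure.restrict_apply hB, ← Set.inter_eq_left.mpr hsub, ← Set.inter_assoc,
    ← Measure.restrict_apply (hB.inter hA), ← map_chart_symm g he,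
    Measure.map_apply_of_aemeasurable (aemeasurable_chart_symm_coordMeasure g) (hB.inter hA),
    Measure.map_apply_of_aemeasurable
      ((aemeasurable_chart_symm_coordMeasure g).mono_measure Measure.restrict_le_self) hB,
    Measure.restrict_apply' hK.measurableSet]
  refine measure_congr ?_
  filter_upwards [(coordMeasure_ac g).ae_le (ae_restrict_mem e.open_target.measurableSet)] with y hy
  refine propext ⟨fun h => ⟨h.1, ?_⟩, fun h => ⟨h.1, Set.mem_image_of_mem _ h.2⟩⟩
  obtain ⟨z, hz, hzy⟩ := h.2
  rwa [← e.symm.injOn (hKt hz) hy hzy]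

lemma isLocallyFiniteMeasure_vol [T2Space M] : IsLocallyFiniteMeasure (vol g) := by
  refine ⟨fun x => ?_⟩
  set e := chartAt (EuclideanSpace ℝ (Fin m)) x
  have he : e ∈ atlas (EuclideanSpace ℝ (Fin m)) M := chart_mem_atlas _ x
  obtain ⟨K, hK, hxK, hKt⟩ := exists_compact_subset e.open_target
    (mem_chart_target (EuclideanSpace ℝ (Fin m)) x)
  refine ⟨e.symm '' K, ?_, ?_⟩
  · have h1 := e.symm.image_mem_nhds (x := e x) (mem_chart_target (EuclideanSpace ℝ (Fin m)) x)
      (mem_interior_iff_mem_nhds.mp hxK)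
    rwa [e.left_inv (mem_chart_source _ x)] at h1
  · obtain ⟨C, hC, h1, -⟩ := coordMeasure_restrict_le g he hK hKt
    rw [← Measure.restrict_apply_self, vol_restrict_image g he hK hKt,
      Measure.map_apply_of_aemeasurable
      ((aemeasurable_chart_symm_coordMeasure g).mono_measure Measure.restrict_le_self)
      (hK.image_of_continuousOn (e.continuousOn_symm.mono hKt)).measurableSet]
    refine (measure_mono (Set.subset_univ _)).trans_lt ((h1 _).trans_lt ?_)
    simp only [Measure.smul_apply, Measure.restrict_apply_univ, smul_eq_mul]
    exact ENNReal.mul_lt_top ENNReal.ofReal_lt_top hK.measure_lt_top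

lemma isFiniteMeasure_vol [T2Space M] [CompactSpace M] : IsFiniteMeasure (vol g) := by
  have := isLocallyFiniteMeasure_vol g
  infer_instance

lemma isOpenPosMeasure_vol : (vol g).IsOpenPosMeasure := by
  refine ⟨fun U hU ⟨x, hx⟩ h0 => ?_⟩
  set e := chartAt (EuclideanSpace ℝ (Fin m)) x
  have he : e ∈ atlas (EuclideanSpace ℝ (Fin m)) M := chart_mem_atlas _ x
  have h1 : ∀ᵐ x ∂(vol g).restrict e.source, x ∉ U :=
    ae_restrict_of_ae (measure_eq_zero_iff_ae_notMem.mp h0)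
  rw [ae_restrict_source_iff g he, ae_restrict_iff' e.open_target.measurableSet] at h1
  have h2 : volume (e.target ∩ e.symm ⁻¹' U) = 0 := by
    rw [measure_eq_zero_iff_ae_notMem]
    filter_upwards [h1] with y hy hy' using hy hy'.1 hy'.2
  refine (e.isOpen_inter_preimage_symm hU).measure_ne_zero volume ⟨e x, ?_, ?_⟩ h2
  · exact mem_chart_target _ x
  · simp only [Set.mem_preimage]
    rwa [e.left_inv (mem_chart_source _ x)]

end Volume

end ExtrinsicHarmonic

/-! ### The Laplace–Beltrami operator: weak form and chart independence -/

namespace ExtrinsicHarmonic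

section Laplacian

variable {m : ℕ}

lemma contDiffOn_pd {U : Set (EuclideanSpace ℝ (Fin m))} (hU : IsOpen U)
    {F : EuclideanSpace ℝ (Fin m) → ℝ} (hF : ContDiffOn ℝ ∞ F U) (i : Fin m) :
    ContDiffOn ℝ ∞ (pd i F) U :=
  (hF.fderiv_of_isOpen hU (by simp)).clm_apply contDiffOn_const

lemma integrable_of_continuousOn_of_compact {U K : Set (EuclideanSpace ℝ (Fin m))}
    {G : EuclideanSpace ℝ (Fin m) → ℝ} (hG : ContinuousOn G U) (hK : IsCompact K)
    (hKU : K ⊆ U) (h0 : ∀ y, y ∉ K → G y = 0) : Integrable G := by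
  rw [← integrableOn_iff_integrable_of_support_subset (s := K)]
  · exact (hG.mono hKU).integrableOn_compact hK
  · intro y hy
    by_contra h
    exact hy (h0 y h)

variable {M : Type*} [TopologicalSpace M]
  [ChartedSpace (EuclideanSpace ℝ (Fin m)) M] [IsManifold (𝓡 m) ∞ M]
  {e e' : OpenPartialHomeomorph M (EuclideanSpace ℝ (Fin m))}
  (g : SmoothMetric m M)

lemma mdiffAt {f : M → ℝ} (hf : ContMDiff (𝓡 m) 𝓘(ℝ, ℝ) ∞ f) (x : M) :
    MDifferentiableAt (𝓡 m) 𝓘(ℝ, ℝ) f x :=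
  hf.mdifferentiable (by simp) x

lemma gam_eq_mfderiv (f h : M → ℝ) (x : M) :
    gam g f h x = mfderiv (𝓡 m) 𝓘(ℝ, ℝ) f x (grad g h x) := inner_grad g f x _

lemma gam_congr {f f' : M → ℝ} {x : M} (hf : f =ᶠ[𝓝 x] f') (h : M → ℝ) :
    gam g f h x = gam g f' h x := by
  rw [gam_eq_mfderiv, gam_eq_mfderiv, hf.mfderiv_eq]
  rfl

lemma gam_mul {f h : M → ℝ} (hf : ContMDiff (𝓡 m) 𝓘(ℝ, ℝ) ∞ f)
    (hh : ContMDiff (𝓡 m) 𝓘(ℝ, ℝ) ∞ h) (w : M → ℝ) (x : M) :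
    gam g (f * h) w x = f x * gam g h w x + h x * gam g f w x := by
  have := ((mdiffAt hf x).hasMFDerivAt.mul (mdiffAt hh x).hasMFDerivAt).mfderiv
  simp only [gam_eq_mfderiv]
  rw [this]
  rfl

lemma gam_add {f h : M → ℝ} (hf : ContMDiff (𝓡 m) 𝓘(ℝ, ℝ) ∞ f)
    (hh : ContMDiff (𝓡 m) 𝓘(ℝ, ℝ) ∞ h) (w : M → ℝ) (x : M) :
    gam g (f + h) w x = gam g f w x + gam g h w x := by
  simp only [gam_eq_mfderiv]
  rw [mfderiv_add (mdiffAt hf x) (mdiffAt hh x)]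
  rfl

lemma gam_smul {f : M → ℝ} (hf : ContMDiff (𝓡 m) 𝓘(ℝ, ℝ) ∞ f) (c : ℝ) (w : M → ℝ) (x : M) :
    gam g (c • f) w x = c * gam g f w x := by
  simp only [gam_eq_mfderiv]
  rw [const_smul_mfderiv (mdiffAt hf x) c]
  rfl

lemma gam_const (c : ℝ) (w : M → ℝ) (x : M) : gam g (fun _ => c) w x = 0 := by
  rw [gam_eq_mfderiv, mfderiv_const]
  rfl

lemma gam_eq_zero {f : M → ℝ} {x : M} (hx : x ∉ tsupport f) (w : M → ℝ) : gam g f w x = 0 := by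
  rw [gam_congr g (notMem_tsupport_iff_eventuallyEq.mp hx)]
  exact gam_const g 0 w x

/-- A function given in the charts by smooth functions is smooth. -/
lemma contMDiff_of_charts {f : M → ℝ}
    (h : ∀ e ∈ atlas (EuclideanSpace ℝ (Fin m)) M, ∃ F : EuclideanSpace ℝ (Fin m) → ℝ,
      ContDiffOn ℝ ∞ F e.target ∧ ∀ y ∈ e.target, f (e.symm y) = F y) :
    ContMDiff (𝓡 m) 𝓘(ℝ, ℝ) ∞ f := by
  intro x
  have he : chartAt (EuclideanSpace ℝ (Fin m)) x ∈ atlas (EuclideanSpace ℝ (Fin m)) M :=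
    chart_mem_atlas _ x
  obtain ⟨F, hF, hfF⟩ := h _ he
  have h1 : ContMDiffOn (𝓡 m) 𝓘(ℝ, ℝ) ∞ (F ∘ chartAt (EuclideanSpace ℝ (Fin m)) x)
      (chartAt (EuclideanSpace ℝ (Fin m)) x).source :=
    (contMDiffOn_iff_contDiffOn.mpr hF).comp (contMDiffOn_chart he) fun z hz =>
      (chartAt (EuclideanSpace ℝ (Fin m)) x).map_source hz
  refine (h1.congr fun z hz => ?_).contMDiffAt
    ((chartAt (EuclideanSpace ℝ (Fin m)) x).open_source.mem_nhds (mem_chart_source _ x))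
  have := hfF _ ((chartAt (EuclideanSpace ℝ (Fin m)) x).map_source hz)
  rwa [(chartAt (EuclideanSpace ℝ (Fin m)) x).left_inv hz] at this

lemma contMDiff_gam {f h : M → ℝ} (hf : ContMDiff (𝓡 m) 𝓘(ℝ, ℝ) ∞ f)
    (hh : ContMDiff (𝓡 m) 𝓘(ℝ, ℝ) ∞ h) : ContMDiff (𝓡 m) 𝓘(ℝ, ℝ) ∞ (gam g f h) := by
  refine contMDiff_of_charts fun e he => ⟨_, ?_, fun y hy =>
    gam_chart g he hy (mdiffAt hf _) (mdiffAt hh _)⟩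
  exact ContDiffOn.sum fun i _ => ContDiffOn.sum fun j _ =>
    ((contDiffOn_gram_inv g he i j).mul
      (contDiffOn_pd e.open_target (contDiffOn_comp_symm he hf) i)).mul
      (contDiffOn_pd e.open_target (contDiffOn_comp_symm he hh) j)

/-- The flux `√(det g) ∑_j g^ij ∂_j f` in the chart `e`. -/
noncomputable def flux (e : OpenPartialHomeomorph M (EuclideanSpace ℝ (Fin m))) (f : M → ℝ)
    (i : Fin m) (y : EuclideanSpace ℝ (Fin m)) : ℝ :=
  density g e y * ∑ j, (gram g e y)⁻¹ i j * fderiv ℝ (f ∘ e.symm) y (stdVec j)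

/-- The Laplace–Beltrami operator in the chart `e`. -/
noncomputable def lapChart (e : OpenPartialHomeomorph M (EuclideanSpace ℝ (Fin m))) (f : M → ℝ)
    (y : EuclideanSpace ℝ (Fin m)) : ℝ :=
  (density g e y)⁻¹ * ∑ i, pd i (flux g e f i) y

lemma contDiffOn_flux (he : e ∈ atlas (EuclideanSpace ℝ (Fin m)) M) {f : M → ℝ}
    (hf : ContMDiff (𝓡 m) 𝓘(ℝ, ℝ) ∞ f) (i : Fin m) :
    ContDiffOn ℝ ∞ (flux g e f i) e.target :=
  (contDiffOn_density g he).mul (ContDiffOn.sum fun j _ => (contDiffOn_gram_inv g he i j).mul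
    (contDiffOn_pd e.open_target (contDiffOn_comp_symm he hf) j))

lemma contDiffOn_lapChart (he : e ∈ atlas (EuclideanSpace ℝ (Fin m)) M) {f : M → ℝ}
    (hf : ContMDiff (𝓡 m) 𝓘(ℝ, ℝ) ∞ f) : ContDiffOn ℝ ∞ (lapChart g e f) e.target :=
  ((contDiffOn_density g he).inv fun _ hy => (density_pos g he hy).ne').mul
    (ContDiffOn.sum fun i _ => contDiffOn_pd e.open_target (contDiffOn_flux g he hf i) i)

lemma lap_eq_lapChart_chartAt (f : M → ℝ) (x : M) :
    lap g f x = lapChart g (chartAt (EuclideanSpace ℝ (Fin m)) x) f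
      (chartAt (EuclideanSpace ℝ (Fin m)) x x) := rfl

/-- A function on `M`, read in the chart `e` and extended by zero. -/
noncomputable def chartExt (e : OpenPartialHomeomorph M (EuclideanSpace ℝ (Fin m))) (φ : M → ℝ) :
    EuclideanSpace ℝ (Fin m) → ℝ :=
  e.target.indicator (φ ∘ e.symm)

lemma chartExt_of_mem {φ : M → ℝ} {y : EuclideanSpace ℝ (Fin m)} (hy : y ∈ e.target) :
    chartExt e φ y = φ (e.symm y) := Set.indicator_of_mem hy _

lemma chartExt_eventuallyEq {φ : M → ℝ} {y : EuclideanSpace ℝ (Fin m)} (hy : y ∈ e.target) :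
    chartExt e φ =ᶠ[𝓝 y] φ ∘ e.symm := by
  filter_upwards [e.open_target.mem_nhds hy] with z hz using chartExt_of_mem hz

variable [T2Space M] [CompactSpace M]

lemma isCompact_image_tsupport {φ : M → ℝ} (hs : tsupport φ ⊆ e.source) :
    IsCompact (e '' tsupport φ) :=
  (isClosed_tsupport φ).isCompact.image_of_continuousOn (e.continuousOn.mono hs)

lemma image_tsupport_subset {φ : M → ℝ} (hs : tsupport φ ⊆ e.source) :
    e '' tsupport φ ⊆ e.target := by
  rintro _ ⟨x, hx, rfl⟩
  exact e.map_source (hs hx)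

lemma tsupport_chartExt {φ : M → ℝ} (hs : tsupport φ ⊆ e.source) :
    tsupport (chartExt e φ) ⊆ e '' tsupport φ := by
  refine closure_minimal (fun y hy => ?_) (isCompact_image_tsupport hs).isClosed
  have hyt : y ∈ e.target := by
    by_contra h
    exact hy (Set.indicator_of_notMem h _)
  refine ⟨e.symm y, subset_tsupport _ ?_, e.right_inv hyt⟩
  rw [Function.mem_support, chartExt_of_mem hyt] at hy
  exact hy

lemma contDiff_chartExt (he : e ∈ atlas (EuclideanSpace ℝ (Fin m)) M) {φ : M → ℝ}
    (hφ : ContMDiff (𝓡 m) 𝓘(ℝ, ℝ) ∞ φ) (hs : tsupport φ ⊆ e.source) :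
    ContDiff ℝ ∞ (chartExt e φ) := by
  rw [← contMDiff_iff_contDiff]
  refine contMDiff_of_tsupport fun y hy => ?_
  have hyt := image_tsupport_subset hs (tsupport_chartExt hs hy)
  rw [contMDiffAt_iff_contDiffAt]
  exact ((contDiffOn_comp_symm he hφ).contDiffAt (e.open_target.mem_nhds hyt)).congr_of_eventuallyEq
    (chartExt_eventuallyEq hyt)

variable [MeasurableSpace M] [BorelSpace M]

/-- Integration by parts in the chart. The factor `1/√det g` cancels the volume density, and the
right-hand side mentions no chart; this characterizes the chart Laplacian intrinsically. -/
lemma integral_lapChart_mul (he : e ∈ atlas (EuclideanSpace ℝ (Fin m)) M) {f φ : M → ℝ}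
    (hf : ContMDiff (𝓡 m) 𝓘(ℝ, ℝ) ∞ f) (hφ : ContMDiff (𝓡 m) 𝓘(ℝ, ℝ) ∞ φ)
    (hs : tsupport φ ⊆ e.source) :
    ∫ x, lapChart g e f (e x) * φ x ∂(vol g) = -∫ x, gam g f φ x ∂(vol g) := by
  have h0 : ∀ x, x ∉ e.source → φ x = 0 := fun x hx => image_eq_zero_of_notMem_tsupport
    fun h => hx (hs h)
  have hc : ContinuousOn (fun x => lapChart g e f (e x) * φ x) e.source :=
    ((contDiffOn_lapChart g he hf).continuousOn.comp e.continuousOn fun x hx =>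
      e.map_source hx).mul hφ.continuous.continuousOn
  set K := e '' tsupport φ
  have hK : IsCompact K := isCompact_image_tsupport hs
  have hKt : K ⊆ e.target := image_tsupport_subset hs
  have hΦ := contDiff_chartExt he hφ hs
  have hΦK : ∀ y, y ∉ K → chartExt e φ y = 0 := fun y hy =>
    image_eq_zero_of_notMem_tsupport fun h => hy (tsupport_chartExt hs h)
  have hdΦK : ∀ i y, y ∉ K → pd i (chartExt e φ) y = 0 := fun i y hy => by
    have := notMem_tsupport_iff_eventuallyEq.mp fun h => hy (tsupport_chartExt hs h)
    rw [pd, this.fderiv_eq]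
    simp
  have hdΦ : ∀ i, Continuous (pd i (chartExt e φ)) := fun i => by
    have := contDiffOn_pd isOpen_univ hΦ.contDiffOn i
    exact (contDiffOn_univ.mp this).continuous
  have hA := fun i => contDiffOn_flux g he hf i
  have hdA := fun i => contDiffOn_pd e.open_target (hA i) i
  have hI1 : ∀ i, Integrable (fun y => pd i (flux g e f i) y * chartExt e φ y) := fun i =>
    integrable_of_continuousOn_of_compact ((hdA i).continuousOn.mul hΦ.continuous.continuousOn)
      hK hKt fun y hy => by rw [hΦK y hy, mul_zero]
  have hI2 : ∀ i, Integrable (fun y => flux g e f i y * pd i (chartExt e φ) y) := fun i =>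
    integrable_of_continuousOn_of_compact ((hA i).continuousOn.mul (hdΦ i).continuousOn)
      hK hKt fun y hy => by rw [hdΦK i y hy, mul_zero]
  have hI3 : ∀ i, Integrable (fun y => flux g e f i y * chartExt e φ y) := fun i =>
    integrable_of_continuousOn_of_compact ((hA i).continuousOn.mul hΦ.continuous.continuousOn)
      hK hKt fun y hy => by rw [hΦK y hy, mul_zero]
  have hparts : ∀ i, ∫ y, flux g e f i y * pd i (chartExt e φ) y =
      -∫ y, pd i (flux g e f i) y * chartExt e φ y := fun i =>
    integral_mul_fderiv_eq_neg_fderiv_mul_of_integrable (hI1 i) (hI2 i) (hI3 i)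
      (fun y hy => ((hA i).contDiffAt (e.open_target.mem_nhds
        (hKt (tsupport_chartExt hs hy)))).differentiableAt (by simp))
      (fun y _ => hΦ.differentiable (by simp) y)
  have hL : ∫ x, lapChart g e f (e x) * φ x ∂(vol g) =
      ∑ i, ∫ y, pd i (flux g e f i) y * chartExt e φ y := by
    rw [← setIntegral_eq_integral_of_forall_compl_eq_zero (s := e.source)
      (fun x hx => by rw [h0 x hx, mul_zero]),
      integral_source g he (hc.aestronglyMeasurable e.open_source.measurableSet),
      ← integral_finsetSum _ fun i _ => hI1 i,
      ← setIntegral_eq_integral_of_forall_compl_eq_zero (s := e.target)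
      (f := fun y => ∑ i, pd i (flux g e f i) y * chartExt e φ y)
      (fun y hy => Finset.sum_eq_zero fun i _ => by rw [hΦK y fun h => hy (hKt h), mul_zero])]
    refine setIntegral_congr_fun e.open_target.measurableSet fun y hy => ?_
    simp only [e.right_inv hy, lapChart, chartExt_of_mem hy, ← Finset.sum_mul]
    rw [← mul_assoc, ← mul_assoc, mul_inv_cancel₀ (density_pos g he hy).ne', one_mul]
  have hR : ∫ x, gam g f φ x ∂(vol g) = ∑ i, ∫ y, flux g e f i y * pd i (chartExt e φ) y := by
    rw [← setIntegral_eq_integral_of_forall_compl_eq_zero (s := e.source)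
      (fun x hx => by rw [gam_comm]; exact gam_eq_zero g (fun h => hx (hs h)) _),
      integral_source g he (contMDiff_gam g hf hφ).continuous.aestronglyMeasurable,
      ← integral_finsetSum _ fun i _ => hI2 i,
      ← setIntegral_eq_integral_of_forall_compl_eq_zero (s := e.target)
      (f := fun y => ∑ i, flux g e f i y * pd i (chartExt e φ) y)
      (fun y hy => Finset.sum_eq_zero fun i _ => by rw [hdΦK i y fun h => hy (hKt h), mul_zero])]
    refine setIntegral_congr_fun e.open_target.measurableSet fun y hy => ?_
    simp only [gam_comm g f φ, gam_chart g he hy (mdiffAt hφ _) (mdiffAt hf _), flux, pd,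
      (chartExt_eventuallyEq hy).fderiv_eq, Finset.mul_sum, Finset.sum_mul]
    exact Finset.sum_congr rfl fun i _ => Finset.sum_congr rfl fun j _ => by ring
  rw [hL, hR, ← Finset.sum_neg_distrib]
  exact Finset.sum_congr rfl fun i _ => by rw [hparts i, neg_neg]

lemma eq_zero_of_integral_smul_eq_zero {U : Set M} (hU : IsOpen U) {F : M → ℝ}
    (hF : ContinuousOn F U)
    (h : ∀ φ : M → ℝ, ContMDiff (𝓡 m) 𝓘(ℝ, ℝ) ∞ φ → tsupport φ ⊆ U →
      ∫ x, φ x * F x ∂(vol g) = 0) : ∀ x ∈ U, F x = 0 := by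
  have := isLocallyFiniteMeasure_vol g
  have := isOpenPosMeasure_vol g
  have hsc : SecondCountableTopology M :=
    ChartedSpace.secondCountable_of_sigmaCompact (EuclideanSpace ℝ (Fin m)) M
  have h1 := hU.ae_eq_zero_of_integral_contMDiff_smul_eq_zero (𝓡 m) (μ := vol g) (f := F)
    (hF.locallyIntegrableOn hU.measurableSet) fun φ hφ _ hs => h φ hφ hs
  intro x hx
  by_contra hne
  have h2 : IsOpen (U ∩ F ⁻¹' {0}ᶜ) := hF.isOpen_inter_preimage hU isOpen_compl_singleton
  refine h2.measure_ne_zero (vol g) ⟨x, hx, hne⟩ ?_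
  rw [measure_eq_zero_iff_ae_notMem]
  filter_upwards [h1] with y hy hy'
  exact hy'.2 (hy hy'.1)

/-- The two chart expressions have the same integrals against test functions supported in the
overlap, and both are continuous. No transformation law for second derivatives is required. -/
lemma lap_eq_lapChart (he : e ∈ atlas (EuclideanSpace ℝ (Fin m)) M) {f : M → ℝ}
    (hf : ContMDiff (𝓡 m) 𝓘(ℝ, ℝ) ∞ f) {x : M} (hx : x ∈ e.source) :
    lap g f x = lapChart g e f (e x) := by
  rw [lap_eq_lapChart_chartAt]
  set e' := chartAt (EuclideanSpace ℝ (Fin m)) x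
  have he' : e' ∈ atlas (EuclideanSpace ℝ (Fin m)) M := chart_mem_atlas _ x
  have := isFiniteMeasure_vol g
  have hc : ∀ e ∈ atlas (EuclideanSpace ℝ (Fin m)) M,
      ContinuousOn (fun x => lapChart g e f (e x)) e.source := fun e he =>
    (contDiffOn_lapChart g he hf).continuousOn.comp e.continuousOn fun x hx => e.map_source hx
  have hint : ∀ e ∈ atlas (EuclideanSpace ℝ (Fin m)) M, ∀ φ : M → ℝ,
      ContMDiff (𝓡 m) 𝓘(ℝ, ℝ) ∞ φ → tsupport φ ⊆ e.source →
      Integrable (fun x => φ x * lapChart g e f (e x)) (vol g) := by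
    intro e he φ hφ hs
    rw [← integrableOn_iff_integrable_of_support_subset (s := tsupport φ)]
    · exact (hφ.continuous.continuousOn.mul ((hc e he).mono hs)).integrableOn_compact
        (isClosed_tsupport φ).isCompact
    · exact (Function.support_mul_subset_left _ _).trans (subset_tsupport φ)
  refine sub_eq_zero.mp (eq_zero_of_integral_smul_eq_zero g (U := e.source ∩ e'.source)
    (F := fun z => lapChart g e' f (e' z) - lapChart g e f (e z))
    (e.open_source.inter e'.open_source)
    (((hc e' he').mono Set.inter_subset_right).sub ((hc e he).mono Set.inter_subset_left))
    (fun φ hφ hs => ?_) x ⟨hx, mem_chart_source _ x⟩)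
  have hs1 := hs.trans Set.inter_subset_left
  have hs2 := hs.trans Set.inter_subset_right
  simp only [mul_sub]
  rw [integral_sub (hint e' he' φ hφ hs2) (hint e he φ hφ hs1)]
  simp only [mul_comm (φ _)]
  rw [integral_lapChart_mul g he' hf hφ hs2, integral_lapChart_mul g he hf hφ hs1, sub_self]

lemma contMDiff_lap {f : M → ℝ} (hf : ContMDiff (𝓡 m) 𝓘(ℝ, ℝ) ∞ f) :
    ContMDiff (𝓡 m) 𝓘(ℝ, ℝ) ∞ (lap g f) :=
  contMDiff_of_charts fun e he => ⟨_, contDiffOn_lapChart g he hf, fun y hy => by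
    rw [lap_eq_lapChart g he hf (e.map_target hy), e.right_inv hy]⟩

end Laplacian

end ExtrinsicHarmonic

/-! ### Partitions of unity, cut-off coordinates and Green's formula -/

namespace ExtrinsicHarmonic

section ChartPartition

variable {m : ℕ} {M : Type*} [TopologicalSpace M]
  [ChartedSpace (EuclideanSpace ℝ (Fin m)) M] [IsManifold (𝓡 m) ∞ M]
  {e e' : OpenPartialHomeomorph M (EuclideanSpace ℝ (Fin m))}
  (g : SmoothMetric m M)

/-- A finite smooth partition of unity subordinate to charts, with cutoff functions. -/
structure ChartPartition (m : ℕ) (M : Type*) [TopologicalSpace M]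
    [ChartedSpace (EuclideanSpace ℝ (Fin m)) M] where
  t : Finset M
  ρ : t → M → ℝ
  χ : t → M → ℝ
  smooth_ρ : ∀ l, ContMDiff (𝓡 m) 𝓘(ℝ, ℝ) ∞ (ρ l)
  smooth_χ : ∀ l, ContMDiff (𝓡 m) 𝓘(ℝ, ℝ) ∞ (χ l)
  tsupport_ρ : ∀ l, tsupport (ρ l) ⊆ (chartAt (EuclideanSpace ℝ (Fin m)) (l : M)).source
  tsupport_χ : ∀ l, tsupport (χ l) ⊆ (chartAt (EuclideanSpace ℝ (Fin m)) (l : M)).source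
  χ_eq_one : ∀ l, ∀ x ∈ tsupport (ρ l), χ l =ᶠ[𝓝 x] fun _ => 1
  nonneg : ∀ l x, 0 ≤ ρ l x
  sum_eq_one : ∀ x, ∑ l, ρ l x = 1

lemma nonempty_chartPartition [T2Space M] [CompactSpace M] : Nonempty (ChartPartition m M) := by
  obtain ⟨t, ht⟩ := isCompact_univ.elim_finite_subcover
    (fun x : M => (chartAt (EuclideanSpace ℝ (Fin m)) x).source)
    (fun x => (chartAt (EuclideanSpace ℝ (Fin m)) x).open_source)
    (fun x _ => Set.mem_iUnion.mpr ⟨x, mem_chart_source _ x⟩)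
  obtain ⟨f, hf⟩ := SmoothPartitionOfUnity.exists_isSubordinate (𝓡 m) (s := Set.univ (α := M))
    isClosed_univ (fun l : t => (chartAt (EuclideanSpace ℝ (Fin m)) (l : M)).source)
    (fun l => (chartAt (EuclideanSpace ℝ (Fin m)) (l : M)).open_source) (fun x hx => by
      obtain ⟨l, hl⟩ := Set.mem_iUnion.mp (ht hx)
      obtain ⟨hlt, hl⟩ := Set.mem_iUnion.mp hl
      exact Set.mem_iUnion.mpr ⟨⟨l, hlt⟩, hl⟩)
  have hχ : ∀ l : t, ∃ χ : M → ℝ, ContMDiff (𝓡 m) 𝓘(ℝ, ℝ) ∞ χ ∧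
      tsupport χ ⊆ (chartAt (EuclideanSpace ℝ (Fin m)) (l : M)).source ∧
      ∀ x ∈ tsupport (f l), χ =ᶠ[𝓝 x] fun _ => 1 := by
    intro l
    obtain ⟨V, hV, hfV, hVs⟩ := normal_exists_closure_subset (isClosed_tsupport (f l))
      (chartAt (EuclideanSpace ℝ (Fin m)) (l : M)).open_source (hf l)
    obtain ⟨χ, h1, h2, -⟩ := exists_contMDiffMap_one_nhds_of_subset_interior (𝓡 m) (n := (⊤ : ℕ∞))
      (isClosed_tsupport (f l)) (t := V) (by rwa [hV.interior_eq])
    refine ⟨χ, χ.contMDiff, (closure_mono fun x hx => ?_).trans hVs, fun x hx => ?_⟩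
    · by_contra h
      exact hx (h2 x h)
    · exact h1.filter_mono (nhds_le_nhdsSet hx)
  choose χ hχ1 hχ2 hχ3 using hχ
  exact ⟨⟨t, fun l => f l, χ, fun l => (f l).contMDiff, hχ1, hf, hχ2, hχ3, fun l x => f.nonneg l x,
    fun x => by rw [← finsum_eq_sum_of_fintype]; exact f.sum_eq_one (Set.mem_univ x)⟩⟩

lemma contMDiff_mul_of_tsupport {χ ψ : M → ℝ} {U : Set M} (hU : IsOpen U)
    (hχ : ContMDiff (𝓡 m) 𝓘(ℝ, ℝ) ∞ χ) (hs : tsupport χ ⊆ U)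
    (hψ : ContMDiffOn (𝓡 m) 𝓘(ℝ, ℝ) ∞ ψ U) :
    ContMDiff (𝓡 m) 𝓘(ℝ, ℝ) ∞ (fun x => χ x * ψ x) := by
  refine contMDiff_of_tsupport fun x hx => ?_
  have hxU : x ∈ U := hs (tsupport_mul_subset_left hx)
  exact hχ.contMDiffAt.mul (hψ.contMDiffAt (hU.mem_nhds hxU))

namespace ChartPartition

variable (P : ChartPartition m M)

/-- The chart of index `l`. -/
abbrev ch (l : P.t) : OpenPartialHomeomorph M (EuclideanSpace ℝ (Fin m)) :=
  chartAt (EuclideanSpace ℝ (Fin m)) (l : M)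

lemma ch_mem (l : P.t) : P.ch l ∈ atlas (EuclideanSpace ℝ (Fin m)) M := chart_mem_atlas _ _

/-- The cut-off coordinate functions. -/
noncomputable def coord (p : P.t × Fin m) (x : M) : ℝ := P.χ p.1 x * P.ch p.1 x p.2

lemma contMDiffOn_chart_apply (l : P.t) (a : Fin m) :
    ContMDiffOn (𝓡 m) 𝓘(ℝ, ℝ) ∞ (fun x => P.ch l x a) (P.ch l).source :=
  (EuclideanSpace.proj (𝕜 := ℝ) a).contMDiff.comp_contMDiffOn (contMDiffOn_chart (P.ch_mem l))

lemma contMDiff_coord (p : P.t × Fin m) : ContMDiff (𝓡 m) 𝓘(ℝ, ℝ) ∞ (P.coord p) :=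
  contMDiff_mul_of_tsupport (P.ch p.1).open_source (P.smooth_χ _) (P.tsupport_χ _)
    (P.contMDiffOn_chart_apply p.1 p.2)

lemma coord_eventuallyEq {l : P.t} {x : M} (hx : x ∈ tsupport (P.ρ l)) (a : Fin m) :
    P.coord (l, a) =ᶠ[𝓝 x] fun z => P.ch l z a := by
  filter_upwards [P.χ_eq_one l x hx] with z hz
  simp [coord, hz]

lemma exists_mem_tsupport (x : M) : ∃ l, x ∈ tsupport (P.ρ l) := by
  by_contra! h
  have := P.sum_eq_one x
  rw [Finset.sum_eq_zero fun l _ => image_eq_zero_of_notMem_tsupport (h l)] at this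
  exact zero_ne_one this

lemma pd_coord {l : P.t} {x : M} (hx : x ∈ tsupport (P.ρ l)) (a i : Fin m) :
    pd i (P.coord (l, a) ∘ (P.ch l).symm) (P.ch l x) = if a = i then 1 else 0 := by
  have hxs := P.tsupport_ρ l hx
  have h1 : P.coord (l, a) ∘ (P.ch l).symm =ᶠ[𝓝 (P.ch l x)]
      (EuclideanSpace.proj (𝕜 := ℝ) a : EuclideanSpace ℝ (Fin m) →L[ℝ] ℝ) := by
    have h2 : Tendsto (P.ch l).symm (𝓝 (P.ch l x)) (𝓝 x) := by
      have := (P.ch l).symm.continuousAt ((P.ch l).map_source hxs)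
      rwa [ContinuousAt, (P.ch l).left_inv hxs] at this
    filter_upwards [h2.eventually (P.coord_eventuallyEq hx a),
      (P.ch l).open_target.mem_nhds ((P.ch l).map_source hxs)] with y hy hyt
    simp only [Function.comp, hy, (P.ch l).right_inv hyt]
    rfl
  rw [pd, h1.fderiv_eq, ContinuousLinearMap.fderiv]
  simp [stdVec]

/-- The gradients of the cut-off coordinate functions span. -/
lemma eq_of_inner_grad_coord {x : M} {X Y : TangentSpace (𝓡 m) x}
    (h : ∀ p, g.inner x X (grad g (P.coord p) x) = g.inner x Y (grad g (P.coord p) x)) : X = Y := by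
  -- On the support of `ρ l` the cutoff is `1` nearby, so the cut-off coordinates are the genuine
  -- coordinates of a chart and their differentials form a basis.
  obtain ⟨l, hl⟩ := P.exists_mem_tsupport x
  have hxs := P.tsupport_ρ l hl
  let T : TangentSpace (𝓡 m) x → EuclideanSpace ℝ (Fin m) := fun Z =>
    mfderiv (𝓡 m) (𝓡 m) (P.ch l) x Z
  have h1 : ∀ (a : Fin m) (Z : TangentSpace (𝓡 m) x), g.inner x Z (grad g (P.coord (l, a)) x) =
      T Z a := by
    intro a Z
    have h2 := mfderiv_comp (I := 𝓡 m) (I' := 𝓡 m) (I'' := 𝓘(ℝ, ℝ)) x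
      (g := (EuclideanSpace.proj (𝕜 := ℝ) a : EuclideanSpace ℝ (Fin m) →L[ℝ] ℝ))
      (EuclideanSpace.proj (𝕜 := ℝ) a : EuclideanSpace ℝ (Fin m) →L[ℝ] ℝ).mdifferentiableAt
      ((chart_mdifferentiable (P.ch_mem l)).mdifferentiableAt hxs)
    rw [g.symm, inner_grad, (P.coord_eventuallyEq hl a).mfderiv_eq]
    change mfderiv (𝓡 m) 𝓘(ℝ, ℝ) ((EuclideanSpace.proj (𝕜 := ℝ) a :
      EuclideanSpace ℝ (Fin m) →L[ℝ] ℝ) ∘ (P.ch l)) x Z = _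
    rw [h2, ContinuousLinearMap.mfderiv_eq]
    rfl
  refine ((chart_mdifferentiable (P.ch_mem l)).mfderiv_bijective hxs).1 ?_
  refine PiLp.ext fun a => ?_
  have := h (l, a)
  rwa [h1, h1] at this

open Classical in
/-- The metric of the chart of index `l`, cut off by the partition of unity. -/
noncomputable def metricCoeff (p q : P.t × Fin m) (x : M) : ℝ :=
  if p.1 = q.1 then P.ρ p.1 x * gram g (P.ch p.1) (P.ch p.1 x) p.2 q.2 else 0

lemma contMDiff_metricCoeff (p q : P.t × Fin m) :
    ContMDiff (𝓡 m) 𝓘(ℝ, ℝ) ∞ (P.metricCoeff g p q) := by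
  unfold metricCoeff
  split_ifs with h
  · exact contMDiff_mul_of_tsupport (P.ch p.1).open_source (P.smooth_ρ _) (P.tsupport_ρ _)
      ((contMDiffOn_iff_contDiffOn.mpr (contDiffOn_gram g (P.ch_mem p.1) p.2 q.2)).comp
        (contMDiffOn_chart (P.ch_mem p.1)) fun z hz => (P.ch p.1).map_source hz)
  · exact contMDiff_const

lemma gam_coord {l : P.t} {x : M} (hx : x ∈ tsupport (P.ρ l)) (a : Fin m) {f : M → ℝ}
    (hf : ContMDiff (𝓡 m) 𝓘(ℝ, ℝ) ∞ f) :
    gam g (P.coord (l, a)) f x =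
      (gram g (P.ch l) (P.ch l x))⁻¹.mulVec (fun j => pd j (f ∘ (P.ch l).symm) (P.ch l x)) a := by
  have hxs := P.tsupport_ρ l hx
  have h := gam_chart g (P.ch_mem l) ((P.ch l).map_source hxs)
    (mdiffAt (P.contMDiff_coord (l, a)) _) (mdiffAt hf _)
  rw [(P.ch l).left_inv hxs] at h
  rw [h]
  simp only [P.pd_coord hx, mul_ite, mul_one, mul_zero, ite_mul, zero_mul]
  rw [Finset.sum_comm]
  simp only [Finset.sum_ite_eq, Finset.mem_univ, if_true]
  rfl

/-- In the chart `l`, pairing with the coordinate functions turns the covariant components `p` of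
`df` into the contravariant ones `G⁻¹ p`; contracting two such vectors with `G` recovers `⟨∇f, ∇h⟩`.
The weights `ρ l` patch these local identities together with globally smooth coefficients. -/
lemma gam_eq_sum {f h : M → ℝ} (hf : ContMDiff (𝓡 m) 𝓘(ℝ, ℝ) ∞ f)
    (hh : ContMDiff (𝓡 m) 𝓘(ℝ, ℝ) ∞ h) (x : M) :
    gam g f h x = ∑ p, ∑ q, P.metricCoeff g p q x * gam g (P.coord p) f x *
      gam g (P.coord q) h x := by
  have h1 : ∀ l, P.ρ l x * gam g f h x = ∑ a, ∑ b, P.ρ l x * gram g (P.ch l) (P.ch l x) a b *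
      gam g (P.coord (l, a)) f x * gam g (P.coord (l, b)) h x := by
    intro l
    by_cases hx : x ∈ tsupport (P.ρ l)
    · have hxs := P.tsupport_ρ l hx
      have h2 := gam_chart g (P.ch_mem l) ((P.ch l).map_source hxs) (mdiffAt hf _) (mdiffAt hh _)
      rw [(P.ch l).left_inv hxs] at h2
      have hinv := Matrix.mul_nonsing_inv _ (isUnit_det_gram g (P.ch_mem l)
        ((P.ch l).map_source hxs))
      simp only [P.gam_coord g hx _ hf, P.gam_coord g hx _ hh]
      set A := gram g (P.ch l) (P.ch l x)
      set p : Fin m → ℝ := fun j => pd j (f ∘ (P.ch l).symm) (P.ch l x)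
      set q : Fin m → ℝ := fun j => pd j (h ∘ (P.ch l).symm) (P.ch l x)
      have h3 : ∀ a, A.mulVec (A⁻¹.mulVec q) a = q a := fun a => by
        rw [Matrix.mulVec_mulVec, hinv, Matrix.one_mulVec]
      have hsymm : ∀ i j, A⁻¹ i j = A⁻¹ j i := fun i j => by
        have : A⁻¹.transpose = A⁻¹ := by rw [Matrix.transpose_nonsing_inv, gram_symm]
        exact congrFun (congrFun this j) i
      calc P.ρ l x * gam g f h x = P.ρ l x * ∑ a, A⁻¹.mulVec p a * q a := by
            rw [h2, Finset.sum_comm]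
            congr 1
            refine Finset.sum_congr rfl fun a _ => ?_
            simp only [Matrix.mulVec, dotProduct, Finset.sum_mul]
            exact Finset.sum_congr rfl fun b _ => by rw [hsymm b a]
        _ = P.ρ l x * ∑ a, A⁻¹.mulVec p a * A.mulVec (A⁻¹.mulVec q) a := by simp only [h3]
        _ = _ := by
            rw [Finset.mul_sum]
            refine Finset.sum_congr rfl fun a _ => ?_
            rw [show ∀ c : Fin m → ℝ, A.mulVec c a = ∑ b, A a b * c b from fun _ => rfl,
              Finset.mul_sum, Finset.mul_sum]
            exact Finset.sum_congr rfl fun b _ => by ring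
    · simp [image_eq_zero_of_notMem_tsupport hx]
  calc gam g f h x = ∑ l, P.ρ l x * gam g f h x := by
        rw [← Finset.sum_mul, P.sum_eq_one, one_mul]
    _ = _ := by
        rw [Fintype.sum_prod_type]
        refine Finset.sum_congr rfl fun l _ => ?_
        rw [h1]
        refine Finset.sum_congr rfl fun a _ => ?_
        rw [Fintype.sum_prod_type, Finset.sum_eq_single l]
        · simp [metricCoeff]
        · intro l' _ hl'
          simp [metricCoeff, hl'.symm]
        · simp

end ChartPartition

section Green

variable [T2Space M] [CompactSpace M] [MeasurableSpace M] [BorelSpace M]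

lemma integrable_of_contMDiff {f : M → ℝ} (hf : ContMDiff (𝓡 m) 𝓘(ℝ, ℝ) ∞ f) :
    Integrable f (vol g) := by
  have := isFiniteMeasure_vol g
  have h := hf.continuous.continuousOn.integrableOn_compact (μ := vol g) isCompact_univ
  rwa [integrableOn_univ] at h

lemma integrable_mul_of_contMDiff {f h : M → ℝ} (hf : ContMDiff (𝓡 m) 𝓘(ℝ, ℝ) ∞ f)
    (hh : ContMDiff (𝓡 m) 𝓘(ℝ, ℝ) ∞ h) : Integrable (fun x => f x * h x) (vol g) :=
  integrable_of_contMDiff g (hf.mul hh)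

lemma contMDiff_const_smul' {f : M → ℝ} (hf : ContMDiff (𝓡 m) 𝓘(ℝ, ℝ) ∞ f) (c : ℝ) :
    ContMDiff (𝓡 m) 𝓘(ℝ, ℝ) ∞ (c • f) :=
  (contMDiff_const (c := c)).mul hf

lemma gam_finset_sum {ι : Type*} (s : Finset ι) {f : ι → M → ℝ}
    (hf : ∀ i, ContMDiff (𝓡 m) 𝓘(ℝ, ℝ) ∞ (f i)) (w : M → ℝ) (x : M) :
    gam g (fun z => ∑ i ∈ s, f i z) w x = ∑ i ∈ s, gam g (f i) w x := by
  classical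
  induction s using Finset.induction_on with
  | empty => simpa using gam_const g 0 w x
  | insert i s his ih =>
    rw [Finset.sum_insert his, ← ih, ← gam_add g (hf i) (contMDiff_finsetSum fun i _ => hf i)]
    congr 1
    ext z
    simp [Finset.sum_insert his]

/-- The test function is split as `∑ ρ_l φ`, and each piece lives in one chart. -/
lemma integral_lap_mul {f φ : M → ℝ} (hf : ContMDiff (𝓡 m) 𝓘(ℝ, ℝ) ∞ f)
    (hφ : ContMDiff (𝓡 m) 𝓘(ℝ, ℝ) ∞ φ) :
    ∫ x, lap g f x * φ x ∂(vol g) = -∫ x, gam g f φ x ∂(vol g) := by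
  obtain ⟨P⟩ := nonempty_chartPartition (m := m) (M := M)
  have hρφ : ∀ l, ContMDiff (𝓡 m) 𝓘(ℝ, ℝ) ∞ (fun x => P.ρ l x * φ x) := fun l =>
    (P.smooth_ρ l).mul hφ
  have h1 : ∀ l, ∫ x, lap g f x * (P.ρ l x * φ x) ∂(vol g) =
      -∫ x, gam g f (fun x => P.ρ l x * φ x) x ∂(vol g) := by
    intro l
    have hs : tsupport (fun x => P.ρ l x * φ x) ⊆ (P.ch l).source :=
      tsupport_mul_subset_left.trans (P.tsupport_ρ l)
    rw [← integral_lapChart_mul g (P.ch_mem l) hf (hρφ l) hs]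
    refine integral_congr_ae (.of_forall fun x => ?_)
    by_cases hx : x ∈ (P.ch l).source
    · simp only [lap_eq_lapChart g (P.ch_mem l) hf hx]
    · have := image_eq_zero_of_notMem_tsupport fun h => hx (P.tsupport_ρ l h)
      simp [this]
  have h2 : ∀ x, φ x = ∑ l, P.ρ l x * φ x := fun x => by
    rw [← Finset.sum_mul, P.sum_eq_one, one_mul]
  have h3 : ∀ x, gam g f φ x = ∑ l, gam g f (fun x => P.ρ l x * φ x) x := by
    intro x
    simp only [gam_comm g f]
    rw [← gam_finset_sum g _ hρφ, ← (funext h2 : φ = _)]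
  simp only [h3]
  rw [integral_finsetSum _ fun l _ => integrable_of_contMDiff g (contMDiff_gam g hf (hρφ l)),
    ← Finset.sum_neg_distrib]
  simp only [← h1]
  rw [← integral_finsetSum (f := fun l x => lap g f x * (P.ρ l x * φ x)) _ fun l _ =>
    integrable_of_contMDiff g ((contMDiff_lap g hf).mul (hρφ l))]
  refine integral_congr_ae (.of_forall fun x => ?_)
  simp only
  rw [← Finset.mul_sum, ← h2]

lemma eq_of_integral_mul_eq {f h : M → ℝ} (hf : ContMDiff (𝓡 m) 𝓘(ℝ, ℝ) ∞ f)
    (hh : ContMDiff (𝓡 m) 𝓘(ℝ, ℝ) ∞ h)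
    (H : ∀ φ : M → ℝ, ContMDiff (𝓡 m) 𝓘(ℝ, ℝ) ∞ φ →
      ∫ x, f x * φ x ∂(vol g) = ∫ x, h x * φ x ∂(vol g)) : f = h := by
  ext x
  refine sub_eq_zero.mp (eq_zero_of_integral_smul_eq_zero g isOpen_univ (F := fun x => f x - h x)
    (hf.continuous.sub hh.continuous).continuousOn (fun φ hφ _ => ?_) x (Set.mem_univ x))
  simp only [mul_comm (φ _), sub_mul]
  rw [integral_sub (integrable_mul_of_contMDiff g hf hφ) (integrable_mul_of_contMDiff g hh hφ),
    H φ hφ, sub_self]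

/-- Linearity here, like the product rule in `lap_mul`, is deduced from the weak formulation: smooth
functions with equal integrals against all test functions coincide. -/
lemma lap_add {f h : M → ℝ} (hf : ContMDiff (𝓡 m) 𝓘(ℝ, ℝ) ∞ f)
    (hh : ContMDiff (𝓡 m) 𝓘(ℝ, ℝ) ∞ h) : lap g (f + h) = lap g f + lap g h := by
  refine eq_of_integral_mul_eq g (contMDiff_lap g (hf.add hh))
    ((contMDiff_lap g hf).add (contMDiff_lap g hh)) fun φ hφ => ?_
  simp only [Pi.add_apply, add_mul]
  rw [MeasureTheory.integral_add (integrable_mul_of_contMDiff g (contMDiff_lap g hf) hφ)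
    (integrable_mul_of_contMDiff g (contMDiff_lap g hh) hφ), integral_lap_mul g hf hφ,
    integral_lap_mul g hh hφ, integral_lap_mul g (hf.add hh) hφ, ← neg_add,
    ← MeasureTheory.integral_add (integrable_of_contMDiff g (contMDiff_gam g hf hφ))
    (integrable_of_contMDiff g (contMDiff_gam g hh hφ))]
  simp only [gam_add g hf hh]

lemma lap_smul {f : M → ℝ} (hf : ContMDiff (𝓡 m) 𝓘(ℝ, ℝ) ∞ f) (c : ℝ) :
    lap g (c • f) = c • lap g f := by
  have hcf : ContMDiff (𝓡 m) 𝓘(ℝ, ℝ) ∞ (c • f) := contMDiff_const_smul' hf c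
  refine eq_of_integral_mul_eq g (contMDiff_lap g hcf)
    (contMDiff_const_smul' (contMDiff_lap g hf) c) fun φ hφ => ?_
  rw [integral_lap_mul g hcf hφ]
  simp only [gam_smul g hf, Pi.smul_apply, smul_eq_mul, mul_assoc]
  rw [MeasureTheory.integral_const_mul, MeasureTheory.integral_const_mul, integral_lap_mul g hf hφ,
    mul_neg]

lemma lap_mul {f h : M → ℝ} (hf : ContMDiff (𝓡 m) 𝓘(ℝ, ℝ) ∞ f)
    (hh : ContMDiff (𝓡 m) 𝓘(ℝ, ℝ) ∞ h) :
    lap g (f * h) = f * lap g h + h * lap g f + (2 : ℝ) • gam g f h := by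
  have hlf := contMDiff_lap g hf
  have hlh := contMDiff_lap g hh
  have hG := contMDiff_gam g hf hh
  refine eq_of_integral_mul_eq g (contMDiff_lap g (hf.mul hh))
    (((hf.mul hlh).add (hh.mul hlf)).add (contMDiff_const_smul' hG 2)) fun φ hφ => ?_
  have e1 := integral_lap_mul g hh (hf.mul hφ)
  have e2 := integral_lap_mul g hf (hh.mul hφ)
  have i1 : Integrable (fun x => f x * lap g h x * φ x) (vol g) :=
    integrable_of_contMDiff g ((hf.mul hlh).mul hφ)
  have i2 : Integrable (fun x => h x * lap g f x * φ x) (vol g) :=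
    integrable_of_contMDiff g ((hh.mul hlf).mul hφ)
  have i3 : Integrable (fun x => 2 * (gam g f h x * φ x)) (vol g) :=
    (integrable_of_contMDiff g (hG.mul hφ)).const_mul 2
  have i4 : Integrable (fun x => f x * gam g h φ x) (vol g) :=
    integrable_of_contMDiff g (hf.mul (contMDiff_gam g hh hφ))
  have i5 : Integrable (fun x => h x * gam g f φ x) (vol g) :=
    integrable_of_contMDiff g (hh.mul (contMDiff_gam g hf hφ))
  have i6 : Integrable (fun x => φ x * gam g f h x) (vol g) :=
    integrable_of_contMDiff g (hφ.mul hG)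
  have i12 : Integrable (fun x => f x * lap g h x * φ x + h x * lap g f x * φ x) (vol g) :=
    i1.add i2
  have r1 : ∀ x, gam g h (f * φ) x = f x * gam g h φ x + φ x * gam g f h x := fun x => by
    rw [gam_comm, gam_mul g hf hφ, gam_comm g φ h]
  have r2 : ∀ x, gam g f (h * φ) x = h x * gam g f φ x + φ x * gam g f h x := fun x => by
    rw [gam_comm, gam_mul g hh hφ, gam_comm g φ f, gam_comm g h f]
  simp only [r1, r2] at e1 e2
  rw [MeasureTheory.integral_add i4 i6] at e1
  rw [MeasureTheory.integral_add i5 i6] at e2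
  have e3 : ∫ x, lap g h x * (f * φ) x ∂(vol g) = ∫ x, f x * lap g h x * φ x ∂(vol g) :=
    integral_congr_ae (.of_forall fun x => by simp only [Pi.mul_apply]; ring)
  have e4 : ∫ x, lap g f x * (h * φ) x ∂(vol g) = ∫ x, h x * lap g f x * φ x ∂(vol g) :=
    integral_congr_ae (.of_forall fun x => by simp only [Pi.mul_apply]; ring)
  rw [e3] at e1
  rw [e4] at e2
  rw [integral_lap_mul g (hf.mul hh) hφ]
  have e5 : ∫ x, gam g (f * h) φ x ∂(vol g) =
      ∫ x, f x * gam g h φ x ∂(vol g) + ∫ x, h x * gam g f φ x ∂(vol g) := by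
    rw [← MeasureTheory.integral_add i4 i5]
    simp only [gam_mul g hf hh]
  have e6 : ∫ x, (f * lap g h + h * lap g f + (2 : ℝ) • gam g f h) x * φ x ∂(vol g) =
      ∫ x, f x * lap g h x * φ x ∂(vol g) + ∫ x, h x * lap g f x * φ x ∂(vol g) +
        2 * ∫ x, φ x * gam g f h x ∂(vol g) := by
    rw [← MeasureTheory.integral_const_mul, ← MeasureTheory.integral_add i1 i2,
      ← MeasureTheory.integral_add i12 (i6.const_mul 2)]
    refine integral_congr_ae (.of_forall fun x => ?_)
    simp only [Pi.add_apply, Pi.mul_apply, Pi.smul_apply, smul_eq_mul]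
    ring
  rw [e5, e6, e1, e2]
  ring

end Green

end ChartPartition

end ExtrinsicHarmonic

/-! ### Smooth functions on M as an abstract algebra with Laplacian -/

namespace ExtrinsicHarmonic

section SmoothAlgebra

variable {m : ℕ} {M : Type*} [TopologicalSpace M]
  [ChartedSpace (EuclideanSpace ℝ (Fin m)) M]

/-- The algebra of smooth functions. -/
def smoothAlgebra (m : ℕ) (M : Type*) [TopologicalSpace M]
    [ChartedSpace (EuclideanSpace ℝ (Fin m)) M] : Subalgebra ℝ (M → ℝ) where
  carrier := {f | ContMDiff (𝓡 m) 𝓘(ℝ, ℝ) ∞ f}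
  mul_mem' := fun hf hh => hf.mul hh
  add_mem' := fun hf hh => hf.add hh
  algebraMap_mem' := fun _ => contMDiff_const

lemma contMDiff_coe (f : smoothAlgebra m M) : ContMDiff (𝓡 m) 𝓘(ℝ, ℝ) ∞ (f : M → ℝ) :=
  f.2

variable [IsManifold (𝓡 m) ∞ M] (g : SmoothMetric m M)

lemma gam_comp {f : M → ℝ} (hf : ContMDiff (𝓡 m) 𝓘(ℝ, ℝ) ∞ f) {ψ : ℝ → ℝ}
    (hψ : ContDiff ℝ ∞ ψ) (w : M → ℝ) (x : M) :
    gam g (ψ ∘ f) w x = deriv ψ (f x) * gam g f w x := by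
  have h1 : MDifferentiableAt 𝓘(ℝ, ℝ) 𝓘(ℝ, ℝ) ψ (f x) :=
    (hψ.differentiable (by simp) _).mdifferentiableAt
  rw [gam_eq_mfderiv, gam_eq_mfderiv, mfderiv_comp x h1 (mdiffAt hf x), mfderiv_eq_fderiv]
  change fderiv ℝ ψ (f x) _ = _
  exact (fderiv_eq_smul_deriv _).trans (mul_comm _ _)

variable [T2Space M] [CompactSpace M] [MeasurableSpace M] [BorelSpace M]

lemma gam_mul_right {f h w : M → ℝ} (hh : ContMDiff (𝓡 m) 𝓘(ℝ, ℝ) ∞ h)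
    (hw : ContMDiff (𝓡 m) 𝓘(ℝ, ℝ) ∞ w) (x : M) :
    gam g f (h * w) x = h x * gam g f w x + w x * gam g f h x := by
  rw [gam_comm, gam_mul g hh hw, gam_comm g w, gam_comm g h]

lemma gam_add_right {f h w : M → ℝ} (hh : ContMDiff (𝓡 m) 𝓘(ℝ, ℝ) ∞ h)
    (hw : ContMDiff (𝓡 m) 𝓘(ℝ, ℝ) ∞ w) (x : M) :
    gam g f (h + w) x = gam g f h x + gam g f w x := by
  rw [gam_comm, gam_add g hh hw, gam_comm g w, gam_comm g h]

lemma gam_smul_right {f h : M → ℝ} (hh : ContMDiff (𝓡 m) 𝓘(ℝ, ℝ) ∞ h) (c : ℝ) (x : M) :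
    gam g f (c • h) x = c * gam g f h x := by
  rw [gam_comm, gam_smul g hh, gam_comm g h]

/-- The algebra of smooth functions on a compact Riemannian manifold, with the derivations
`⟨∇F_α, ∇·⟩` given by the cut-off coordinate functions `F_α`. -/
noncomputable def laplaceAlgebra (P : ChartPartition m M) :
    LaplaceAlgebra (vol g) (smoothAlgebra m M) (P.t × Fin m) where
  ev := (smoothAlgebra m M).val
  measurable_ev f := (contMDiff_coe f).continuous.measurable
  bounded f := by
    obtain ⟨C, hC⟩ := isCompact_univ.bddAbove_image (contMDiff_coe f).continuous.abs.continuousOn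
    exact ⟨C, fun x => hC (Set.mem_image_of_mem _ (Set.mem_univ x))⟩
  D α := Derivation.mk'
    { toFun := fun f => ⟨gam g (P.coord α) f, contMDiff_gam g (P.contMDiff_coord α) (contMDiff_coe f)⟩
      map_add' := fun f h => Subtype.ext <| funext fun x =>
        gam_add_right g (contMDiff_coe f) (contMDiff_coe h) x
      map_smul' := fun c f => Subtype.ext <| funext fun x => gam_smul_right g (contMDiff_coe f) c x }
    (fun f h => Subtype.ext <| funext fun x => gam_mul_right g (contMDiff_coe f) (contMDiff_coe h) x)
  dv α := ⟨-lap g (P.coord α), (contMDiff_lap g (P.contMDiff_coord α)).neg⟩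
  ibp α f := by
    have h1 := integral_lap_mul g (P.contMDiff_coord α) (contMDiff_coe f)
    rw [← neg_eq_iff_eq_neg, ← MeasureTheory.integral_neg] at h1
    refine Eq.trans h1.symm (integral_congr_ae (.of_forall fun x => ?_))
    change -(lap g (P.coord α) x * (f : M → ℝ) x) = (f : M → ℝ) x * -lap g (P.coord α) x
    ring
  exists_comp ψ hψ f := by
    refine ⟨⟨ψ ∘ f, hψ.comp_contMDiff (contMDiff_coe f)⟩, fun x => rfl, fun α x => ?_⟩
    change gam g (P.coord α) (ψ ∘ f) x = _ * gam g (P.coord α) f x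
    rw [gam_comm, gam_comp g (contMDiff_coe f) hψ, gam_comm g f]
    rfl
  L :=
    { toFun := fun f => ⟨lap g f, contMDiff_lap g (contMDiff_coe f)⟩
      map_add' := fun f h => Subtype.ext (lap_add g (contMDiff_coe f) (contMDiff_coe h))
      map_smul' := fun c f => Subtype.ext (lap_smul g (contMDiff_coe f) c) }
  Γ := LinearMap.mk₂ ℝ
    (fun f h => ⟨gam g f h, contMDiff_gam g (contMDiff_coe f) (contMDiff_coe h)⟩)
    (fun f f' h => Subtype.ext <| funext fun x => gam_add g (contMDiff_coe f) (contMDiff_coe f') h x)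
    (fun c f h => Subtype.ext <| funext fun x => gam_smul g (contMDiff_coe f) c h x)
    (fun f h h' => Subtype.ext <| funext fun x => gam_add_right g (contMDiff_coe h) (contMDiff_coe h') x)
    (fun c f h => Subtype.ext <| funext fun x => gam_smul_right g (contMDiff_coe h) c x)
  G α β := ⟨P.metricCoeff g α β, P.contMDiff_metricCoeff g α β⟩
  L_mul f h := Subtype.ext (lap_mul g (contMDiff_coe f) (contMDiff_coe h))
  Γ_comm f h := Subtype.ext <| funext fun x => gam_comm g f h x
  green f h := by
    have h1 := integral_lap_mul g (contMDiff_coe h) (contMDiff_coe f)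
    rw [← neg_eq_iff_eq_neg] at h1
    change ∫ x, gam g f h x ∂(vol g) = -∫ x, (f : M → ℝ) x * lap g h x ∂(vol g)
    simp only [gam_comm g f, ← h1, mul_comm]
  Γ_eq f h := by
    refine Subtype.ext <| funext fun x => ?_
    rw [AddSubmonoidClass.coe_finsetSum, Finset.sum_apply]
    simp only [AddSubmonoidClass.coe_finsetSum, Finset.sum_apply]
    exact P.gam_eq_sum g (contMDiff_coe f) (contMDiff_coe h) x
  ext_integral f h := by
    refine Subtype.ext <| eq_of_integral_mul_eq g (contMDiff_coe f) contMDiff_const fun φ hφ => ?_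
    have h1 := h ⟨φ, hφ⟩
    simp only [ZeroMemClass.coe_zero, Pi.zero_apply, mul_comm _ (φ _), mul_zero, integral_zero]
    exact h1

variable (P : ChartPartition m M)

@[simp] lemma laplaceAlgebra_ev (f : smoothAlgebra m M) : (laplaceAlgebra g P).ev f = f := rfl

@[simp] lemma laplaceAlgebra_D (α : P.t × Fin m) (f : smoothAlgebra m M) :
    ((laplaceAlgebra g P).D α f : M → ℝ) = gam g (P.coord α) f := rfl

lemma laplaceAlgebra_L_pow (s : ℕ) (f : smoothAlgebra m M) :
    (((laplaceAlgebra g P).L ^ s) f : M → ℝ) = (lap g)^[s] f := by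
  induction s generalizing f with
  | zero => rfl
  | succ s ih => rw [pow_succ, Module.End.mul_apply, ih, Function.iterate_succ_apply]; rfl

/-- The gradient in terms of the cut-off coordinate functions. -/
lemma grad_eq_sum {f : M → ℝ} (hf : ContMDiff (𝓡 m) 𝓘(ℝ, ℝ) ∞ f) (x : M) :
    grad g f x = ∑ α, ∑ β, (P.metricCoeff g α β x * gam g (P.coord α) f x) •
      grad g (P.coord β) x := by
  refine P.eq_of_inner_grad_coord g fun p => ?_
  change gam g f (P.coord p) x = _
  rw [P.gam_eq_sum g hf (P.contMDiff_coord p)]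
  simp only [map_sum, map_smul, sum_apply, smul_apply, smul_eq_mul]
  rfl

end SmoothAlgebra

end ExtrinsicHarmonic

/-! ### Local W^{k,2} convergence on open subsets of Euclidean space -/

namespace ExtrinsicHarmonic

section EuclideanSobolev

variable {m : ℕ} {U : Set (EuclideanSpace ℝ (Fin m))}

lemma infty_add_natCast_le (j : ℕ) : (∞ : WithTop ℕ∞) + j ≤ ∞ := by
  exact_mod_cast le_top

lemma pd_congr_of_eqOn (hU : IsOpen U) {F H : EuclideanSpace ℝ (Fin m) → ℝ} (h : Set.EqOn F H U)
    (i : Fin m) : Set.EqOn (pd i F) (pd i H) U := fun y hy => by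
  have : F =ᶠ[𝓝 y] H := h.eventuallyEq_of_mem (hU.mem_nhds hy)
  rw [pd, pd, this.fderiv_eq]

lemma partialD_zero (α : Fin 0 → Fin m) (F : EuclideanSpace ℝ (Fin m) → ℝ) :
    partialD α F = F := by
  ext y
  simp [partialD]

lemma contDiffOn_partialD (hU : IsOpen U) {F : EuclideanSpace ℝ (Fin m) → ℝ}
    (hF : ContDiffOn ℝ ∞ F U) {j : ℕ} (α : Fin j → Fin m) : ContDiffOn ℝ ∞ (partialD α F) U := by
  intro y hy
  have h1 : ContDiffAt ℝ ∞ (iteratedFDeriv ℝ j F) y :=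
    (hF.contDiffAt (hU.mem_nhds hy)).iteratedFDeriv_right (m := ∞) (infty_add_natCast_le j)
  exact ((ContinuousMultilinearMap.apply ℝ (fun _ : Fin j => EuclideanSpace ℝ (Fin m)) ℝ
    (fun i => stdVec (α i))).contDiff.contDiffAt.comp y h1).contDiffWithinAt

lemma partialD_cons (hU : IsOpen U) {F : EuclideanSpace ℝ (Fin m) → ℝ}
    (hF : ContDiffOn ℝ ∞ F U) {j : ℕ} (i : Fin m) (α : Fin j → Fin m) :
    Set.EqOn (partialD (Fin.cons i α : Fin (j + 1) → Fin m) F) (pd i (partialD α F)) U := by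
  intro y hy
  have h1 : DifferentiableAt ℝ (iteratedFDeriv ℝ j F) y :=
    ((hF.contDiffAt (hU.mem_nhds hy)).iteratedFDeriv_right (m := ∞) (i := j)
      (infty_add_natCast_le j)).differentiableAt (by simp)
  have h2 := (ContinuousMultilinearMap.apply ℝ (fun _ : Fin j => EuclideanSpace ℝ (Fin m)) ℝ
    (fun i => stdVec (α i))).hasFDerivAt.comp y h1.hasFDerivAt
  rw [partialD, iteratedFDeriv_succ_apply_left, pd]
  have h3 : fderiv ℝ (partialD α F) y = _ := h2.fderiv
  rw [h3]
  rfl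

lemma pd_comm (hU : IsOpen U) {F : EuclideanSpace ℝ (Fin m) → ℝ} (hF : ContDiffOn ℝ ∞ F U)
    (i j : Fin m) : Set.EqOn (pd i (pd j F)) (pd j (pd i F)) U := by
  intro y hy
  have hs : IsSymmSndFDerivAt ℝ F y :=
    (hF.contDiffAt (hU.mem_nhds hy)).isSymmSndFDerivAt (by
      rw [minSmoothness_of_isRCLikeNormedField]
      exact WithTop.coe_le_coe.mpr (le_top (a := (2 : ℕ∞))))
  have h1 : DifferentiableAt ℝ (fderiv ℝ F) y :=
    ((hF.contDiffAt (hU.mem_nhds hy)).fderiv_right (m := ∞) (by simp)).differentiableAt (by simp)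
  have h2 : ∀ a b, pd a (pd b F) y = fderiv ℝ (fderiv ℝ F) y (stdVec a) (stdVec b) := by
    intro a b
    have := (h1.hasFDerivAt.clm_apply (hasFDerivAt_const (stdVec b) y)).fderiv
    change fderiv ℝ (fun y => fderiv ℝ F y (stdVec b)) y (stdVec a) = _
    rw [this]
    simp
  rw [h2, h2]
  exact hs.eq _ _

/-- `partialD (Fin.cons i α)` has `∂_i` outermost, while the recursion in `SConv` differentiates
innermost first. Symmetry of second derivatives carries `∂_i` through the others. -/
lemma partialD_pd (hU : IsOpen U) {F : EuclideanSpace ℝ (Fin m) → ℝ} (hF : ContDiffOn ℝ ∞ F U)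
    {j : ℕ} (i : Fin m) (α : Fin j → Fin m) :
    Set.EqOn (partialD α (pd i F)) (partialD (Fin.cons i α : Fin (j + 1) → Fin m) F) U := by
  refine Set.EqOn.trans ?_ (partialD_cons hU hF i α).symm
  induction j with
  | zero => rw [partialD_zero, partialD_zero]; exact fun _ _ => rfl
  | succ j ih =>
    rw [← Fin.cons_self_tail α]
    refine (partialD_cons hU (contDiffOn_pd hU hF i) _ _).trans ?_
    refine (pd_congr_of_eqOn hU (ih (Fin.tail α)) _).trans ?_
    refine (pd_comm hU (contDiffOn_partialD hU hF _) _ _).trans ?_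
    exact pd_congr_of_eqOn hU (partialD_cons hU hF _ _).symm _

/-- `T n → H` in `L²_loc(U)`. -/
def LConvTo (U : Set (EuclideanSpace ℝ (Fin m))) (T : ℕ → EuclideanSpace ℝ (Fin m) → ℝ)
    (H : EuclideanSpace ℝ (Fin m) → ℝ) : Prop :=
  ∀ K ⊆ U, IsCompact K → MemLp H 2 (volume.restrict K) ∧
    Tendsto (fun n => eLpNorm (fun y => T n y - H y) 2 (volume.restrict K)) atTop (𝓝 0)

lemma memLp_of_continuousOn {K : Set (EuclideanSpace ℝ (Fin m))} (hK : IsCompact K)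
    {F : EuclideanSpace ℝ (Fin m) → ℝ} (hF : ContinuousOn F K) :
    MemLp F 2 (volume.restrict K) := by
  have : IsFiniteMeasure (volume.restrict K) := ⟨by simpa using hK.measure_lt_top⟩
  obtain ⟨C, hC⟩ := hK.bddAbove_image hF.norm
  refine MemLp.of_bound (hF.aestronglyMeasurable hK.measurableSet) C ?_
  filter_upwards [ae_restrict_mem hK.measurableSet] with y hy using hC (Set.mem_image_of_mem _ hy)

namespace LConvTo

variable {T T' : ℕ → EuclideanSpace ℝ (Fin m) → ℝ} {H H' : EuclideanSpace ℝ (Fin m) → ℝ}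

lemma congr (h : LConvTo U T H) (hT : ∀ n, Set.EqOn (T n) (T' n) U) : LConvTo U T' H := by
  refine fun K hK hKc => ⟨(h K hK hKc).1, (h K hK hKc).2.congr fun n => eLpNorm_congr_ae ?_⟩
  filter_upwards [ae_restrict_mem hKc.measurableSet] with y hy
  rw [hT n (hK hy)]

lemma add (h : LConvTo U T H) (h' : LConvTo U T' H') (hc : ∀ n, ContinuousOn (T n) U)
    (hc' : ∀ n, ContinuousOn (T' n) U) :
    LConvTo U (fun n y => T n y + T' n y) (fun y => H y + H' y) := by
  intro K hK hKc
  obtain ⟨h1, h2⟩ := h K hK hKc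
  obtain ⟨h1', h2'⟩ := h' K hK hKc
  refine ⟨h1.add h1', tendsto_of_tendsto_of_tendsto_of_le_of_le tendsto_const_nhds
    (by simpa using h2.add h2') (fun _ => zero_le) fun n => ?_⟩
  have h3 := eLpNorm_add_le
    ((memLp_of_continuousOn hKc ((hc n).mono hK)).aestronglyMeasurable.sub h1.aestronglyMeasurable)
    ((memLp_of_continuousOn hKc ((hc' n).mono hK)).aestronglyMeasurable.sub
      h1'.aestronglyMeasurable) (p := 2) (by norm_num)
  refine le_trans (le_of_eq ?_) h3
  congr 1
  ext y
  simp only [Pi.add_apply, Pi.sub_apply]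
  ring

lemma mul (h : LConvTo U T H) {c : EuclideanSpace ℝ (Fin m) → ℝ} (hc : ContinuousOn c U) :
    LConvTo U (fun n y => c y * T n y) (fun y => c y * H y) := by
  intro K hK hKc
  obtain ⟨h1, h2⟩ := h K hK hKc
  obtain ⟨C, hC⟩ := hKc.bddAbove_image (hc.mono hK).norm
  have hb : ∀ᵐ y ∂volume.restrict K, ‖c y‖ ≤ C := by
    filter_upwards [ae_restrict_mem hKc.measurableSet] with y hy using hC (Set.mem_image_of_mem _ hy)
  refine ⟨?_, tendsto_of_tendsto_of_tendsto_of_le_of_le tendsto_const_nhds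
    (h := fun n => ENNReal.ofReal C * eLpNorm (fun y => T n y - H y) 2 (volume.restrict K))
    ?_ (fun _ => zero_le) fun n => ?_⟩
  · refine MemLp.of_le_mul (c := C) h1
      (((hc.mono hK).aestronglyMeasurable hKc.measurableSet).mul h1.aestronglyMeasurable) ?_
    filter_upwards [hb] with y hy
    rw [norm_mul]
    gcongr
  · simpa using ENNReal.Tendsto.const_mul h2 (Or.inr ENNReal.ofReal_ne_top)
  · refine eLpNorm_le_mul_eLpNorm_of_ae_le_mul ?_ _
    filter_upwards [hb] with y hy
    rw [← mul_sub, norm_mul]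
    gcongr

lemma tendsto_setIntegral (h : LConvTo U T H) (hc : ∀ n, ContinuousOn (T n) U)
    {K : Set (EuclideanSpace ℝ (Fin m))} (hK : K ⊆ U) (hKc : IsCompact K) :
    Tendsto (fun n => ∫ y in K, T n y) atTop (𝓝 (∫ y in K, H y)) := by
  have : IsFiniteMeasure (volume.restrict K) := ⟨by simpa using hKc.measure_lt_top⟩
  obtain ⟨h1, h2⟩ := h K hK hKc
  have hm := fun n => memLp_of_continuousOn hKc ((hc n).mono hK)
  refine tendsto_integral_of_L1' _ h1.aestronglyMeasurable
    (.of_forall fun n => (hm n).integrable (by norm_num)) ?_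
  refine tendsto_of_tendsto_of_tendsto_of_le_of_le tendsto_const_nhds
    (h := fun n => eLpNorm (fun y => T n y - H y) 2 (volume.restrict K) *
      (volume.restrict K) Set.univ ^ (1 / (1 : ENNReal).toReal - 1 / (2 : ENNReal).toReal))
    ?_ (fun _ => zero_le) fun n => ?_
  · have h3 : (volume.restrict K) Set.univ ^ (1 / (1 : ENNReal).toReal - 1 / (2 : ENNReal).toReal)
        ≠ ⊤ := ENNReal.rpow_ne_top_of_nonneg (by norm_num) (measure_ne_top _ _)
    simpa using ENNReal.Tendsto.mul_const h2 (Or.inr h3)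
  · exact eLpNorm_le_eLpNorm_mul_rpow_measure_univ (by norm_num)
      ((hm n).aestronglyMeasurable.sub h1.aestronglyMeasurable)

lemma locallyIntegrableOn (h : LConvTo U T H) (hU : IsOpen U) : LocallyIntegrableOn H U := by
  rw [MeasureTheory.locallyIntegrableOn_iff hU.isLocallyClosed]
  intro K hK hKc
  have : IsFiniteMeasure (volume.restrict K) := ⟨by simpa using hKc.measure_lt_top⟩
  exact (h K hK hKc).1.integrable (by norm_num)

end LConvTo

/-- Convergence of smooth functions in `W^{k,2}_loc(U)`. -/
def SConv (U : Set (EuclideanSpace ℝ (Fin m))) :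
    ℕ → (ℕ → EuclideanSpace ℝ (Fin m) → ℝ) → Prop
  | 0, T => (∀ n, ContDiffOn ℝ ∞ (T n) U) ∧ ∃ H, LConvTo U T H
  | k + 1, T => ((∀ n, ContDiffOn ℝ ∞ (T n) U) ∧ ∃ H, LConvTo U T H) ∧
      ∀ i, SConv U k fun n => pd i (T n)

namespace SConv

variable {k : ℕ} {T T' : ℕ → EuclideanSpace ℝ (Fin m) → ℝ}

lemma contDiffOn (h : SConv U k T) (n : ℕ) : ContDiffOn ℝ ∞ (T n) U := by
  cases k with
  | zero => exact h.1 n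
  | succ k => exact h.1.1 n

lemma exists_lim (h : SConv U k T) : ∃ H, LConvTo U T H := by
  cases k with
  | zero => exact h.2
  | succ k => exact h.1.2

lemma of_succ (h : SConv U (k + 1) T) : SConv U k T := by
  induction k generalizing T with
  | zero => exact h.1
  | succ k ih => exact ⟨h.1, fun i => ih (h.2 i)⟩

lemma congr (h : SConv U k T) (hU : IsOpen U) (hT : ∀ n, Set.EqOn (T n) (T' n) U) :
    SConv U k T' := by
  induction k generalizing T T' with
  | zero =>
    exact ⟨fun n => (h.1 n).congr (hT n).symm, h.2.imp fun H hH => hH.congr hT⟩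
  | succ k ih =>
    exact ⟨⟨fun n => (h.1.1 n).congr (hT n).symm, h.1.2.imp fun H hH => hH.congr hT⟩,
      fun i => ih (h.2 i) fun n => pd_congr_of_eqOn hU (hT n) i⟩

lemma add (h : SConv U k T) (h' : SConv U k T') (hU : IsOpen U) :
    SConv U k fun n y => T n y + T' n y := by
  induction k generalizing T T' with
  | zero =>
    obtain ⟨H, hH⟩ := h.2
    obtain ⟨H', hH'⟩ := h'.2
    exact ⟨fun n => (h.1 n).add (h'.1 n), _, hH.add hH' (fun n => (h.1 n).continuousOn)
      fun n => (h'.1 n).continuousOn⟩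
  | succ k ih =>
    obtain ⟨H, hH⟩ := h.1.2
    obtain ⟨H', hH'⟩ := h'.1.2
    refine ⟨⟨fun n => (h.1.1 n).add (h'.1.1 n), _, hH.add hH' (fun n => (h.1.1 n).continuousOn)
      fun n => (h'.1.1 n).continuousOn⟩, fun i => (ih (h.2 i) (h'.2 i)).congr hU fun n y hy => ?_⟩
    have h1 := ((h.1.1 n).contDiffAt (hU.mem_nhds hy)).differentiableAt (by simp)
    have h2 := ((h'.1.1 n).contDiffAt (hU.mem_nhds hy)).differentiableAt (by simp)
    simp only [pd]
    rw [fderiv_fun_add h1 h2]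
    rfl

lemma mul (h : SConv U k T) (hU : IsOpen U) {c : EuclideanSpace ℝ (Fin m) → ℝ}
    (hc : ContDiffOn ℝ ∞ c U) : SConv U k fun n y => c y * T n y := by
  induction k generalizing T c with
  | zero =>
    obtain ⟨H, hH⟩ := h.2
    exact ⟨fun n => hc.mul (h.1 n), _, hH.mul hc.continuousOn⟩
  | succ k ih =>
    obtain ⟨H, hH⟩ := h.1.2
    refine ⟨⟨fun n => hc.mul (h.1.1 n), _, hH.mul hc.continuousOn⟩, fun i =>
      ((ih (h.2 i) hc).add (ih h.of_succ (contDiffOn_pd hU hc i)) hU).congr hU fun n y hy => ?_⟩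
    have h1 := ((h.1.1 n).contDiffAt (hU.mem_nhds hy)).differentiableAt (by simp)
    have h2 := (hc.contDiffAt (hU.mem_nhds hy)).differentiableAt (by simp)
    simp only [pd]
    rw [fderiv_fun_mul h2 h1]
    simp [mul_comm]

lemma zero : SConv U k fun _ _ => (0 : ℝ) := by
  induction k with
  | zero => exact ⟨fun _ => contDiffOn_const, 0, fun K _ _ => ⟨MemLp.zero, by simp⟩⟩
  | succ k ih =>
    refine ⟨⟨fun _ => contDiffOn_const, 0, fun K _ _ => ⟨MemLp.zero, by simp⟩⟩, fun i => ?_⟩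
    have : (fun (n : ℕ) => pd i fun _ : EuclideanSpace ℝ (Fin m) => (0 : ℝ)) =
        fun _ _ => (0 : ℝ) := by
      ext n y
      simp [pd]
    rwa [this]

lemma sum {ι : Type*} (s : Finset ι) {T : ι → ℕ → EuclideanSpace ℝ (Fin m) → ℝ}
    (h : ∀ a ∈ s, SConv U k (T a)) (hU : IsOpen U) :
    SConv U k fun n y => ∑ a ∈ s, T a n y := by
  classical
  induction s using Finset.induction_on with
  | empty => simpa using zero
  | insert a s ha ih =>
    simp only [Finset.sum_insert ha]
    exact (h a (by simp)).add (ih fun b hb => h b (by simp [hb])) hU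

lemma exists_lim_partialD (h : SConv U k T) (hU : IsOpen U) {j : ℕ} (hj : j ≤ k)
    (α : Fin j → Fin m) : ∃ H, LConvTo U (fun n => partialD α (T n)) H := by
  induction j generalizing T k with
  | zero => simpa only [partialD_zero] using h.exists_lim
  | succ j ih =>
    obtain ⟨k, rfl⟩ : ∃ k', k = k' + 1 := ⟨k - 1, by omega⟩
    obtain ⟨H, hH⟩ := ih (h.2 (α 0)) (by omega) (Fin.tail α)
    refine ⟨H, hH.congr fun n => ?_⟩
    have := partialD_pd hU (h.contDiffOn n) (α 0) (Fin.tail α)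
    rwa [Fin.cons_self_tail] at this

lemma of_partialD (hU : IsOpen U) (hs : ∀ n, ContDiffOn ℝ ∞ (T n) U)
    (h : ∀ j ≤ k, ∀ α : Fin j → Fin m, ∃ H, LConvTo U (fun n => partialD α (T n)) H) :
    SConv U k T := by
  have h0 : ∃ H, LConvTo U T H := by
    simpa only [partialD_zero] using h 0 (Nat.zero_le _) Fin.elim0
  induction k generalizing T with
  | zero => exact ⟨hs, h0⟩
  | succ k ih =>
    have h1 : ∀ i, ∀ j ≤ k, ∀ α : Fin j → Fin m,
        ∃ H, LConvTo U (fun n => partialD α (pd i (T n))) H := by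
      intro i j hj α
      obtain ⟨H, hH⟩ := h (j + 1) (by omega) (Fin.cons i α)
      exact ⟨H, hH.congr fun n => (partialD_pd hU (hs n) i α).symm⟩
    refine ⟨⟨hs, h0⟩, fun i => ih (fun n => contDiffOn_pd hU (hs n) i) (h1 i) ?_⟩
    simpa only [partialD_zero] using h1 i 0 (Nat.zero_le _) Fin.elim0

end SConv

lemma tsupport_pd_subset (i : Fin m) (φ : EuclideanSpace ℝ (Fin m) → ℝ) :
    tsupport (pd i φ) ⊆ tsupport φ :=
  (tsupport_fderiv_apply_subset ℝ _)

lemma contDiff_pd {φ : EuclideanSpace ℝ (Fin m) → ℝ} (hφ : ContDiff ℝ ∞ φ) (i : Fin m) :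
    ContDiff ℝ ∞ (pd i φ) :=
  contDiffOn_univ.mp (contDiffOn_pd isOpen_univ hφ.contDiffOn i)

lemma partialD_cons_eq {φ : EuclideanSpace ℝ (Fin m) → ℝ} (hφ : ContDiff ℝ ∞ φ) {j : ℕ} (i : Fin m)
    (α : Fin j → Fin m) :
    partialD (Fin.cons i α : Fin (j + 1) → Fin m) φ = pd i (partialD α φ) :=
  funext fun y => partialD_cons isOpen_univ hφ.contDiffOn i α (Set.mem_univ y)

lemma contDiff_partialD {φ : EuclideanSpace ℝ (Fin m) → ℝ} (hφ : ContDiff ℝ ∞ φ) {j : ℕ}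
    (α : Fin j → Fin m) : ContDiff ℝ ∞ (partialD α φ) :=
  contDiffOn_univ.mp (contDiffOn_partialD isOpen_univ hφ.contDiffOn α)

lemma tsupport_partialD_subset {φ : EuclideanSpace ℝ (Fin m) → ℝ} (hφ : ContDiff ℝ ∞ φ) {j : ℕ}
    (α : Fin j → Fin m) : tsupport (partialD α φ) ⊆ tsupport φ := by
  induction j with
  | zero => rw [partialD_zero]
  | succ j ih =>
    rw [← Fin.cons_self_tail α, partialD_cons_eq hφ]
    exact (tsupport_pd_subset _ _).trans (ih _)

lemma integral_mul_pd (hU : IsOpen U) {T φ : EuclideanSpace ℝ (Fin m) → ℝ}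
    (hT : ContDiffOn ℝ ∞ T U) (hφ : ContDiff ℝ ∞ φ) (hc : HasCompactSupport φ)
    (hs : tsupport φ ⊆ U) (i : Fin m) : ∫ y, T y * pd i φ y = -∫ y, pd i T y * φ y := by
  have h0 : ∀ y, y ∉ tsupport φ → φ y = 0 := fun y hy => image_eq_zero_of_notMem_tsupport hy
  have h0' : ∀ y, y ∉ tsupport φ → pd i φ y = 0 := fun y hy =>
    image_eq_zero_of_notMem_tsupport fun h => hy (tsupport_pd_subset i φ h)
  refine integral_mul_fderiv_eq_neg_fderiv_mul_of_integrable
    (integrable_of_continuousOn_of_compact ((contDiffOn_pd hU hT i).continuousOn.mul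
      hφ.continuous.continuousOn) hc hs fun y hy => ?_)
    (integrable_of_continuousOn_of_compact (hT.continuousOn.mul
      (contDiff_pd hφ i).continuous.continuousOn) hc hs fun y hy => ?_)
    (integrable_of_continuousOn_of_compact (hT.continuousOn.mul
      hφ.continuous.continuousOn) hc hs fun y hy => ?_)
    (fun y hy => (hT.contDiffAt (hU.mem_nhds (hs hy))).differentiableAt (by simp))
    (fun y _ => hφ.differentiable (by simp) y)
  · rw [h0 y hy, mul_zero]
  · exact (congrArg (T y * ·) (h0' y hy)).trans (mul_zero _)
  · rw [h0 y hy, mul_zero]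

lemma integral_mul_partialD (hU : IsOpen U) {T φ : EuclideanSpace ℝ (Fin m) → ℝ}
    (hT : ContDiffOn ℝ ∞ T U) (hφ : ContDiff ℝ ∞ φ) (hc : HasCompactSupport φ)
    (hs : tsupport φ ⊆ U) {j : ℕ} (α : Fin j → Fin m) :
    ∫ y, T y * partialD α φ y = (-1) ^ j * ∫ y, partialD α T y * φ y := by
  induction j generalizing T with
  | zero => simp [partialD_zero]
  | succ j ih =>
    rw [← Fin.cons_self_tail α, partialD_cons_eq hφ,
      integral_mul_pd hU hT (contDiff_partialD hφ _)
        (hc.of_isClosed_subset (isClosed_tsupport _) (tsupport_partialD_subset hφ _))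
        ((tsupport_partialD_subset hφ _).trans hs), ih (contDiffOn_pd hU hT _)]
    rw [pow_succ]
    have : ∫ y, partialD (Fin.tail α) (pd (α 0) T) y * φ y =
        ∫ y, partialD (Fin.cons (α 0) (Fin.tail α) : Fin (j + 1) → Fin m) T y * φ y := by
      refine integral_congr_ae (.of_forall fun y => ?_)
      by_cases hy : y ∈ tsupport φ
      · simp only [partialD_pd hU hT (α 0) (Fin.tail α) (hs hy)]
      · simp [image_eq_zero_of_notMem_tsupport hy]
    rw [this]
    ring

lemma LConvTo.tendsto_integral_mul {T : ℕ → EuclideanSpace ℝ (Fin m) → ℝ}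
    {H φ : EuclideanSpace ℝ (Fin m) → ℝ} (h : LConvTo U T H) (hT : ∀ n, ContinuousOn (T n) U)
    (hφ : Continuous φ) (hc : HasCompactSupport φ) (hs : tsupport φ ⊆ U) :
    Tendsto (fun n => ∫ y, T n y * φ y) atTop (𝓝 (∫ y, H y * φ y)) := by
  have h1 := (h.mul hφ.continuousOn).tendsto_setIntegral
    (fun n => hφ.continuousOn.mul (hT n)) hs hc
  have h2 : ∀ F : EuclideanSpace ℝ (Fin m) → ℝ, ∫ y in tsupport φ, φ y * F y = ∫ y, F y * φ y := by
    intro F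
    rw [setIntegral_eq_integral_of_forall_compl_eq_zero fun y hy => by
      rw [image_eq_zero_of_notMem_tsupport hy, zero_mul]]
    simp only [mul_comm]
  simpa only [h2] using h1

/-- Classical derivatives pass to the limit. -/
lemma SConv.exists_isWeakDeriv {k : ℕ} {T : ℕ → EuclideanSpace ℝ (Fin m) → ℝ}
    {F : EuclideanSpace ℝ (Fin m) → ℝ} (h : SConv U k T) (hU : IsOpen U) (hF : LConvTo U T F)
    {j : ℕ} (hj : j ≤ k) (α : Fin j → Fin m) :
    ∃ H, IsWeakDeriv U α F H ∧ LConvTo U (fun n => partialD α (T n)) H := by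
  obtain ⟨H, hH⟩ := h.exists_lim_partialD hU hj α
  refine ⟨H, ⟨hF.locallyIntegrableOn hU, hH.locallyIntegrableOn hU, fun φ hφ hc hs => ?_⟩, hH⟩
  have h1 := hF.tendsto_integral_mul (fun n => (h.contDiffOn n).continuousOn)
    (contDiff_partialD hφ α).continuous
    (hc.of_isClosed_subset (isClosed_tsupport _) (tsupport_partialD_subset hφ α))
    ((tsupport_partialD_subset hφ α).trans hs)
  have h2 := (hH.tendsto_integral_mul (fun n => (contDiffOn_partialD hU (h.contDiffOn n)
    α).continuousOn) hφ.continuous hc hs).const_mul ((-1) ^ j)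
  refine tendsto_nhds_unique h1 (h2.congr fun n => ?_)
  rw [integral_mul_partialD hU (h.contDiffOn n) hφ hc hs]

end EuclideanSobolev

end ExtrinsicHarmonic

/-! ### Uniqueness of weak derivatives; charts versus global derivations -/

namespace ExtrinsicHarmonic

section WeakUnique

variable {m : ℕ} {U : Set (EuclideanSpace ℝ (Fin m))}

lemma ae_eq_of_integral_mul_eq (hU : IsOpen U) {F H : EuclideanSpace ℝ (Fin m) → ℝ}
    (hF : LocallyIntegrableOn F U) (hH : LocallyIntegrableOn H U)
    (h : ∀ φ : EuclideanSpace ℝ (Fin m) → ℝ, ContDiff ℝ ∞ φ → HasCompactSupport φ →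
      tsupport φ ⊆ U → ∫ y, F y * φ y = ∫ y, H y * φ y) : F =ᵐ[volume.restrict U] H := by
  have hint : ∀ G : EuclideanSpace ℝ (Fin m) → ℝ, LocallyIntegrableOn G U →
      ∀ φ : EuclideanSpace ℝ (Fin m) → ℝ, ContDiff ℝ ∞ φ → HasCompactSupport φ →
      tsupport φ ⊆ U → Integrable (fun y => G y * φ y) := by
    intro G hG φ hφ hc hs
    rw [← integrableOn_iff_integrable_of_support_subset (s := tsupport φ)]
    · exact (hG.integrableOn_compact_subset hs hc).mul_continuousOn hφ.continuous.continuousOn hc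
    · exact (Function.support_mul_subset_right _ _).trans (subset_tsupport φ)
  have h1 := hU.ae_eq_zero_of_integral_contDiff_smul_eq_zero (μ := volume) (f := fun y => F y - H y)
    (hF.sub hH) fun φ hφ hc hs => by
      simp only [smul_eq_mul, mul_comm (φ _), sub_mul]
      rw [integral_sub (hint F hF φ hφ hc hs) (hint H hH φ hφ hc hs), h φ hφ hc hs, sub_self]
  rw [Filter.EventuallyEq, ae_restrict_iff' hU.measurableSet]
  filter_upwards [h1] with y hy hyU using sub_eq_zero.mp (hy hyU)

lemma IsWeakDeriv.ae_unique (hU : IsOpen U) {j : ℕ} {α : Fin j → Fin m}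
    {F H H' : EuclideanSpace ℝ (Fin m) → ℝ} (h : IsWeakDeriv U α F H)
    (h' : IsWeakDeriv U α F H') : H =ᵐ[volume.restrict U] H' := by
  refine ae_eq_of_integral_mul_eq hU h.2.1 h'.2.1 fun φ hφ hc hs => ?_
  have h1 := (h.2.2 φ hφ hc hs).symm.trans (h'.2.2 φ hφ hc hs)
  exact mul_left_cancel₀ (pow_ne_zero _ (by norm_num)) h1

lemma IsWeakDeriv.ae_eq_of_zero (hU : IsOpen U) {α : Fin 0 → Fin m}
    {F H : EuclideanSpace ℝ (Fin m) → ℝ} (h : IsWeakDeriv U α F H) :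
    F =ᵐ[volume.restrict U] H := by
  refine ae_eq_of_integral_mul_eq hU h.1 h.2.1 fun φ hφ hc hs => ?_
  simpa [partialD_zero] using h.2.2 φ hφ hc hs

lemma LConvTo.ae_unique (hU : IsOpen U) {T : ℕ → EuclideanSpace ℝ (Fin m) → ℝ}
    {H H' : EuclideanSpace ℝ (Fin m) → ℝ} (hT : ∀ n, ContinuousOn (T n) U) (h : LConvTo U T H)
    (h' : LConvTo U T H') : H =ᵐ[volume.restrict U] H' :=
  ae_eq_of_integral_mul_eq hU (h.locallyIntegrableOn hU) (h'.locallyIntegrableOn hU)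
    fun _ hφ hc hs => tendsto_nhds_unique (h.tendsto_integral_mul hT hφ.continuous hc hs)
      (h'.tendsto_integral_mul hT hφ.continuous hc hs)

end WeakUnique

section Bridge

variable {m : ℕ} {M : Type*} [TopologicalSpace M]
  [ChartedSpace (EuclideanSpace ℝ (Fin m)) M] [IsManifold (𝓡 m) ∞ M]
  {e : OpenPartialHomeomorph M (EuclideanSpace ℝ (Fin m))}
  (g : SmoothMetric m M) [T2Space M] [CompactSpace M] [MeasurableSpace M] [BorelSpace M]

lemma ae_of_charts {p : M → Prop} (h : ∀ e ∈ atlas (EuclideanSpace ℝ (Fin m)) M,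
    ∀ᵐ y ∂volume.restrict e.target, p (e.symm y)) : ∀ᵐ x ∂vol g, p x := by
  obtain ⟨t, ht⟩ := isCompact_univ.elim_finite_subcover
    (fun x : M => (chartAt (EuclideanSpace ℝ (Fin m)) x).source)
    (fun x => (chartAt (EuclideanSpace ℝ (Fin m)) x).open_source)
    (fun x _ => Set.mem_iUnion.mpr ⟨x, mem_chart_source _ x⟩)
  have h1 : ∀ z ∈ t, ∀ᵐ x ∂vol g, x ∈ (chartAt (EuclideanSpace ℝ (Fin m)) z).source → p x := by
    intro z _
    rw [← ae_restrict_iff' (chartAt (EuclideanSpace ℝ (Fin m)) z).open_source.measurableSet,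
      ae_restrict_source_iff g (chart_mem_atlas _ z)]
    exact h _ (chart_mem_atlas _ z)
  filter_upwards [(ae_ball_iff t.countable_toSet).mpr h1] with x hx
  obtain ⟨z, hz⟩ := Set.mem_iUnion.mp (ht (Set.mem_univ x))
  obtain ⟨hzt, hz⟩ := Set.mem_iUnion.mp hz
  exact hx z hzt hz

lemma ae_comp_symm (he : e ∈ atlas (EuclideanSpace ℝ (Fin m)) M) {p : M → Prop}
    (h : ∀ᵐ x ∂vol g, p x) : ∀ᵐ y ∂volume.restrict e.target, p (e.symm y) :=
  (ae_restrict_source_iff g he).mp (ae_restrict_of_ae h)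

lemma aestronglyMeasurable_comp_symm (he : e ∈ atlas (EuclideanSpace ℝ (Fin m)) M) {w : M → ℝ}
    (hw : AEStronglyMeasurable w (vol g)) :
    AEStronglyMeasurable (w ∘ e.symm) (volume.restrict e.target) := by
  have h1 : AEStronglyMeasurable w (Measure.map e.symm (coordMeasure g e)) := by
    rw [map_chart_symm g he]
    exact hw.restrict
  exact (h1.comp_aemeasurable (aemeasurable_chart_symm_coordMeasure g)).mono_ac
    (ac_coordMeasure g he)

lemma exists_eLpNorm_comp_symm_le (he : e ∈ atlas (EuclideanSpace ℝ (Fin m)) M)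
    {K : Set (EuclideanSpace ℝ (Fin m))} (hK : IsCompact K) (hKt : K ⊆ e.target) :
    ∃ C : ENNReal, C ≠ ⊤ ∧ ∀ w : M → ℝ, AEStronglyMeasurable w (vol g) →
      eLpNorm (w ∘ e.symm) 2 (volume.restrict K) ≤ C * eLpNorm w 2 (vol g) := by
  obtain ⟨C, hC, -, h2⟩ := coordMeasure_restrict_le g he hK hKt
  refine ⟨ENNReal.ofReal C ^ (1 / (2 : ENNReal)).toReal,
    ENNReal.rpow_ne_top_of_nonneg (by positivity) ENNReal.ofReal_ne_top, fun w hw => ?_⟩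
  have h1 : AEStronglyMeasurable w (Measure.map e.symm (coordMeasure g e)) := by
    rw [map_chart_symm g he]
    exact hw.restrict
  calc eLpNorm (w ∘ e.symm) 2 (volume.restrict K)
      ≤ eLpNorm (w ∘ e.symm) 2 (ENNReal.ofReal C • (coordMeasure g e).restrict K) :=
        eLpNorm_mono_measure _ h2
    _ = ENNReal.ofReal C ^ (1 / (2 : ENNReal)).toReal •
          eLpNorm (w ∘ e.symm) 2 ((coordMeasure g e).restrict K) :=
        eLpNorm_smul_measure_of_ne_top (by norm_num) _ _
    _ ≤ _ := by
        rw [smul_eq_mul]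
        gcongr
        refine (eLpNorm_mono_measure _ Measure.restrict_le_self).trans ?_
        rw [← eLpNorm_map_measure h1 (aemeasurable_chart_symm_coordMeasure g),
          map_chart_symm g he]
        exact eLpNorm_mono_measure _ Measure.restrict_le_self

lemma exists_eLpNorm_le_comp_symm (he : e ∈ atlas (EuclideanSpace ℝ (Fin m)) M)
    {A : Set M} (hA : IsCompact A) (hAs : A ⊆ e.source) :
    ∃ C : ENNReal, C ≠ ⊤ ∧ ∀ w : M → ℝ, AEStronglyMeasurable w (vol g) → (∀ x, x ∉ A → w x = 0) →
      eLpNorm w 2 (vol g) ≤ C * eLpNorm (w ∘ e.symm) 2 (volume.restrict (e '' A)) := by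
  have hK : IsCompact (e '' A) := hA.image_of_continuousOn (e.continuousOn.mono hAs)
  have hKt : e '' A ⊆ e.target := by
    rintro _ ⟨x, hx, rfl⟩
    exact e.map_source (hAs hx)
  have hA' : e.symm '' (e '' A) = A := e.symm_image_image_of_subset_source hAs
  obtain ⟨C, hC, h1, -⟩ := coordMeasure_restrict_le g he hK hKt
  refine ⟨ENNReal.ofReal C ^ (1 / (2 : ENNReal)).toReal,
    ENNReal.rpow_ne_top_of_nonneg (by positivity) ENNReal.ofReal_ne_top, fun w hw h0 => ?_⟩
  have h2 := vol_restrict_image g he hK hKt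
  rw [hA'] at h2
  calc eLpNorm w 2 (vol g) = eLpNorm w 2 ((vol g).restrict A) := by
        rw [← eLpNorm_indicator_eq_eLpNorm_restrict hA.measurableSet]
        congr 1
        ext x
        by_cases hx : x ∈ A
        · simp [hx]
        · simp [hx, h0 x hx]
    _ = eLpNorm (w ∘ e.symm) 2 ((coordMeasure g e).restrict (e '' A)) := by
        rw [h2, eLpNorm_map_measure (by rw [← h2]; exact hw.restrict)
          ((aemeasurable_chart_symm_coordMeasure g).mono_measure Measure.restrict_le_self)]
    _ ≤ eLpNorm (w ∘ e.symm) 2 (ENNReal.ofReal C • volume.restrict (e '' A)) :=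
        eLpNorm_mono_measure _ h1
    _ = _ := eLpNorm_smul_measure_of_ne_top (by norm_num) _ _

/-- `v n → f` in `L²(M)`. -/
def ConvL2 (v : ℕ → smoothAlgebra m M) (f : M → ℝ) : Prop :=
  MemLp f 2 (vol g) ∧
    Tendsto (fun n => eLpNorm (fun x => (v n : M → ℝ) x - f x) 2 (vol g)) atTop (𝓝 0)

variable {g} in
lemma ConvL2.lConvTo {v : ℕ → smoothAlgebra m M} {f : M → ℝ} (h : ConvL2 g v f)
    (he : e ∈ atlas (EuclideanSpace ℝ (Fin m)) M) :
    LConvTo e.target (fun n => (v n : M → ℝ) ∘ e.symm) (f ∘ e.symm) := by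
  intro K hK hKc
  obtain ⟨C, hC, hb⟩ := exists_eLpNorm_comp_symm_le g he hKc hK
  refine ⟨⟨(aestronglyMeasurable_comp_symm g he h.1.1).mono_measure
    (Measure.restrict_mono hK le_rfl), (hb f h.1.1).trans_lt (ENNReal.mul_lt_top hC.lt_top h.1.2)⟩,
    tendsto_of_tendsto_of_tendsto_of_le_of_le tendsto_const_nhds
    (h := fun n => C * eLpNorm (fun x => (v n : M → ℝ) x - f x) 2 (vol g)) ?_
    (fun _ => zero_le) fun n => ?_⟩
  · simpa using ENNReal.Tendsto.const_mul h.2 (Or.inr hC)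
  · exact hb (fun x => (v n : M → ℝ) x - f x)
      ((contMDiff_coe (v n)).continuous.aestronglyMeasurable.sub h.1.1)

variable (P : ChartPartition m M)

/-- Smooth functions with the Sobolev seminorms of the chart partition `P`. -/
noncomputable abbrev sobAlg : SobolevAlgebra (vol g) (smoothAlgebra m M) (P.t × Fin m) :=
  (laplaceAlgebra g P).toSobolevAlgebra

lemma exists_convL2 {k : ℕ} {v : ℕ → smoothAlgebra m M} [IsFiniteMeasure (vol g)]
    (h : (sobAlg g P).CauchyN k v) : ∃ f, ConvL2 g v f := by
  obtain ⟨f, hf⟩ := cauchySeq_tendsto_of_complete h.cauchySeq_lp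
  refine ⟨f, Lp.memLp f, ?_⟩
  rw [tendsto_iff_edist_tendsto_0] at hf
  refine hf.congr fun n => ?_
  rw [Lp.edist_def]
  refine eLpNorm_congr_ae ?_
  filter_upwards [(sobAlg g P).coeFn_lp (v n)] with x hx
  simp [hx]

/-- `∂_i f = ⟨∇f, ∂_i⟩`, with `∇f` expanded by `grad_eq_sum`: coordinate derivatives are
combinations of the global derivatives `D α f` with smooth coefficients independent of `f`. The
converse expansion underlies `sConv_D`; together they identify the two notions of W^{k,2}
convergence. -/
lemma pd_comp_symm_eq_sum (he : e ∈ atlas (EuclideanSpace ℝ (Fin m)) M) (i : Fin m)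
    (f : smoothAlgebra m M) :
    Set.EqOn (fun y => ∑ α, ∑ β, (P.metricCoeff g α β ∘ e.symm) y *
        pd i (P.coord β ∘ e.symm) y * (((sobAlg g P).D α f : M → ℝ) ∘ e.symm) y)
      (pd i ((f : M → ℝ) ∘ e.symm)) e.target := by
  intro y hy
  have hf := contMDiff_coe f
  rw [← inner_grad_coordVec g he hy (mdiffAt hf _), grad_eq_sum g P hf]
  simp only [map_sum, map_smul, sum_apply, smul_apply, smul_eq_mul,
    inner_grad_coordVec g he hy (mdiffAt (P.contMDiff_coord _) _)]
  refine Finset.sum_congr rfl fun α _ => Finset.sum_congr rfl fun β _ => ?_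
  simp only [Function.comp, laplaceAlgebra_D]
  ring

lemma CauchyN.sConv [IsFiniteMeasure (vol g)] (he : e ∈ atlas (EuclideanSpace ℝ (Fin m)) M) {k : ℕ}
    {v : ℕ → smoothAlgebra m M} (h : (sobAlg g P).CauchyN k v) :
    SConv e.target k (fun n => (v n : M → ℝ) ∘ e.symm) := by
  have hs : ∀ w : ℕ → smoothAlgebra m M, ∀ n, ContDiffOn ℝ ∞ ((w n : M → ℝ) ∘ e.symm) e.target :=
    fun w n => contDiffOn_comp_symm he (contMDiff_coe (w n))
  induction k generalizing v with
  | zero =>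
    obtain ⟨f, hf⟩ := exists_convL2 g P h
    exact ⟨hs v, _, hf.lConvTo he⟩
  | succ k ih =>
    obtain ⟨f, hf⟩ := exists_convL2 g P h
    refine ⟨⟨hs v, _, hf.lConvTo he⟩, fun i => ?_⟩
    refine SConv.congr (SConv.sum _ (fun α _ => SConv.sum _ (fun β _ => ?_) e.open_target)
      e.open_target) e.open_target fun n => pd_comp_symm_eq_sum g P he i (v n)
    have h1 : (sobAlg g P).CauchyN k fun n => (sobAlg g P).dw [α] (v n) := h.dw [α] (by simp)
    exact (ih h1).mul e.open_target ((contDiffOn_comp_symm he (P.contMDiff_metricCoeff g α β)).mul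
      (contDiffOn_pd e.open_target (contDiffOn_comp_symm he (P.contMDiff_coord β)) i))

lemma sConv_D (he : e ∈ atlas (EuclideanSpace ℝ (Fin m)) M) {U : Set (EuclideanSpace ℝ (Fin m))}
    (hU : IsOpen U) (hUt : U ⊆ e.target) {k : ℕ} {v : ℕ → smoothAlgebra m M}
    (h : SConv U (k + 1) fun n => (v n : M → ℝ) ∘ e.symm) (α : P.t × Fin m) :
    SConv U k fun n => ((sobAlg g P).D α (v n) : M → ℝ) ∘ e.symm := by
  refine SConv.congr (T := fun n y => ∑ i, ∑ j, ((gram g e y)⁻¹ i j *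
    pd i (P.coord α ∘ e.symm) y) * pd j ((v n : M → ℝ) ∘ e.symm) y) (SConv.sum _ (fun i _ =>
      SConv.sum _ (fun j _ => ?_) hU) hU) hU fun n y hy => ?_
  · exact (h.2 j).mul hU (((contDiffOn_gram_inv g he i j).mul (contDiffOn_pd e.open_target
      (contDiffOn_comp_symm he (P.contMDiff_coord α)) i)).mono hUt)
  · exact (gam_chart g he (hUt hy) (mdiffAt (P.contMDiff_coord α) _)
      (mdiffAt (contMDiff_coe (v n)) _)).symm

lemma tsupport_D_subset (α : P.t × Fin m) (f : smoothAlgebra m M) :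
    tsupport ((sobAlg g P).D α f : M → ℝ) ⊆ tsupport (f : M → ℝ) := by
  refine closure_minimal (fun x hx => ?_) (isClosed_tsupport _)
  by_contra h
  exact hx ((gam_comm g _ _ x).trans (gam_eq_zero g h _))

lemma tsupport_dw_subset (I : List (P.t × Fin m)) (f : smoothAlgebra m M) :
    tsupport ((sobAlg g P).dw I f : M → ℝ) ⊆ tsupport (f : M → ℝ) := by
  induction I generalizing f with
  | nil => exact subset_rfl
  | cons α I ih => exact (ih _).trans (tsupport_D_subset g P α f)

lemma sConv_dw (he : e ∈ atlas (EuclideanSpace ℝ (Fin m)) M) {U : Set (EuclideanSpace ℝ (Fin m))}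
    (hU : IsOpen U) (hUt : U ⊆ e.target) {k : ℕ} {v : ℕ → smoothAlgebra m M}
    (h : SConv U k fun n => (v n : M → ℝ) ∘ e.symm) (I : List (P.t × Fin m)) (hI : I.length ≤ k) :
    ∃ H, LConvTo U (fun n => ((sobAlg g P).dw I (v n) : M → ℝ) ∘ e.symm) H := by
  induction I generalizing v k with
  | nil => exact h.exists_lim
  | cons α I ih =>
    obtain ⟨k, rfl⟩ : ∃ k', k = k' + 1 := ⟨k - 1, by simp at hI; omega⟩
    exact ih (sConv_D g P he hU hUt h α) (by simpa using hI)

/-- Sequences supported in a compact subset of a chart which converge there are Cauchy. -/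
lemma cauchyN_of_sConv [IsFiniteMeasure (vol g)] (he : e ∈ atlas (EuclideanSpace ℝ (Fin m)) M)
    {U : Set (EuclideanSpace ℝ (Fin m))}
    (hU : IsOpen U) (hUt : U ⊆ e.target) {A : Set M} (hA : IsCompact A) (hAs : A ⊆ e.source)
    (hAU : e '' A ⊆ U) {k : ℕ} {v : ℕ → smoothAlgebra m M}
    (h : SConv U k fun n => (v n : M → ℝ) ∘ e.symm) (hv : ∀ n, tsupport (v n : M → ℝ) ⊆ A) :
    (sobAlg g P).CauchyN k v := by
  obtain ⟨C, hC, hb⟩ := exists_eLpNorm_le_comp_symm g he hA hAs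
  rw [SobolevAlgebra.CauchyN, SobolevAlgebra.tendsto_N_zero_iff]
  intro I hI
  obtain ⟨H, hH⟩ := sConv_dw g P he hU hUt h I hI
  have hK : IsCompact (e '' A) := hA.image_of_continuousOn (e.continuousOn.mono hAs)
  obtain ⟨hm, hlim⟩ := hH _ hAU hK
  set S := sobAlg g P
  set T : ℕ → EuclideanSpace ℝ (Fin m) → ℝ := fun n => (S.dw I (v n) : M → ℝ) ∘ e.symm
  set d : ℕ → ENNReal := fun n => eLpNorm (fun y => T n y - H y) 2 (volume.restrict (e '' A))
  have hTm : ∀ n, AEStronglyMeasurable (T n) (volume.restrict (e '' A)) := fun n =>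
    ((contDiffOn_comp_symm he (contMDiff_coe (S.dw I (v n)))).continuousOn.mono
      (hAU.trans hUt)).aestronglyMeasurable hK.measurableSet
  have hle : ∀ p : ℕ × ℕ, ‖S.lp (S.dw I (v p.1 - v p.2))‖ₑ ≤ C * (d p.1 + d p.2) := by
    intro p
    have h1 : ‖S.lp (S.dw I (v p.1 - v p.2))‖ₑ =
        eLpNorm (S.dw I (v p.1 - v p.2) : M → ℝ) 2 (vol g) := by
      rw [Lp.enorm_def]
      exact eLpNorm_congr_ae (S.coeFn_lp _)
    rw [h1]
    refine (hb _ (contMDiff_coe _).continuous.aestronglyMeasurable fun x hx => ?_).trans ?_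
    · refine image_eq_zero_of_notMem_tsupport fun h2 => hx ?_
      have h3 := tsupport_dw_subset g P I _ h2
      have h4 : tsupport ((v p.1 - v p.2 : smoothAlgebra m M) : M → ℝ) ⊆ A := by
        refine closure_minimal (fun x hx => ?_) hA.isClosed
        by_contra hxA
        refine hx ?_
        have e1 := image_eq_zero_of_notMem_tsupport fun h => hxA (hv p.1 h)
        have e2 := image_eq_zero_of_notMem_tsupport fun h => hxA (hv p.2 h)
        change (v p.1 : M → ℝ) x - (v p.2 : M → ℝ) x = 0
        rw [e1, e2, sub_zero]
      exact h4 h3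
    · gcongr
      have h5 := eLpNorm_sub_le ((hTm p.1).sub hm.1) ((hTm p.2).sub hm.1) (p := 2) (by norm_num)
      refine le_trans (le_of_eq ?_) h5
      congr 1
      ext y
      simp [T, map_sub]
  have hlim2 : Tendsto (fun p : ℕ × ℕ => C * (d p.1 + d p.2)) atTop (𝓝 0) := by
    have h1 : Tendsto (fun p : ℕ × ℕ => d p.1 + d p.2) atTop (𝓝 (0 + 0)) := by
      rw [← prod_atTop_atTop_eq]
      exact (hlim.comp tendsto_fst).add (hlim.comp tendsto_snd)
    simpa using ENNReal.Tendsto.const_mul h1 (Or.inr hC)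
  rw [tendsto_zero_iff_enorm_tendsto_zero]
  exact tendsto_of_tendsto_of_tendsto_of_le_of_le tendsto_const_nhds hlim2 (fun _ => zero_le) hle

/-- `v n → f` in `W^{k,2}(M)`. -/
def Approx [IsFiniteMeasure (vol g)] (k : ℕ) (v : ℕ → smoothAlgebra m M) (f : M → ℝ) : Prop :=
  (sobAlg g P).CauchyN k v ∧ ConvL2 g v f

lemma sConv_of_sobolevTendsto {k : ℕ} {v : ℕ → smoothAlgebra m M} {f : M → ℝ}
    (h : SobolevTendsto m k (fun n => (v n : M → ℝ)) f)
    (he : e ∈ atlas (EuclideanSpace ℝ (Fin m)) M) :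
    SConv e.target k fun n => (v n : M → ℝ) ∘ e.symm := by
  have hs : ∀ n, ContDiffOn ℝ ∞ ((v n : M → ℝ) ∘ e.symm) e.target := fun n =>
    contDiffOn_comp_symm he (contMDiff_coe (v n))
  refine SConv.of_partialD e.open_target hs fun j hj α => ?_
  obtain ⟨H, hH, hlim⟩ := h e he j hj α
  refine ⟨H, fun K hK hKc => ⟨?_, hlim K hK hKc⟩⟩
  have h1 : AEStronglyMeasurable H (volume.restrict K) :=
    (hH.2.1.integrableOn_compact_subset hK hKc).aestronglyMeasurable
  -- Convergence makes the distance to `H` finite for some `n`, so `H` is in L² on `K` as a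
  -- difference of two L² functions.
  obtain ⟨n, hn⟩ := ((hlim K hK hKc).eventually (gt_mem_nhds (ENNReal.zero_lt_top))).exists
  have h2 := memLp_of_continuousOn hKc
    ((contDiffOn_partialD e.open_target (hs n) α).continuousOn.mono hK)
  have h3 : MemLp (fun y => partialD α ((v n : M → ℝ) ∘ e.symm) y - H y) 2 (volume.restrict K) :=
    ⟨h2.1.sub h1, hn⟩
  refine (h2.sub h3).ae_eq (.of_forall fun y => ?_)
  simp

/-- Write `v = ∑ ρ_l v`. Each summand is supported in a compact subset of one chart, where local
convergence gives the Cauchy property. -/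
lemma cauchyN_of_sobolevTendsto [IsFiniteMeasure (vol g)] {k : ℕ} {v : ℕ → smoothAlgebra m M}
    {f : M → ℝ} (h : SobolevTendsto m k (fun n => (v n : M → ℝ)) f) :
    (sobAlg g P).CauchyN k v := by
  let ρ : P.t → smoothAlgebra m M := fun l => ⟨P.ρ l, P.smooth_ρ l⟩
  have h1 : ∀ n, v n = ∑ l, ρ l * v n := by
    intro n
    rw [← Finset.sum_mul]
    have : ∑ l, ρ l = 1 := by
      refine Subtype.ext <| funext fun x => ?_
      rw [AddSubmonoidClass.coe_finsetSum, Finset.sum_apply]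
      exact P.sum_eq_one x
    rw [this, one_mul]
  rw [show v = fun n => ∑ l, ρ l * v n from funext h1]
  refine SobolevAlgebra.CauchyN.sum fun l _ => ?_
  have hl := P.tsupport_ρ l
  refine cauchyN_of_sConv g P (P.ch_mem l) (P.ch l).open_target subset_rfl
    (isClosed_tsupport (P.ρ l)).isCompact hl (image_tsupport_subset hl) ?_ fun n =>
      tsupport_mul_subset_left
  exact (sConv_of_sobolevTendsto h (P.ch_mem l)).mul (P.ch l).open_target
    (contDiffOn_comp_symm (P.ch_mem l) (P.smooth_ρ l))

lemma ConvL2.congr_ae {v : ℕ → smoothAlgebra m M} {f f' : M → ℝ} (h : ConvL2 g v f)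
    (hf : f =ᵐ[vol g] f') : ConvL2 g v f' :=
  ⟨h.1.ae_eq hf, h.2.congr fun n => eLpNorm_congr_ae (by filter_upwards [hf] with x hx; rw [hx])⟩

lemma approx_of_sobolevTendsto [IsFiniteMeasure (vol g)] {k : ℕ} {v : ℕ → smoothAlgebra m M}
    {f : M → ℝ} (h : SobolevTendsto m k (fun n => (v n : M → ℝ)) f) : Approx g P k v f := by
  have hc := cauchyN_of_sobolevTendsto g P h
  refine ⟨hc, ?_⟩
  obtain ⟨f', hf'⟩ := exists_convL2 g P hc
  refine hf'.congr_ae g (ae_of_charts g fun e he => ?_)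
  obtain ⟨H, hH, hlim⟩ := h e he 0 (Nat.zero_le _) Fin.elim0
  have h1 := hH.ae_eq_of_zero e.open_target
  have hs : ∀ n, ContinuousOn ((v n : M → ℝ) ∘ e.symm) e.target := fun n =>
    (contDiffOn_comp_symm he (contMDiff_coe (v n))).continuousOn
  obtain ⟨H', hH'⟩ := (sConv_of_sobolevTendsto h he).exists_lim
  have h2 : LConvTo e.target (fun n => (v n : M → ℝ) ∘ e.symm) H := by
    intro K hK hKc
    have h3 := hlim K hK hKc
    simp only [partialD_zero] at h3
    refine ⟨?_, h3⟩
    have h4 : AEStronglyMeasurable H (volume.restrict K) :=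
      (hH.2.1.integrableOn_compact_subset hK hKc).aestronglyMeasurable
    obtain ⟨n, hn⟩ := (h3.eventually (gt_mem_nhds (ENNReal.zero_lt_top))).exists
    have h5 := memLp_of_continuousOn hKc ((hs n).mono hK)
    have h6 : MemLp (fun y => ((v n : M → ℝ) ∘ e.symm) y - H y) 2 (volume.restrict K) :=
      ⟨h5.1.sub h4, hn⟩
    refine (h5.sub h6).ae_eq (.of_forall fun y => ?_)
    simp
  filter_upwards [h1, (hf'.lConvTo he).ae_unique e.open_target hs h2] with y hy1 hy2
  exact hy2.trans hy1.symm

variable {g P} in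
lemma Approx.sobolevTendsto [IsFiniteMeasure (vol g)] {k : ℕ} {v : ℕ → smoothAlgebra m M}
    {f : M → ℝ} (h : Approx g P k v f) : SobolevTendsto m k (fun n => (v n : M → ℝ)) f := by
  intro e he j hj α
  obtain ⟨H, h1, h2⟩ := (CauchyN.sConv g P he h.1).exists_isWeakDeriv e.open_target
    (h.2.lConvTo he) hj α
  exact ⟨H, h1, fun K hK hKc => (h2 K hK hKc).2⟩

end Bridge

end ExtrinsicHarmonic

/-! ### Mollification of bounded local Sobolev functions -/

namespace ExtrinsicHarmonic

section Mollify

variable {m : ℕ} {U : Set (EuclideanSpace ℝ (Fin m))}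

/-- Convolution. -/
noncomputable def mollify (h η : EuclideanSpace ℝ (Fin m) → ℝ) (y : EuclideanSpace ℝ (Fin m)) : ℝ :=
  ∫ z, h z * η (y - z)

variable {h η : EuclideanSpace ℝ (Fin m) → ℝ}

lemma mollify_eq : mollify h η = convolution h η (ContinuousLinearMap.mul ℝ ℝ) volume := rfl

lemma contDiff_mollify (hh : LocallyIntegrable h) (hη : ContDiff ℝ ∞ η)
    (hc : HasCompactSupport η) : ContDiff ℝ ∞ (mollify h η) :=
  hc.contDiff_convolution_right (ContinuousLinearMap.mul ℝ ℝ) hh hη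

lemma pd_mollify (hh : LocallyIntegrable h) (hη : ContDiff ℝ ∞ η)
    (hc : HasCompactSupport η) (i : Fin m) : pd i (mollify h η) = mollify h (pd i η) := by
  ext y
  have hη1 : ContDiff ℝ 1 η := hη.of_le (by exact_mod_cast le_top)
  rw [pd, mollify_eq, (hc.hasFDerivAt_convolution_right _ hh hη1 y).fderiv,
    convolution_precompR_apply _ hh (hc.fderiv ℝ) (hη1.continuous_fderiv one_ne_zero)]
  rfl

lemma hasCompactSupport_partialD (hη : ContDiff ℝ ∞ η) (hc : HasCompactSupport η) {j : ℕ}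
    (α : Fin j → Fin m) : HasCompactSupport (partialD α η) :=
  hc.of_isClosed_subset (isClosed_tsupport _) (tsupport_partialD_subset hη α)

lemma partialD_mollify (hh : LocallyIntegrable h) (hη : ContDiff ℝ ∞ η)
    (hc : HasCompactSupport η) {j : ℕ} (α : Fin j → Fin m) :
    partialD α (mollify h η) = mollify h (partialD α η) := by
  induction j with
  | zero => simp [partialD_zero]
  | succ j ih =>
    rw [← Fin.cons_self_tail α, partialD_cons_eq (contDiff_mollify hh hη hc), ih,
      pd_mollify hh (contDiff_partialD hη _) (hasCompactSupport_partialD hη hc _),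
      partialD_cons_eq hη]

lemma partialD_const_sub (hη : ContDiff ℝ ∞ η) {j : ℕ} (α : Fin j → Fin m)
    (y : EuclideanSpace ℝ (Fin m)) :
    partialD α (fun z => η (y - z)) = fun z => (-1) ^ j * partialD α η (y - z) := by
  have hs : ContDiff ℝ ∞ (fun z => η (y - z)) := hη.comp (contDiff_const.sub contDiff_id)
  induction j with
  | zero => simp [partialD_zero]
  | succ j ih =>
    rw [← Fin.cons_self_tail α, partialD_cons_eq hs, ih, partialD_cons_eq hη]
    ext z
    have h1 : HasFDerivAt (partialD (Fin.tail α) η) _ (y - z) :=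
      ((contDiff_partialD hη (Fin.tail α)).differentiable (by simp) (y - z)).hasFDerivAt
    have h2 := (h1.comp z ((hasFDerivAt_const y z).sub (hasFDerivAt_id z))).const_mul ((-1 : ℝ) ^ j)
    have h3 : fderiv ℝ (fun z => (-1 : ℝ) ^ j * partialD (Fin.tail α) η (y - z)) z = _ := h2.fderiv
    rw [pd, h3]
    simp [pow_succ]

/-- Derivatives of mollifications are mollifications of weak derivatives. -/
lemma partialD_mollify_eq {F H : EuclideanSpace ℝ (Fin m) → ℝ} {j : ℕ} {α : Fin j → Fin m}
    (hFH : IsWeakDeriv U α F H) {K : Set (EuclideanSpace ℝ (Fin m))} (hK : IsCompact K)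
    (hKU : K ⊆ U) (hη : ContDiff ℝ ∞ η) {r : ℝ} (hr : tsupport η ⊆ Metric.closedBall 0 r)
    {y : EuclideanSpace ℝ (Fin m)} (hy : Metric.closedBall y r ⊆ K) :
    partialD α (mollify (K.indicator F) η) y = mollify (K.indicator H) η y := by
  have hc : HasCompactSupport η :=
    (isCompact_closedBall _ _).of_isClosed_subset (isClosed_tsupport _) hr
  have hint : LocallyIntegrable (K.indicator F) :=
    ((integrable_indicator_iff hK.measurableSet).mpr
      (hFH.1.integrableOn_compact_subset hKU hK)).locallyIntegrable
  -- The reflected and translated mollifier is an admissible test function: its support lies in the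
  -- ball around `y`, hence in `K ⊆ U`.
  set φ : EuclideanSpace ℝ (Fin m) → ℝ := fun z => η (y - z) with hφdef
  have hφ : ContDiff ℝ ∞ φ := hη.comp (contDiff_const.sub contDiff_id)
  have hφs : tsupport φ ⊆ Metric.closedBall y r := by
    refine closure_minimal (fun z hz => ?_) Metric.isClosed_closedBall
    have h1 : y - z ∈ Metric.closedBall (0 : EuclideanSpace ℝ (Fin m)) r := hr (subset_tsupport _ hz)
    rw [mem_closedBall_zero_iff] at h1
    rwa [Metric.mem_closedBall, dist_comm, dist_eq_norm]
  have hφc : HasCompactSupport φ :=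
    (isCompact_closedBall _ _).of_isClosed_subset (isClosed_tsupport _) hφs
  have h2 : ∀ (G ψ : EuclideanSpace ℝ (Fin m) → ℝ), tsupport ψ ⊆ K →
      ∫ z, K.indicator G z * ψ z = ∫ z, G z * ψ z := by
    intro G ψ hψ
    refine integral_congr_ae (.of_forall fun z => ?_)
    by_cases hz : z ∈ K
    · simp [hz]
    · simp [hz, image_eq_zero_of_notMem_tsupport fun h => hz (hψ h)]
  have h3 := hFH.2.2 φ hφ hφc ((hφs.trans hy).trans hKU)
  rw [partialD_mollify hint hη hc, mollify, mollify]
  rw [h2 H φ (hφs.trans hy)]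
  have h4 : ∀ z, partialD α η (y - z) = (-1) ^ j * partialD α φ z := fun z => by
    rw [partialD_const_sub hη, ← mul_assoc, ← mul_pow]
    norm_num
  simp only [h4, mul_left_comm _ ((-1 : ℝ) ^ j)]
  rw [MeasureTheory.integral_const_mul,
    h2 F _ ((tsupport_partialD_subset hφ α).trans (hφs.trans hy)), h3, ← mul_assoc, ← mul_pow]
  norm_num

variable {r : ℝ}

/-- A mollifier of radius `r`. -/
structure IsMollifier (η : EuclideanSpace ℝ (Fin m) → ℝ) (r : ℝ) : Prop where
  contDiff : ContDiff ℝ ∞ η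
  nonneg : ∀ y, 0 ≤ η y
  integral_eq : ∫ y, η y = 1
  support : tsupport η ⊆ Metric.closedBall 0 r

lemma exists_isMollifier (m : ℕ) (hr : 0 < r) :
    ∃ η : EuclideanSpace ℝ (Fin m) → ℝ, IsMollifier η r := by
  let b : ContDiffBump (0 : EuclideanSpace ℝ (Fin m)) := ⟨r / 2, r, by linarith, by linarith⟩
  exact ⟨b.normed volume, b.contDiff_normed, b.nonneg_normed, b.integral_normed,
    b.tsupport_normed_eq.subset⟩

namespace IsMollifier

lemma hasCompactSupport (hη : IsMollifier η r) : HasCompactSupport η :=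
  (isCompact_closedBall _ _).of_isClosed_subset (isClosed_tsupport _) hη.support

lemma integrable (hη : IsMollifier η r) : Integrable η :=
  hη.contDiff.continuous.integrable_of_hasCompactSupport hη.hasCompactSupport

lemma integral_sub (hη : IsMollifier η r) (y : EuclideanSpace ℝ (Fin m)) :
    ∫ z, η (y - z) = 1 := by
  rw [integral_sub_left_eq_self (fun z => η z) volume y, hη.integral_eq]

lemma eq_zero (hη : IsMollifier η r) {y : EuclideanSpace ℝ (Fin m)} (hy : r < ‖y‖) : η y = 0 :=
  image_eq_zero_of_notMem_tsupport fun h => by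
    have := hη.support h
    rw [mem_closedBall_zero_iff] at this
    linarith

lemma integrable_sub (hη : IsMollifier η r) (y : EuclideanSpace ℝ (Fin m)) :
    Integrable fun z => η (y - z) := hη.integrable.comp_sub_left y

lemma integrable_mul_sub (hη : IsMollifier η r) (hh : LocallyIntegrable h)
    (y : EuclideanSpace ℝ (Fin m)) : Integrable fun z => h z * η (y - z) :=
  hη.hasCompactSupport.convolutionExists_right (ContinuousLinearMap.mul ℝ ℝ) hh
    hη.contDiff.continuous y

lemma abs_mollify_le (hη : IsMollifier η r) {A : ℝ} (hh : ∀ᵐ z, |h z| ≤ A)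
    (y : EuclideanSpace ℝ (Fin m)) : |mollify h η y| ≤ A := by
  calc |mollify h η y| ≤ ∫ z, A * η (y - z) := by
        rw [← Real.norm_eq_abs]
        refine norm_integral_le_of_norm_le ((hη.integrable_sub y).const_mul A) ?_
        filter_upwards [hh] with z hz
        rw [norm_mul, Real.norm_eq_abs, Real.norm_of_nonneg (hη.nonneg _)]
        exact mul_le_mul_of_nonneg_right hz (hη.nonneg _)
    _ = A := by rw [MeasureTheory.integral_const_mul, hη.integral_sub, mul_one]

/-- Jensen's inequality, obtained by expanding the nonnegative variance `∫ (h - a)² η(y - ·)` with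
`a` the mean. -/
lemma sq_mollify_le (hη : IsMollifier η r) (hh : Integrable h) (hh2 : Integrable fun z => h z ^ 2)
    (y : EuclideanSpace ℝ (Fin m)) : mollify h η y ^ 2 ≤ mollify (fun z => h z ^ 2) η y := by
  set a := mollify h η y
  have i1 := hη.integrable_mul_sub hh.locallyIntegrable y
  have i2 := hη.integrable_mul_sub hh2.locallyIntegrable y
  have i3 := hη.integrable_sub y
  have h1 : 0 ≤ ∫ z, (h z - a) ^ 2 * η (y - z) :=
    integral_nonneg fun z => mul_nonneg (sq_nonneg _) (hη.nonneg _)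
  have h2 : ∫ z, (h z - a) ^ 2 * η (y - z) =
      mollify (fun z => h z ^ 2) η y - 2 * a * a + a ^ 2 := by
    have : ∀ z, (h z - a) ^ 2 * η (y - z) =
        (h z ^ 2 * η (y - z) - 2 * a * (h z * η (y - z))) + a ^ 2 * η (y - z) := fun z => by ring
    simp only [this]
    have i4 : Integrable fun z => h z ^ 2 * η (y - z) - 2 * a * (h z * η (y - z)) :=
      i2.sub (i1.const_mul _)
    rw [integral_add i4 (i3.const_mul _),
      MeasureTheory.integral_sub i2 (i1.const_mul _), MeasureTheory.integral_const_mul,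
      MeasureTheory.integral_const_mul, hη.integral_sub]
    change _ - 2 * a * a + _ = _
    rw [mul_one]
    rfl
  nlinarith

end IsMollifier

lemma eLpNorm_two_le_of_integral_sq_le {X : Type*} [MeasurableSpace X] {μ : Measure X} {F G : X → ℝ}
    (hF : MemLp F 2 μ) (hG : MemLp G 2 μ) (h : ∫ x, F x ^ 2 ∂μ ≤ ∫ x, G x ^ 2 ∂μ) :
    eLpNorm F 2 μ ≤ eLpNorm G 2 μ := by
  rw [hF.eLpNorm_eq_integral_rpow_norm (by norm_num) (by norm_num),
    hG.eLpNorm_eq_integral_rpow_norm (by norm_num) (by norm_num)]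
  simp only [ENNReal.toReal_ofNat, Real.rpow_ofNat, Real.norm_eq_abs, sq_abs]
  exact ENNReal.ofReal_le_ofReal (Real.rpow_le_rpow (integral_nonneg fun _ => sq_nonneg _) h
    (by norm_num))

lemma IsMollifier.memLp_mollify (hη : IsMollifier η r) (hh : Integrable h) (hh2 : MemLp h 2) :
    MemLp (mollify h η) 2 ∧ eLpNorm (mollify h η) 2 volume ≤ eLpNorm h 2 volume := by
  have hsq : Integrable fun z => h z ^ 2 := hh2.integrable_sq
  have hcont := (contDiff_mollify hh.locallyIntegrable hη.contDiff hη.hasCompactSupport).continuous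
  have hi : Integrable (mollify (fun z => h z ^ 2) η) :=
    hsq.integrable_convolution (ContinuousLinearMap.mul ℝ ℝ) hη.integrable
  have hle := hη.sq_mollify_le hh hsq
  have hi2 : Integrable fun y => mollify h η y ^ 2 :=
    hi.mono' (hcont.pow 2).aestronglyMeasurable (.of_forall fun y => by
      rw [Real.norm_of_nonneg (sq_nonneg _)]
      exact hle y)
  have hm : MemLp (mollify h η) 2 := (memLp_two_iff_integrable_sq hcont.aestronglyMeasurable).mpr hi2
  refine ⟨hm, eLpNorm_two_le_of_integral_sq_le hm hh2 ?_⟩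
  calc ∫ y, mollify h η y ^ 2 ≤ ∫ y, mollify (fun z => h z ^ 2) η y :=
        integral_mono hi2 hi hle
    _ = ∫ z, h z ^ 2 := by
        rw [mollify_eq, integral_convolution _ hsq hη.integrable, hη.integral_eq]
        simp

/-- Mollifications converge in `L²_loc`. -/
lemma tendsto_mollify {η : ℕ → EuclideanSpace ℝ (Fin m) → ℝ} {r : ℕ → ℝ}
    (hη : ∀ n, IsMollifier (η n) (r n)) (hr : Tendsto r atTop (𝓝 0)) (hh : Integrable h)
    (hh2 : MemLp h 2) {K : Set (EuclideanSpace ℝ (Fin m))} (hK : IsCompact K) :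
    Tendsto (fun n => eLpNorm (fun y => mollify h (η n) y - h y) 2 (volume.restrict K)) atTop
      (𝓝 0) := by
  have hfin : IsFiniteMeasure (volume.restrict K) := ⟨by simpa using hK.measure_lt_top⟩
  rw [ENNReal.tendsto_nhds_zero]
  intro ε hε
  have hε3 : ε / 3 ≠ 0 := (ENNReal.div_pos hε.ne' (by norm_num)).ne'
  -- Mollification contracts L², so it suffices to treat a continuous compactly supported `c` near
  -- `h`, for which convergence is uniform.
  obtain ⟨c, hcs, hcε, hcc, hc2⟩ := hh2.exists_hasCompactSupport_eLpNorm_sub_le (by norm_num) hε3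
  have hci : Integrable c := hcc.integrable_of_hasCompactSupport hcs
  set B : ENNReal := (volume.restrict K) Set.univ ^ (2 : ENNReal).toReal⁻¹ with hB
  have hBt : B ≠ ⊤ := ENNReal.rpow_ne_top_of_nonneg (by norm_num) (measure_ne_top _ _)
  obtain ⟨δ, hδ, hBδ⟩ : ∃ δ : ℝ, 0 < δ ∧ B * ENNReal.ofReal δ ≤ ε / 3 := by
    have h1 : Tendsto (fun δ : ℝ => B * ENNReal.ofReal δ) (𝓝[>] 0) (𝓝 0) := by
      have h2 : Tendsto (fun δ : ℝ => ENNReal.ofReal δ) (𝓝[>] 0) (𝓝 0) := by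
        have := ENNReal.continuous_ofReal.tendsto (0 : ℝ)
        rw [ENNReal.ofReal_zero] at this
        exact this.mono_left nhdsWithin_le_nhds
      simpa using ENNReal.Tendsto.const_mul h2 (Or.inr hBt)
    obtain ⟨δ, h1, h2⟩ := ((h1.eventually (ge_mem_nhds (pos_iff_ne_zero.mpr hε3))).and
      self_mem_nhdsWithin).exists
    exact ⟨δ, h2, h1⟩
  have huc := hcs.uniformContinuous_of_continuous hcc
  obtain ⟨s, hs, hsc⟩ := Metric.uniformContinuous_iff.mp huc δ hδ
  filter_upwards [hr.eventually (gt_mem_nhds hs)] with n hn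
  have hcn : ∀ y, |mollify c (η n) y - c y| ≤ δ := by
    intro y
    have h1 : mollify c (η n) y - c y = ∫ z, (c z - c y) * η n (y - z) := by
      simp only [sub_mul]
      rw [MeasureTheory.integral_sub ((hη n).integrable_mul_sub hci.locallyIntegrable y)
        (((hη n).integrable_sub y).const_mul _), MeasureTheory.integral_const_mul,
        (hη n).integral_sub, mul_one]
      rfl
    rw [h1, ← Real.norm_eq_abs]
    calc ‖∫ z, (c z - c y) * η n (y - z)‖ ≤ ∫ z, δ * η n (y - z) := by
          refine norm_integral_le_of_norm_le (((hη n).integrable_sub y).const_mul δ)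
            (.of_forall fun z => ?_)
          rw [norm_mul, Real.norm_of_nonneg ((hη n).nonneg _)]
          rcases le_or_gt ‖y - z‖ (r n) with h2 | h2
          · refine mul_le_mul_of_nonneg_right ?_ ((hη n).nonneg _)
            refine (hsc (a := z) (b := y) ?_).le
            rw [dist_comm, dist_eq_norm]
            linarith
          · rw [(hη n).eq_zero h2, mul_zero, mul_zero]
      _ = δ := by rw [MeasureTheory.integral_const_mul, (hη n).integral_sub, mul_one]
  have hhc := hh.sub hci
  have hhc2 : MemLp (h - c) 2 := hh2.sub hc2
  obtain ⟨hm, hmle⟩ := (hη n).memLp_mollify hhc hhc2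
  have hcont := (contDiff_mollify hci.locallyIntegrable (hη n).contDiff
    (hη n).hasCompactSupport).continuous
  have hdec : (fun y => mollify h (η n) y - h y) =
      mollify (h - c) (η n) + ((fun y => mollify c (η n) y - c y) - (h - c)) := by
    ext y
    have : mollify (h - c) (η n) y = mollify h (η n) y - mollify c (η n) y := by
      simp only [mollify, Pi.sub_apply, sub_mul]
      exact MeasureTheory.integral_sub ((hη n).integrable_mul_sub hh.locallyIntegrable y)
        ((hη n).integrable_mul_sub hci.locallyIntegrable y)
    simp only [Pi.add_apply, Pi.sub_apply, this]
    ring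
  have hcm : AEStronglyMeasurable (fun y => mollify c (η n) y - c y) (volume.restrict K) :=
    (hcont.sub hcc).aestronglyMeasurable
  rw [hdec]
  calc _ ≤ eLpNorm (mollify (h - c) (η n)) 2 (volume.restrict K) +
        (eLpNorm (fun y => mollify c (η n) y - c y) 2 (volume.restrict K) +
          eLpNorm (h - c) 2 (volume.restrict K)) :=
        (eLpNorm_add_le hm.1.restrict (hcm.sub hhc2.1.restrict) (by norm_num)).trans
          (add_le_add le_rfl (eLpNorm_sub_le hcm hhc2.1.restrict (by norm_num)))
    _ ≤ ε / 3 + (ε / 3 + ε / 3) := by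
        gcongr
        · exact (eLpNorm_mono_measure _ Measure.restrict_le_self).trans (hmle.trans hcε)
        · refine (eLpNorm_le_of_ae_bound (C := δ) (.of_forall hcn)).trans hBδ
        · exact (eLpNorm_mono_measure _ Measure.restrict_le_self).trans hcε
    _ = ε := by rw [← add_assoc, ENNReal.add_thirds]

/-- Bounded local Sobolev functions are limits of bounded smooth functions. -/
lemma exists_sConv (hU : IsOpen U) {V : Set (EuclideanSpace ℝ (Fin m))} {A : Set (EuclideanSpace ℝ (Fin m))}
    (hA : IsCompact A) (hAU : A ⊆ U) (hV : IsOpen V) (hVA : V ⊆ A) {k : ℕ}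
    {F : EuclideanSpace ℝ (Fin m) → ℝ} {B : ℝ} (hB : 0 ≤ B)
    (hF : ∀ᵐ y ∂volume.restrict U, |F y| ≤ B)
    (h : ∀ j ≤ k, ∀ α : Fin j → Fin m, ∃ H, IsWeakDeriv U α F H ∧
      ∀ K ⊆ U, IsCompact K → MemLp H 2 (volume.restrict K)) :
    ∃ w : ℕ → EuclideanSpace ℝ (Fin m) → ℝ, (∀ n, ContDiff ℝ ∞ (w n)) ∧ (∀ n y, |w n y| ≤ B) ∧
      SConv V k w ∧ LConvTo V w F := by
  obtain ⟨r, hr, hrU⟩ := hA.exists_cthickening_subset_open hU hAU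
  -- Balls of radius `r/(n+1)` around points of `V ⊆ A` stay in the thickening. Cutting `F` and its
  -- weak derivatives off outside `K` makes them globally integrable without affecting their
  -- mollifications on `V`.
  set K := Metric.cthickening r A
  have hK : IsCompact K := hA.cthickening
  choose η hη using fun n : ℕ => exists_isMollifier m (r := r / (n + 1)) (by positivity)
  have hr0 : Tendsto (fun n : ℕ => r / ((n : ℝ) + 1)) atTop (𝓝 0) := by
    simpa using tendsto_const_nhds.div_atTop
      (tendsto_natCast_atTop_atTop.atTop_add (tendsto_const_nhds (x := (1 : ℝ)))) (a := r)
  have hball : ∀ n : ℕ, ∀ y ∈ V, Metric.closedBall y (r / (n + 1)) ⊆ K := by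
    intro n y hy z hz
    refine Metric.mem_cthickening_of_dist_le z y r A (hVA hy) ?_
    refine (Metric.mem_closedBall.mp hz).trans ?_
    rw [div_le_iff₀ (by positivity)]
    have : (0 : ℝ) ≤ n := Nat.cast_nonneg n
    nlinarith
  have hfin : IsFiniteMeasure (volume.restrict K) := ⟨by simpa using hK.measure_lt_top⟩
  have hind : ∀ H : EuclideanSpace ℝ (Fin m) → ℝ, MemLp H 2 (volume.restrict K) →
      MemLp (K.indicator H) 2 ∧ Integrable (K.indicator H) := fun H hH =>
    ⟨(memLp_indicator_iff_restrict hK.measurableSet).mpr hH,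
      (integrable_indicator_iff hK.measurableSet).mpr (hH.integrable (by norm_num))⟩
  have hVconv : ∀ H : EuclideanSpace ℝ (Fin m) → ℝ, MemLp H 2 (volume.restrict K) →
      LConvTo V (fun n => mollify (K.indicator H) (η n)) H := by
    intro H hH L hL hLc
    have hLK : L ⊆ K := hL.trans (hVA.trans (Metric.self_subset_cthickening A))
    refine ⟨hH.mono_measure (Measure.restrict_mono hLK le_rfl),
      (tendsto_mollify hη hr0 (hind H hH).2 (hind H hH).1 hLc).congr fun n =>
        eLpNorm_congr_ae ?_⟩
    filter_upwards [ae_restrict_mem hLc.measurableSet] with y hy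
    rw [Set.indicator_of_mem (hLK hy)]
  have h0 : MemLp F 2 (volume.restrict K) := by
    obtain ⟨H, hH, hHm⟩ := h 0 (Nat.zero_le _) Fin.elim0
    refine (hHm K hrU hK).ae_eq ?_
    have := (hH.ae_eq_of_zero hU).symm
    exact ae_mono (Measure.restrict_mono hrU le_rfl) this
  refine ⟨fun n => mollify (K.indicator F) (η n), fun n => contDiff_mollify
    (hind F h0).2.locallyIntegrable (hη n).contDiff (hη n).hasCompactSupport, fun n y =>
    (hη n).abs_mollify_le ?_ y, SConv.of_partialD hV (fun n => (contDiff_mollify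
    (hind F h0).2.locallyIntegrable (hη n).contDiff (hη n).hasCompactSupport).contDiffOn)
    fun j hj α => ?_, hVconv F h0⟩
  · rw [ae_restrict_iff' hU.measurableSet] at hF
    filter_upwards [hF] with z hz
    by_cases hzK : z ∈ K
    · rw [Set.indicator_of_mem hzK]
      exact hz (hrU hzK)
    · rw [Set.indicator_of_notMem hzK]
      simpa using hB
  · obtain ⟨H, hH, hHm⟩ := h j hj α
    exact ⟨H, (hVconv H (hHm K hrU hK)).congr fun n y hy =>
      (partialD_mollify_eq hH hK hrU (hη n).contDiff (hη n).support (hball n y hy)).symm⟩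

end Mollify

end ExtrinsicHarmonic

/-! ### Bounded smooth approximation on M -/

namespace ExtrinsicHarmonic

section Density

variable {m : ℕ} {M : Type*} [TopologicalSpace M]
  [ChartedSpace (EuclideanSpace ℝ (Fin m)) M] [IsManifold (𝓡 m) ∞ M]
  {e : OpenPartialHomeomorph M (EuclideanSpace ℝ (Fin m))}
  (g : SmoothMetric m M) [T2Space M] [CompactSpace M] [MeasurableSpace M] [BorelSpace M]

variable {g} in
lemma ConvL2.add {v w : ℕ → smoothAlgebra m M} {f h : M → ℝ} (hv : ConvL2 g v f)
    (hw : ConvL2 g w h) : ConvL2 g (fun n => v n + w n) (fun x => f x + h x) := by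
  refine ⟨hv.1.add hw.1, tendsto_of_tendsto_of_tendsto_of_le_of_le tendsto_const_nhds
    (by simpa using hv.2.add hw.2) (fun _ => zero_le) fun n => ?_⟩
  refine le_trans (le_of_eq ?_) (eLpNorm_add_le
    ((contMDiff_coe (v n)).continuous.aestronglyMeasurable.sub hv.1.1)
    ((contMDiff_coe (w n)).continuous.aestronglyMeasurable.sub hw.1.1) (by norm_num))
  congr 1
  ext x
  simp only [Pi.add_apply, AddMemClass.coe_add]
  ring

lemma ConvL2.zero : ConvL2 g (fun _ => 0) (fun _ : M => (0 : ℝ)) :=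
  ⟨MemLp.zero, by simp⟩

variable {g} in
lemma ConvL2.sum {κ : Type*} (s : Finset κ) {v : κ → ℕ → smoothAlgebra m M} {f : κ → M → ℝ}
    (h : ∀ a ∈ s, ConvL2 g (v a) (f a)) :
    ConvL2 g (fun n => ∑ a ∈ s, v a n) (fun x => ∑ a ∈ s, f a x) := by
  classical
  induction s using Finset.induction_on with
  | empty => simpa using ConvL2.zero g
  | insert a s ha ih =>
    simp only [Finset.sum_insert ha]
    exact (h a (by simp)).add (ih fun b hb => h b (by simp [hb]))

variable (P : ChartPartition m M) [IsFiniteMeasure (vol g)]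

/-- Mollify in a chart and multiply by `ρ l`. The bound `ρ l x * B` is kept pointwise so that the
sum over `l` is again bounded by `B`. -/
lemma exists_local_approx {k : ℕ} {f : M → ℝ} {B : ℝ} (hB : 0 ≤ B) (hf : MemSobolev m k f)
    (hf2 : MemLp f 2 (vol g)) (hfB : ∀ᵐ x ∂vol g, |f x| ≤ B) (l : P.t) :
    ∃ v : ℕ → smoothAlgebra m M, (∀ n x, |(v n : M → ℝ) x| ≤ P.ρ l x * B) ∧
      (sobAlg g P).CauchyN k v ∧ ConvL2 g v (fun x => P.ρ l x * f x) := by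
  have he := P.ch_mem l
  have hρ := P.tsupport_ρ l
  have hA : IsCompact (tsupport (P.ρ l)) := (isClosed_tsupport _).isCompact
  obtain ⟨L, hL, hAL, hLt⟩ := exists_compact_between (isCompact_image_tsupport hρ)
    (P.ch l).open_target (image_tsupport_subset hρ)
  have hFB : ∀ᵐ y ∂volume.restrict (P.ch l).target, |(f ∘ (P.ch l).symm) y| ≤ B :=
    ae_comp_symm g he hfB
  obtain ⟨w, hws, hwB, hwc, hwF⟩ := exists_sConv (P.ch l).open_target hL hLt isOpen_interior
    interior_subset hB hFB fun j hj α => hf _ he j hj α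
  have hVt : interior L ⊆ (P.ch l).target := interior_subset.trans hLt
  have hsm : ∀ n, ContMDiff (𝓡 m) 𝓘(ℝ, ℝ) ∞ (fun x => P.ρ l x * w n (P.ch l x)) := fun n =>
    contMDiff_mul_of_tsupport (P.ch l).open_source (P.smooth_ρ l) hρ
      ((contMDiff_iff_contDiff.mpr (hws n)).comp_contMDiffOn (contMDiffOn_chart he))
  have hρs := contDiffOn_comp_symm he (P.smooth_ρ l)
  have heq : ∀ n, Set.EqOn (fun y => (P.ρ l ∘ (P.ch l).symm) y * w n y)
      ((fun x => P.ρ l x * w n (P.ch l x)) ∘ (P.ch l).symm) (P.ch l).target := by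
    intro n y hy
    simp only [Function.comp, (P.ch l).right_inv hy]
  have hAi : (P.ch l) '' tsupport (P.ρ l) ⊆ interior L := hAL
  refine ⟨fun n => ⟨_, hsm n⟩, fun n x => ?_, ?_, ?_, ?_⟩
  · change |P.ρ l x * w n (P.ch l x)| ≤ _
    rw [abs_mul, abs_of_nonneg (P.nonneg l x)]
    exact mul_le_mul_of_nonneg_left (hwB n _) (P.nonneg l x)
  · refine cauchyN_of_sConv g P he isOpen_interior hVt hA hρ hAi ?_ fun n =>
      tsupport_mul_subset_left
    exact (hwc.mul isOpen_interior (hρs.mono hVt)).congr isOpen_interior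
      fun n => (heq n).mono hVt
  · obtain ⟨C, hC⟩ := isCompact_univ.bddAbove_image (P.smooth_ρ l).continuous.norm.continuousOn
    refine hf2.of_le_mul (c := C) ((P.smooth_ρ l).continuous.aestronglyMeasurable.mul hf2.1)
      (.of_forall fun x => ?_)
    rw [norm_mul]
    exact mul_le_mul_of_nonneg_right (hC (Set.mem_image_of_mem _ (Set.mem_univ x))) (norm_nonneg _)
  · obtain ⟨C, hC, hb⟩ := exists_eLpNorm_le_comp_symm g he hA hρ
    have hK := isCompact_image_tsupport hρ
    have h1 := (hwF.mul (hρs.continuousOn.mono hVt) _ hAi hK).2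
    refine tendsto_of_tendsto_of_tendsto_of_le_of_le tendsto_const_nhds
      (h := fun n => C * eLpNorm (fun y => (P.ρ l ∘ (P.ch l).symm) y * w n y -
        (P.ρ l ∘ (P.ch l).symm) y * (f ∘ (P.ch l).symm) y) 2
        (volume.restrict ((P.ch l) '' tsupport (P.ρ l)))) ?_
      (fun _ => zero_le) fun n => ?_
    · simpa using ENNReal.Tendsto.const_mul h1 (Or.inr hC)
    · refine (hb _ ((hsm n).continuous.aestronglyMeasurable.sub
        ((P.smooth_ρ l).continuous.aestronglyMeasurable.mul hf2.1)) fun x hx => ?_).trans ?_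
      · simp [image_eq_zero_of_notMem_tsupport hx]
      · refine le_of_eq (congrArg (C * ·) (eLpNorm_congr_ae ?_))
        filter_upwards [ae_restrict_mem hK.measurableSet] with y hy
        have := heq n (hVt (hAi hy))
        simp only [Function.comp] at this ⊢
        simp only [Pi.sub_apply, Pi.mul_apply, this]

/-- Bounded Sobolev functions are limits of uniformly bounded sequences of smooth functions. -/
lemma exists_approx {k : ℕ} {f : M → ℝ} {B : ℝ} (hB : 0 ≤ B) (hf : MemSobolev m k f)
    (hf2 : MemLp f 2 (vol g)) (hfB : ∀ᵐ x ∂vol g, |f x| ≤ B) :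
    ∃ v : ℕ → smoothAlgebra m M, (∀ n x, |(v n : M → ℝ) x| ≤ B) ∧ Approx g P k v f := by
  choose v hvB hvc hvf using exists_local_approx g P hB hf hf2 hfB
  refine ⟨fun n => ∑ l, v l n, fun n x => ?_, SobolevAlgebra.CauchyN.sum fun l _ => hvc l, ?_⟩
  · rw [AddSubmonoidClass.coe_finsetSum, Finset.sum_apply]
    calc |∑ l, (v l n : M → ℝ) x| ≤ ∑ l, |(v l n : M → ℝ) x| := Finset.abs_sum_le_sum_abs _ _
      _ ≤ ∑ l, P.ρ l x * B := Finset.sum_le_sum fun l _ => hvB l n x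
      _ = B := by rw [← Finset.sum_mul, P.sum_eq_one, one_mul]
  · convert ConvL2.sum Finset.univ fun l _ => hvf l using 1
    ext x
    rw [← Finset.sum_mul, P.sum_eq_one, one_mul]

end Density

end ExtrinsicHarmonic

/-! ### Weak Laplacians and weak gradients as limits -/

namespace ExtrinsicHarmonic

section Limits

variable {m : ℕ} {M : Type*} [TopologicalSpace M]
  [ChartedSpace (EuclideanSpace ℝ (Fin m)) M] [IsManifold (𝓡 m) ∞ M]
  {e : OpenPartialHomeomorph M (EuclideanSpace ℝ (Fin m))}
  {g : SmoothMetric m M} [T2Space M] [CompactSpace M] [MeasurableSpace M] [BorelSpace M]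
  [IsFiniteMeasure (vol g)]

lemma memLp_coe (f : smoothAlgebra m M) : MemLp (f : M → ℝ) 2 (vol g) := by
  obtain ⟨P⟩ := nonempty_chartPartition (m := m) (M := M)
  exact (laplaceAlgebra g P).memLp f 2

lemma ConvL2.tendsto_toLp {v : ℕ → smoothAlgebra m M} {f : M → ℝ} (h : ConvL2 g v f) :
    Tendsto (fun n => (memLp_coe (g := g) (v n)).toLp) atTop (𝓝 (h.1.toLp f)) := by
  rw [tendsto_iff_edist_tendsto_0]
  refine h.2.congr fun n => ?_
  rw [Lp.edist_toLp_toLp]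
  rfl

lemma ConvL2.ae_unique {v : ℕ → smoothAlgebra m M} {f f' : M → ℝ} (h : ConvL2 g v f)
    (h' : ConvL2 g v f') : f =ᵐ[vol g] f' :=
  (MemLp.toLp_eq_toLp_iff h.1 h'.1).mp (tendsto_nhds_unique h.tendsto_toLp h'.tendsto_toLp)

lemma integral_mul_eq_inner {f h : M → ℝ} (hf : MemLp f 2 (vol g)) (hh : MemLp h 2 (vol g)) :
    ∫ x, f x * h x ∂vol g = inner ℝ (hf.toLp f) (hh.toLp h) := by
  rw [L2.inner_def]
  refine integral_congr_ae ?_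
  filter_upwards [hf.coeFn_toLp, hh.coeFn_toLp] with x hx hy
  simp [hx, hy, mul_comm]

lemma ConvL2.tendsto_integral_mul {v w : ℕ → smoothAlgebra m M} {f h : M → ℝ}
    (hv : ConvL2 g v f) (hw : ConvL2 g w h) :
    Tendsto (fun n => ∫ x, (v n : M → ℝ) x * (w n : M → ℝ) x ∂vol g) atTop
      (𝓝 (∫ x, f x * h x ∂vol g)) := by
  rw [integral_mul_eq_inner hv.1 hw.1]
  simp only [integral_mul_eq_inner (memLp_coe (g := g) (v _)) (memLp_coe (w _))]
  exact hv.tendsto_toLp.inner hw.tendsto_toLp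

lemma convL2_const (φ : smoothAlgebra m M) : ConvL2 g (fun _ => φ) φ :=
  ⟨memLp_coe φ, by simp⟩

lemma exists_abs_le (f : smoothAlgebra m M) : ∃ C : ℝ, 0 < C ∧ ∀ x, |(f : M → ℝ) x| ≤ C := by
  obtain ⟨C, hC⟩ := isCompact_univ.bddAbove_image (contMDiff_coe f).continuous.abs.continuousOn
  exact ⟨max C 1, by positivity,
    fun x => (hC (Set.mem_image_of_mem _ (Set.mem_univ x))).trans (le_max_left _ _)⟩

lemma ConvL2.mul_left {v : ℕ → smoothAlgebra m M} {f : M → ℝ} (h : ConvL2 g v f)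
    (φ : smoothAlgebra m M) : ConvL2 g (fun n => φ * v n) (fun x => (φ : M → ℝ) x * f x) := by
  obtain ⟨C, hC0, hC⟩ := exists_abs_le φ
  have hb : ∀ᵐ x ∂vol g, ‖(φ : M → ℝ) x‖ ≤ C := .of_forall hC
  have hφ := (contMDiff_coe φ).continuous.aestronglyMeasurable (μ := vol g)
  have hle : ∀ w : M → ℝ, eLpNorm (fun x => (φ : M → ℝ) x * w x) 2 (vol g) ≤
      ENNReal.ofReal C * eLpNorm w 2 (vol g) := fun w => by
    refine eLpNorm_le_mul_eLpNorm_of_ae_le_mul (.of_forall fun x => ?_) 2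
    rw [norm_mul]
    exact mul_le_mul_of_nonneg_right (hC x) (norm_nonneg _)
  refine ⟨⟨hφ.mul h.1.1, (hle f).trans_lt (ENNReal.mul_lt_top ENNReal.ofReal_lt_top h.1.2)⟩,
    tendsto_of_tendsto_of_tendsto_of_le_of_le tendsto_const_nhds
      (h := fun n => ENNReal.ofReal C * eLpNorm (fun x => (v n : M → ℝ) x - f x) 2 (vol g)) ?_
      (fun _ => zero_le) fun n => ?_⟩
  · simpa using ENNReal.Tendsto.const_mul h.2 (Or.inr ENNReal.ofReal_ne_top)
  · refine le_trans (le_of_eq ?_) (hle _)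
    congr 1
    ext x
    simp only [MulMemClass.coe_mul, Pi.mul_apply]
    ring

lemma ConvL2.smul {v : ℕ → smoothAlgebra m M} {f : M → ℝ} (h : ConvL2 g v f) (c : ℝ) :
    ConvL2 g (fun n => c • v n) (fun x => c * f x) := by
  convert h.mul_left (algebraMap ℝ _ c) using 2
  · rw [Algebra.smul_def]
  · rfl

lemma ConvL2.comp {v : ℕ → smoothAlgebra m M} {f : M → ℝ} (h : ConvL2 g v f) {s : ℕ → ℕ}
    (hs : Tendsto s atTop atTop) : ConvL2 g (fun n => v (s n)) f := ⟨h.1, h.2.comp hs⟩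

lemma ae_eq_of_integral_mul_smooth_eq {f h : M → ℝ} (hf : Integrable f (vol g))
    (hh : Integrable h (vol g))
    (H : ∀ φ : smoothAlgebra m M, ∫ x, f x * (φ : M → ℝ) x ∂vol g =
      ∫ x, h x * (φ : M → ℝ) x ∂vol g) : f =ᵐ[vol g] h := by
  have h1 := ae_eq_zero_of_integral_contMDiff_smul_eq_zero (𝓡 m) (μ := vol g)
    (f := fun x => f x - h x) (hf.sub hh).locallyIntegrable fun φ hφ _ => by
      have h2 := H ⟨φ, hφ⟩
      obtain ⟨C, -, hC⟩ := exists_abs_le (⟨φ, hφ⟩ : smoothAlgebra m M)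
      have hb : ∀ᵐ x ∂vol g, ‖φ x‖ ≤ C := .of_forall hC
      have hm := hφ.continuous.aestronglyMeasurable (μ := vol g)
      simp only [smul_eq_mul, mul_comm (φ _), sub_mul]
      rw [integral_sub (hf.mul_bdd hm hb) (hh.mul_bdd hm hb)]
      exact sub_eq_zero.mpr h2
  filter_upwards [h1] with x hx using sub_eq_zero.mp hx

lemma IsWeakLap.ae_unique {s : ℕ} {f h h' : M → ℝ} (H : IsWeakLap g s f h)
    (H' : IsWeakLap g s f h') : h =ᵐ[vol g] h' :=
  ae_eq_of_integral_mul_smooth_eq (H.1.integrable (by norm_num)) (H'.1.integrable (by norm_num))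
    fun φ => (H.2 φ (contMDiff_coe φ)).trans (H'.2 φ (contMDiff_coe φ)).symm

lemma IsWeakLap.wlap_ae_eq {s : ℕ} {f h : M → ℝ} (H : IsWeakLap g s f h) :
    wlap g s f =ᵐ[vol g] h := by
  have h1 : ∃ h, IsWeakLap g s f h := ⟨h, H⟩
  rw [wlap, dif_pos h1]
  exact h1.choose_spec.ae_unique H

variable {P : ChartPartition m M}

lemma isWeakLap_of_convL2 {s : ℕ} {v : ℕ → smoothAlgebra m M} {f h : M → ℝ} (hv : ConvL2 g v f)
    (hL : ConvL2 g (fun n => ((laplaceAlgebra g P).L ^ s) (v n)) h) : IsWeakLap g s f h := by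
  refine ⟨hL.1, fun φ hφ => ?_⟩
  have h1 := hL.tendsto_integral_mul (convL2_const ⟨φ, hφ⟩)
  have h2 := hv.tendsto_integral_mul (convL2_const (((laplaceAlgebra g P).L ^ s) ⟨φ, hφ⟩))
  rw [laplaceAlgebra_L_pow] at h2
  refine tendsto_nhds_unique h1 (h2.congr fun n => ?_)
  have h3 := (laplaceAlgebra g P).L_pow_comm s (v n) ⟨φ, hφ⟩
  rw [mul_comm (⟨φ, hφ⟩ : smoothAlgebra m M)] at h3
  simp only [laplaceAlgebra_ev, MulMemClass.coe_mul, Pi.mul_apply,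
    laplaceAlgebra_L_pow g P s ⟨φ, hφ⟩] at h3
  exact h3

lemma Approx.mono {j k : ℕ} {v : ℕ → smoothAlgebra m M} {f : M → ℝ} (h : Approx g P k v f)
    (hj : j ≤ k) : Approx g P j v f := ⟨h.1.mono hj, h.2⟩

lemma approx_const (k : ℕ) (φ : smoothAlgebra m M) : Approx g P k (fun _ => φ) φ :=
  ⟨SobolevAlgebra.CauchyN.const φ, convL2_const φ⟩

lemma Approx.add {k : ℕ} {v w : ℕ → smoothAlgebra m M} {f h : M → ℝ} (hv : Approx g P k v f)
    (hw : Approx g P k w h) : Approx g P k (fun n => v n + w n) (fun x => f x + h x) :=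
  ⟨hv.1.add hw.1, hv.2.add hw.2⟩

lemma Approx.mul_left {k : ℕ} {v : ℕ → smoothAlgebra m M} {f : M → ℝ} (hv : Approx g P k v f)
    (φ : smoothAlgebra m M) : Approx g P k (fun n => φ * v n) (fun x => (φ : M → ℝ) x * f x) :=
  ⟨hv.1.mul_left φ, hv.2.mul_left φ⟩

lemma Approx.congr_ae {k : ℕ} {v : ℕ → smoothAlgebra m M} {f f' : M → ℝ} (h : Approx g P k v f)
    (hf : f =ᵐ[vol g] f') : Approx g P k v f' := ⟨h.1, h.2.congr_ae g hf⟩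

/-- `L^s v_n` is Cauchy in W^{j,2} because `L` has order two. Its limit satisfies the weak equation,
whose solution is unique almost everywhere, so it is the chosen `wlap`. -/
lemma Approx.wlap {j k s : ℕ} {v : ℕ → smoothAlgebra m M} {f : M → ℝ} (h : Approx g P k v f)
    (hj : j + 2 * s ≤ k) :
    Approx g P j (fun n => ((laplaceAlgebra g P).L ^ s) (v n)) (wlap g s f) := by
  have h1 : (laplaceAlgebra g P).CauchyN j fun n => ((laplaceAlgebra g P).L ^ s) (v n) :=
    (LaplaceAlgebra.bdd_L_pow j s).cauchyN (h.1.mono hj)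
  obtain ⟨f', hf'⟩ := exists_convL2 g P h1
  exact ⟨h1, hf'.congr_ae g (isWeakLap_of_convL2 (P := P) h.2 hf').wlap_ae_eq.symm⟩

variable (g P) in
/-- The vector field with the components `z`. -/
noncomputable def vecOfComponents (z : P.t × Fin m → M → ℝ) (x : M) : TangentSpace (𝓡 m) x :=
  ∑ α, ∑ β, (P.metricCoeff g α β x * z α x) • grad g (P.coord β) x

lemma IsWeakDeriv.congr_ae {U : Set (EuclideanSpace ℝ (Fin m))} (hU : IsOpen U) {j : ℕ}
    {α : Fin j → Fin m} {F H H' : EuclideanSpace ℝ (Fin m) → ℝ} (h : IsWeakDeriv U α F H)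
    (hH : H =ᵐ[volume.restrict U] H') (hL : LocallyIntegrableOn H' U) : IsWeakDeriv U α F H' := by
  refine ⟨h.1, hL, fun φ hφ hc hs => ?_⟩
  rw [h.2.2 φ hφ hc hs]
  congr 1
  refine integral_congr_ae ?_
  filter_upwards [(ae_restrict_iff' hU.measurableSet).mp hH] with y hy
  by_cases hyU : y ∈ U
  · rw [hy hyU]
  · rw [image_eq_zero_of_notMem_tsupport fun h => hyU (hs h), mul_zero, mul_zero]

lemma inner_vecOfComponents_coordVec (he : e ∈ atlas (EuclideanSpace ℝ (Fin m)) M)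
    {y : EuclideanSpace ℝ (Fin m)} (hy : y ∈ e.target) (z : P.t × Fin m → M → ℝ) (i : Fin m) :
    g.inner (e.symm y) (vecOfComponents g P z (e.symm y)) (coordVec e y i) =
      ∑ α, ∑ β, (P.metricCoeff g α β ∘ e.symm) y * pd i (P.coord β ∘ e.symm) y *
        (z α ∘ e.symm) y := by
  simp only [vecOfComponents, map_sum, map_smul, sum_apply, smul_apply, smul_eq_mul]
  refine Finset.sum_congr rfl fun α _ => Finset.sum_congr rfl fun β _ => ?_
  rw [inner_grad_coordVec g he hy (mdiffAt (P.contMDiff_coord β) _), Function.comp, Function.comp]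
  ring

lemma LConvTo.finset_sum {U : Set (EuclideanSpace ℝ (Fin m))} {κ : Type*} (s : Finset κ)
    {T : κ → ℕ → EuclideanSpace ℝ (Fin m) → ℝ} {H : κ → EuclideanSpace ℝ (Fin m) → ℝ}
    (h : ∀ a ∈ s, LConvTo U (T a) (H a)) (hc : ∀ a n, ContinuousOn (T a n) U) :
    LConvTo U (fun n y => ∑ a ∈ s, T a n y) fun y => ∑ a ∈ s, H a y := by
  classical
  induction s using Finset.induction_on with
  | empty => exact fun K _ _ => ⟨by simp, by simp⟩
  | insert a s ha ih =>
    simp only [Finset.sum_insert ha]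
    exact (h a (by simp)).add (ih fun b hb => h b (by simp [hb])) (hc a)
      fun n => continuousOn_finsetSum _ fun b _ => hc b n

lemma lConvTo_pd (he : e ∈ atlas (EuclideanSpace ℝ (Fin m)) M) {v : ℕ → smoothAlgebra m M}
    {z : P.t × Fin m → M → ℝ} (hz : ∀ α, ConvL2 g (fun n => (sobAlg g P).D α (v n)) (z α))
    (i : Fin m) : LConvTo e.target (fun n => pd i ((v n : M → ℝ) ∘ e.symm))
      fun y => ∑ α, ∑ β, (P.metricCoeff g α β ∘ e.symm) y * pd i (P.coord β ∘ e.symm) y *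
        (z α ∘ e.symm) y := by
  have hc : ∀ α β, ContinuousOn (fun y => (P.metricCoeff g α β ∘ e.symm) y *
      pd i (P.coord β ∘ e.symm) y) e.target := fun α β =>
    ((contDiffOn_comp_symm he (P.contMDiff_metricCoeff g α β)).mul
      (contDiffOn_pd e.open_target (contDiffOn_comp_symm he (P.contMDiff_coord β)) i)).continuousOn
  have hD : ∀ α n, ContinuousOn (((sobAlg g P).D α (v n) : M → ℝ) ∘ e.symm) e.target := fun α n =>
    (contDiffOn_comp_symm he (contMDiff_coe _)).continuousOn
  refine LConvTo.congr (LConvTo.finset_sum _ (fun α _ => LConvTo.finset_sum _ (fun β _ =>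
    ((hz α).lConvTo he).mul (hc α β)) fun β n => (hc α β).mul (hD α n)) fun α n =>
      continuousOn_finsetSum _ fun β _ => (hc α β).mul (hD α n)) fun n => ?_
  exact pd_comp_symm_eq_sum g P he i (v n)

lemma isWeakGrad_vecOfComponents {v : ℕ → smoothAlgebra m M} {f : M → ℝ}
    (hv : Approx g P 1 v f) {z : P.t × Fin m → M → ℝ}
    (hz : ∀ α, ConvL2 g (fun n => (sobAlg g P).D α (v n)) (z α)) :
    IsWeakGrad g f (vecOfComponents g P z) := by
  intro e he i
  obtain ⟨H, h1, h2⟩ := (CauchyN.sConv g P he hv.1).exists_isWeakDeriv e.open_target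
    (hv.2.lConvTo he) le_rfl (fun _ : Fin 1 => i)
  have hs : ∀ n, ContDiffOn ℝ ∞ ((v n : M → ℝ) ∘ e.symm) e.target := fun n =>
    contDiffOn_comp_symm he (contMDiff_coe (v n))
  have h3 := lConvTo_pd he hz i
  have e1 : ∀ n, Set.EqOn (partialD (fun _ : Fin 1 => i) ((v n : M → ℝ) ∘ e.symm))
      (pd i ((v n : M → ℝ) ∘ e.symm)) e.target := by
    intro n
    have := partialD_cons e.open_target (hs n) i Fin.elim0
    rw [partialD_zero] at this
    convert this using 2
    ext j
    fin_cases j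
    rfl
  have h4 : LConvTo e.target (fun n => pd i ((v n : M → ℝ) ∘ e.symm)) H := LConvTo.congr h2 e1
  have h5 := h4.ae_unique e.open_target
    (fun n => (contDiffOn_pd e.open_target (hs n) i).continuousOn) h3
  have h6 : (fun y => ∑ α, ∑ β, (P.metricCoeff g α β ∘ e.symm) y * pd i (P.coord β ∘ e.symm) y *
      (z α ∘ e.symm) y) =ᵐ[volume.restrict e.target]
      fun y => g.inner (e.symm y) (vecOfComponents g P z (e.symm y)) (coordVec e y i) := by
    filter_upwards [ae_restrict_mem e.open_target.measurableSet] with y hy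
    exact (inner_vecOfComponents_coordVec he hy z i).symm
  exact h1.congr_ae e.open_target (h5.trans h6)
    (LocallyIntegrableOn.congr h6 (h3.locallyIntegrableOn e.open_target))

lemma IsWeakGrad.ae_unique {f : M → ℝ} {X Y : (x : M) → TangentSpace (𝓡 m) x}
    (hX : IsWeakGrad g f X) (hY : IsWeakGrad g f Y) : ∀ᵐ x ∂vol g, X x = Y x := by
  refine ae_of_charts g fun e he => ?_
  have h1 := ae_all_iff.mpr fun i => (hX e he i).ae_unique e.open_target (hY e he i)
  filter_upwards [h1, ae_restrict_mem e.open_target.measurableSet] with y hy hyt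
  exact ext_coordVec g he hyt hy

lemma IsWeakGrad.wgrad_ae_eq {f : M → ℝ} {X : (x : M) → TangentSpace (𝓡 m) x}
    (hX : IsWeakGrad g f X) : ∀ᵐ x ∂vol g, wgrad g f x = X x := by
  have h1 : ∃ X, IsWeakGrad g f X := ⟨X, hX⟩
  rw [wgrad, dif_pos h1]
  exact h1.choose_spec.ae_unique hX

end Limits

end ExtrinsicHarmonic

/-! ### Inner products of weak gradients -/

namespace ExtrinsicHarmonic

section WeakGradient

variable {m : ℕ} {M : Type*} [TopologicalSpace M]
  [ChartedSpace (EuclideanSpace ℝ (Fin m)) M] [IsManifold (𝓡 m) ∞ M]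
  {e : OpenPartialHomeomorph M (EuclideanSpace ℝ (Fin m))}
  {g : SmoothMetric m M} [T2Space M] [CompactSpace M] [MeasurableSpace M] [BorelSpace M]
  [IsFiniteMeasure (vol g)] {P : ChartPartition m M}

/-- The components `z α` are not independent, since the derivations are an overcomplete frame. The
relation `D β v = ∑ G α γ (D γ F_β) (D α v)` holds for smooth `v` and passes to the L² limit. -/
lemma inner_grad_coord_vecOfComponents_ae_eq {v : ℕ → smoothAlgebra m M}
    {z : P.t × Fin m → M → ℝ} (hz : ∀ α, ConvL2 g (fun n => (sobAlg g P).D α (v n)) (z α))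
    (β : P.t × Fin m) :
    (fun x => g.inner x (vecOfComponents g P z x) (grad g (P.coord β) x)) =ᵐ[vol g] z β := by
  let S := laplaceAlgebra g P
  let a : P.t × Fin m → P.t × Fin m → smoothAlgebra m M := fun α γ =>
    S.G α γ * S.D γ ⟨P.coord β, P.contMDiff_coord β⟩
  have h1 : ConvL2 g (fun n => ∑ α, ∑ γ, a α γ * S.D α (v n))
      (fun x => ∑ α, ∑ γ, (a α γ : M → ℝ) x * z α x) :=
    ConvL2.sum _ fun α _ => ConvL2.sum _ fun γ _ => (hz α).mul_left (a α γ)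
  have h2 : ∀ n, ∑ α, ∑ γ, a α γ * S.D α (v n) = S.D β (v n) := by
    intro n
    have e1 : S.D β (v n) = S.Γ (v n) ⟨P.coord β, P.contMDiff_coord β⟩ := by
      rw [S.Γ_comm]; rfl
    rw [e1, S.Γ_eq]
    exact Finset.sum_congr rfl fun α _ => Finset.sum_congr rfl fun γ _ => by simp only [a]; ring
  simp only [h2] at h1
  filter_upwards [h1.ae_unique (hz β)] with x hx
  rw [← hx]
  simp only [vecOfComponents, map_sum, map_smul, sum_apply, smul_apply, smul_eq_mul]
  refine Finset.sum_congr rfl fun α _ => Finset.sum_congr rfl fun γ _ => ?_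
  change P.metricCoeff g α γ x * z α x * gam g (P.coord γ) (P.coord β) x =
    P.metricCoeff g α γ x * gam g (P.coord γ) (P.coord β) x * z α x
  ring

lemma inner_vecOfComponents_ae_eq {v : ℕ → smoothAlgebra m M}
    {z z' : P.t × Fin m → M → ℝ} (hz : ∀ α, ConvL2 g (fun n => (sobAlg g P).D α (v n)) (z α)) :
    (fun x => g.inner x (vecOfComponents g P z x) (vecOfComponents g P z' x)) =ᵐ[vol g]
      fun x => ∑ α, ∑ β, P.metricCoeff g α β x * z' α x * z β x := by
  have h1 := ae_all_iff.mpr fun β => inner_grad_coord_vecOfComponents_ae_eq hz β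
  filter_upwards [h1] with x hx
  rw [show vecOfComponents g P z' x = ∑ α, ∑ β, (P.metricCoeff g α β x * z' α x) •
    grad g (P.coord β) x from rfl]
  simp only [map_sum, map_smul, smul_eq_mul, hx]

lemma Approx.exists_components {v : ℕ → smoothAlgebra m M} {f : M → ℝ} (hv : Approx g P 1 v f) :
    ∃ z : P.t × Fin m → M → ℝ, ∀ α, ConvL2 g (fun n => (sobAlg g P).D α (v n)) (z α) := by
  choose z hz using fun α => exists_convL2 g P (hv.1.dw (j := 0) [α] (by simp))
  exact ⟨z, hz⟩

lemma gradDot_ae_eq {v w : ℕ → smoothAlgebra m M} {f h : M → ℝ} (hv : Approx g P 1 v f)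
    (hw : Approx g P 1 w h) {z z' : P.t × Fin m → M → ℝ}
    (hz : ∀ α, ConvL2 g (fun n => (sobAlg g P).D α (v n)) (z α))
    (hz' : ∀ α, ConvL2 g (fun n => (sobAlg g P).D α (w n)) (z' α)) :
    gradDot g f h =ᵐ[vol g] fun x => ∑ α, ∑ β, P.metricCoeff g α β x * z α x * z' β x := by
  filter_upwards [(isWeakGrad_vecOfComponents hv hz).wgrad_ae_eq,
    (isWeakGrad_vecOfComponents hw hz').wgrad_ae_eq,
    inner_vecOfComponents_ae_eq (z' := z) hz'] with x h1 h2 h3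
  rw [gradDot, h1, h2, g.symm, h3]

lemma Approx.gradDot_left {j k : ℕ} {v : ℕ → smoothAlgebra m M} {f : M → ℝ}
    (hv : Approx g P k v f) (hj : j + 1 ≤ k) (φ : smoothAlgebra m M) :
    Approx g P j (fun n => (laplaceAlgebra g P).Γ φ (v n)) (gradDot g φ f) := by
  have hv1 : Approx g P 1 v f := hv.mono (by omega)
  obtain ⟨z, hz⟩ := hv1.exists_components
  refine ⟨(LaplaceAlgebra.bdd_Γ j φ).cauchyN (hv.1.mono hj), ?_⟩
  let S := laplaceAlgebra g P
  have h2 : ConvL2 g (fun n => ∑ α, ∑ β, (S.G α β * S.D α φ) * S.D β (v n))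
      (fun x => ∑ α, ∑ β, ((S.G α β * S.D α φ : smoothAlgebra m M) : M → ℝ) x * z β x) :=
    ConvL2.sum _ fun α _ => ConvL2.sum _ fun β _ => (hz β).mul_left _
  have h3 := gradDot_ae_eq (approx_const 1 φ) hv1 (fun α => convL2_const (S.D α φ)) hz
  simp only [← S.Γ_eq] at h2
  exact h2.congr_ae g h3.symm

lemma memLp_mul_smooth {f : M → ℝ} (hf : MemLp f 2 (vol g)) (φ : smoothAlgebra m M) :
    MemLp (fun x => (φ : M → ℝ) x * f x) 2 (vol g) := by
  obtain ⟨C, hC0, hC⟩ := exists_abs_le φ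
  refine hf.of_le_mul (c := C)
    ((contMDiff_coe φ).continuous.aestronglyMeasurable.mul hf.1) (.of_forall fun x => ?_)
  rw [norm_mul]
  exact mul_le_mul_of_nonneg_right (hC x) (norm_nonneg _)

lemma integrable_gradDot {v w : ℕ → smoothAlgebra m M} {f h : M → ℝ} (hv : Approx g P 1 v f)
    (hw : Approx g P 1 w h) : Integrable (gradDot g f h) (vol g) := by
  obtain ⟨z, hz⟩ := hv.exists_components
  obtain ⟨z', hz'⟩ := hw.exists_components
  refine Integrable.congr (integrable_finsetSum _ fun α _ => integrable_finsetSum _ fun β _ => ?_)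
    (gradDot_ae_eq hv hw hz hz').symm
  exact (memLp_mul_smooth (hz α).1 ((laplaceAlgebra g P).G α β)).integrable_mul (hz' β).1

lemma Approx.tendsto_integral_Γ_mul {v w : ℕ → smoothAlgebra m M} {f h : M → ℝ}
    (hv : Approx g P 1 v f) (hw : Approx g P 1 w h) (φ : smoothAlgebra m M) :
    Tendsto (fun n => ∫ x, (((laplaceAlgebra g P).Γ (v n) (w n) * φ : smoothAlgebra m M) :
      M → ℝ) x ∂vol g) atTop (𝓝 (∫ x, gradDot g f h x * (φ : M → ℝ) x ∂vol g)) := by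
  obtain ⟨z, hz⟩ := hv.exists_components
  obtain ⟨z', hz'⟩ := hw.exists_components
  let S := laplaceAlgebra g P
  have e1 : ∫ x, gradDot g f h x * (φ : M → ℝ) x ∂vol g =
      ∑ α, ∑ β, ∫ x, (((S.G α β * φ : smoothAlgebra m M) : M → ℝ) x * z α x) * z' β x ∂vol g := by
    have hi : ∀ α β, Integrable (fun x => (((S.G α β * φ : smoothAlgebra m M) : M → ℝ) x * z α x) *
        z' β x) (vol g) := fun α β => (memLp_mul_smooth (hz α).1 _).integrable_mul (hz' β).1
    simp only [← integral_finsetSum _ fun β _ => hi _ β]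
    rw [← integral_finsetSum _ fun α _ => integrable_finsetSum _ fun β _ => hi α β]
    refine integral_congr_ae ?_
    filter_upwards [gradDot_ae_eq hv hw hz hz'] with x hx
    rw [hx]
    simp only [Finset.sum_mul]
    refine Finset.sum_congr rfl fun α _ => Finset.sum_congr rfl fun β _ => ?_
    change _ = P.metricCoeff g α β x * (φ : M → ℝ) x * z α x * z' β x
    ring
  have e2 : ∀ n, ∫ x, ((S.Γ (v n) (w n) * φ : smoothAlgebra m M) : M → ℝ) x ∂vol g =
      ∑ α, ∑ β, ∫ x, ((S.G α β * φ * S.D α (v n) : smoothAlgebra m M) : M → ℝ) x *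
        (S.D β (w n) : M → ℝ) x ∂vol g := by
    intro n
    have e3 : S.Γ (v n) (w n) * φ =
        ∑ α, ∑ β, (S.G α β * φ * S.D α (v n)) * S.D β (w n) := by
      rw [S.Γ_eq]
      simp only [Finset.sum_mul]
      exact Finset.sum_congr rfl fun α _ => Finset.sum_congr rfl fun β _ => by ring
    have e4 := S.integral_sum Finset.univ fun α => ∑ β, (S.G α β * φ * S.D α (v n)) * S.D β (w n)
    rw [← e3] at e4
    simp only [S.integral_sum] at e4
    exact e4
  simp only [e1]
  refine Tendsto.congr (fun n => (e2 n).symm) ?_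
  exact tendsto_finsetSum _ fun α _ => tendsto_finsetSum _ fun β _ =>
    ((hz α).mul_left _).tendsto_integral_mul (hz' β)

lemma Approx.tendsto_integral_Γ {v w : ℕ → smoothAlgebra m M} {f h : M → ℝ}
    (hv : Approx g P 1 v f) (hw : Approx g P 1 w h) :
    Tendsto (fun n => ∫ x, ((laplaceAlgebra g P).Γ (v n) (w n) : M → ℝ) x ∂vol g) atTop
      (𝓝 (∫ x, gradDot g f h x ∂vol g)) := by
  simpa using hv.tendsto_integral_Γ_mul hw 1

end WeakGradient

end ExtrinsicHarmonic

/-! ### Duality pairings, multiplier and energy along approximations -/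

namespace ExtrinsicHarmonic

section Pairings

variable {m : ℕ} {M : Type*} [TopologicalSpace M]
  [ChartedSpace (EuclideanSpace ℝ (Fin m)) M] [IsManifold (𝓡 m) ∞ M]
  {g : SmoothMetric m M} [T2Space M] [CompactSpace M] [MeasurableSpace M] [BorelSpace M]
  [IsFiniteMeasure (vol g)] {P : ChartPartition m M}

/-- For smooth functions all three cases equal `∫ L^p v · w`, by self-adjointness and Green's
formula. Each case puts at most `k` derivatives on `v` and, as `2p ≤ k + l`, at most `l` on `w`, so
it converges under the given approximations. -/
lemma Approx.tendsto_lapPair {k l p : ℕ} (hp : 2 * p ≤ k + l) {v w : ℕ → smoothAlgebra m M}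
    {f h : M → ℝ} (hv : Approx g P k v f) (hw : Approx g P l w h) :
    Tendsto (fun n => ∫ x, (((laplaceAlgebra g P).L ^ p) (v n) * w n : smoothAlgebra m M).1 x ∂vol g)
      atTop (𝓝 (lapPair g k p f h)) := by
  let S := laplaceAlgebra g P
  rw [lapPair]
  split_ifs with h1 h2
  · exact (hv.wlap (j := 0) (s := p) (by omega)).2.tendsto_integral_mul hw.2
  · obtain ⟨s, rfl⟩ := h2
    have e1 : (s + s) / 2 = s := by omega
    rw [e1]
    refine ((hv.wlap (j := 0) (s := s) (by omega)).2.tendsto_integral_mul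
      (hw.wlap (j := 0) (s := p - s) (by omega)).2).congr fun n => ?_
    have e2 := S.L_pow_comm (p - s) ((S.L ^ s) (v n)) (w n)
    rw [← Module.End.mul_apply, ← pow_add, Nat.sub_add_cancel (by omega), mul_comm (w n)] at e2
    exact e2
  · obtain ⟨s, rfl⟩ : ∃ s, k = 2 * s + 1 := Nat.not_even_iff_odd.mp h2
    have e1 : (2 * s + 1) / 2 = s := by omega
    rw [e1]
    refine ((hv.wlap (j := 1) (s := s) (by omega)).tendsto_integral_Γ
      (hw.wlap (j := 1) (s := p - s - 1) (by omega))).neg.congr fun n => ?_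
    have e3 := S.green ((S.L ^ s) (v n)) ((S.L ^ (p - s - 1)) (w n))
    have e4 : S.L ((S.L ^ (p - s - 1)) (w n)) = (S.L ^ (p - s)) (w n) := by
      rw [← Module.End.mul_apply, ← pow_succ', show p - s - 1 + 1 = p - s by omega]
    rw [e4] at e3
    have e2 := S.L_pow_comm (p - s) ((S.L ^ s) (v n)) (w n)
    rw [← Module.End.mul_apply, ← pow_add, Nat.sub_add_cancel (by omega), mul_comm (w n)] at e2
    rw [e2, ← neg_eq_iff_eq_neg] at e3
    exact e3

lemma distLap_iterate (T : (M → ℝ) → ℝ) (j : ℕ) (φ : M → ℝ) :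
    (distLap g)^[j] T φ = T ((lap g)^[j] φ) := by
  induction j generalizing T with
  | zero => rfl
  | succ j ih => rw [Function.iterate_succ_apply, ih, distLap, ← Function.iterate_succ_apply' (lap g)]

/-- The multiplier of a map is the limit of the multipliers of smooth approximations. -/
lemma tendsto_smoothMultiplier {n k : ℕ} (hk : 2 ≤ k) {u : M → EuclideanSpace ℝ (Fin (n + 1))}
    {v : Fin (n + 1) → ℕ → smoothAlgebra m M} (hv : ∀ a, Approx g P k (v a) fun x => u x a)
    (φ : smoothAlgebra m M) :
    Tendsto (fun i => ∑ a, (laplaceAlgebra g P).smoothMultiplier k (v a i) φ) atTop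
      (𝓝 (multiplier g k u φ)) := by
  let S := laplaceAlgebra g P
  -- Two derivatives are spent on `Δu`, leaving W^{k-2,2}; this is just enough to pair with `Δ^p u`
  -- for `p ≤ k - 1`.
  have hL : ∀ a, Approx g P (k - 2) (fun i => S.L (v a i)) (wlap g 1 fun x => u x a) := fun a => by
    simpa using (hv a).wlap (j := k - 2) (s := 1) (by omega)
  have h1 : ∀ a, Approx g P 1 (v a) fun x => u x a := fun a => (hv a).mono (by omega)
  have e1 : multiplier g k u φ =
      ∑ a, ((∫ x, gradDot g (fun z => u z a) (fun z => u z a) x *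
        ((S.L ^ (k - 1)) φ : smoothAlgebra m M).1 x ∂vol g) +
      ∑ j ∈ Finset.range (k - 1), lapPair g k (k - 1 - j) (fun z => u z a)
        (fun x => ((S.L ^ j) φ : smoothAlgebra m M).1 x * wlap g 1 (fun z => u z a) x) +
      2 * ∑ j ∈ Finset.range (k - 1), -lapPair g k (k - 1 - j) (fun z => u z a)
        (fun x => ((S.L ^ j) φ : smoothAlgebra m M).1 x * wlap g 1 (fun z => u z a) x +
          gradDot g ((S.L ^ j) φ : smoothAlgebra m M) (fun z => u z a) x)) := by
    simp only [multiplier, Pi.add_apply, Pi.smul_apply, smul_eq_mul, Finset.sum_apply,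
      distLap_iterate, ofFun, lapDotLap, gradLapDotGrad, S, laplaceAlgebra_L_pow]
    rw [Finset.sum_add_distrib, Finset.sum_add_distrib, ← Finset.mul_sum]
    congr 1
    · congr 1
      · have hi : ∀ a, Integrable (fun x => gradDot g (fun z => u z a) (fun z => u z a) x *
            ((S.L ^ (k - 1)) φ : smoothAlgebra m M).1 x) (vol g) := fun a => by
          obtain ⟨C, -, hC⟩ := exists_abs_le ((S.L ^ (k - 1)) φ)
          exact (integrable_gradDot (h1 a) (h1 a)).mul_bdd
            (contMDiff_coe _).continuous.aestronglyMeasurable (.of_forall hC)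
        simp only [S, laplaceAlgebra_L_pow] at hi
        rw [← integral_finsetSum _ fun a _ => hi a]
        simp only [Finset.sum_mul]
      · exact Finset.sum_comm
    · congr 1
      simp only [← Finset.sum_neg_distrib]
      exact Finset.sum_comm
  rw [e1]
  refine tendsto_finsetSum _ fun a _ => Tendsto.add (Tendsto.add ?_ ?_) (Tendsto.const_mul 2 ?_)
  · exact (h1 a).tendsto_integral_Γ_mul (h1 a) _
  · refine tendsto_finsetSum _ fun j hj => ?_
    have hj' := Finset.mem_range.mp hj
    exact (hv a).tendsto_lapPair (by omega) ((hL a).mul_left ((S.L ^ j) φ))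
  · refine tendsto_finsetSum _ fun j hj => Tendsto.neg ?_
    have hj' := Finset.mem_range.mp hj
    exact (hv a).tendsto_lapPair (by omega) (((hL a).mul_left ((S.L ^ j) φ)).add
      ((hv a).gradDot_left (by omega) ((S.L ^ j) φ)))

lemma tendsto_energy {n k : ℕ} {u : M → EuclideanSpace ℝ (Fin (n + 1))}
    {v : Fin (n + 1) → ℕ → smoothAlgebra m M} (hv : ∀ a, Approx g P k (v a) fun x => u x a) :
    Tendsto (fun i => ∑ a, (laplaceAlgebra g P).q k (v a i) (v a i)) atTop
      (𝓝 (energy g k u)) := by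
  simp only [LaplaceAlgebra.q, energy]
  split_ifs with h
  · have hs : ∀ a, Approx g P 0 _ _ := fun a => (hv a).wlap (j := 0) (s := k / 2) (by omega)
    rw [integral_finsetSum _ fun a _ => (hs a).2.1.integrable_sq]
    refine tendsto_finsetSum _ fun a _ => ?_
    simp only [sq]
    exact (hs a).2.tendsto_integral_mul (hs a).2
  · have hs : ∀ a, Approx g P 1 _ _ := fun a => (hv a).wlap (j := 1) (s := k / 2) (by
      have := Nat.not_even_iff_odd.mp h
      obtain ⟨s, rfl⟩ := this
      omega)
    rw [integral_finsetSum _ fun a _ => integrable_gradDot (hs a) (hs a)]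
    exact tendsto_finsetSum _ fun a _ => (hs a).tendsto_integral_Γ (hs a)

end Pairings

end ExtrinsicHarmonic

/-! ### Double limits and expansions of the energy form -/

namespace ExtrinsicHarmonic

/-- A joint limit controls the iterated one. It compares the value with `n → ∞` for fixed `i` to the
value on the diagonal `n = i`. -/
lemma tendsto_zero_of_double {F : ℕ × ℕ → ℝ} {G : ℕ → ℝ} (hF : Tendsto F atTop (𝓝 0))
    (hG : ∀ i, Tendsto (fun n => F (i, n)) atTop (𝓝 (G i))) : Tendsto G atTop (𝓝 0) := by
  rw [Metric.tendsto_atTop] at hF ⊢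
  intro ε hε
  obtain ⟨⟨a, b⟩, h⟩ := hF (ε / 2) (by positivity)
  refine ⟨a, fun i hi => ?_⟩
  rw [Real.dist_0_eq_abs]
  have h1 : |G i| ≤ ε / 2 := le_of_tendsto (hG i).abs (by
    filter_upwards [eventually_ge_atTop b] with n hn
    have := h (i, n) ⟨hi, hn⟩
    rw [Real.dist_0_eq_abs] at this
    exact this.le)
  linarith

namespace SobolevAlgebra

variable {X : Type*} [MeasurableSpace X] {μ : Measure X} [IsFiniteMeasure μ]
  {𝒜 : Type*} [CommRing 𝒜] [Algebra ℝ 𝒜] {ι : Type*} [Fintype ι] {S : SobolevAlgebra μ 𝒜 ι}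
  {k : ℕ} {v : ℕ → 𝒜}

lemma CauchyN.comp (hv : S.CauchyN k v) {s : ℕ → ℕ} (hs : Tendsto s atTop atTop) :
    S.CauchyN k (fun i => v (s i)) := by
  rw [cauchyN_iff] at hv ⊢
  intro ε hε
  obtain ⟨n, hn⟩ := hv ε hε
  obtain ⟨n', hn'⟩ := eventually_atTop.mp (hs.eventually_ge_atTop n)
  exact ⟨n', fun i hi j hj => hn _ (hn' i hi) _ (hn' j hj)⟩

lemma cauchyN_of_tendsto (hv : Tendsto (fun i => S.N k (v i)) atTop (𝓝 0)) : S.CauchyN k v := by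
  have h1 : Tendsto (fun p : ℕ × ℕ => S.N k (v p.1) + S.N k (v p.2)) atTop (𝓝 (0 + 0)) := by
    rw [← prod_atTop_atTop_eq]
    exact (hv.comp tendsto_fst).add (hv.comp tendsto_snd)
  rw [add_zero] at h1
  exact squeeze_zero (fun _ => S.N_nonneg _ _) (fun p => S.N_sub_le _ _ _) h1

/-- The derivations are closable: `D v_i` has an L² limit by the Cauchy property, and integration by
parts shows this limit is orthogonal to every smooth function. -/
lemma tendsto_lp_dw_zero (hv : S.CauchyN k v) (h0 : Tendsto (fun i => S.lp (v i)) atTop (𝓝 0))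
    (hext : ∀ h : Lp ℝ 2 μ, (∀ φ, inner ℝ h (S.lp φ) = 0) → h = 0)
    (I : List ι) (hI : I.length ≤ k) : Tendsto (fun i => S.lp (S.dw I (v i))) atTop (𝓝 0) := by
  induction I generalizing v k with
  | nil => exact h0
  | cons α I ih =>
    have hk : I.length + 1 ≤ k := by simpa using hI
    have h1 : S.CauchyN I.length fun i => S.D α (v i) := hv.dw [α] (by simpa using hk)
    refine ih h1 ?_ le_rfl
    obtain ⟨h, hh⟩ := cauchySeq_tendsto_of_complete h1.cauchySeq_lp
    rw [hext h fun φ => ?_] at hh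
    · exact hh
    · have e1 : ∀ i, inner ℝ (S.lp (S.D α (v i))) (S.lp φ) =
          inner ℝ (S.lp (v i)) (S.lp (φ * S.dv α - S.D α φ)) := by
        intro i
        have := S.ibp α (v i * φ)
        rw [Derivation.leibniz, smul_eq_mul, smul_eq_mul, map_add] at this
        have e2 := MeasureTheory.integral_add (S.integrable (v i * S.D α φ))
          (S.integrable (φ * S.D α (v i)))
        have e3 := MeasureTheory.integral_sub (S.integrable (v i * φ * S.dv α))
          (S.integrable (v i * S.D α φ))
        have e4 : v i * (φ * S.dv α - S.D α φ) = v i * φ * S.dv α - v i * S.D α φ := by ring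
        rw [inner_lp, inner_lp, e4, map_sub, mul_comm (S.D α (v i))]
        simp only [Pi.add_apply, Pi.sub_apply] at this e2 e3 ⊢
        linarith
      have h2 := hh.inner (𝕜 := ℝ) (tendsto_const_nhds (x := S.lp φ))
      have h3 := h0.inner (𝕜 := ℝ) (tendsto_const_nhds (x := S.lp (φ * S.dv α - S.D α φ)))
      rw [inner_zero_left] at h3
      exact tendsto_nhds_unique h2 (h3.congr fun i => (e1 i).symm)

end SobolevAlgebra

namespace LaplaceAlgebra

variable {X : Type*} [MeasurableSpace X] {μ : Measure X} [IsFiniteMeasure μ]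
  {𝒜 : Type*} [CommRing 𝒜] [Algebra ℝ 𝒜] {ι : Type*} [Fintype ι] {S : LaplaceAlgebra μ 𝒜 ι}

lemma integral_L (f : 𝒜) : ∫ x, S.ev (S.L f) x ∂μ = 0 := by
  have h1 := S.green 1 f
  rw [S.Γ_eq, one_mul] at h1
  have h2 : ∀ α, S.D α 1 = 0 := fun α => (S.D α).map_one_eq_zero
  simp only [h2, mul_zero, zero_mul, Finset.sum_const_zero, map_zero, Pi.zero_apply,
    MeasureTheory.integral_zero] at h1
  linarith

lemma tendsto_q_zero_left {κ : Type*} {l : Filter κ} {k : ℕ} {v w : κ → 𝒜} {B : ℝ}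
    (hv : Tendsto (fun i => S.N k (v i)) l (𝓝 0)) (hw : ∀ i, S.N k (w i) ≤ B) :
    Tendsto (fun i => S.q k (v i) (w i)) l (𝓝 0) := by
  obtain ⟨C, hC, h⟩ := S.exists_abs_q_le k
  refine squeeze_zero_norm (a := fun i => C * (S.N k (v i) * B)) (fun i => (h _ _).trans ?_) ?_
  · exact mul_le_mul_of_nonneg_left (mul_le_mul_of_nonneg_left (hw i) (S.N_nonneg _ _)) hC
  · simpa using (hv.mul_const B).const_mul C

lemma tendsto_q_zero_right {κ : Type*} {l : Filter κ} {k : ℕ} {v w : κ → 𝒜} {B : ℝ}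
    (hv : ∀ i, S.N k (v i) ≤ B) (hw : Tendsto (fun i => S.N k (w i)) l (𝓝 0)) :
    Tendsto (fun i => S.q k (v i) (w i)) l (𝓝 0) := by
  simp only [S.q_comm k (v _)]
  exact tendsto_q_zero_left hw hv

/-- The pairings of `v_n` with `v_n w_i` and of `v_i` with `v_i w_i` are asymptotically equal. -/
lemma tendsto_q_mul_sub {k : ℕ} {v w : ℕ → 𝒜} (hv : S.BddCauchy k v) (hw : S.BddCauchy k w) :
    Tendsto (fun p : ℕ × ℕ => S.q k (v p.2) (v p.2 * w p.1) - S.q k (v p.1) (v p.1 * w p.1)) atTop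
      (𝓝 0) := by
  obtain ⟨A, hA0, hA⟩ := hv.exists_small
  obtain ⟨B, hB0, hB⟩ := hw.exists_small
  obtain ⟨C, hC1, hC⟩ := S.exists_small_mul k
  have hsub : Tendsto (fun p : ℕ × ℕ => S.N k (v p.2 - v p.1)) atTop (𝓝 0) :=
    Tendsto.congr (fun p => S.N_sub_comm _ _ _) hv.2
  -- The difference splits as `q(v_n - v_i, v_n w_i) + q(v_i, (v_n - v_i) w_i)`. In the second term
  -- the product is null in W^{k,2} because `v_n - v_i` is bounded and null.
  have h1 := tendsto_q_zero_left (S := S) (B := C * A * B) (w := fun p : ℕ × ℕ => v p.2 * w p.1) hsub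
    fun p => (hC _ _ _ _ hA0 hB0 (hA _) (hB _)).2
  have hfst : Tendsto (fun p : ℕ × ℕ => p.1) atTop atTop := by
    rw [← prod_atTop_atTop_eq]; exact tendsto_fst
  have h2 := tendsto_q_zero_right (S := S) (B := A) (fun p : ℕ × ℕ => (hA p.1).2)
    (SobolevAlgebra.BddCauchy.tendsto_mul_zero (A := A + A) (f := fun p : ℕ × ℕ => v p.2 - v p.1)
      (fun p x => by
        rw [map_sub]
        exact (abs_sub _ _).trans (add_le_add ((hA _).1 x) ((hA _).1 x))) hsub hw hfst)
  have h3 := h1.add h2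
  rw [add_zero] at h3
  refine h3.congr fun p => ?_
  rw [sub_mul, q_sub_left, q_sub_right]
  ring

lemma tendsto_q_sub {k : ℕ} {v w : ℕ → 𝒜} (hv : S.CauchyN k v) (hw : S.CauchyN k w) :
    Tendsto (fun p : ℕ × ℕ => S.q k (v p.2) (w p.1) - S.q k (v p.1) (w p.1)) atTop
      (𝓝 0) := by
  obtain ⟨B, _, hB⟩ := hw.bounded
  have hsub : Tendsto (fun p : ℕ × ℕ => S.N k (v p.2 - v p.1)) atTop (𝓝 0) :=
    Tendsto.congr (fun p => S.N_sub_comm _ _ _) hv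
  simp only [← q_sub_left]
  exact tendsto_q_zero_left (w := fun p : ℕ × ℕ => w p.1) hsub fun p => hB _

/-- The second order expansion of `q` along a perturbation. -/
lemma exists_q_expansion {κ : Type*} (k : ℕ) {B C : ℝ} (hB : 0 ≤ B) (hC : 0 ≤ C)
    (v ψ : κ → 𝒜)
    (hv : ∀ i, S.N k (v i) ≤ B) (hψ : ∀ i, S.N k (ψ i) ≤ B) :
    ∃ K, 0 ≤ K ∧ ∀ (t : ℝ) (i : κ) (w : 𝒜), |t| ≤ 1 → S.N k (w - v i - t • ψ i) ≤ C * t ^ 2 →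
      |S.q k w w - S.q k (v i) (v i) - 2 * t * S.q k (v i) (ψ i)| ≤ K * t ^ 2 := by
  obtain ⟨Q, hQ, h⟩ := S.exists_abs_q_le k
  refine ⟨Q * (B * B) + 2 * (Q * (B * C)) + 2 * (Q * (B * C)) + Q * (C * C), ?_,
    fun t i w ht hw => ?_⟩
  · positivity
  obtain ⟨r, hr⟩ : ∃ r, r = w - v i - t • ψ i := ⟨_, rfl⟩
  rw [← hr] at hw
  have ew : w = v i + (t • ψ i + r) := by rw [hr]; abel
  have e1 : S.q k w w - S.q k (v i) (v i) - 2 * t * S.q k (v i) (ψ i) =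
      t ^ 2 * S.q k (ψ i) (ψ i) + 2 * S.q k (v i) r + 2 * (t * S.q k (ψ i) r) + S.q k r r := by
    rw [ew]
    simp only [q_add_left, q_add_right, q_smul_left, q_smul_right, S.q_comm k r, S.q_comm k (ψ i) (v i)]
    ring
  -- Used to reduce the quartic contribution of the remainder to `t²`.
  have ht2 : t ^ 2 ≤ 1 := by rw [← sq_abs]; nlinarith [abs_nonneg t]
  have b1 : |S.q k (ψ i) (ψ i)| ≤ Q * (B * B) := (h _ _).trans (mul_le_mul_of_nonneg_left
    (mul_le_mul (hψ i) (hψ i) (S.N_nonneg _ _) hB) hQ)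
  have b2 : |S.q k (v i) r| ≤ Q * (B * (C * t ^ 2)) := (h _ _).trans (mul_le_mul_of_nonneg_left
    (mul_le_mul (hv i) hw (S.N_nonneg _ _) hB) hQ)
  have b3 : |S.q k (ψ i) r| ≤ Q * (B * (C * t ^ 2)) := (h _ _).trans (mul_le_mul_of_nonneg_left
    (mul_le_mul (hψ i) hw (S.N_nonneg _ _) hB) hQ)
  have b4 : |S.q k r r| ≤ Q * ((C * t ^ 2) * (C * t ^ 2)) := (h _ _).trans
    (mul_le_mul_of_nonneg_left (mul_le_mul hw hw (S.N_nonneg _ _) (by positivity)) hQ)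
  have b3' : |t * S.q k (ψ i) r| ≤ Q * (B * (C * t ^ 2)) := by
    rw [abs_mul]
    exact (mul_le_of_le_one_left (abs_nonneg _) ht).trans b3
  have b1' : |t ^ 2 * S.q k (ψ i) (ψ i)| ≤ t ^ 2 * (Q * (B * B)) := by
    rw [abs_mul, abs_of_nonneg (sq_nonneg t)]
    exact mul_le_mul_of_nonneg_left b1 (sq_nonneg t)
  have b4' : |S.q k r r| ≤ Q * (C * C) * t ^ 2 := b4.trans (by
    have : 0 ≤ Q * (C * C) * t ^ 2 := by positivity
    nlinarith)
  rw [e1]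
  rw [abs_le] at b1' b2 b3' b4' ⊢
  constructor <;> linarith [b1'.1, b1'.2, b2.1, b2.2, b3'.1, b3'.2, b4'.1, b4'.2]

end LaplaceAlgebra

end ExtrinsicHarmonic

/-! ### Distributions continuous for bounded W^{k,2} convergence and their products -/

namespace ExtrinsicHarmonic

section Distributions

variable {m : ℕ} {M : Type*} [TopologicalSpace M]
  [ChartedSpace (EuclideanSpace ℝ (Fin m)) M] [IsManifold (𝓡 m) ∞ M]
  {g : SmoothMetric m M} [T2Space M] [CompactSpace M] [MeasurableSpace M] [BorelSpace M]
  [IsFiniteMeasure (vol g)] {P : ChartPartition m M} {k : ℕ}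

lemma ConvL2.tendsto_lp {v : ℕ → smoothAlgebra m M} {f : M → ℝ} (h : ConvL2 g v f) :
    Tendsto (fun n => (laplaceAlgebra g P).lp (v n)) atTop (𝓝 (h.1.toLp f)) := h.tendsto_toLp

lemma lp_eq_zero_of_inner_smooth (h : Lp ℝ 2 (vol g))
    (H : ∀ φ, inner ℝ h ((laplaceAlgebra g P).lp φ) = 0) : h = 0 := by
  have h1 : (h : M → ℝ) =ᵐ[vol g] fun _ => 0 := by
    refine ae_eq_of_integral_mul_smooth_eq ((Lp.memLp h).integrable (by norm_num))
      (integrable_zero _ _ _) fun φ => ?_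
    have := H φ
    rw [← Lp.toLp_coeFn h (Lp.memLp h)] at this
    simp only [zero_mul, integral_zero]
    exact (integral_mul_eq_inner (Lp.memLp h) (memLp_coe φ)).trans this
  exact (Lp.eq_zero_iff_ae_eq_zero).mpr h1

lemma Approx.tendsto_N_zero {v : ℕ → smoothAlgebra m M} (h : Approx g P k v 0) :
    Tendsto (fun i => (sobAlg g P).N k (v i)) atTop (𝓝 0) := by
  rw [SobolevAlgebra.tendsto_N_zero_iff]
  intro I hI
  have h1 : Tendsto (fun i => (sobAlg g P).lp (v i)) atTop (𝓝 0) := by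
    have := h.2.tendsto_lp (P := P)
    rwa [MemLp.toLp_zero] at this
  have h2 := SobolevAlgebra.tendsto_lp_dw_zero h.1 h1 lp_eq_zero_of_inner_smooth I hI
  exact h2

lemma approx_zero_of_tendsto {v : ℕ → smoothAlgebra m M}
    (h : Tendsto (fun i => (sobAlg g P).N k (v i)) atTop (𝓝 0)) : Approx g P k v 0 := by
  refine ⟨SobolevAlgebra.cauchyN_of_tendsto h, MemLp.zero, ?_⟩
  have h1 : Tendsto (fun i => (sobAlg g P).lp (v i)) atTop (𝓝 0) :=
    squeeze_zero_norm (fun i => (sobAlg g P).norm_lp_le k (v i)) h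
  rw [tendsto_iff_edist_tendsto_0] at h1
  refine h1.congr fun i => ?_
  rw [Lp.edist_def]
  refine eLpNorm_congr_ae ?_
  filter_upwards [(sobAlg g P).coeFn_lp (v i), Lp.coeFn_zero ℝ 2 (vol g)] with x hx hy
  rw [Pi.sub_apply, hx, hy]
  rfl

/-- A uniformly bounded sequence of smooth functions that converges in `W^{k,2}`. -/
def BddApprox (g : SmoothMetric m M) [IsFiniteMeasure (vol g)] (P : ChartPartition m M) (k : ℕ)
    (v : ℕ → smoothAlgebra m M) (f : M → ℝ) : Prop :=
  (∃ A, ∀ i x, |(v i : M → ℝ) x| ≤ A) ∧ Approx g P k v f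

lemma BddApprox.bddCauchy {v : ℕ → smoothAlgebra m M} {f : M → ℝ} (h : BddApprox g P k v f) :
    (sobAlg g P).BddCauchy k v := ⟨h.1, h.2.1⟩

lemma BddApprox.boundedApprox {v : ℕ → smoothAlgebra m M} {f : M → ℝ} (h : BddApprox g P k v f) :
    BoundedApprox m k (fun i => (v i : M → ℝ)) f :=
  ⟨fun i => contMDiff_coe (v i), h.1, h.2.sobolevTendsto⟩

lemma exists_bddApprox (g : SmoothMetric m M) [IsFiniteMeasure (vol g)] (P : ChartPartition m M)
    {w : ℕ → M → ℝ} {f : M → ℝ} (h : BoundedApprox m k w f) :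
    ∃ v : ℕ → smoothAlgebra m M, (∀ i, (v i : M → ℝ) = w i) ∧ BddApprox g P k v f :=
  ⟨fun i => ⟨w i, h.1 i⟩, fun _ => rfl, h.2.1, approx_of_sobolevTendsto g P h.2.2⟩

variable {T : (M → ℝ) → ℝ}

lemma IsSobolevDistribution.map_sub (hT : IsSobolevDistribution m k T) (φ ψ : smoothAlgebra m M) :
    T (φ - ψ : smoothAlgebra m M) = T φ - T ψ := by
  have h1 := hT.1 (φ - ψ : smoothAlgebra m M) ψ (contMDiff_coe _) (contMDiff_coe _)
  rw [← AddMemClass.coe_add, sub_add_cancel] at h1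
  linarith

lemma IsSobolevDistribution.map_sum (hT : IsSobolevDistribution m k T) {κ : Type*} (s : Finset κ)
    (φ : κ → smoothAlgebra m M) :
    T (∑ a ∈ s, φ a : smoothAlgebra m M) = ∑ a ∈ s, T (φ a) := by
  classical
  induction s using Finset.induction_on with
  | empty =>
    have := hT.2.1 0 (0 : smoothAlgebra m M) (contMDiff_coe _)
    simpa using this
  | insert a s ha ih =>
    rw [Finset.sum_insert ha, Finset.sum_insert ha, ← ih]
    exact hT.1 _ _ (contMDiff_coe _) (contMDiff_coe _)

/-- Continuity is defined through sequences; for a countably generated filter, such as `atTop` on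
pairs of indices, sequences suffice. -/
lemma IsSobolevDistribution.tendsto_zero (hT : IsSobolevDistribution m k T) {κ : Type*}
    {l : Filter κ} [l.IsCountablyGenerated] {z : κ → smoothAlgebra m M} {A : ℝ}
    (hA : ∀ i x, |(z i : M → ℝ) x| ≤ A)
    (hz : Tendsto (fun i => (sobAlg g P).N k (z i)) l (𝓝 0)) :
    Tendsto (fun i => T (z i)) l (𝓝 0) := by
  refine tendsto_of_seq_tendsto fun s hs => ?_
  have h1 : BddApprox g P k (fun i => z (s i)) 0 :=
    ⟨⟨A, fun i => hA (s i)⟩, approx_zero_of_tendsto (hz.comp hs)⟩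
  exact hT.2.2 _ h1.boundedApprox

lemma bdd_sub_mul {v w : ℕ → smoothAlgebra m M} (hv : (sobAlg g P).BddCauchy k v)
    (hw : (sobAlg g P).BddCauchy k w) : ∃ A, ∀ (p : ℕ × ℕ) x,
      |(((v p.2 - v p.1) * w p.1 : smoothAlgebra m M) : M → ℝ) x| ≤ A := by
  obtain ⟨A, hA⟩ := hv.1
  obtain ⟨B, hB⟩ := hw.1
  refine ⟨(A + A) * B, fun p x => ?_⟩
  simp only [MulMemClass.coe_mul, AddSubgroupClass.coe_sub, Pi.mul_apply, Pi.sub_apply, abs_mul]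
  have h1 : |(v p.2 : M → ℝ) x - (v p.1 : M → ℝ) x| ≤ A + A :=
    (abs_sub _ _).trans (add_le_add (hA _ x) (hA _ x))
  exact mul_le_mul h1 (hB _ x) (abs_nonneg _) ((abs_nonneg _).trans h1)

/-- The values at `v_n w_i` and at `v_i w_i` are asymptotically equal. -/
lemma IsSobolevDistribution.tendsto_mul_sub (hT : IsSobolevDistribution m k T)
    {v w : ℕ → smoothAlgebra m M} (hv : (sobAlg g P).BddCauchy k v)
    (hw : (sobAlg g P).BddCauchy k w) :
    Tendsto (fun p : ℕ × ℕ => T (v p.2 * w p.1 : smoothAlgebra m M) -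
      T (v p.1 * w p.1 : smoothAlgebra m M)) atTop (𝓝 0) := by
  obtain ⟨A, hA⟩ := bdd_sub_mul hv hw
  obtain ⟨B, hB⟩ := hv.1
  have hfst : Tendsto (fun p : ℕ × ℕ => p.1) atTop atTop := by
    rw [← prod_atTop_atTop_eq]; exact tendsto_fst
  have hsub : Tendsto (fun p : ℕ × ℕ => (sobAlg g P).N k (v p.2 - v p.1)) atTop (𝓝 0) :=
    Tendsto.congr (fun p => SobolevAlgebra.N_sub_comm _ _ _ _) hv.2
  refine (hT.tendsto_zero (g := g) (P := P) hA (SobolevAlgebra.BddCauchy.tendsto_mul_zero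
    (A := B + B) (f := fun p : ℕ × ℕ => v p.2 - v p.1) (fun p x => ?_) hsub hw hfst)).congr
    fun p => ?_
  · rw [_root_.map_sub]
    exact (abs_sub _ _).trans (add_le_add (hB _ x) (hB _ x))
  · rw [sub_mul, hT.map_sub]

lemma IsSobolevDistribution.exists_tendsto (hT : IsSobolevDistribution m k T)
    {v : ℕ → smoothAlgebra m M} (hv : (sobAlg g P).BddCauchy k v) :
    ∃ c, Tendsto (fun i => T (v i)) atTop (𝓝 c) := by
  refine cauchySeq_tendsto_of_complete ?_
  rw [Metric.cauchySeq_iff]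
  -- With the constant sequence `1` as second factor, asymptotic equality is the Cauchy property.
  have h := hT.tendsto_mul_sub hv (SobolevAlgebra.BddCauchy.const 1)
  simp only [mul_one] at h
  rw [Metric.tendsto_atTop] at h
  intro ε hε
  obtain ⟨⟨a, b⟩, hN⟩ := h ε hε
  refine ⟨max a b, fun i hi j hj => ?_⟩
  have := hN (j, i) ⟨le_of_max_le_left hj, le_of_max_le_right hi⟩
  rwa [Real.dist_0_eq_abs] at this

/-- The product of a Sobolev distribution with a bounded Sobolev function exists. -/
lemma IsSobolevDistribution.exists_isProduct (hT : IsSobolevDistribution m k T)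
    {v : ℕ → smoothAlgebra m M} {f : M → ℝ} (hv : BddApprox g P k v f) :
    ∃ S, IsProduct m k T f S := by
  have h1 : ∀ φ : smoothAlgebra m M, ∃ c, Tendsto (fun i => T (v i * φ : smoothAlgebra m M)) atTop (𝓝 c) := fun φ =>
    hT.exists_tendsto (g := g) (P := P) (hv.bddCauchy.mul (SobolevAlgebra.BddCauchy.const φ))
  choose S hS using h1
  classical
  refine ⟨fun φ => if h : IsSmooth m φ then S ⟨φ, h⟩ else 0, ⟨_, hv.boundedApprox⟩,
    fun w hw φ hφ => ?_⟩
  obtain ⟨w', hw', hw''⟩ := exists_bddApprox g P hw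
  simp only [dif_pos hφ]
  obtain ⟨A, hA⟩ := (SobolevAlgebra.BddCauchy.mul (hw''.bddCauchy.sub hv.bddCauchy)
    (SobolevAlgebra.BddCauchy.const ⟨φ, hφ⟩)).1
  -- Two bounded approximations of the same `f` differ by a bounded null sequence, so the limit does
  -- not depend on the choice.
  have h0 : Approx g P k (fun i => w' i - v i) 0 := by
    have h3 : ConvL2 g (fun i => w' i - v i) fun x => f x + -1 * f x := by
      simpa [sub_eq_add_neg] using hw''.2.2.add (hv.2.2.smul (-1))
    refine ⟨hw''.2.1.sub hv.2.1, h3.congr_ae g (.of_forall fun x => ?_)⟩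
    simp
  have h4 := (h0.mul_left ⟨φ, hφ⟩).congr_ae (f' := 0) (.of_forall fun x => by simp)
  have h5 := hT.tendsto_zero (g := g) (P := P) hA (by simpa [mul_comm] using h4.tendsto_N_zero)
  have h6 := h5.add (hS ⟨φ, hφ⟩)
  rw [zero_add] at h6
  refine h6.congr fun i => ?_
  rw [sub_mul, hT.map_sub, sub_add_cancel, ← hw']
  rfl

end Distributions

end ExtrinsicHarmonic

/-! ### The multiplier of a sphere-valued Sobolev map -/

namespace ExtrinsicHarmonic

section SphereMaps

variable {m : ℕ} {M : Type*} [TopologicalSpace M]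
  [ChartedSpace (EuclideanSpace ℝ (Fin m)) M] [IsManifold (𝓡 m) ∞ M]
  {g : SmoothMetric m M} [T2Space M] [CompactSpace M] [MeasurableSpace M] [BorelSpace M]
  [IsFiniteMeasure (vol g)] {P : ChartPartition m M} {n k : ℕ}
  {u : M → EuclideanSpace ℝ (Fin (n + 1))}

lemma BddApprox.comp {v : ℕ → smoothAlgebra m M} {f : M → ℝ} (h : BddApprox g P k v f) {s : ℕ → ℕ}
    (hs : Tendsto s atTop atTop) : BddApprox g P k (fun i => v (s i)) f :=
  ⟨h.1.imp fun _ h i => h (s i), h.2.1.comp hs, h.2.2.comp hs⟩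

variable (P) in
/-- A map into the sphere has uniformly bounded smooth approximations that converge in `W^{k,2}`
and almost everywhere. -/
lemma MemSobolevSphere.exists_approx (hu : MemSobolevSphere g k u) :
    ∃ v : Fin (n + 1) → ℕ → smoothAlgebra m M, (∀ a, BddApprox g P k (v a) fun x => u x a) ∧
      ∀ᵐ x ∂vol g, ∀ a, Tendsto (fun i => (v a i : M → ℝ) x) atTop (𝓝 (u x a)) := by
  have h1 : ∀ a, ∃ v : ℕ → smoothAlgebra m M, BddApprox g P k v fun x => u x a := fun a => by
    obtain ⟨v, hv, hv'⟩ := ExtrinsicHarmonic.exists_approx g P zero_le_one (hu.1 a).2 (hu.1 a).1 (by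
      filter_upwards [hu.2] with x hx
      rw [← hx, ← Real.norm_eq_abs]
      exact PiLp.norm_apply_le (u x) a)
    exact ⟨v, ⟨1, hv⟩, hv'⟩
  choose v hv using h1
  -- Summing over components lets one subsequence converge almost everywhere for all of them.
  have h2 : TendstoInMeasure (vol g)
      (fun i x => ∑ a, ‖(v a i : M → ℝ) x - u x a‖) atTop fun _ => (0 : ℝ) := by
    have hm : ∀ i a, AEStronglyMeasurable (fun x => ‖(v a i : M → ℝ) x - u x a‖) (vol g) :=
      fun i a => ((memLp_coe (v a i)).1.sub (hv a).2.2.1.1).norm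
    refine tendstoInMeasure_of_tendsto_eLpNorm (p := 2) (by norm_num)
      (fun i => Finset.aestronglyMeasurable_fun_sum _ fun a _ => hm i a)
      aestronglyMeasurable_const ?_
    refine tendsto_of_tendsto_of_tendsto_of_le_of_le tendsto_const_nhds
      (h := fun i => ∑ a, eLpNorm (fun x => (v a i : M → ℝ) x - u x a) 2 (vol g)) ?_
      (fun _ => zero_le) fun i => ?_
    · simpa using tendsto_finsetSum _ fun a _ => (hv a).2.2.2
    · refine le_trans (le_of_eq ?_) ((eLpNorm_sum_le (s := Finset.univ) (fun a _ => hm i a)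
        (by norm_num)).trans (Finset.sum_le_sum fun a _ => (eLpNorm_norm _).le))
      congr 1
      ext x
      simp
  obtain ⟨s, hs, hs'⟩ := h2.exists_seq_tendsto_ae
  refine ⟨fun a i => v a (s i), fun a => (hv a).comp hs.tendsto_atTop, ?_⟩
  filter_upwards [hs'] with x hx a
  rw [tendsto_iff_norm_sub_tendsto_zero]
  exact squeeze_zero (fun _ => norm_nonneg _) (fun i => Finset.single_le_sum
    (f := fun a => ‖(v a (s i) : M → ℝ) x - u x a‖) (fun _ _ => norm_nonneg _)
    (Finset.mem_univ a)) hx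

lemma sum_sq_eq_one (hu : ∀ᵐ x ∂vol g, ‖u x‖ = 1) : ∀ᵐ x ∂vol g, ∑ a, u x a * u x a = 1 := by
  filter_upwards [hu] with x hx
  have := EuclideanSpace.real_norm_sq_eq (u x)
  rw [hx, one_pow] at this
  simpa only [sq] using this.symm

variable {v : Fin (n + 1) → ℕ → smoothAlgebra m M}

lemma tendsto_sum_integral_mul_self (hu : ∀ᵐ x ∂vol g, ‖u x‖ = 1)
    (hv : ∀ a, ConvL2 g (v a) fun x => u x a) (φ : smoothAlgebra m M) :
    Tendsto (fun i => ∑ a, ∫ x, ((v a i * v a i * φ : smoothAlgebra m M) : M → ℝ) x ∂vol g) atTop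
      (𝓝 (∫ x, (φ : M → ℝ) x ∂vol g)) := by
  have h1 : Tendsto (fun i => ∑ a, ∫ x, (v a i : M → ℝ) x * ((φ * v a i : smoothAlgebra m M) :
      M → ℝ) x ∂vol g) atTop (𝓝 (∑ a, ∫ x, u x a * ((φ : M → ℝ) x * u x a) ∂vol g)) :=
    tendsto_finsetSum _ fun a _ => (hv a).tendsto_integral_mul ((hv a).mul_left φ)
  have h2 : ∑ a, ∫ x, u x a * ((φ : M → ℝ) x * u x a) ∂vol g = ∫ x, (φ : M → ℝ) x ∂vol g := by
    have hi : ∀ a, Integrable (fun x => u x a * ((φ : M → ℝ) x * u x a)) (vol g) := fun a =>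
      (hv a).1.integrable_mul ((hv a).mul_left φ).1
    rw [← integral_finsetSum _ fun a _ => hi a]
    refine integral_congr_ae ?_
    filter_upwards [sum_sq_eq_one hu] with x hx
    calc ∑ a, u x a * ((φ : M → ℝ) x * u x a) = (φ : M → ℝ) x * ∑ a, u x a * u x a := by
          rw [Finset.mul_sum]; exact Finset.sum_congr rfl fun a _ => by ring
      _ = _ := by rw [hx, mul_one]
  rw [h2] at h1
  refine h1.congr fun i => Finset.sum_congr rfl fun a _ => integral_congr_ae (.of_forall fun x => ?_)
  simp only [MulMemClass.coe_mul, Pi.mul_apply]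
  ring

/-- Sum `smoothMultiplier_eq` over the components. The constraint `|u|² = 1` enters here: the first
integrals tend to `½ ∫ Δ^k φ`, which is zero on a closed manifold, and the others are `(-1)^k q(v, v
φ)`. -/
lemma tendsto_sum_q_mul (hk : 2 ≤ k) (hu : ∀ᵐ x ∂vol g, ‖u x‖ = 1)
    (hv : ∀ a, Approx g P k (v a) fun x => u x a) (φ : smoothAlgebra m M) :
    Tendsto (fun i => ∑ a, (laplaceAlgebra g P).q k (v a i) (v a i * φ)) atTop
      (𝓝 (-((-1) ^ k * multiplier g k u φ))) := by
  let S := laplaceAlgebra g P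
  have h1 := tendsto_sum_integral_mul_self hu (fun a => (hv a).2) ((S.L ^ k) φ)
  have h0 : ∫ x, ((S.L ^ k) φ : smoothAlgebra m M).1 x ∂vol g = 0 := by
    obtain ⟨k, rfl⟩ : ∃ j, k = j + 1 := ⟨k - 1, by omega⟩
    rw [pow_succ', Module.End.mul_apply]
    exact S.integral_L _
  rw [h0] at h1
  have h2 := ((h1.const_mul (1 / 2)).sub (tendsto_smoothMultiplier hk hv φ)).const_mul ((-1 : ℝ) ^ k)
  rw [mul_zero, zero_sub, mul_neg] at h2
  refine h2.congr fun i => ?_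
  simp only [(laplaceAlgebra g P).smoothMultiplier_eq (by omega : 1 ≤ k), LaplaceAlgebra.q_eq,
    Finset.sum_sub_distrib, ← Finset.mul_sum]
  exact congrArg _ (sub_sub_cancel _ _)

/-- The multiplier along a bounded convergent sequence. -/
lemma tendsto_sum_q_mul_add (hk : 2 ≤ k) (hu : ∀ᵐ x ∂vol g, ‖u x‖ = 1)
    (hv : ∀ a, BddApprox g P k (v a) fun x => u x a) {w : ℕ → smoothAlgebra m M}
    (hw : (sobAlg g P).BddCauchy k w) :
    Tendsto (fun i => ∑ a, (laplaceAlgebra g P).q k (v a i) (v a i * w i) +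
      (-1) ^ k * multiplier g k u (w i)) atTop (𝓝 0) := by
  have h1 := tendsto_finsetSum Finset.univ fun a _ =>
    LaplaceAlgebra.tendsto_q_mul_sub (S := laplaceAlgebra g P) (hv a).bddCauchy hw
  rw [Finset.sum_const_zero] at h1
  have h2 := tendsto_zero_of_double h1 (G := fun i => -((-1) ^ k * multiplier g k u (w i)) -
    -- For fixed `i`, letting `n → ∞` in `q(v_n, v_n w_i)` gives the multiplier at the smooth
    -- function `w_i`; the joint estimate then permits the diagonal.
    ∑ a, (laplaceAlgebra g P).q k (v a i) (v a i * w i)) fun i => by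
      simp only [Finset.sum_sub_distrib]
      exact (tendsto_sum_q_mul hk hu (fun a => (hv a).2) (w i)).sub_const _
  have h3 := h2.neg
  rw [neg_zero] at h3
  exact h3.congr fun i => by ring

/-- Linearity is inherited from the limit of `q(v, v φ)`. For continuity, if `z_i → 0` boundedly
then `v_i z_i → 0` in W^{k,2}, while `v_i` stays bounded there, and `q` is bounded. -/
lemma isSobolevDistribution_multiplier (hk : 2 ≤ k) (hu : ∀ᵐ x ∂vol g, ‖u x‖ = 1)
    (hv : ∀ a, BddApprox g P k (v a) fun x => u x a) :
    IsSobolevDistribution m k (multiplier g k u) := by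
  let S := laplaceAlgebra g P
  have hl := fun φ => tendsto_sum_q_mul hk hu (fun a => (hv a).2) φ
  have hc : ((-1 : ℝ) ^ k) ≠ 0 := pow_ne_zero _ (by norm_num)
  refine ⟨fun φ ψ hφ hψ => ?_, fun c φ hφ => ?_, fun w hw => ?_⟩
  · have h1 := (hl ⟨φ, hφ⟩).add (hl ⟨ψ, hψ⟩)
    have h2 := hl (⟨φ, hφ⟩ + ⟨ψ, hψ⟩)
    simp only [mul_add, S.q_add_right, Finset.sum_add_distrib, S] at h2
    have h3 := tendsto_nhds_unique h1 h2
    refine mul_left_cancel₀ hc ?_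
    rw [mul_add]
    have h4 : ((⟨φ, hφ⟩ + ⟨ψ, hψ⟩ : smoothAlgebra m M) : M → ℝ) = φ + ψ := rfl
    rw [h4] at h3
    linarith
  · have h1 := (hl ⟨φ, hφ⟩).const_mul c
    have h2 := hl (c • ⟨φ, hφ⟩)
    simp only [mul_smul_comm, S.q_smul_right, ← Finset.mul_sum, S] at h2
    have h3 := tendsto_nhds_unique h1 h2
    refine mul_left_cancel₀ hc ?_
    have h4 : ((c • ⟨φ, hφ⟩ : smoothAlgebra m M) : M → ℝ) = c • φ := rfl
    rw [h4] at h3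
    linarith
  · obtain ⟨z, hz, hz'⟩ := exists_bddApprox g P hw
    have h0 := hz'.2.tendsto_N_zero
    obtain ⟨A, hA⟩ := hz'.1
    have h1 : Tendsto (fun i => ∑ a, S.q k (v a i) (v a i * z i)) atTop (𝓝 0) := by
      rw [← Finset.sum_const_zero (s := (Finset.univ : Finset (Fin (n + 1))))]
      refine tendsto_finsetSum _ fun a _ => ?_
      obtain ⟨B, _, hB⟩ := (hv a).2.1.bounded
      refine LaplaceAlgebra.tendsto_q_zero_right (S := S) hB ?_
      exact (SobolevAlgebra.BddCauchy.tendsto_mul_zero hA h0 (hv a).bddCauchy tendsto_id).congr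
        fun i => by rw [mul_comm]; rfl
    have h2 := ((tendsto_sum_q_mul_add hk hu hv hz'.bddCauchy).sub h1).const_mul ((-1 : ℝ) ^ k)
    rw [sub_zero, mul_zero] at h2
    refine h2.congr fun i => ?_
    rw [add_sub_cancel_left, ← mul_assoc, ← mul_pow, neg_one_mul, neg_neg, one_pow, one_mul, hz]

end SphereMaps

end ExtrinsicHarmonic

/-! ### First variation of the energy -/

namespace ExtrinsicHarmonic

section FirstVariation

variable {m : ℕ} {M : Type*} [TopologicalSpace M]
  [ChartedSpace (EuclideanSpace ℝ (Fin m)) M] [IsManifold (𝓡 m) ∞ M]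
  {g : SmoothMetric m M} [T2Space M] [CompactSpace M] [MeasurableSpace M] [BorelSpace M]
  [IsFiniteMeasure (vol g)] {P : ChartPartition m M} {n k : ℕ}
  {u : M → EuclideanSpace ℝ (Fin (n + 1))} {v : Fin (n + 1) → ℕ → smoothAlgebra m M}

lemma ConvL2.ae_eq_of_tendsto_ae {w : ℕ → smoothAlgebra m M} {f h : M → ℝ} (hw : ConvL2 g w h)
    (hf : ∀ᵐ x ∂vol g, Tendsto (fun i => (w i : M → ℝ) x) atTop (𝓝 (f x))) : h =ᵐ[vol g] f := by
  have h1 : TendstoInMeasure (vol g) (fun i => (w i : M → ℝ)) atTop h :=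
    tendstoInMeasure_of_tendsto_eLpNorm (p := 2) (by norm_num) (fun i => (memLp_coe (w i)).1)
      hw.1.1 hw.2
  obtain ⟨s, hs, hs'⟩ := h1.exists_seq_tendsto_ae
  filter_upwards [hf, hs'] with x hx hx'
  exact tendsto_nhds_unique hx' (hx.comp hs.tendsto_atTop)

-- The constraint `|u| = 1` at `x` makes one plus the limiting defect equal to `|u + tΦ|²`, whose
-- power `-1/2` is the normalizing factor of `Π`.
open SobolevAlgebra in
lemma tendsto_approxVariation {c : ℕ → ℝ} {B : ℝ} (hc : ∀ j, |c j| ≤ B * 2 ^ j)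
    (hsum : ∀ s : ℝ, |s| ≤ 1 / 8 → HasSum (fun j => c j * s ^ j) ((1 + s) ^ (-(1 / 2) : ℝ)))
    {φ : Fin (n + 1) → smoothAlgebra m M} {Φ : M → EuclideanSpace ℝ (Fin (n + 1))}
    (hΦ : ∀ a x, (φ a : M → ℝ) x = Φ x a) {t : ℝ} {x : M} (hx : ‖u x‖ = 1)
    (hvx : ∀ a, Tendsto (fun i => (v a i : M → ℝ) x) atTop (𝓝 (u x a)))
    (hs : ∀ i, |((sqDefect v φ t i : smoothAlgebra m M) : M → ℝ) x| ≤ 1 / 8) (a : Fin (n + 1)) :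
    Tendsto (fun i => ((approxVariation v φ c t a i : smoothAlgebra m M) : M → ℝ) x) atTop (𝓝 (variation u Φ t x a)) := by
  have hz : Tendsto (fun i => ((sqDefect v φ t i : smoothAlgebra m M) : M → ℝ) x) atTop
      (𝓝 (2 * t * (∑ b, u x b * Φ x b) + t ^ 2 * ∑ b, Φ x b * Φ x b)) := by
    have e1 : ∀ i, ((sqDefect v φ t i : smoothAlgebra m M) : M → ℝ) x =
        2 * t * (∑ b, (v b i : M → ℝ) x * Φ x b) + t ^ 2 * ∑ b, Φ x b * Φ x b := by
      intro i
      simp only [sqDefect, dot, AddMemClass.coe_add, SetLike.val_smul, Pi.add_apply, Pi.smul_apply,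
        AddSubmonoidClass.coe_finsetSum, Finset.sum_apply, MulMemClass.coe_mul, Pi.mul_apply,
        smul_eq_mul, hΦ]
    simp only [e1]
    exact ((tendsto_finsetSum _ fun b _ => (hvx b).mul_const _).const_mul _).add_const _
  have h1 := tendsto_partial_sums_inv_sqrt hc hsum hs hz tendsto_id
  have h2 := h1.mul ((hvx a).add_const (t * Φ x a))
  have e2 : 1 + (2 * t * (∑ b, u x b * Φ x b) + t ^ 2 * ∑ b, Φ x b * Φ x b) =
      ‖u x + t • Φ x‖ ^ 2 := by
    have h3 := EuclideanSpace.real_norm_sq_eq (u x)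
    rw [hx, one_pow] at h3
    rw [EuclideanSpace.real_norm_sq_eq, h3, Finset.mul_sum, Finset.mul_sum,
      ← Finset.sum_add_distrib, ← Finset.sum_add_distrib]
    refine Finset.sum_congr rfl fun b _ => ?_
    simp only [PiLp.add_apply, PiLp.smul_apply, smul_eq_mul]
    ring
  have e3 : (‖u x + t • Φ x‖ ^ 2) ^ (-(1 / 2) : ℝ) = ‖u x + t • Φ x‖⁻¹ := by
    rw [← Real.rpow_natCast, ← Real.rpow_mul (norm_nonneg _), ← Real.rpow_neg_one]
    norm_num
  rw [e2, e3] at h2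
  refine h2.congr fun i => ?_
  simp only [id, approxVariation, partialSeries, MulMemClass.coe_mul, Pi.mul_apply,
    AddMemClass.coe_add, SetLike.val_smul, Pi.add_apply, Pi.smul_apply, smul_eq_mul, hΦ,
    AddSubmonoidClass.coe_finsetSum, Finset.sum_apply, SubmonoidClass.coe_pow, Pi.pow_apply]

-- The term `φ` gives `(-1)^k Δ^k u^a (φ^a)`. In the normal term, exchanging the sums over `a` and
-- `b` yields `∑_a q(v_a, v_a (v_b φ_b))`, which by `tendsto_sum_q_mul_add` behaves like `-(-1)^k
-- λ_k(v_b φ_b)`, hence tends to `-(-1)^k s b`.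
open SobolevAlgebra in
lemma tendsto_sum_q_tangentPart (hk : 2 ≤ k) (hu : ∀ᵐ x ∂vol g, ‖u x‖ = 1)
    (hv : ∀ a, BddApprox g P k (v a) fun x => u x a) {φ : Fin (n + 1) → smoothAlgebra m M}
    {s : Fin (n + 1) → ℝ} (hs : ∀ a, Tendsto (fun i => multiplier g k u
      (v a i * φ a : smoothAlgebra m M)) atTop (𝓝 (s a))) :
    Tendsto (fun i => ∑ a, (laplaceAlgebra g P).q k (v a i) (tangentPart v φ a i)) atTop
      (𝓝 ((-1) ^ k * ∑ a, ((distLap g)^[k] (ofFun g fun x => u x a) (φ a) + s a))) := by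
  let S := laplaceAlgebra g P
  have h1 : ∀ a, Tendsto (fun i => S.q k (v a i) (φ a)) atTop
      (𝓝 ((-1) ^ k * (distLap g)^[k] (ofFun g fun x => u x a) (φ a))) := by
    intro a
    have e1 : (distLap g)^[k] (ofFun g fun x => u x a) (φ a) =
        ∫ x, u x a * (((S.L ^ k) (φ a) : smoothAlgebra m M) : M → ℝ) x ∂vol g := by
      rw [distLap_iterate, laplaceAlgebra_L_pow]
      rfl
    rw [e1]
    refine (((hv a).2.2.tendsto_integral_mul (convL2_const ((S.L ^ k) (φ a)))).const_mul _).congr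
      fun i => ?_
    rw [S.q_eq, S.L_pow_comm]
    rfl
  have h2 : ∀ b, Tendsto (fun i => ∑ a, S.q k (v a i) (v a i * (v b i * φ b))) atTop
      (𝓝 (-((-1) ^ k * s b))) := by
    intro b
    have h3 := tendsto_sum_q_mul_add hk hu hv ((hv b).bddCauchy.mul (BddCauchy.const (φ b)))
    have h4 := h3.sub ((hs b).const_mul ((-1) ^ k))
    rw [zero_sub] at h4
    exact h4.congr fun i => add_sub_cancel_right _ _
  have h5 := (tendsto_finsetSum Finset.univ fun a _ => h1 a).sub
    (tendsto_finsetSum Finset.univ fun b _ => h2 b)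
  have e2 : ∑ a, (-1 : ℝ) ^ k * (distLap g)^[k] (ofFun g fun x => u x a) (φ a) -
      ∑ b, -((-1) ^ k * s b) =
      (-1) ^ k * ∑ a, ((distLap g)^[k] (ofFun g fun x => u x a) (φ a) + s a) := by
    rw [Finset.sum_neg_distrib, ← Finset.mul_sum, ← Finset.mul_sum, Finset.sum_add_distrib]
    ring
  rw [e2] at h5
  refine h5.congr fun i => ?_
  rw [Finset.sum_comm, ← Finset.sum_sub_distrib]
  refine Finset.sum_congr rfl fun a _ => ?_
  rw [tangentPart, S.q_sub_right, dot]
  congr 1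
  simp only [S.q_eq, ← Finset.mul_sum]
  rw [← S.integral_sum, ← Finset.sum_mul, ← Finset.mul_sum]

open SobolevAlgebra in
/-- The energy of the variation is differentiable at `0`. -/
lemma hasDerivAt_energy_variation (hu : ∀ᵐ x ∂vol g, ‖u x‖ = 1)
    (hv : ∀ a, BddApprox g P k (v a) fun x => u x a)
    (hvx : ∀ᵐ x ∂vol g, ∀ a, Tendsto (fun i => (v a i : M → ℝ) x) atTop (𝓝 (u x a)))
    {φ : Fin (n + 1) → smoothAlgebra m M} {Φ : M → EuclideanSpace ℝ (Fin (n + 1))}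
    (hΦ : ∀ a x, (φ a : M → ℝ) x = Φ x a) {ℓ : ℝ}
    (hℓ : Tendsto (fun i => ∑ a, (laplaceAlgebra g P).q k (v a i) (tangentPart v φ a i)) atTop
      (𝓝 ℓ)) :
    HasDerivAt (fun t => energy g k (variation u Φ t)) (2 * ℓ) 0 := by
  let S := laplaceAlgebra g P
  obtain ⟨c, hc0, hc1, ⟨B, hB, hc⟩, hsum⟩ := exists_coeff_inv_sqrt
  have hvb := fun a => (hv a).bddCauchy
  obtain ⟨δ, hδ, C, hC, h⟩ := exists_approxVariation (S := sobAlg g P) (φ := φ) hc0 hc1 hB hc hvb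
  have henergy : ∀ t, |t| < δ → Tendsto (fun i => ∑ a, S.q k (approxVariation v φ c t a i)
      (approxVariation v φ c t a i)) atTop (𝓝 (energy g k (variation u Φ t))) := by
    intro t ht
    obtain ⟨hs, hw⟩ := h t ht
    refine tendsto_energy fun a => ⟨(hw a).1.2, ?_⟩
    obtain ⟨f, hf⟩ := exists_convL2 g P (hw a).1.2
    refine hf.congr_ae g (hf.ae_eq_of_tendsto_ae ?_)
    filter_upwards [hu, hvx] with x hx hx'
    exact tendsto_approxVariation hc hsum hΦ hx hx' (fun i => hs i x) a
  have henergy0 : Tendsto (fun i => ∑ a, S.q k (v a i) (v a i)) atTop (𝓝 (energy g k u)) :=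
    tendsto_energy fun a => (hv a).2
  have hK : ∀ a, ∃ K, 0 ≤ K ∧ ∀ t : ℝ, |t| < δ → |t| ≤ 1 → ∀ i,
      |S.q k (approxVariation v φ c t a i) (approxVariation v φ c t a i) -
        S.q k (v a i) (v a i) - 2 * t * S.q k (v a i) (tangentPart v φ a i)| ≤ K * t ^ 2 := by
    intro a
    obtain ⟨B1, hB1, h1⟩ := (hv a).2.1.bounded
    obtain ⟨B2, hB2, h2⟩ := (bddCauchy_tangentPart (φ := φ) hvb a).2.bounded
    obtain ⟨K, hK0, hK⟩ := LaplaceAlgebra.exists_q_expansion (S := S) k (B := max B1 B2)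
      (le_max_of_le_left hB1) hC (v a) (tangentPart v φ a)
      (fun i => (h1 i).trans (le_max_left _ _)) fun i => (h2 i).trans (le_max_right _ _)
    exact ⟨K, hK0, fun t ht ht1 i => hK t i _ ht1 (((h t ht).2 a).2 i).2⟩
  choose K hK0 hK using hK
  -- The constants in the quadratic expansion do not depend on `i`, so the estimate survives `i →
  -- ∞`; this replaces any interchange of limit and derivative.
  have hbound : ∀ t : ℝ, |t| < δ → |t| ≤ 1 →
      |energy g k (variation u Φ t) - energy g k u - 2 * t * ℓ| ≤ (∑ a, K a) * t ^ 2 := by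
    intro t ht ht1
    refine le_of_tendsto (((henergy t ht).sub henergy0).sub (hℓ.const_mul (2 * t))).abs
      (.of_forall fun i => ?_)
    rw [← Finset.sum_sub_distrib, Finset.mul_sum, ← Finset.sum_sub_distrib, Finset.sum_mul]
    exact (Finset.abs_sum_le_sum_abs _ _).trans (Finset.sum_le_sum fun a _ => hK a t ht ht1 i)
  -- `variation u Φ 0` agrees with `u` only almost everywhere; the bound at `t = 0` gives equality
  -- of energies directly.
  have h0 : energy g k (variation u Φ 0) = energy g k u := by
    have := hbound 0 (by simpa using hδ) (by simp)
    simpa [sub_eq_zero] using this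
  rw [hasDerivAt_iff_isLittleO_nhds_zero]
  refine Asymptotics.IsBigO.trans_isLittleO (g := fun t : ℝ => t ^ 2) ?_
    (Asymptotics.isLittleO_pow_id one_lt_two)
  refine Asymptotics.IsBigO.of_bound (∑ a, K a) ?_
  filter_upwards [Metric.ball_mem_nhds (0 : ℝ) (lt_min hδ one_pos)] with t ht
  rw [Metric.mem_ball, Real.dist_0_eq_abs, lt_min_iff] at ht
  rw [zero_add, h0, smul_eq_mul, Real.norm_eq_abs, Real.norm_eq_abs, abs_of_nonneg (sq_nonneg t),
    show t * (2 * ℓ) = 2 * t * ℓ by ring]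
  exact hbound t ht.1 ht.2.le

end FirstVariation

end ExtrinsicHarmonic

/-! ### The Euler–Lagrange equation and uniqueness of the multiplier -/

namespace ExtrinsicHarmonic

section EulerLagrange

variable {m : ℕ} {M : Type*} [TopologicalSpace M]
  [ChartedSpace (EuclideanSpace ℝ (Fin m)) M] [IsManifold (𝓡 m) ∞ M]
  {g : SmoothMetric m M} [T2Space M] [CompactSpace M] [MeasurableSpace M] [BorelSpace M]
  [IsFiniteMeasure (vol g)] {P : ChartPartition m M} {n k : ℕ}
  {u : M → EuclideanSpace ℝ (Fin (n + 1))} {v : Fin (n + 1) → ℕ → smoothAlgebra m M}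

lemma contMDiff_component {Φ : M → EuclideanSpace ℝ (Fin (n + 1))}
    (hΦ : ContMDiff (𝓡 m) 𝓘(ℝ, EuclideanSpace ℝ (Fin (n + 1))) ∞ Φ) (a : Fin (n + 1)) :
    ContMDiff (𝓡 m) 𝓘(ℝ, ℝ) ∞ fun x => Φ x a :=
  (EuclideanSpace.proj (𝕜 := ℝ) a).contDiff.contMDiff.comp hΦ

lemma contMDiff_single {φ : M → ℝ} (hφ : IsSmooth m φ) (a : Fin (n + 1)) :
    ContMDiff (𝓡 m) 𝓘(ℝ, EuclideanSpace ℝ (Fin (n + 1))) ∞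
      fun x => φ x • EuclideanSpace.single a (1 : ℝ) :=
  (ContDiff.contMDiff (f := fun y : ℝ => y • EuclideanSpace.single a (1 : ℝ))
    (contDiff_id.smul contDiff_const)).comp hφ

/-- The derivative of the energy is, up to the nonzero factor `2 (-1)^k`, the sum over `a` of the
equations tested with `φ^a`. The test map is arbitrary, so vanishing of all these sums is equivalent
to each component equation. -/
lemma isWeaklyHarmonic_iff_solvesEulerLagrange (hk : 2 ≤ k) (hu : ∀ᵐ x ∂vol g, ‖u x‖ = 1)
    (hv : ∀ a, BddApprox g P k (v a) fun x => u x a)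
    (hvx : ∀ᵐ x ∂vol g, ∀ a, Tendsto (fun i => (v a i : M → ℝ) x) atTop (𝓝 (u x a))) :
    IsWeaklyHarmonic g k u ↔ SolvesEulerLagrange g k (multiplier g k u) u := by
  have hT := isSobolevDistribution_multiplier hk hu hv
  have hc : ((-1 : ℝ) ^ k) ≠ 0 := pow_ne_zero _ (by norm_num)
  have key : ∀ (S : Fin (n + 1) → (M → ℝ) → ℝ),
      (∀ a, IsProduct m k (multiplier g k u) (fun x => u x a) (S a)) →
      ∀ (φ : Fin (n + 1) → smoothAlgebra m M) (Φ : M → EuclideanSpace ℝ (Fin (n + 1))),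
      (∀ a x, (φ a : M → ℝ) x = Φ x a) →
      HasDerivAt (fun t => energy g k (variation u Φ t)) (2 * ((-1) ^ k *
        ∑ a, ((distLap g)^[k] (ofFun g fun x => u x a) (φ a) + S a (φ a)))) 0 := by
    intro S hS φ Φ hΦ
    exact hasDerivAt_energy_variation hu hv hvx hΦ (tendsto_sum_q_tangentPart hk hu hv
      fun a => (hS a).2 _ (hv a).boundedApprox (φ a) (contMDiff_coe (φ a)))
  constructor
  · intro hh
    choose S hS using fun a => hT.exists_isProduct (hv a)
    refine fun a => ⟨S a, hS a, fun φ hφ => ?_⟩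
    classical
    -- A test map with a single nonzero component isolates the equation with index `a`.
    let ψ : Fin (n + 1) → smoothAlgebra m M := Pi.single a ⟨φ, hφ⟩
    have h1 := key S hS ψ (fun x => φ x • EuclideanSpace.single a (1 : ℝ)) fun b x => by
      by_cases hb : b = a
      · subst hb
        simp [ψ]
      · simp [ψ, hb]
    have h2 := h1.unique (hh _ (contMDiff_single hφ a))
    rw [mul_eq_zero, or_iff_right two_ne_zero, mul_eq_zero, or_iff_right hc,
      Finset.sum_eq_single a] at h2
    · simpa [ψ] using h2
    · intro b _ hb
      have h3 : ((ψ b : smoothAlgebra m M) : M → ℝ) = 0 := by simp [ψ, hb]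
      have h4 := (hS b).2 _ (hv b).boundedApprox 0 contMDiff_const
      have h5 : multiplier g k u 0 = 0 := by
        simpa using hT.2.1 0 (0 : M → ℝ) contMDiff_const
      simp only [mul_zero, h5] at h4
      have h6 : (lap g)^[k] (0 : M → ℝ) = 0 := by
        rw [← ZeroMemClass.coe_zero (smoothAlgebra m M), ← laplaceAlgebra_L_pow g P, map_zero]
      rw [h3, distLap_iterate, h6, tendsto_nhds_unique h4 tendsto_const_nhds]
      simp [ofFun]
    · simp
  · intro hs Φ hΦ
    choose S hS hS' using hs
    have h1 := key S hS (fun a => ⟨fun x => Φ x a, contMDiff_component hΦ a⟩) Φ fun _ _ => rfl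
    have h2 : ∀ a, (distLap g)^[k] (ofFun g fun x => u x a) (fun x => Φ x a) +
        S a (fun x => Φ x a) = 0 := fun a => hS' a _ (contMDiff_component hΦ a)
    simpa [h2] using h1

/-- The square of the modulus of the approximations tends to `1`. -/
lemma approx_sum_mul_self (hu : ∀ᵐ x ∂vol g, ‖u x‖ = 1)
    (hv : ∀ a, BddApprox g P k (v a) fun x => u x a)
    (hvx : ∀ᵐ x ∂vol g, ∀ a, Tendsto (fun i => (v a i : M → ℝ) x) atTop (𝓝 (u x a)))
    (φ : smoothAlgebra m M) :
    BddApprox g P k (fun i => ∑ a, v a i * (v a i * φ)) φ := by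
  have h1 : (sobAlg g P).BddCauchy k fun i => ∑ a, v a i * (v a i * φ) :=
    SobolevAlgebra.BddCauchy.sum fun a _ => (hv a).bddCauchy.mul
      ((hv a).bddCauchy.mul (SobolevAlgebra.BddCauchy.const φ))
  refine ⟨h1.1, h1.2, ?_⟩
  obtain ⟨f, hf⟩ := exists_convL2 g P h1.2
  refine hf.congr_ae g (hf.ae_eq_of_tendsto_ae ?_)
  filter_upwards [hvx, sum_sq_eq_one hu] with x hx hx'
  have h2 := tendsto_finsetSum Finset.univ fun a _ =>
    (hx a).mul ((hx a).mul_const ((φ : M → ℝ) x))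
  have h3 : ∑ a, u x a * (u x a * (φ : M → ℝ) x) = (φ : M → ℝ) x := by
    simp only [← mul_assoc]
    rw [← Finset.sum_mul, hx', one_mul]
  rw [h3] at h2
  refine h2.congr fun i => ?_
  simp only [AddSubmonoidClass.coe_finsetSum, Finset.sum_apply, MulMemClass.coe_mul, Pi.mul_apply]

/-- Formally `λ = λ|u|² = -⟨u, Δ^k u⟩ = λ_k`: each equation is tested with `v_i^a φ`, which tends to
`u^a φ`, and the results are summed. -/
lemma eq_multiplier_of_solvesEulerLagrange (hk : 2 ≤ k) (hu : ∀ᵐ x ∂vol g, ‖u x‖ = 1)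
    (hv : ∀ a, BddApprox g P k (v a) fun x => u x a)
    (hvx : ∀ᵐ x ∂vol g, ∀ a, Tendsto (fun i => (v a i : M → ℝ) x) atTop (𝓝 (u x a)))
    {T : (M → ℝ) → ℝ} (hT : IsSobolevDistribution m k T) (hs : SolvesEulerLagrange g k T u)
    (φ : smoothAlgebra m M) : T φ = multiplier g k u φ := by
  let A := laplaceAlgebra g P
  choose S hS hS' using hs
  have hwb : ∀ a, (sobAlg g P).BddCauchy k fun i => v a i * φ := fun a =>
    (hv a).bddCauchy.mul (SobolevAlgebra.BddCauchy.const φ)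
  -- `∑_a v_a² φ → |u|² φ = φ` boundedly, so continuity of `T` applies.
  have h1 : Tendsto (fun i => ∑ a, T (v a i * (v a i * φ) : smoothAlgebra m M)) atTop (𝓝 (T φ)) := by
    have e1 := approx_sum_mul_self hu hv hvx φ
    have e3 : BddApprox g P k (fun i => (∑ a, v a i * (v a i * φ)) - φ) 0 := by
      have e4 := e1.bddCauchy.sub (SobolevAlgebra.BddCauchy.const φ)
      refine ⟨e4.1, e4.2, ?_⟩
      simpa [sub_eq_add_neg, Pi.zero_def] using e1.2.2.add ((convL2_const φ).smul (-1))
    have e5 := hT.2.2 _ e3.boundedApprox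
    simp only [hT.map_sub, hT.map_sum] at e5
    exact tendsto_sub_nhds_zero_iff.mp e5
  -- The value of the product `T u^a` at `v_i φ` is the limit in `n` of `T(v_n v_i φ)`, compared
  -- here with the diagonal value.
  have h2 : Tendsto (fun i => ∑ a, (S a (v a i * φ : smoothAlgebra m M) -
      T (v a i * (v a i * φ) : smoothAlgebra m M))) atTop (𝓝 0) := by
    rw [← Finset.sum_const_zero (s := (Finset.univ : Finset (Fin (n + 1))))]
    refine tendsto_finsetSum _ fun a _ => ?_
    refine tendsto_zero_of_double (hT.tendsto_mul_sub (hv a).bddCauchy (hwb a)) fun i => ?_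
    exact ((hS a).2 _ (hv a).boundedApprox _ (contMDiff_coe (v a i * φ))).sub_const _
  -- By the equation, `-(-1)^k S a` is `(-1)^k Δ^k u^a`, and its value at `v_i φ` is the limit in
  -- `n` of `q(v_n, v_i φ)`; again this is compared with the diagonal.
  have h3 : Tendsto (fun i => ∑ a, (-((-1) ^ k * S a (v a i * φ : smoothAlgebra m M)) -
      A.q k (v a i) (v a i * φ))) atTop (𝓝 0) := by
    rw [← Finset.sum_const_zero (s := (Finset.univ : Finset (Fin (n + 1))))]
    refine tendsto_finsetSum _ fun a _ => ?_
    refine tendsto_zero_of_double (LaplaceAlgebra.tendsto_q_sub (S := A) (hv a).2.1 (hwb a).2)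
      fun i => Tendsto.sub_const ?_ _
    have e1 := eq_neg_of_add_eq_zero_right (hS' a _ (contMDiff_coe (v a i * φ)))
    rw [distLap_iterate, ← laplaceAlgebra_L_pow g P] at e1
    rw [e1, mul_neg, neg_neg]
    refine (((hv a).2.2.tendsto_integral_mul (convL2_const ((A.L ^ k) (v a i * φ)))).const_mul
      _).congr fun j => ?_
    rw [A.q_eq, A.L_pow_comm]
    rfl
  have h4 := tendsto_sum_q_mul hk hu (fun a => (hv a).2) φ
  have h5 := ((h3.add h4).add (h2.const_mul ((-1) ^ k))).add (h1.const_mul ((-1) ^ k))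
  -- The four sequences cancel identically, so their limits give `0 = -(-1)^k λ_k(φ) + (-1)^k T(φ)`.
  have h6 : (fun i => ∑ a, (-((-1) ^ k * S a (v a i * φ : smoothAlgebra m M)) -
      A.q k (v a i) (v a i * φ)) + ∑ a, A.q k (v a i) (v a i * φ) +
      (-1) ^ k * ∑ a, (S a (v a i * φ : smoothAlgebra m M) -
      T (v a i * (v a i * φ) : smoothAlgebra m M)) +
      (-1) ^ k * ∑ a, T (v a i * (v a i * φ) : smoothAlgebra m M)) = fun _ => 0 := by
    funext i
    rw [Finset.sum_sub_distrib, Finset.sum_sub_distrib, Finset.sum_neg_distrib, ← Finset.mul_sum]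
    ring
  rw [h6] at h5
  have h7 := tendsto_nhds_unique h5 tendsto_const_nhds
  have hc : ((-1 : ℝ) ^ k) ≠ 0 := pow_ne_zero _ (by norm_num)
  refine mul_left_cancel₀ hc ?_
  linarith

end EulerLagrange

end ExtrinsicHarmonic

theorem proposition2p1 {m n k : ℕ} (hk : 2 ≤ k)
    {M : Type*} [TopologicalSpace M] [T2Space M] [CompactSpace M]
    [ChartedSpace (EuclideanSpace ℝ (Fin m)) M] [IsManifold (𝓡 m) ∞ M]
    [MeasurableSpace M] [BorelSpace M]
    (g : SmoothMetric m M)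
    (u : M → EuclideanSpace ℝ (Fin (n + 1))) (hu : MemSobolevSphere g k u) :
    IsSobolevDistribution m k (multiplier g k u) ∧
    (IsWeaklyHarmonic g k u ↔ SolvesEulerLagrange g k (multiplier g k u) u) ∧
    ∀ lam : (M → ℝ) → ℝ, IsSobolevDistribution m k lam → SolvesEulerLagrange g k lam u →
      ∀ φ : M → ℝ, IsSmooth m φ → lam φ = multiplier g k u φ := by
  have := isFiniteMeasure_vol g
  obtain ⟨P⟩ := nonempty_chartPartition (m := m) (M := M)
  obtain ⟨v, hv, hvx⟩ := hu.exists_approx P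
  exact ⟨isSobolevDistribution_multiplier hk hu.2 hv,
    isWeaklyHarmonic_iff_solvesEulerLagrange hk hu.2 hv hvx,
    fun lam hlam hs φ hφ => eq_multiplier_of_solvesEulerLagrange hk hu.2 hv hvx hlam hs ⟨φ, hφ⟩⟩
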